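/- Let $d\ge 2$, $p\ge 1$, and let $\Omega\subset\mathbb R^d$ be a bounded Lipschitz domain (connectedness is not required). Let $\mathcal T_0$ be a finite regular (conforming) triangulation of $\overline\Omega$ into non-degenerate tagged simplices, i.e. ordered simplices $(x_0,\dots,x_d)$ with a type $\gamma\in\{0,\dots,d-1\}$. The newest vertex bisection (NVB) of a tagged simplex replaces it by its children $(x_0,\frac{x_0+x_d}2,x_1,\dots,x_{d-1})$ and $(x_d,\frac{x_0+x_d}2,x_1,\dots,x_\gamma,x_{d-1},\dots,x_{\gamma+1})$, both of type $\gamma+1 \bmod d$. For $\mathcal M\subseteq\mathcal T$, $\mathtt{refine}(\mathcal T,\mathcal M)$ denotes the coarsest regular triangulation obtained from $\mathcal T$ by finitely many bisections such that each element of $\mathcal M$ is bisected at least once; $\mathcal T'=\mathtt{refine}(\mathcal T)$ means that $\mathcal T'$ arises from $\mathcal T$ by finitely many steps $\mathtt{refine}(\cdot,\mathcal M)$ with arbitrary sets $\mathcal M$ of marked elements. Let $\mathcal T_{\ell+1}=\mathtt{refine}(\mathcal T_\ell)$ for all $\ell\ge 0$. Let $\mathcal S^p(\mathcal T_\ell)$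 be the space of continuous functions on $\overline\Omega$ which are polynomials of degree at most $p$ on every $T\in\mathcal T_\ell$, with Lagrange nodes $\mathcal N_\ell$ and nodal basis $(\phi_{\ell,z})_{z\in\mathcal N_\ell}$. For each $z\in\mathcal N_\ell$ let $\sigma_{\ell,z}$ be the element $T\in\mathcal T_\ell$ if $z$ lies in the interior of $T$, and otherwise any facet of $\mathcal T_\ell$ containing $z$, with $\sigma_{\ell,z}\subseteq\partial\Omega$ if $z\in\partial\Omega$. Let $\psi_{\ell,z}$ be the polynomial of degree at most $p$ on $\sigma_{\ell,z}$ with $\int_{\sigma_{\ell,z}}\psi_{\ell,z}\phi_{\ell,y}=\delta_{yz}$ for all nodes $y\in\sigma_{\ell,z}$, and define the Scott–Zhang interpolant of $v\in H^1(\Omega)$ by $$\mathbb J_\ell v=\sum_{z\in\mathcal N_\ell}\Big(\int_{\sigma_{\ell,z}}\psi_{\ell,z}\,v\Big)\phi_{\ell,z},$$ where $v$ on a facet is understood in the sense of traces. Assume that the choices are such that $(\mathbb J_{\ell+1}v)|_T=(\mathbb J_\ell v)|_T$ for all $v\in H^1(\Omega)$, all $\ell\ge0$, and all $T\in\mathcal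 T_\ell\cap\mathcal T_{\ell+1}$ whose patch $\bigcup\{T'\in\mathcal T_\ell: T'\cap T\ne\emptyset\}$ is contained in $\bigcup(\mathcal T_\ell\cap\mathcal T_{\ell+1})$. Then each $\mathbb J_\ell$ is a bounded linear operator on $H^1(\Omega)$, for every $v\in H^1(\Omega)$ the limit $\mathbb J_\infty v:=\lim_{\ell\to\infty}\mathbb J_\ell v$ exists in $H^1(\Omega)$, and $\mathbb J_\infty:H^1(\Omega)\to H^1(\Omega)$ is a bounded linear operator. -/

import Mathlib

open MeasureTheory Filter Topology Set
open scoped ENNReal NNReal ContDiff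

noncomputable section

namespace AFEM

/-- Euclidean space `ℝ^d`. -/
abbrev E (d : ℕ) : Type := EuclideanSpace ℝ (Fin d)

/-- The partial derivative `∂_j f (x)`. -/
def partialDeriv {d : ℕ} (j : Fin d) (f : E d → ℝ) (x : E d) : ℝ :=
  fderiv ℝ f x (EuclideanSpace.single j 1)

/-! ### The domain -/

/-- `Ω ⊆ ℝ^d` is a bounded Lipschitz domain: it is open, bounded, and around each boundary point
it is, for some unit vector `n`, the part lying above the graph of a Lipschitz function on the
hyperplane orthogonal to `n`. The function `g` enters only through its values at the orthogonal
projections `y - ⟨n, y⟩ n`. -/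
structure IsBoundedLipschitzDomain {d : ℕ} (Ω : Set (E d)) : Prop where
  isOpen : IsOpen Ω
  isBounded : Bornology.IsBounded Ω
  graph : ∀ x ∈ frontier Ω, ∃ (n : E d) (r : ℝ) (L : ℝ≥0) (g : E d → ℝ),
    ‖n‖ = 1 ∧ 0 < r ∧ LipschitzWith L g ∧
    Ω ∩ Metric.ball x r = {y ∈ Metric.ball x r | g (y - inner ℝ n y • n) < inner ℝ n y}

/-! ### The Sobolev space `H¹(Ω)` -/

/-- Lebesgue measure on `Ω`. -/
abbrev volOn {d : ℕ} (Ω : Set (E d)) : Measure (E d) := volume.restrict Ω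

/-- `G` is the weak `j`-th partial derivative of `u` on `Ω`. -/
def IsWeakPartial {d : ℕ} (Ω : Set (E d)) (j : Fin d) (u G : E d → ℝ) : Prop :=
  ∀ φ : E d → ℝ, ContDiff ℝ ∞ φ → HasCompactSupport φ → tsupport φ ⊆ Ω →
    ∫ x in Ω, u x * partialDeriv j φ x = - ∫ x in Ω, G x * φ x

/-- The Hilbert space `L²(Ω) × L²(Ω)^d` with `‖(u, G)‖² = ‖u‖² + ∑ⱼ ‖Gⱼ‖²`. -/
abbrev L2Pair {d : ℕ} (Ω : Set (E d)) : Type :=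
  WithLp 2 (Lp ℝ 2 (volOn Ω) × PiLp 2 (fun _ : Fin d => Lp ℝ 2 (volOn Ω)))

lemma integrable_mul_test {d : ℕ} {Ω : Set (E d)} (u : Lp ℝ 2 (volOn Ω)) {φ : E d → ℝ}
    (hφ : Continuous φ) (hc : HasCompactSupport φ) :
    Integrable (fun x => u x * φ x) (volOn Ω) :=
  (Lp.memLp u).integrable_mul (q := 2) (hφ.memLp_of_hasCompactSupport hc)

lemma continuous_partialDeriv {d : ℕ} (j : Fin d) {φ : E d → ℝ} (hφ : ContDiff ℝ ∞ φ) :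
    Continuous (partialDeriv j φ) :=
  (hφ.continuous_fderiv (by simp)).clm_apply continuous_const

lemma hasCompactSupport_partialDeriv {d : ℕ} (j : Fin d) {φ : E d → ℝ}
    (hc : HasCompactSupport φ) : HasCompactSupport (partialDeriv j φ) :=
  hc.fderiv_apply (𝕜 := ℝ) (EuclideanSpace.single j 1)

/-- The Sobolev space `H¹(Ω)`: the pairs `(u, ∇u)` of an `L²(Ω)`-function and its weak gradient in
`L²(Ω)^d`, with the norm `(‖u‖² + ‖∇u‖²)^{1/2}` inherited from `L²(Ω) × L²(Ω)^d`. -/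
def H1 {d : ℕ} (Ω : Set (E d)) : Submodule ℝ (L2Pair Ω) where
  carrier := {w | ∀ j, IsWeakPartial Ω j w.fst (w.snd j)}
  zero_mem' := by
    intro j φ _ _ _
    have h : ((0 : Lp ℝ 2 (volOn Ω)) : E d → ℝ) =ᵐ[volOn Ω] 0 := Lp.coeFn_zero _ _ _
    have h1 : ∫ x in Ω, (0 : Lp ℝ 2 (volOn Ω)) x * partialDeriv j φ x = 0 :=
      integral_eq_zero_of_ae (by filter_upwards [h] with x hx; rw [hx]; simp)
    have h2 : ∫ x in Ω, (0 : Lp ℝ 2 (volOn Ω)) x * φ x = 0 :=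
      integral_eq_zero_of_ae (by filter_upwards [h] with x hx; rw [hx]; simp)
    exact h1.trans (by simpa using h2)
  add_mem' := by
    intro a b ha hb j φ h1 h2 h3
    have key : ∀ (u w : Lp ℝ 2 (volOn Ω)) (ψ : E d → ℝ), Continuous ψ → HasCompactSupport ψ →
        ∫ x in Ω, (u + w : Lp ℝ 2 (volOn Ω)) x * ψ x
          = (∫ x in Ω, u x * ψ x) + ∫ x in Ω, w x * ψ x := by
      intro u w ψ hψ hc
      rw [← integral_add (integrable_mul_test u hψ hc) (integrable_mul_test w hψ hc)]
      refine integral_congr_ae ?_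
      filter_upwards [Lp.coeFn_add u w] with x hx
      rw [hx, Pi.add_apply, add_mul]
    have e1 := key a.fst b.fst _ (continuous_partialDeriv j h1) (hasCompactSupport_partialDeriv j h2)
    have e2 := key (a.snd j) (b.snd j) _ h1.continuous h2
    have ea := ha j φ h1 h2 h3
    have eb := hb j φ h1 h2 h3
    refine e1.trans ?_
    refine Eq.trans ?_ (congrArg Neg.neg e2).symm
    rw [ea, eb]; ring
  smul_mem' := by
    intro c a ha j φ h1 h2 h3
    have key : ∀ (u : Lp ℝ 2 (volOn Ω)) (ψ : E d → ℝ),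
        ∫ x in Ω, (c • u : Lp ℝ 2 (volOn Ω)) x * ψ x = c * ∫ x in Ω, u x * ψ x := by
      intro u ψ
      rw [← integral_const_mul]
      refine integral_congr_ae ?_
      filter_upwards [Lp.coeFn_smul c u] with x hx
      rw [hx, Pi.smul_apply, smul_eq_mul, mul_assoc]
    refine (key a.fst _).trans ?_
    refine Eq.trans ?_ (congrArg Neg.neg (key (a.snd j) _)).symm
    rw [ha j φ h1 h2 h3]; ring

/-- The underlying function of `v ∈ H¹(Ω)` (defined up to null sets of `Ω`). -/
def fn {d : ℕ} {Ω : Set (E d)} (v : H1 Ω) : E d → ℝ := v.1.fst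

/-- The `j`-th component of the weak gradient of `v ∈ H¹(Ω)`. -/
def grad {d : ℕ} {Ω : Set (E d)} (v : H1 Ω) (j : Fin d) : E d → ℝ := v.1.snd j

/-! ### Tagged simplices and newest vertex bisection -/

/-- A tagged `d`-simplex: an ordered list of `d+1` vertices and a type `γ ∈ {0, …, d-1}`.
Its refinement edge joins the first and the last vertex. -/
structure TaggedSimplex (d : ℕ) where
  verts : Fin (d + 1) → E d
  type : Fin d

namespace TaggedSimplex

variable {d : ℕ} (K : TaggedSimplex d)

/-- The element `T ⊆ ℝ^d` as a (closed) set. -/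
def body : Set (E d) := convexHull ℝ (range K.verts)

/-- The facet opposite to the `i`-th vertex. -/
def facet (i : Fin (d + 1)) : Set (E d) := convexHull ℝ (K.verts '' {i}ᶜ)

/-- The `k`-th vertex, for a natural number `k ≤ d`. -/
def vert (k : ℕ) : E d := K.verts (Fin.ofNat (d + 1) k)

/-- The type of the children. -/
def nextType : Fin d := ⟨(K.type + 1) % d, Nat.mod_lt _ K.type.pos⟩

/-- The first child `(x₀, (x₀ + x_d)/2, x₁, …, x_{d-1})` of `(x₀, …, x_d)`. -/
def child₁ : TaggedSimplex d where
  verts i :=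
    if (i : ℕ) = 0 then K.vert 0
    else if (i : ℕ) = 1 then midpoint ℝ (K.vert 0) (K.vert d)
    else K.vert (i - 1)
  type := K.nextType

/-- The second child `(x_d, (x₀ + x_d)/2, x₁, …, x_γ, x_{d-1}, …, x_{γ+1})` of `(x₀, …, x_d)` with
type `γ`. -/
def child₂ : TaggedSimplex d where
  verts i :=
    if (i : ℕ) = 0 then K.vert d
    else if (i : ℕ) = 1 then midpoint ℝ (K.vert 0) (K.vert d)
    else if (i : ℕ) ≤ K.type + 1 then K.vert (i - 1)
    else K.vert (d + K.type + 1 - i)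
  type := K.nextType

end TaggedSimplex

/-- A collection of tagged simplices. -/
abbrev Mesh (d : ℕ) : Type := Set (TaggedSimplex d)

/-- `T` is a regular (conforming) triangulation of `Ω` into non-degenerate simplices: any two
elements intersect in the convex hull of their common vertices. -/
structure IsRegularTriangulation {d : ℕ} (Ω : Set (E d)) (T : Mesh d) : Prop where
  finite : T.Finite
  nondegenerate : ∀ K ∈ T, AffineIndependent ℝ K.verts
  cover : ⋃ K ∈ T, K.body = closure Ω
  injOn : InjOn TaggedSimplex.body T
  conforming : ∀ K ∈ T, ∀ K' ∈ T,
    K.body ∩ K'.body = convexHull ℝ (range K.verts ∩ range K'.verts)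

/-- `T'` arises from `T` by bisecting one element. -/
def BisectStep {d : ℕ} (T T' : Mesh d) : Prop :=
  ∃ K ∈ T, T' = (T \ {K}) ∪ {K.child₁, K.child₂}

/-- `T'` arises from `T` by finitely many bisections (hanging nodes are allowed). -/
def IsBisection {d : ℕ} : Mesh d → Mesh d → Prop := Relation.ReflTransGen BisectStep

/-- `T'` is a regular triangulation, obtained from `T` by bisections, in which all elements of `M`
have been bisected at least once. -/
structure IsAdmissible {d : ℕ} (Ω : Set (E d)) (T M T' : Mesh d) : Prop where
  regular : IsRegularTriangulation Ω T'
  bisection : IsBisection T T'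
  marked : ∀ K ∈ M, K ∉ T'

/-- `T' = refine(T, M)`: the coarsest regular triangulation obtained from `T` by bisections such
that all marked elements have been bisected at least once. -/
def IsRefineMarked {d : ℕ} (Ω : Set (E d)) (T M T' : Mesh d) : Prop :=
  IsAdmissible Ω T M T' ∧ ∀ T'', IsAdmissible Ω T M T'' → IsBisection T' T''

/-- `T' = refine(T)`: finitely many successive steps `refine(·, M)` with arbitrary sets of marked
elements lead from `T` to `T'`. -/
def IsRefine {d : ℕ} (Ω : Set (E d)) : Mesh d → Mesh d → Prop :=
  Relation.ReflTransGen (fun T T' => ∃ M ⊆ T, IsRefineMarked Ω T M T')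

/-- The elements of a mesh as subsets of `ℝ^d`. -/
def elements {d : ℕ} (T : Mesh d) : Set (Set (E d)) := TaggedSimplex.body '' T

/-- The patch of `S`: the union of all elements of the mesh which intersect `S`. -/
def patch {d : ℕ} (T : Mesh d) (S : Set (E d)) : Set (E d) :=
  ⋃₀ {S' ∈ elements T | (S' ∩ S).Nonempty}

/-! ### Lagrange finite elements of degree `p` -/

/-- Evaluation of a polynomial in `d` variables at a point of `ℝ^d`. -/
def polyEval {d : ℕ} (q : MvPolynomial (Fin d) ℝ) (x : E d) : ℝ := MvPolynomial.eval (fun j => x j) q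

/-- The space `S^p(T)` of continuous functions on the closure of `Ω` that are polynomials of degree
at most `p` on every element. -/
def splineSpace {d : ℕ} (Ω : Set (E d)) (T : Mesh d) (p : ℕ) : Set (E d → ℝ) :=
  {V | ContinuousOn V (closure Ω) ∧ ∀ K ∈ T, ∃ q : MvPolynomial (Fin d) ℝ,
    q.totalDegree ≤ p ∧ ∀ x ∈ K.body, V x = polyEval q x}

/-- The Lagrange nodes of degree `p` of the mesh: the points of the elements all of whose
barycentric coordinates are integer multiples of `1/p`. -/
def nodes {d : ℕ} (T : Mesh d) (p : ℕ) : Set (E d) :=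
  {z | ∃ K ∈ T, ∃ a : Fin (d + 1) → ℕ, ∑ i, a i = p ∧ z = ∑ i, ((a i : ℝ) / p) • K.verts i}

open Classical in
/-- The nodal basis function `φ_z ∈ S^p(T)` of the node `z`, characterized by `φ_z(y) = δ_{yz}` for
all nodes `y`. -/
def nodalBasis {d : ℕ} (Ω : Set (E d)) (T : Mesh d) (p : ℕ) (z : E d) : E d → ℝ :=
  if h : ∃ V ∈ splineSpace Ω T p, ∀ y ∈ nodes T p, V y = if y = z then 1 else 0
  then h.choose else 0

/-! ### Traces on facets -/

/-- Surface measure on the `i`-th facet of `K`. -/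
def facetMeasure {d : ℕ} (K : TaggedSimplex d) (i : Fin (d + 1)) : Measure (E d) :=
  (μHE[d - 1]).restrict (K.facet i)

/-- `g ∈ L²(F)` is the trace of `v|_K ∈ H¹(K)` on the facet `F` of `K`: the `L²(F)`-limit of
restrictions to `F` of smooth functions which converge to `v` in `H¹(K)`. -/
def IsFacetTrace {d : ℕ} {Ω : Set (E d)} (K : TaggedSimplex d) (i : Fin (d + 1)) (v : H1 Ω)
    (g : E d → ℝ) : Prop :=
  MemLp g 2 (facetMeasure K i) ∧ ∃ φ : ℕ → E d → ℝ, (∀ n, ContDiff ℝ ∞ (φ n)) ∧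
    Tendsto (fun n => eLpNorm (fun x => φ n x - fn v x) 2 (volOn (interior K.body))) atTop (𝓝 0) ∧
    (∀ j, Tendsto (fun n => eLpNorm (fun x => partialDeriv j (φ n) x - grad v j x) 2
      (volOn (interior K.body))) atTop (𝓝 0)) ∧
    Tendsto (fun n => eLpNorm (fun x => φ n x - g x) 2 (facetMeasure K i)) atTop (𝓝 0)

open Classical in
/-- The trace of `v` on the `i`-th facet of `K` (unique up to null sets of the facet). -/
def facetTrace {d : ℕ} {Ω : Set (E d)} (K : TaggedSimplex d) (i : Fin (d + 1)) (v : H1 Ω) :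
    E d → ℝ :=
  if h : ∃ g, IsFacetTrace K i v g then h.choose else 0

/-! ### The Scott-Zhang projection -/

/-- The domain of integration attached to a node: an element or a facet of an element. -/
inductive Carrier (d : ℕ) where
  | elem (K : TaggedSimplex d) : Carrier d
  | facet (K : TaggedSimplex d) (i : Fin (d + 1)) : Carrier d

namespace Carrier

variable {d : ℕ}

/-- The set `σ`. -/
def set : Carrier d → Set (E d)
  | elem K => K.body
  | facet K i => K.facet i

/-- Lebesgue measure resp. surface measure on `σ`. -/
def measure : Carrier d → Measure (E d)
  | elem K => volOn K.body
  | facet K i => facetMeasure K i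

/-- The restriction resp. trace of `v ∈ H¹(Ω)` on `σ`. -/
def restrict {Ω : Set (E d)} : Carrier d → H1 Ω → E d → ℝ
  | elem _, v => fn v
  | facet K i, v => facetTrace K i v

/-- `σ` is an admissible choice for the node `z`: the element `K` itself if `z` lies in the interior
of `K`, and otherwise a facet of the mesh which contains `z`, where the facet has to lie on the
boundary of `Ω` if `z` does. -/
def Admissible (Ω : Set (E d)) (T : Mesh d) (z : E d) : Carrier d → Prop
  | elem K => K ∈ T ∧ z ∈ interior K.body
  | facet K i => K ∈ T ∧ z ∈ K.facet i ∧ (z ∈ frontier Ω → K.facet i ⊆ frontier Ω)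

end Carrier

/-- `q`, restricted to `σ`, is the `L²(σ)`-dual basis function of degree at most `p` of the node
`z`: `∫_σ q φ_y = δ_{yz}` for all nodes `y` on `σ`. -/
def IsDualFunction {d : ℕ} (Ω : Set (E d)) (T : Mesh d) (p : ℕ) (σ : Carrier d) (z : E d)
    (q : MvPolynomial (Fin d) ℝ) : Prop :=
  open Classical in
  q.totalDegree ≤ p ∧ ∀ y ∈ nodes T p ∩ σ.set,
    ∫ x, polyEval q x * nodalBasis Ω T p y x ∂σ.measure = if y = z then 1 else 0

open Classical in
/-- The `L²(σ)`-dual basis function `ψ_z` (its values on `σ` are unique). -/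
def dualFunction {d : ℕ} (Ω : Set (E d)) (T : Mesh d) (p : ℕ) (σ : Carrier d) (z : E d) :
    MvPolynomial (Fin d) ℝ :=
  if h : ∃ q, IsDualFunction Ω T p σ z q then h.choose else 0

/-- The Scott-Zhang interpolant `J v = ∑_z (∫_{σ_z} ψ_z v) φ_z` of `v ∈ H¹(Ω)` in `S^p(T)`, with
respect to the choice `z ↦ σ_z`. -/
def scottZhang {d : ℕ} {Ω : Set (E d)} (T : Mesh d) (p : ℕ) (σ : E d → Carrier d) (v : H1 Ω)
    (x : E d) : ℝ :=
  ∑ᶠ z ∈ nodes T p,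
    (∫ y, polyEval (dualFunction Ω T p (σ z) z) y * (σ z).restrict v y ∂(σ z).measure) *
      nodalBasis Ω T p z x

end AFEM

end

/-! Fix `v` and `δ > 0`. At a late level the domain splits into two parts. Where an element and all
its neighbours are never bisected again, the interpolants no longer change, by the locality
assumption on the choices. Everywhere else the elements have diameter at most `δ`, and there every
interpolant is close to `v` in `H¹`, with an error that tends to zero with `δ` uniformly over all
meshes. Hence `J l v` is a Cauchy sequence; `H¹` is complete, and Banach-Steinhaus makes the
pointwise limit a bounded operator (`exists_limit_of_shaped`).

The splitting rests on the geometry of bisection. All descendants of the initial mesh are similar,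
by translation and dilation, to finitely many simplices, and their diameters tend to zero with the
generation (`exists_shapes`). So only finitely many elements have diameter at least `δ / κ`, and
each of them that is present at a late level stays forever (`exists_persistent`). Since touching
elements have diameters comparable up to `κ` (`exists_star_bound`), an element larger than `δ` has
only persistent neighbours, and `scottZhang_eq_of_persistent` applies.

Smallness of the error follows from a local stability estimate on patches (`exists_local_stability`)
and from the reproduction of affine functions, available because `p ≥ 1` (`exists_local_approx`):
the error on an element is controlled by the distance of the gradient to a constant vector on the
patch. Replacing the gradient by a uniformly continuous field makes these distances small on small
patches, and the finite overlap of patches allows summation (`exists_smallPart_bound`).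

Stability in turn combines the scaled trace inequality (`exists_traceBound`), the scaling of the
dual functions (`exists_dual_bound`), the Poincaré inequality on convex sets (`poincare`) and a
comparison of mean values over touching elements (`IsRegularTriangulation.mean_sub_sq_le`). The
comparison moves through common facets. The elements around a point are linked by such steps because
a Lipschitz domain is locally star-shaped with respect to a ball
(`IsRegularTriangulation.star_connected`). -/

noncomputable section

namespace AFEM

open scoped Convolution

/-! ### Smooth approximation of Sobolev functions on convex sets. -/

/-- The affine map `x ↦ a + s x` has Jacobian `s^d`. -/
lemma map_volume_affine {d : ℕ} (a : E d) {s : ℝ} (hs : 0 < s) :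
    (volume : Measure (E d)).map (fun x => a + s • x)
      = ENNReal.ofReal ((s ^ d)⁻¹) • (volume : Measure (E d)) := by
  have h1 : (fun x : E d => a + s • x) = (fun x => a + x) ∘ (fun x => s • x) := rfl
  rw [h1, ← Measure.map_map (measurable_const_add a) (measurable_const_smul s),
    Measure.map_addHaar_smul _ hs.ne', Measure.map_smul, map_add_left_eq_self]
  simp [abs_of_pos (inv_pos.mpr (pow_pos hs d))]

lemma measurableEmbedding_affine {d : ℕ} (a : E d) {s : ℝ} (hs : 0 < s) :
    MeasurableEmbedding (fun x : E d => a + s • x) := by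
  have h1 : (fun x : E d => a + s • x) = (fun x => a + x) ∘ (fun x => s • x) := rfl
  rw [h1]
  exact (measurableEmbedding_addLeft a).comp (measurableEmbedding_const_smul₀ hs.ne')

lemma eLpNorm_comp_affine_le {d : ℕ} (a : E d) {s : ℝ} (hs : 1 / 2 ≤ s) (f : E d → ℝ) :
    eLpNorm (fun x => f (a + s • x)) 2 volume ≤ 2 ^ d * eLpNorm f 2 volume := by
  have hs0 : 0 < s := by linarith
  have h := (measurableEmbedding_affine a hs0).eLpNorm_map_measure (g := f) (p := 2)
    (μ := volume)
  rw [map_volume_affine a hs0, eLpNorm_smul_measure_of_ne_top (by simp)] at h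
  change _ = eLpNorm (fun x => f (a + s • x)) 2 volume at h
  rw [← h, smul_eq_mul]
  gcongr
  have h2 : (s ^ d)⁻¹ ≤ 2 ^ d := by
    rw [inv_le_comm₀ (by positivity) (by positivity), ← inv_pow]
    exact pow_le_pow_left₀ (by norm_num) (by linarith) d
  have h3 : ENNReal.ofReal ((s ^ d)⁻¹) ≤ 2 ^ d := by
    refine (ENNReal.ofReal_le_ofReal h2).trans ?_
    rw [ENNReal.ofReal_pow (by norm_num)]
    simp
  -- The exact factor is the square root of the Jacobian; as its bound `2 ^ d` is at least one, the
  -- root can be dropped.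
  refine (ENNReal.rpow_le_rpow h3 (by positivity)).trans ?_
  refine (ENNReal.rpow_le_rpow_of_exponent_le (one_le_pow₀ (by norm_num)) (?_ : _ ≤ (1:ℝ))).trans
    (by simp)
  norm_num

/-- Convolution with a mollifier is a contraction on `L²`. -/
lemma eLpNorm_normed_convolution_le {d : ℕ} (ρ : ContDiffBump (0 : E d)) {f : E d → ℝ}
    (hf : Measurable f) :
    eLpNorm (ρ.normed volume ⋆[ContinuousLinearMap.lsmul ℝ ℝ, volume] f) 2 volume
      ≤ eLpNorm f 2 volume := by
  -- The normalised bump is the density of a probability measure `P`. The inclusion of `L²(P)` in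
  -- `L¹(P)` bounds the squared convolution by the `P`-average of squared translates; Tonelli and
  -- translation invariance finish.
  set P : Measure (E d) := volume.withDensity (fun y => ENNReal.ofReal (ρ.normed volume y)) with hP
  have hm : Measurable (fun y => ENNReal.ofReal (ρ.normed volume y)) :=
    (ρ.continuous_normed.measurable).ennreal_ofReal
  have hprob : IsProbabilityMeasure P := by
    constructor
    rw [hP, withDensity_apply _ MeasurableSet.univ, Measure.restrict_univ,
      ← ofReal_integral_eq_lintegral_ofReal ρ.integrable_normed
        (Eventually.of_forall fun x => ρ.nonneg_normed x), ρ.integral_normed]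
    simp
  have hpt : ∀ x, ‖(ρ.normed volume ⋆[ContinuousLinearMap.lsmul ℝ ℝ, volume] f) x‖ₑ ^ (2 : ℝ)
      ≤ ∫⁻ y, ‖f (x - y)‖ₑ ^ (2 : ℝ) ∂P := by
    intro x
    have hfx : Measurable (fun y => f (x - y)) := hf.comp (measurable_const.sub measurable_id)
    have h1 : ‖(ρ.normed volume ⋆[ContinuousLinearMap.lsmul ℝ ℝ, volume] f) x‖ₑ
        ≤ eLpNorm (fun y => f (x - y)) 1 P := by
      rw [eLpNorm_one_eq_lintegral_enorm, hP, lintegral_withDensity_eq_lintegral_mul _ hm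
        hfx.enorm, convolution_def]
      refine (enorm_integral_le_lintegral_enorm _).trans_eq (lintegral_congr fun y => ?_)
      simp only [ContinuousLinearMap.lsmul_apply, smul_eq_mul, enorm_mul, Pi.mul_apply]
      rw [Real.enorm_of_nonneg (ρ.nonneg_normed y)]
    have h2 : eLpNorm (fun y => f (x - y)) 1 P ≤ eLpNorm (fun y => f (x - y)) 2 P :=
      eLpNorm_le_eLpNorm_of_exponent_le (by norm_num) hfx.aestronglyMeasurable
    have h3 := ENNReal.rpow_le_rpow (h1.trans h2) (z := 2) (by norm_num)
    refine h3.trans_eq ?_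
    rw [eLpNorm_eq_lintegral_rpow_enorm_toReal (by norm_num) (by norm_num), ← ENNReal.rpow_mul]
    simp
  rw [eLpNorm_eq_lintegral_rpow_enorm_toReal (by norm_num) (by norm_num),
    eLpNorm_eq_lintegral_rpow_enorm_toReal (by norm_num) (by norm_num)]
  gcongr ?_ ^ _
  simp only [ENNReal.toReal_ofNat]
  calc ∫⁻ x, ‖(ρ.normed volume ⋆[ContinuousLinearMap.lsmul ℝ ℝ, volume] f) x‖ₑ ^ (2 : ℝ)
      ≤ ∫⁻ x, ∫⁻ y, ‖f (x - y)‖ₑ ^ (2 : ℝ) ∂P := lintegral_mono hpt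
    _ = ∫⁻ y, (∫⁻ x, ‖f (x - y)‖ₑ ^ (2 : ℝ)) ∂P := by
        refine lintegral_lintegral_swap ?_
        exact ((hf.comp (measurable_fst.sub measurable_snd)).enorm.pow_const _).aemeasurable
    _ = ∫⁻ y, (∫⁻ x, ‖f x‖ₑ ^ (2 : ℝ)) ∂P := by
        refine lintegral_congr fun y => ?_
        exact lintegral_sub_right_eq_self (fun x => ‖f x‖ₑ ^ (2 : ℝ)) y
    _ = ∫⁻ x, ‖f x‖ₑ ^ (2 : ℝ) := by simp

/-- Mollification combined with a small dilation converges in `L²`. -/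
lemma exists_mollify_dilate_close {d : ℕ} {f : E d → ℝ} (hf : Measurable f)
    (hf2 : MemLp f 2 volume) (x₀ : E d) {C : Set (E d)} (hC : Bornology.IsBounded C)
    (hCm : MeasurableSet C) {ε : ℝ} (hε : 0 < ε) :
    ∃ η > 0, η ≤ 1 / 2 ∧ ∀ t : ℝ, 1 - η < t → t < 1 → ∀ ρ : ContDiffBump (0 : E d), ρ.rOut < η →
      eLpNorm (fun x => (ρ.normed volume ⋆[ContinuousLinearMap.lsmul ℝ ℝ, volume] f)
        ((1 - t) • x₀ + t • x) - f x) 2 (volOn C) ≤ ENNReal.ofReal ε := by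
  obtain ⟨R, hR0, hR⟩ : ∃ R > 0, ∀ x ∈ C, ‖x₀ - x‖ ≤ R := by
    obtain ⟨R, hR⟩ := hC.subset_closedBall x₀
    refine ⟨max R 1, by positivity, fun x hx => ?_⟩
    have := hR hx
    rw [Metric.mem_closedBall, dist_comm, dist_eq_norm] at this
    exact this.trans (le_max_left _ _)
  have hCfin : volume C ≠ ⊤ := hC.measure_lt_top.ne
  -- With `g` continuous, compactly supported and `e`-close to `f`, the three summands pay for the
  -- smoothed difference `f - g`, for `g - f`, and for the uniform error `2 * e` of the smoothed `g`
  -- on `C`.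
  set K : ℝ := 2 ^ d + 1 + 2 * ((volume C).toReal ^ (1 / 2 : ℝ)) with hK
  have hK0 : 0 < K := by positivity
  set e : ℝ := ε / K with he
  have he0 : 0 < e := by positivity
  obtain ⟨g, hgc, hfg, hgcont, hg2⟩ := hf2.exists_hasCompactSupport_eLpNorm_sub_le (by norm_num)
    (ε := ENNReal.ofReal e) (by simpa using he0)
  have hunif := hgc.uniformContinuous_of_continuous hgcont
  rw [Metric.uniformContinuous_iff] at hunif
  obtain ⟨δ, hδ, hunif⟩ := hunif e he0
  -- The bound `1 / 2` keeps the Jacobian below `2 ^ d`, `δ` limits the radius of the bump, and `δ /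
  -- (2 * R)` limits the displacement `(1 - t) * ‖x₀ - x‖`.
  refine ⟨min (1 / 2) (min δ (δ / (2 * R))), by positivity, min_le_left _ _, ?_⟩
  intro t ht1 ht2 ρ hρ
  have hη1 : 1 - t < δ / (2 * R) := by
    have := (min_le_right (1/2) (min δ (δ / (2 * R)))).trans (min_le_right _ _); linarith
  have hη2 : 1 / 2 ≤ t := by
    have := (min_le_left (1/2) (min δ (δ / (2 * R)))); linarith
  have hη3 : ρ.rOut < δ :=
    hρ.trans_le ((min_le_right (1/2) (min δ (δ / (2 * R)))).trans (min_le_left _ _))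
  set M : (E d → ℝ) → E d → ℝ := fun f x =>
    (ρ.normed volume ⋆[ContinuousLinearMap.lsmul ℝ ℝ, volume] f) ((1 - t) • x₀ + t • x) with hM
  have hgm : Measurable g := hgcont.measurable
  have hdiff : ∀ x, M f x - f x = M (f - g) x + ((M g x - g x) + (g x - f x)) := by
    intro x
    have hl : ∀ u : E d → ℝ, LocallyIntegrable u volume →
        ∀ z, ConvolutionExistsAt (ρ.normed volume) u z (ContinuousLinearMap.lsmul ℝ ℝ) volume :=
      fun u hu z => (ρ.hasCompactSupport_normed.convolutionExists_left _ ρ.continuous_normed hu) z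
    have e1 : M f x = M (f - g) x + M g x := by
      simp only [hM]
      rw [← (hl (f - g) ((hf2.sub hg2).locallyIntegrable (by norm_num)) _).distrib_add
        (hl g (hg2.locallyIntegrable (by norm_num)) _)]
      congr 1
      simp
    rw [e1]; ring
  have hcont : ∀ u : E d → ℝ, LocallyIntegrable u volume →
      Continuous (ρ.normed volume ⋆[ContinuousLinearMap.lsmul ℝ ℝ, volume] u) := fun u hu =>
    ρ.hasCompactSupport_normed.continuous_convolution_left _ ρ.continuous_normed hu
  have hMm : ∀ u : E d → ℝ, LocallyIntegrable u volume → Measurable (M u) := fun u hu =>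
    ((hcont u hu).comp (by fun_prop : Continuous fun x : E d => (1 - t) • x₀ + t • x)).measurable
  have hm1 : Measurable (M (f - g)) := hMm _ ((hf2.sub hg2).locallyIntegrable (by norm_num))
  have hm2 : Measurable (M g) := hMm _ (hg2.locallyIntegrable (by norm_num))
  have b1 : eLpNorm (M (f - g)) 2 (volOn C) ≤ 2 ^ d * ENNReal.ofReal e := by
    refine (eLpNorm_mono_measure _ Measure.restrict_le_self).trans ?_
    refine (eLpNorm_comp_affine_le _ hη2 _).trans ?_
    gcongr
    exact (eLpNorm_normed_convolution_le ρ (hf.sub hgm)).trans hfg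
  have b3 : eLpNorm (fun x => g x - f x) 2 (volOn C) ≤ ENNReal.ofReal e := by
    refine (eLpNorm_mono_measure _ Measure.restrict_le_self).trans ?_
    have := eLpNorm_sub_comm g f 2 (volume : Measure (E d))
    exact (this.trans_le hfg)
  have b2 : eLpNorm (fun x => M g x - g x) 2 (volOn C)
      ≤ volume C ^ (1 / 2 : ℝ) * ENNReal.ofReal (2 * e) := by
    have := eLpNorm_le_of_ae_bound (p := 2) (μ := volOn C) (f := fun x => M g x - g x) (C := 2 * e)
      (by
        filter_upwards [ae_restrict_mem hCm] with x hx
        set z := (1 - t) • x₀ + t • x with hz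
        have hzx : dist z x < δ := by
          have : z - x = (1 - t) • (x₀ - x) := by rw [hz]; module
          rw [dist_eq_norm, this, norm_smul, Real.norm_of_nonneg (by linarith)]
          calc (1 - t) * ‖x₀ - x‖ ≤ (1 - t) * R := by
                exact mul_le_mul_of_nonneg_left (hR x hx) (by linarith)
            _ ≤ δ / (2 * R) * R := by gcongr
            _ = δ / 2 := by field_simp
            _ < δ := by linarith
        have c1 : dist (M g x) (g z) ≤ e :=
          ρ.dist_normed_convolution_le hgm.aestronglyMeasurable
            (fun y hy => (hunif ((Metric.mem_ball.mp hy).trans hη3)).le)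
        have c2 : dist (g z) (g x) ≤ e := (hunif hzx).le
        rw [← dist_eq_norm]
        linarith [dist_triangle (M g x) (g z) (g x)])
    simpa using this
  have hfun : (fun x => (ρ.normed volume ⋆[ContinuousLinearMap.lsmul ℝ ℝ, volume] f)
        ((1 - t) • x₀ + t • x) - f x) = (M (f - g) + ((fun x => M g x - g x) + fun x => g x - f x)) :=
    funext hdiff
  rw [hfun]
  refine (eLpNorm_add_le hm1.aestronglyMeasurable ((hm2.sub hgm).add (hgm.sub hf)).aestronglyMeasurable
    (by norm_num)).trans ?_
  refine (add_le_add b1 ((eLpNorm_add_le (hm2.sub hgm).aestronglyMeasurable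
    (hgm.sub hf).aestronglyMeasurable (by norm_num)).trans (add_le_add b2 b3))).trans ?_
  have hv : volume C ^ (1 / 2 : ℝ) = ENNReal.ofReal ((volume C).toReal ^ (1 / 2 : ℝ)) := by
    rw [← ENNReal.ofReal_rpow_of_nonneg ENNReal.toReal_nonneg (by norm_num),
      ENNReal.ofReal_toReal hCfin]
  have h2d : (2 : ℝ≥0∞) ^ d = ENNReal.ofReal (2 ^ d) := by
    rw [ENNReal.ofReal_pow (by norm_num)]; simp
  rw [hv, h2d, ← ENNReal.ofReal_mul (by positivity), ← ENNReal.ofReal_mul (by positivity),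
    ← ENNReal.ofReal_add (by positivity) (by positivity),
    ← ENNReal.ofReal_add (by positivity) (by positivity)]
  refine ENNReal.ofReal_le_ofReal (le_of_eq ?_)
  have : ε = K * e := by rw [he]; field_simp
  rw [this, hK]; ring

lemma memLp_fn {d : ℕ} {Ω : Set (E d)} (v : H1 Ω) : MemLp (fn v) 2 (volOn Ω) := Lp.memLp v.1.fst
lemma memLp_grad {d : ℕ} {Ω : Set (E d)} (v : H1 Ω) (j : Fin d) : MemLp (grad v j) 2 (volOn Ω) :=
  Lp.memLp (v.1.snd j)
lemma measurable_fn {d : ℕ} {Ω : Set (E d)} (v : H1 Ω) : Measurable (fn v) :=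
  (Lp.stronglyMeasurable v.1.fst).measurable
lemma measurable_grad {d : ℕ} {Ω : Set (E d)} (v : H1 Ω) (j : Fin d) : Measurable (grad v j) :=
  (Lp.stronglyMeasurable (v.1.snd j)).measurable

/-- On convex subdomains, `H¹` functions are limits of smooth functions. -/
theorem exists_smooth_approx {d : ℕ} {Ω C : Set (E d)} (hC : Convex ℝ C) (hCo : IsOpen C)
    (hCb : Bornology.IsBounded C) (hCΩ : C ⊆ Ω) (v : H1 Ω) {ε : ℝ} (hε : 0 < ε) :
    ∃ φ : E d → ℝ, ContDiff ℝ ∞ φ ∧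
      eLpNorm (fun x => φ x - fn v x) 2 (volOn C) ≤ ENNReal.ofReal ε ∧
      ∀ j, eLpNorm (fun x => partialDeriv j φ x - grad v j x) 2 (volOn C) ≤ ENNReal.ofReal ε := by
  rcases C.eq_empty_or_nonempty with rfl | ⟨x₀, hx₀⟩
  · exact ⟨0, contDiff_const, by simp [volOn], by simp [volOn]⟩
  have hmem : ∀ u : E d → ℝ, MemLp u 2 (volOn Ω) → MemLp (C.indicator u) 2 volume := fun u hu =>
    (memLp_indicator_iff_restrict hCo.measurableSet).mpr
      (hu.mono_measure (Measure.restrict_mono hCΩ le_rfl))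
  have hε2 : 0 < ε / 2 := by linarith
  set f := C.indicator (fn v) with hf
  have hf2 := hmem _ (memLp_fn v)
  have hfm : Measurable f := (measurable_fn v).indicator hCo.measurableSet
  -- The zero extensions `f` and `G j` need not be related by a weak derivative across the boundary
  -- of `C`; the relation is used only where the bump sees nothing but `C`.
  set G : Fin d → E d → ℝ := fun j => C.indicator (grad v j) with hG
  have hG2 := fun j => hmem _ (memLp_grad v j)
  have hGm : ∀ j, Measurable (G j) := fun j => (measurable_grad v j).indicator hCo.measurableSet
  have hGn : ∀ j, ∃ N : ℝ, 0 ≤ N ∧ eLpNorm (G j) 2 volume ≤ ENNReal.ofReal N := fun j =>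
    ⟨(eLpNorm (G j) 2 volume).toReal, ENNReal.toReal_nonneg,
      (ENNReal.ofReal_toReal (hG2 j).eLpNorm_ne_top).ge⟩
  choose N hN0 hN using hGn
  obtain ⟨η₀, hη₀, hη₀', hη₀f⟩ := exists_mollify_dilate_close hfm hf2 x₀ hCb hCo.measurableSet hε2
  have := fun j => exists_mollify_dilate_close (hGm j) (hG2 j) x₀ hCb hCo.measurableSet hε2
  choose η hη hη' hηG using this
  set S := 1 + ∑ j, N j with hS
  have hSpos : 0 < S := by
    have : 0 ≤ ∑ j, N j := Finset.sum_nonneg fun j _ => hN0 j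
    linarith
  have hNS : ∀ j, N j ≤ S := fun j => by
    have := Finset.single_le_sum (fun i _ => hN0 i) (Finset.mem_univ j)
    linarith
  -- The last condition pays for the factor `t` that the chain rule puts in front of the smoothed
  -- gradient, whose norm is at most `2 ^ d * S`.
  obtain ⟨m, hm0, hmη₀, hmη, hmS⟩ : ∃ m > 0, m ≤ η₀ ∧ (∀ j, m ≤ η j) ∧
      m * (2 ^ d * S) ≤ ε / 2 := by
    have hfin : ∃ m > 0, ∀ j, m ≤ η j := by
      rcases isEmpty_or_nonempty (Fin d) with h | h
      · exact ⟨1, one_pos, fun j => h.elim j⟩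
      · obtain ⟨j, hj⟩ := Finite.exists_min η
        exact ⟨η j, hη j, hj⟩
    obtain ⟨m, hm, hmj⟩ := hfin
    refine ⟨min (min η₀ m) (ε / 2 / (2 ^ d * S)), by positivity,
      (min_le_left _ _).trans (min_le_left _ _),
      fun j => ((min_le_left _ _).trans (min_le_right _ _)).trans (hmj j), ?_⟩
    calc _ ≤ (ε / 2 / (2 ^ d * S)) * (2 ^ d * S) := by gcongr; exact min_le_right _ _
      _ = ε / 2 := by field_simp
  set t : ℝ := 1 - m / 2 with ht
  have ht1 : t < 1 := by linarith
  have ht12 : 1 / 2 ≤ t := by linarith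
  set A : E d → E d := fun x => (1 - t) • x₀ + t • x with hA
  have hAcont : Continuous A := by fun_prop
  have hcl : IsCompact (closure C) := hCb.isCompact_closure
  -- Contracting towards the interior point `x₀` moves even the closure into the open set `C`;
  -- compactness then leaves a margin `δ` for the bump.
  have hAC : A '' closure C ⊆ C := by
    rintro _ ⟨x, hx, rfl⟩
    have := hC.combo_interior_closure_mem_interior (by rwa [hCo.interior_eq]) hx
      (a := 1 - t) (b := t) (by linarith) (by linarith) (by ring)
    rwa [hCo.interior_eq] at this
  obtain ⟨δ, hδ, hδC⟩ := (hcl.image hAcont).exists_cthickening_subset_open hCo hAC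
  obtain ⟨r, hr0, hrδ, hrm⟩ : ∃ r > 0, r < δ ∧ r < m :=
    ⟨min δ m / 2, by positivity, by linarith [min_le_left δ m, lt_min hδ hm0],
      by linarith [min_le_right δ m, lt_min hδ hm0]⟩
  let ρ : ContDiffBump (0 : E d) := ⟨r / 2, r, by linarith, by linarith⟩
  have hρr : ρ.rOut = r := rfl
  have hball : ∀ x ∈ C, Metric.closedBall (A x) r ⊆ C := fun x hx =>
    (Metric.closedBall_subset_closedBall hrδ.le).trans
      ((Metric.closedBall_subset_cthickening (mem_image_of_mem A (subset_closure hx)) δ).trans hδC)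
  have hloc : LocallyIntegrable f volume := hf2.locallyIntegrable (by norm_num)
  have hρs : ContDiff ℝ ∞ (ρ.normed (volume : Measure (E d))) := ρ.contDiff_normed
  set F := ρ.normed volume ⋆[ContinuousLinearMap.lsmul ℝ ℝ, volume] f with hF
  have hFs : ContDiff ℝ ∞ F := ρ.hasCompactSupport_normed.contDiff_convolution_left _ hρs hloc
  -- The derivative falls on the bump, and `y ↦ ρ (A x - y)` is a test function supported in `C ⊆
  -- Ω`, so the definition of the weak gradient transfers the derivative to `v`.
  have hder : ∀ j, ∀ x ∈ C, partialDeriv j (fun x => F (A x)) x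
      = t * (ρ.normed volume ⋆[ContinuousLinearMap.lsmul ℝ ℝ, volume] (G j)) (A x) := by
    intro j x hx
    have hAd : HasFDerivAt A (t • ContinuousLinearMap.id ℝ (E d)) x :=
      ((hasFDerivAt_id x).const_smul t).const_add _
    have hFd := ρ.hasCompactSupport_normed.hasFDerivAt_convolution_left
      (ContinuousLinearMap.lsmul ℝ ℝ) (hρs.of_le (by simp)) hloc (A x)
    have hcomp : HasFDerivAt (fun x => F (A x)) _ x := hFd.comp x hAd
    rw [partialDeriv, hcomp.fderiv]
    simp only [ContinuousLinearMap.comp_apply, smul_apply,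
      ContinuousLinearMap.id_apply, map_smul, smul_eq_mul]
    congr 1
    have hci := ((ρ.hasCompactSupport_normed (μ := volume)).fderiv (𝕜 := ℝ)).convolutionExists_left
      (ContinuousLinearMap.precompL (E d) (ContinuousLinearMap.lsmul ℝ ℝ))
      (hρs.continuous_fderiv (by simp)) hloc (A x)
    refine (ContinuousLinearMap.integral_apply hci _).trans ?_
    simp only [ContinuousLinearMap.precompL_apply, ContinuousLinearMap.lsmul_apply, smul_eq_mul]
    -- the test function
    set ψ : E d → ℝ := fun y => ρ.normed volume (A x - y) with hψ
    have hψs : ContDiff ℝ ∞ ψ := hρs.comp (contDiff_const.sub contDiff_id)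
    have hsupp : tsupport ψ ⊆ Metric.closedBall (A x) r := by
      refine closure_minimal (fun y hy => ?_) Metric.isClosed_closedBall
      have : A x - y ∈ Function.support (ρ.normed (volume : Measure (E d))) := hy
      rw [ρ.support_normed_eq, Metric.mem_ball, dist_zero_right] at this
      rw [Metric.mem_closedBall, dist_comm, dist_eq_norm]
      exact this.le
    have hψc : HasCompactSupport ψ :=
      (isCompact_closedBall (A x) r).of_isClosed_subset (isClosed_tsupport _) hsupp
    have hψd : ∀ y, partialDeriv j ψ y = - fderiv ℝ (ρ.normed volume) (A x - y)
        (EuclideanSpace.single j 1) := by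
      intro y
      have h1 : HasFDerivAt (fun y => A x - y) (-ContinuousLinearMap.id ℝ (E d)) y :=
        (hasFDerivAt_id y).const_sub _
      have h2 : HasFDerivAt (ρ.normed (volume : Measure (E d))) _ (A x - y) :=
        (hρs.differentiable (by simp) (A x - y)).hasFDerivAt
      have h3 : HasFDerivAt ψ _ y := h2.comp y h1
      rw [partialDeriv, h3.fderiv]; simp
    have hw := v.2 j ψ hψs hψc (hsupp.trans ((hball x hx).trans hCΩ))
    -- rewrite integrals over `Ω` as integrals over everything
    have hin : ∀ (u w : E d → ℝ), (∀ y ∉ C, w y = 0) →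
        ∫ y in Ω, u y * w y = ∫ y, C.indicator u y * w y := by
      intro u w hw0
      have e1 : ∀ y, C.indicator u y * w y = C.indicator (fun y => u y * w y) y := by
        intro y
        by_cases hy : y ∈ C <;> simp [hy]
      have e2 : ∀ y, u y * w y = C.indicator (fun y => u y * w y) y := by
        intro y
        by_cases hy : y ∈ C <;> simp [hy, hw0]
      simp_rw [e1]
      rw [integral_congr_ae (Eventually.of_forall e2), integral_indicator hCo.measurableSet,
        integral_indicator hCo.measurableSet, Measure.restrict_restrict hCo.measurableSet,
        inter_eq_self_of_subset_left hCΩ]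
    have z1 : ∀ y ∉ C, ψ y = 0 := fun y hy => image_eq_zero_of_notMem_tsupport
      fun h => hy ((hsupp.trans (hball x hx)) h)
    have z2 : ∀ y ∉ C, partialDeriv j ψ y = 0 := by
      intro y hy
      have : y ∉ tsupport (fderiv ℝ ψ) := fun h =>
        hy ((hsupp.trans (hball x hx)) (tsupport_fderiv_subset ℝ h))
      rw [partialDeriv, image_eq_zero_of_notMem_tsupport this]; simp
    have hw' : ∫ y in Ω, fn v y * partialDeriv j ψ y = - ∫ y in Ω, grad v j y * ψ y := hw
    rw [hin _ _ z1, hin _ _ z2] at hw'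
    have r1 : ∫ y, f y * partialDeriv j ψ y = - ∫ y,
        fderiv ℝ (ρ.normed volume) (A x - y) (EuclideanSpace.single j 1) * f y := by
      rw [← integral_neg]
      exact integral_congr_ae (Eventually.of_forall fun y => by simp only [hψd]; ring)
    have r2 : (ρ.normed volume ⋆[ContinuousLinearMap.lsmul ℝ ℝ, volume] (G j)) (A x)
        = ∫ y, G j y * ψ y := by
      rw [convolution_def, ← integral_sub_left_eq_self _ volume (A x)]
      exact integral_congr_ae (Eventually.of_forall fun y => by simp [hψ, mul_comm])
    have r3 : ∫ y, fderiv ℝ (ρ.normed volume) y (EuclideanSpace.single j 1) * f (A x - y)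
        = ∫ y, fderiv ℝ (ρ.normed volume) (A x - y) (EuclideanSpace.single j 1) * f y := by
      rw [← integral_sub_left_eq_self _ volume (A x)]
      exact integral_congr_ae (Eventually.of_forall fun y => by simp)
    have hw3 : ∫ y, f y * partialDeriv j ψ y = - ∫ y, G j y * ψ y := hw'
    rw [r2, r3]
    linarith
  refine ⟨fun x => F (A x), hFs.comp (by fun_prop), ?_, fun j => ?_⟩
  · refine le_trans (le_of_eq (eLpNorm_congr_ae ?_)) ((hη₀f t (by linarith) ht1 ρ
      (by rw [hρr]; linarith)).trans (ENNReal.ofReal_le_ofReal (by linarith)))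
    filter_upwards [ae_restrict_mem hCo.measurableSet] with x hx
    simp [hA, hF, hf, hx]
  · set Mj := fun x => (ρ.normed volume ⋆[ContinuousLinearMap.lsmul ℝ ℝ, volume] (G j)) (A x)
      with hMj
    have hMc : Continuous Mj := (ρ.hasCompactSupport_normed.continuous_convolution_left _
      ρ.continuous_normed ((hG2 j).locallyIntegrable (by norm_num))).comp hAcont
    have e1 : eLpNorm (fun x => partialDeriv j (fun x => F (A x)) x - grad v j x) 2 (volOn C)
        = eLpNorm ((fun x => (Mj x - G j x)) + (t - 1) • Mj) 2 (volOn C) := by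
      refine eLpNorm_congr_ae ?_
      filter_upwards [ae_restrict_mem hCo.measurableSet] with x hx
      rw [hder j x hx]
      simp only [Pi.add_apply, Pi.smul_apply, smul_eq_mul, hG, hMj, indicator_of_mem hx]
      ring
    rw [e1]
    refine (eLpNorm_add_le (hMc.measurable.sub (hGm j)).aestronglyMeasurable
      (hMc.measurable.const_smul _).aestronglyMeasurable (by norm_num)).trans ?_
    have b1 := hηG j t (by linarith [hmη j]) ht1 ρ (by rw [hρr]; linarith [hmη j])
    have b2 : eLpNorm ((t - 1) • Mj) 2 (volOn C) ≤ ENNReal.ofReal (ε / 2) := by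
      rw [eLpNorm_const_smul]
      have c1 : eLpNorm Mj 2 (volOn C) ≤ 2 ^ d * ENNReal.ofReal S := by
        refine (eLpNorm_mono_measure _ Measure.restrict_le_self).trans ?_
        refine (eLpNorm_comp_affine_le _ ht12 _).trans ?_
        gcongr
        exact (eLpNorm_normed_convolution_le ρ (hGm j)).trans
          ((hN j).trans (ENNReal.ofReal_le_ofReal (hNS j)))
      have c2 : ‖t - 1‖ₑ ≤ ENNReal.ofReal m := by
        rw [← ofReal_norm]
        refine ENNReal.ofReal_le_ofReal ?_
        rw [Real.norm_eq_abs, abs_le]; constructor <;> linarith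
      have h2d : (2 : ℝ≥0∞) ^ d = ENNReal.ofReal (2 ^ d) := by
        rw [ENNReal.ofReal_pow (by norm_num)]; simp
      refine (mul_le_mul' c2 c1).trans ?_
      rw [h2d, ← ENNReal.ofReal_mul (by positivity), ← ENNReal.ofReal_mul (by positivity)]
      exact ENNReal.ofReal_le_ofReal hmS
    refine (add_le_add b1 b2).trans ?_
    rw [← ENNReal.ofReal_add (by positivity) (by positivity), add_halves]

/-! ### Integrals of squares -/

lemma eLpNorm_two_sq {α : Type*} [MeasurableSpace α] {μ : Measure α} (f : α → ℝ) :
    eLpNorm f 2 μ ^ 2 = ∫⁻ x, ‖f x‖ₑ ^ 2 ∂μ := by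
  have := eLpNorm_nnreal_pow_eq_lintegral (f := f) (μ := μ) (p := 2) (by norm_num)
  simpa using this

lemma lintegral_enorm_sq_eq {α : Type*} [MeasurableSpace α] {μ : Measure α} {f : α → ℝ}
    (hf : MemLp f 2 μ) : ∫⁻ x, ‖f x‖ₑ ^ 2 ∂μ = ENNReal.ofReal (∫ x, f x ^ 2 ∂μ) := by
  rw [ofReal_integral_eq_lintegral_ofReal hf.integrable_sq (Eventually.of_forall fun x => sq_nonneg _)]
  refine lintegral_congr fun x => ?_
  rw [← sq_abs, ENNReal.ofReal_pow (abs_nonneg _), ← Real.enorm_eq_ofReal_abs]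

lemma integral_sq_le_of_eLpNorm_le {α : Type*} [MeasurableSpace α] {μ : Measure α} {f : α → ℝ}
    (hf : MemLp f 2 μ) {ε : ℝ} (hε : 0 ≤ ε) (h : eLpNorm f 2 μ ≤ ENNReal.ofReal ε) :
    ∫ x, f x ^ 2 ∂μ ≤ ε ^ 2 := by
  have h1 : eLpNorm f 2 μ ^ 2 ≤ ENNReal.ofReal ε ^ 2 := by gcongr
  rw [eLpNorm_two_sq, lintegral_enorm_sq_eq hf, ← ENNReal.ofReal_pow hε] at h1
  exact (ENNReal.ofReal_le_ofReal_iff (by positivity)).mp h1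

lemma eLpNorm_le_of_integral_sq_le {α : Type*} [MeasurableSpace α] {μ : Measure α} {f : α → ℝ}
    (hf : MemLp f 2 μ) {ε : ℝ} (hε : 0 ≤ ε) (h : ∫ x, f x ^ 2 ∂μ ≤ ε ^ 2) :
    eLpNorm f 2 μ ≤ ENNReal.ofReal ε := by
  have h1 : eLpNorm f 2 μ ^ 2 ≤ ENNReal.ofReal ε ^ 2 := by
    rw [eLpNorm_two_sq, lintegral_enorm_sq_eq hf, ← ENNReal.ofReal_pow hε]
    exact ENNReal.ofReal_le_ofReal h
  exact (ENNReal.pow_le_pow_left_iff (by norm_num)).mp h1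

/-- Cauchy-Schwarz against the constant function `1`. -/
lemma sq_lintegral_le {α : Type*} [MeasurableSpace α] {μ : Measure α} {f : α → ℝ≥0∞}
    (hf : AEMeasurable f μ) : (∫⁻ x, f x ∂μ) ^ 2 ≤ μ univ * ∫⁻ x, f x ^ 2 ∂μ := by
  have h := ENNReal.lintegral_mul_le_Lp_mul_Lq μ Real.HolderConjugate.two_two
    (aemeasurable_const (b := (1 : ℝ≥0∞))) hf
  have h2 := pow_le_pow_left' h 2
  have e : ∀ a : ℝ≥0∞, (a ^ (1 / 2 : ℝ)) ^ 2 = a := fun a => by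
    rw [← ENNReal.rpow_natCast, ← ENNReal.rpow_mul]; norm_num
  rw [mul_pow, e, e] at h2
  simpa using h2

/-- The squared Euclidean norm of the gradient. -/
def gradSq {d : ℕ} (φ : E d → ℝ) (x : E d) : ℝ := ∑ j, partialDeriv j φ x ^ 2

lemma gradSq_nonneg {d : ℕ} (φ : E d → ℝ) (x : E d) : 0 ≤ gradSq φ x :=
  Finset.sum_nonneg fun _ _ => sq_nonneg _

lemma continuous_gradSq {d : ℕ} {φ : E d → ℝ} (hφ : ContDiff ℝ ∞ φ) : Continuous (gradSq φ) :=
  continuous_finsetSum _ fun j _ => (continuous_partialDeriv j hφ).pow 2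

lemma fderiv_apply_sq_le {d : ℕ} (φ : E d → ℝ) (x w : E d) :
    (fderiv ℝ φ x w) ^ 2 ≤ gradSq φ x * ‖w‖ ^ 2 := by
  have hw : w = ∑ j, w j • EuclideanSpace.single j (1 : ℝ) := by
    ext i; simp [Finset.sum_apply, Pi.single_apply]
  have h1 : fderiv ℝ φ x w = ∑ j, partialDeriv j φ x * w j := by
    conv_lhs => rw [hw]
    rw [map_sum]
    exact Finset.sum_congr rfl fun j _ => by simp [partialDeriv, mul_comm]
  rw [h1, EuclideanSpace.norm_sq_eq]
  simp only [Real.norm_eq_abs, sq_abs]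
  exact Finset.sum_mul_sq_le_sq_mul_sq _ _ _

/-- The increment of a smooth function along a segment. -/
lemma enorm_sub_sq_le_path {d : ℕ} {φ : E d → ℝ} (hφ : ContDiff ℝ ∞ φ) (x w : E d) {T : ℝ}
    (hT : 0 ≤ T) :
    ‖φ (x + T • w) - φ x‖ₑ ^ 2
      ≤ ENNReal.ofReal (T * ‖w‖ ^ 2) * ∫⁻ r in Ioc 0 T, ENNReal.ofReal (gradSq φ (x + r • w)) := by
  have hd : ∀ r : ℝ, HasDerivAt (fun r : ℝ => φ (x + r • w)) (fderiv ℝ φ (x + r • w) w) r := by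
    intro r
    have h1 : HasDerivAt (fun r : ℝ => x + r • w) w r := by
      simpa using ((hasDerivAt_id r).smul_const w).const_add x
    exact ((hφ.differentiable (by simp) _).hasFDerivAt).comp_hasDerivAt r h1
  have hc : Continuous (fun r : ℝ => fderiv ℝ φ (x + r • w) w) :=
    ((hφ.continuous_fderiv (by simp)).comp (by fun_prop : Continuous fun r : ℝ => x + r • w)).clm_apply
      continuous_const
  have h1 := intervalIntegral.integral_eq_sub_of_hasDerivAt (a := 0) (b := T) (fun r _ => hd r)
    (hc.intervalIntegrable _ _)
  rw [intervalIntegral.integral_of_le hT] at h1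
  simp only [zero_smul, add_zero] at h1
  rw [← h1]
  -- Cauchy-Schwarz in the path parameter, at the cost of the length `T`.
  have h2 := sq_lintegral_le (μ := volume.restrict (Ioc 0 T)) hc.measurable.enorm.aemeasurable
  refine (pow_le_pow_left' (enorm_integral_le_lintegral_enorm _) 2).trans (h2.trans ?_)
  simp only [Measure.restrict_apply MeasurableSet.univ, univ_inter, Real.volume_Ioc, sub_zero]
  rw [ENNReal.ofReal_mul hT, mul_assoc]
  gcongr
  have hgm : Measurable fun r : ℝ => ENNReal.ofReal (gradSq φ (x + r • w)) :=
    ((continuous_gradSq hφ).comp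
      (by fun_prop : Continuous fun r : ℝ => x + r • w)).measurable.ennreal_ofReal
  rw [← lintegral_const_mul _ hgm]
  refine lintegral_mono fun r => ?_
  rw [Real.enorm_eq_ofReal_abs, ← ENNReal.ofReal_pow (abs_nonneg _), sq_abs,
    ← ENNReal.ofReal_mul (by positivity), mul_comm (‖w‖ ^ 2)]
  exact ENNReal.ofReal_le_ofReal (fderiv_apply_sq_le _ _ _)

lemma lintegral_comp_affine {d : ℕ} (a : E d) {s : ℝ} (hs : 0 < s) (f : E d → ℝ≥0∞) :
    ∫⁻ x, f (a + s • x) = ENNReal.ofReal ((s ^ d)⁻¹) * ∫⁻ x, f x := by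
  rw [← (measurableEmbedding_affine a hs).lintegral_map f, map_volume_affine a hs,
    lintegral_smul_measure, smul_eq_mul]

lemma lintegral_comp_affine_le {d : ℕ} (a : E d) {s : ℝ} (hs : 1 / 2 ≤ s) (f : E d → ℝ≥0∞) :
    ∫⁻ x, f (a + s • x) ≤ 2 ^ d * ∫⁻ x, f x := by
  rw [lintegral_comp_affine a (by linarith)]
  gcongr
  have h2 : (s ^ d)⁻¹ ≤ 2 ^ d := by
    rw [inv_le_comm₀ (pow_pos (by linarith) d) (by positivity), ← inv_pow]
    exact pow_le_pow_left₀ (by norm_num) (by linarith) d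
  refine (ENNReal.ofReal_le_ofReal h2).trans ?_
  rw [ENNReal.ofReal_pow (by norm_num)]
  simp

/-! ### The Poincaré inequality on convex sets -/

/-- By convexity the increment is an integral of the gradient along a segment inside `C`. For every
`r` one of the two endpoints enters `y + r • (x - y)` with a coefficient of at least `1 / 2`;
integrating over that endpoint first costs only `2 ^ d`. -/
lemma lintegral_sub_sq_le {d : ℕ} {C : Set (E d)} (hC : Convex ℝ C) (hCm : MeasurableSet C)
    {δ : ℝ} (hδ : ∀ x ∈ C, ∀ y ∈ C, ‖x - y‖ ≤ δ) {φ : E d → ℝ} (hφ : ContDiff ℝ ∞ φ) :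
    ∫⁻ x in C, ∫⁻ y in C, ‖φ x - φ y‖ₑ ^ 2
      ≤ ENNReal.ofReal (δ ^ 2) * (2 ^ d * volume C * ∫⁻ x in C, ENNReal.ofReal (gradSq φ x)) := by
  set F : E d → ℝ≥0∞ := C.indicator fun x => ENNReal.ofReal (gradSq φ x) with hF
  have hFm : Measurable F := ((continuous_gradSq hφ).measurable.ennreal_ofReal).indicator hCm
  have hFint : ∫⁻ x, F x = ∫⁻ x in C, ENNReal.ofReal (gradSq φ x) := lintegral_indicator hCm _
  have h1 : ∀ x ∈ C, ∀ y ∈ C, ‖φ x - φ y‖ₑ ^ 2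
      ≤ ENNReal.ofReal (δ ^ 2) * ∫⁻ r in Ioc (0:ℝ) 1, F (y + r • (x - y)) := by
    intro x hx y hy
    have h := enorm_sub_sq_le_path hφ y (x - y) (T := 1) zero_le_one
    simp only [one_smul, add_sub_cancel, one_mul] at h
    refine h.trans ?_
    refine mul_le_mul' (ENNReal.ofReal_le_ofReal ?_) ?_
    · exact pow_le_pow_left₀ (norm_nonneg _) (hδ x hx y hy) 2
    · refine setLIntegral_mono' measurableSet_Ioc fun r hr => ?_
      rw [hF, indicator_of_mem]
      exact hC.add_smul_sub_mem hy hx ⟨hr.1.le, hr.2⟩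
  have h2 : ∀ r ∈ Ioc (0:ℝ) 1, ∫⁻ x in C, ∫⁻ y in C, F (y + r • (x - y))
      ≤ 2 ^ d * volume C * ∫⁻ x, F x := by
    have key : ∀ r : ℝ, 1 / 2 ≤ r → ∀ y, ∫⁻ x in C, F (y + r • (x - y)) ≤ 2 ^ d * ∫⁻ x, F x := by
      intro r hr y
      refine (setLIntegral_le_lintegral _ _).trans ?_
      have := lintegral_comp_affine_le ((1 - r) • y) hr F
      refine le_trans (le_of_eq (lintegral_congr fun x => ?_)) this
      congr 1; module
    have meas : Measurable (fun z : ℝ × E d × E d => F (z.2.2 + z.1 • (z.2.1 - z.2.2))) :=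
      hFm.comp (by fun_prop)
    intro r hr
    rcases le_total (1 / 2 : ℝ) r with h | h
    · rw [lintegral_lintegral_swap (f := fun x y => F (y + r • (x - y)))
        (Measurable.aemeasurable (hFm.comp
          (by fun_prop : Measurable fun z : E d × E d => z.2 + r • (z.1 - z.2))))]
      refine (lintegral_mono fun y => key r h y).trans ?_
      simp only [lintegral_const, Measure.restrict_apply MeasurableSet.univ, univ_inter]
      exact le_of_eq (by ring)
    · have : ∀ x, ∫⁻ y in C, F (y + r • (x - y)) ≤ 2 ^ d * ∫⁻ x, F x := by
        intro x
        have := key (1 - r) (by linarith) x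
        refine le_trans (le_of_eq (lintegral_congr fun y => ?_)) this
        congr 1; module
      refine (lintegral_mono this).trans ?_
      simp only [lintegral_const, Measure.restrict_apply MeasurableSet.univ, univ_inter]
      exact le_of_eq (by ring)
  calc ∫⁻ x in C, ∫⁻ y in C, ‖φ x - φ y‖ₑ ^ 2
      ≤ ∫⁻ x in C, ∫⁻ y in C, ENNReal.ofReal (δ ^ 2) * ∫⁻ r in Ioc (0:ℝ) 1, F (y + r • (x - y)) :=
        setLIntegral_mono' hCm fun x hx => setLIntegral_mono' hCm fun y hy => h1 x hx y hy
    _ = ENNReal.ofReal (δ ^ 2) * ∫⁻ x in C, ∫⁻ y in C, ∫⁻ r in Ioc (0:ℝ) 1, F (y + r • (x - y)) := by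
        rw [← lintegral_const_mul]
        · refine lintegral_congr fun x => ?_
          rw [lintegral_const_mul]
          exact Measurable.lintegral_prod_right' (f := fun z : E d × ℝ => F (z.1 + z.2 • (x - z.1)))
            (hFm.comp (by fun_prop))
        · exact Measurable.lintegral_prod_right'
            (f := fun z : E d × E d => ∫⁻ r in Ioc (0:ℝ) 1, F (z.2 + r • (z.1 - z.2)))
            (Measurable.lintegral_prod_right'
              (f := fun z : (E d × E d) × ℝ => F (z.1.2 + z.2 • (z.1.1 - z.1.2)))
              (hFm.comp (by fun_prop)))
    _ = ENNReal.ofReal (δ ^ 2) * ∫⁻ r in Ioc (0:ℝ) 1, ∫⁻ x in C, ∫⁻ y in C, F (y + r • (x - y)) := by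
        congr 1
        rw [← lintegral_lintegral_swap (f := fun x r => ∫⁻ y in C, F (y + r • (x - y)))
          (Measurable.aemeasurable (Measurable.lintegral_prod_right'
            (f := fun z : (E d × ℝ) × E d => F (z.2 + z.1.2 • (z.1.1 - z.2)))
              (hFm.comp (by fun_prop))))]
        refine lintegral_congr fun x => ?_
        exact lintegral_lintegral_swap (f := fun y r => F (y + r • (x - y)))
          (Measurable.aemeasurable (hFm.comp
            (by fun_prop : Measurable fun z : E d × ℝ => z.1 + z.2 • (x - z.1))))
    _ ≤ ENNReal.ofReal (δ ^ 2) * ∫⁻ r in Ioc (0:ℝ) 1, 2 ^ d * volume C * ∫⁻ x, F x := by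
        refine mul_le_mul_right ?_ _
        exact setLIntegral_mono' measurableSet_Ioc h2
    _ = _ := by rw [← hFint]; simp

/-- The mean value of `w` over `C`. -/
def avg {d : ℕ} (C : Set (E d)) (w : E d → ℝ) : ℝ := (volume C).toReal⁻¹ * ∫ x in C, w x

/-- The deviation from the mean is the average over `y` of `φ x - φ y`, so Cauchy-Schwarz reduces
the claim to the double integral. -/
lemma lintegral_sub_avg_sq_le {d : ℕ} {C : Set (E d)} (hC : Convex ℝ C) (hCm : MeasurableSet C)
    (hCb : Bornology.IsBounded C) (hC0 : volume C ≠ 0)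
    {δ : ℝ} (hδ : ∀ x ∈ C, ∀ y ∈ C, ‖x - y‖ ≤ δ) {φ : E d → ℝ} (hφ : ContDiff ℝ ∞ φ) :
    ∫⁻ x in C, ‖φ x - avg C φ‖ₑ ^ 2
      ≤ ENNReal.ofReal (δ ^ 2) * (2 ^ d * ∫⁻ x in C, ENNReal.ofReal (gradSq φ x)) := by
  have hCfin : volume C ≠ ⊤ := hCb.measure_lt_top.ne
  have hV : 0 < (volume C).toReal := ENNReal.toReal_pos hC0 hCfin
  have hint : IntegrableOn φ C := (hφ.continuous.continuousOn.integrableOn_compact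
    hCb.isCompact_closure).mono_set subset_closure
  have hpt : ∀ x, volume C * ‖φ x - avg C φ‖ₑ ^ 2 ≤ ∫⁻ y in C, ‖φ x - φ y‖ₑ ^ 2 := by
    intro x
    have hc : IntegrableOn (fun _ => φ x) C := integrableOn_const hCfin
    have e1 : ∫ y in C, (φ x - φ y) = (volume C).toReal * (φ x - avg C φ) := by
      rw [integral_sub hc hint, avg]
      simp only [integral_const, measureReal_restrict_apply_univ, smul_eq_mul]
      simp only [Measure.real]
      field_simp
    have e2 : volume C * ‖φ x - avg C φ‖ₑ = ‖∫ y in C, (φ x - φ y)‖ₑ := by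
      rw [e1, enorm_mul, Real.enorm_of_nonneg hV.le, ENNReal.ofReal_toReal hCfin]
    have e3 : (volume C * ‖φ x - avg C φ‖ₑ) ^ 2 ≤ volume C * ∫⁻ y in C, ‖φ x - φ y‖ₑ ^ 2 := by
      rw [e2]
      refine (pow_le_pow_left' (enorm_integral_le_lintegral_enorm _) 2).trans ?_
      have := sq_lintegral_le (μ := volOn C) (f := fun y => ‖φ x - φ y‖ₑ)
        (measurable_const.sub hφ.continuous.measurable).enorm.aemeasurable
      simpa using this
    rw [mul_pow, sq (volume C), mul_assoc] at e3
    exact (ENNReal.mul_le_mul_iff_right hC0 hCfin).mp e3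
  have hmain := lintegral_mono (μ := volOn C) hpt
  have hm : Measurable fun x => ‖φ x - avg C φ‖ₑ ^ 2 :=
    (hφ.continuous.measurable.sub_const _).enorm.pow_const _
  rw [lintegral_const_mul _ hm] at hmain
  have h2 := hmain.trans (lintegral_sub_sq_le hC hCm hδ hφ)
  refine (ENNReal.mul_le_mul_iff_right hC0 hCfin).mp (h2.trans (le_of_eq ?_))
  ring

/-- The mean is the best constant in `L²`. This allows the mean of a smooth approximation to be
exchanged for the mean of the function itself. -/
lemma integral_sub_avg_sq_le {d : ℕ} {C : Set (E d)} (hCfin : volume C ≠ ⊤)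
    (hC0 : volume C ≠ 0) {w : E d → ℝ} (hw : MemLp w 2 (volOn C)) (c : ℝ) :
    ∫ x in C, (w x - avg C w) ^ 2 ≤ ∫ x in C, (w x - c) ^ 2 := by
  have hV : 0 < (volume C).toReal := ENNReal.toReal_pos hC0 hCfin
  have : IsFiniteMeasure (volOn C) := ⟨by simpa using hCfin.lt_top⟩
  set m := avg C w with hm
  have hw1 : Integrable w (volOn C) := hw.integrable (by norm_num)
  have hwm : MemLp (fun x => w x - m) 2 (volOn C) := hw.sub (memLp_const m)
  have e0 : ∫ x in C, (w x - m) = 0 := by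
    rw [integral_sub hw1 (integrable_const _), hm, avg]
    simp only [integral_const, measureReal_restrict_apply_univ, smul_eq_mul]
    simp only [Measure.real]
    field_simp; simp
  have e1 : ∀ x, (w x - c) ^ 2 = (w x - m) ^ 2 + (2 * (m - c) * (w x - m) + (m - c) ^ 2) := by
    intro x; ring
  simp_rw [e1]
  have i2 : Integrable (fun x => 2 * (m - c) * (w x - m)) (volOn C) :=
    (hwm.integrable (by norm_num)).const_mul _
  have i3 : Integrable (fun _ : E d => (m - c) ^ 2) (volOn C) := integrable_const _
  rw [integral_add (g := fun x => 2 * (m - c) * (w x - m) + (m - c) ^ 2) hwm.integrable_sq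
    (i2.add i3), integral_add i2 i3, integral_const_mul, e0]
  have : 0 ≤ ∫ x in C, (m - c) ^ 2 := integral_nonneg fun x => sq_nonneg _
  simp only [mul_zero, zero_add]; linarith

/-- The squared `H¹`-seminorm of `v` on `A`. -/
def energy {d : ℕ} {Ω : Set (E d)} (A : Set (E d)) (v : H1 Ω) : ℝ :=
  ∑ j, ∫ x in A, grad v j x ^ 2

lemma energy_nonneg {d : ℕ} {Ω : Set (E d)} (A : Set (E d)) (v : H1 Ω) : 0 ≤ energy A v :=
  Finset.sum_nonneg fun _ _ => integral_nonneg fun _ => sq_nonneg _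

lemma memLp_fn_of_subset {d : ℕ} {Ω A : Set (E d)} (h : A ⊆ Ω) (v : H1 Ω) :
    MemLp (fn v) 2 (volOn A) := (memLp_fn v).mono_measure (Measure.restrict_mono h le_rfl)

lemma memLp_grad_of_subset {d : ℕ} {Ω A : Set (E d)} (h : A ⊆ Ω) (v : H1 Ω) (j : Fin d) :
    MemLp (grad v j) 2 (volOn A) := (memLp_grad v j).mono_measure (Measure.restrict_mono h le_rfl)

lemma memLp_of_continuous_of_bounded {d : ℕ} {C : Set (E d)} (hCb : Bornology.IsBounded C)
    {φ : E d → ℝ} (hφ : Continuous φ) : MemLp φ 2 (volOn C) := by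
  refine MemLp.mono_measure (Measure.restrict_mono subset_closure le_rfl) ?_
  have : MemLp φ ⊤ (volOn (closure C)) := by
    obtain ⟨M, hM⟩ := hCb.isCompact_closure.exists_bound_of_continuousOn hφ.continuousOn
    refine memLp_top_of_bound hφ.aestronglyMeasurable M ?_
    filter_upwards [ae_restrict_mem isClosed_closure.measurableSet] with x hx using hM x hx
  have hf : IsFiniteMeasure (volOn (closure C)) :=
    ⟨by simpa using hCb.isCompact_closure.measure_lt_top⟩
  exact this.mono_exponent le_top

lemma integral_add_sq_le {α : Type*} [MeasurableSpace α] {μ : Measure α} {f g : α → ℝ}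
    (hf : MemLp f 2 μ) (hg : MemLp g 2 μ) :
    ∫ x, (f x + g x) ^ 2 ∂μ ≤ 2 * ∫ x, f x ^ 2 ∂μ + 2 * ∫ x, g x ^ 2 ∂μ := by
  rw [← integral_const_mul, ← integral_const_mul,
    ← integral_add (hf.integrable_sq.const_mul 2) (hg.integrable_sq.const_mul 2)]
  refine integral_mono (hf.add hg).integrable_sq
    ((hf.integrable_sq.const_mul 2).add (hg.integrable_sq.const_mul 2)) fun x => ?_
  nlinarith [sq_nonneg (f x - g x)]

/-- Smooth approximation in terms of integrals of squares. -/
lemma exists_smooth_approx_sq {d : ℕ} {Ω C : Set (E d)} (hC : Convex ℝ C) (hCo : IsOpen C)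
    (hCb : Bornology.IsBounded C) (hCΩ : C ⊆ Ω) (v : H1 Ω) {ε : ℝ} (hε : 0 < ε) :
    ∃ φ : E d → ℝ, ContDiff ℝ ∞ φ ∧ ∫ x in C, (φ x - fn v x) ^ 2 ≤ ε ∧
      ∀ j, ∫ x in C, (partialDeriv j φ x - grad v j x) ^ 2 ≤ ε := by
  obtain ⟨φ, hφ, h1, h2⟩ := exists_smooth_approx hC hCo hCb hCΩ v (Real.sqrt_pos.mpr hε)
  refine ⟨φ, hφ, ?_, fun j => ?_⟩
  · have := integral_sq_le_of_eLpNorm_le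
      ((memLp_of_continuous_of_bounded hCb hφ.continuous).sub (memLp_fn_of_subset hCΩ v))
      (Real.sqrt_nonneg _) h1
    rwa [Real.sq_sqrt hε.le] at this
  · have := integral_sq_le_of_eLpNorm_le
      ((memLp_of_continuous_of_bounded hCb (continuous_partialDeriv j hφ)).sub
        (memLp_grad_of_subset hCΩ v j)) (Real.sqrt_nonneg _) (h2 j)
    rwa [Real.sq_sqrt hε.le] at this

lemma integral_gradSq_le {d : ℕ} {Ω C : Set (E d)} (hCb : Bornology.IsBounded C) (hCΩ : C ⊆ Ω)
    (v : H1 Ω) {ε : ℝ} {φ : E d → ℝ} (hφ : ContDiff ℝ ∞ φ)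
    (h : ∀ j, ∫ x in C, (partialDeriv j φ x - grad v j x) ^ 2 ≤ ε) :
    ∫ x in C, gradSq φ x ≤ 2 * d * ε + 2 * energy C v := by
  unfold gradSq energy
  rw [integral_finsetSum _ fun j _ =>
    (memLp_of_continuous_of_bounded hCb (continuous_partialDeriv j hφ)).integrable_sq]
  calc ∑ j, ∫ x in C, partialDeriv j φ x ^ 2
      ≤ ∑ j : Fin d, (2 * ε + 2 * ∫ x in C, grad v j x ^ 2) := by
        refine Finset.sum_le_sum fun j _ => ?_
        have := integral_add_sq_le ((memLp_of_continuous_of_bounded hCb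
          (continuous_partialDeriv j hφ)).sub (memLp_grad_of_subset hCΩ v j))
          (memLp_grad_of_subset hCΩ v j)
        simp only [Pi.sub_apply, sub_add_cancel] at this
        linarith [h j]
    _ = _ := by
        rw [Finset.sum_add_distrib, Finset.mul_sum]
        simp only [Finset.sum_const, Finset.card_univ, Fintype.card_fin, nsmul_eq_mul]
        ring

/-- The Poincaré inequality for `H¹` functions on convex subdomains. -/
theorem poincare {d : ℕ} {Ω C : Set (E d)} (hC : Convex ℝ C) (hCo : IsOpen C)
    (hCb : Bornology.IsBounded C) (hCn : C.Nonempty) (hCΩ : C ⊆ Ω)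
    {δ : ℝ} (hδ : ∀ x ∈ C, ∀ y ∈ C, ‖x - y‖ ≤ δ) (v : H1 Ω) :
    ∫ x in C, (fn v x - avg C (fn v)) ^ 2 ≤ 4 * 2 ^ d * δ ^ 2 * energy C v := by
  have hCfin : volume C ≠ ⊤ := hCb.measure_lt_top.ne
  have hC0 : volume C ≠ 0 := (hCo.measure_pos volume hCn).ne'
  have : IsFiniteMeasure (volOn C) := ⟨by simpa using hCfin.lt_top⟩
  have hw := memLp_fn_of_subset hCΩ v
  -- A smooth `φ` with squared errors at most `ε` inherits the smooth inequality. One factor `2`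
  -- comes from splitting off `φ`, another from comparing its gradient with that of `v`; the
  -- remainder vanishes with `ε`.
  have hmain : ∀ ε > 0, ∫ x in C, (fn v x - avg C (fn v)) ^ 2
      ≤ 4 * 2 ^ d * δ ^ 2 * energy C v + (2 + 4 * 2 ^ d * δ ^ 2 * d) * ε := by
    intro ε hε
    obtain ⟨φ, hφ, h1, h2⟩ := exists_smooth_approx_sq hC hCo hCb hCΩ v hε
    have hφm := memLp_of_continuous_of_bounded hCb hφ.continuous
    have hφm2 : MemLp (fun x => φ x - avg C φ) 2 (volOn C) := hφm.sub (memLp_const _)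
    have h3 := lintegral_sub_avg_sq_le hC hCo.measurableSet hCb hC0 hδ hφ
    have hgi : Integrable (gradSq φ) (volOn C) :=
      ((continuous_gradSq hφ).continuousOn.integrableOn_compact
        hCb.isCompact_closure).mono_set subset_closure
    rw [lintegral_enorm_sq_eq hφm2, ← ofReal_integral_eq_lintegral_ofReal hgi
      (Eventually.of_forall (gradSq_nonneg φ)), show (2 : ℝ≥0∞) ^ d = ENNReal.ofReal (2 ^ d) by
        rw [ENNReal.ofReal_pow (by norm_num)]; simp, ← ENNReal.ofReal_mul (by positivity),
      ← ENNReal.ofReal_mul (by positivity), ENNReal.ofReal_le_ofReal_iff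
        (mul_nonneg (sq_nonneg _) (mul_nonneg (by positivity)
          (integral_nonneg (gradSq_nonneg φ))))] at h3
    have h4 := integral_gradSq_le hCb hCΩ v hφ h2
    have h5 := integral_sub_avg_sq_le hCfin hC0 hw (avg C φ)
    have h6 := integral_add_sq_le (hw.sub hφm) hφm2
    simp only [Pi.sub_apply, sub_add_sub_cancel] at h6
    have h7 : ∫ x in C, (fn v x - φ x) ^ 2 = ∫ x in C, (φ x - fn v x) ^ 2 :=
      integral_congr_ae (Eventually.of_forall fun x => by ring)
    have h8 : δ ^ 2 * (2 ^ d * ∫ x in C, gradSq φ x)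
        ≤ δ ^ 2 * (2 ^ d * (2 * d * ε + 2 * energy C v)) := by gcongr
    rw [h7] at h6
    nlinarith
  refine le_of_forall_pos_le_add fun ε hε => ?_
  have hk : 0 < 2 + 4 * 2 ^ d * δ ^ 2 * d := by positivity
  have := hmain (ε / (2 + 4 * 2 ^ d * δ ^ 2 * d)) (by positivity)
  rwa [mul_div_cancel₀ _ hk.ne'] at this

/-! ### Elements, facets and their measures. -/

namespace TaggedSimplex

variable {d : ℕ} (K : TaggedSimplex d)

lemma dim_pos {d : ℕ} (K : TaggedSimplex d) : 0 < d := K.type.pos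

lemma body_convex : Convex ℝ K.body := convex_convexHull ℝ _
lemma body_compact : IsCompact K.body := (finite_range K.verts).isCompact_convexHull (𝕜 := ℝ)
lemma body_closed : IsClosed K.body := K.body_compact.isClosed
lemma body_bounded : Bornology.IsBounded K.body := K.body_compact.isBounded
lemma facet_compact (i : Fin (d + 1)) : IsCompact (K.facet i) :=
  (toFinite (K.verts '' {i}ᶜ)).isCompact_convexHull (𝕜 := ℝ)
lemma facet_closed (i : Fin (d + 1)) : IsClosed (K.facet i) := (K.facet_compact i).isClosed
lemma facet_subset_body (i : Fin (d + 1)) : K.facet i ⊆ K.body :=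
  convexHull_mono (image_subset_range _ _)
lemma vert_mem_body (i : Fin (d + 1)) : K.verts i ∈ K.body := subset_convexHull ℝ _ ⟨i, rfl⟩

/-- The frontier of a convex set is a null set. This reconciles integrals over closed elements with
Sobolev functions, which live on open sets. -/
lemma volOn_body : volOn K.body = volOn (interior K.body) := by
  refine (Measure.restrict_congr_set ?_).symm
  exact interior_ae_eq_of_null_frontier (K.body_convex.addHaar_frontier volume)

lemma norm_sub_le_diam {x y : E d} (hx : x ∈ K.body) (hy : y ∈ K.body) :
    ‖x - y‖ ≤ Metric.diam K.body := by
  rw [← dist_eq_norm]; exact Metric.dist_le_diam_of_mem K.body_bounded hx hy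

end TaggedSimplex

/-- A facet, seen inside its affine hull, is a convex body. -/
lemma exists_facet_param {d : ℕ} (K : TaggedSimplex d) (hK : AffineIndependent ℝ K.verts)
    (i : Fin (d + 1)) :
    ∃ (V : Submodule ℝ (E d)) (p : E d) (D : Set V), Module.finrank ℝ V = d - 1 ∧
      Convex ℝ D ∧ (interior D).Nonempty ∧ IsClosed D ∧ K.facet i = (fun v : V => p + v) '' D ∧
      K.verts i - p ∉ V ∧ p ∈ K.facet i := by
  have hd := K.dim_pos
  have hcard : Fintype.card {k // k ≠ i} = d - 1 + 1 := by
    rw [Fintype.card_subtype_compl]; simp; omega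
  have : Nonempty {k // k ≠ i} := by
    rw [← Fintype.card_pos_iff]; omega
  obtain ⟨k₀⟩ := this
  set x : {k // k ≠ i} → E d := fun k => K.verts k with hx
  have hxi : AffineIndependent ℝ x := hK.comp_embedding ⟨Subtype.val, Subtype.val_injective⟩
  set V := vectorSpan ℝ (range x) with hV
  have hVd : Module.finrank ℝ V = d - 1 := hxi.finrank_vectorSpan hcard
  set p := x k₀ with hp
  have hmem : ∀ k, x k - p ∈ V := fun k => vsub_mem_vectorSpan ℝ ⟨k, rfl⟩ ⟨k₀, rfl⟩
  set w : {k // k ≠ i} → V := fun k => ⟨x k - p, hmem k⟩ with hw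
  let f : V →ᵃ[ℝ] E d := (AffineMap.const ℝ V p) + V.subtype.toAffineMap
  have hf : ∀ v, f v = p + v := fun v => by simp [f]
  have hfw : f ∘ w = x := by ext1 k; simp [hf, hw]
  have hwi : AffineIndependent ℝ w := AffineIndependent.of_comp f (by rwa [hfw])
  have himg : K.verts '' {i}ᶜ = range x := by
    ext y; constructor
    · rintro ⟨k, hk, rfl⟩; exact ⟨⟨k, hk⟩, rfl⟩
    · rintro ⟨k, rfl⟩; exact ⟨k, k.2, rfl⟩
  refine ⟨V, p, convexHull ℝ (range w), hVd, convex_convexHull ℝ _, ?_, ?_, ?_, ?_, ?_⟩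
  · rw [interior_convexHull_nonempty_iff_affineSpan_eq_top,
      hwi.affineSpan_eq_top_iff_card_eq_finrank_add_one, hcard, hVd]
  · exact ((finite_range w).isCompact_convexHull (𝕜 := ℝ)).isClosed
  · have := f.image_convexHull (range w)
    rw [← range_comp, hfw] at this
    rw [TaggedSimplex.facet, himg, ← this]
    exact image_congr fun v _ => hf v
  · intro h
    have h1 := hK.notMem_affineSpan_sdiff i univ
    apply h1
    rw [← compl_eq_univ_sdiff, himg]
    have hpm : p ∈ affineSpan ℝ (range x) := subset_affineSpan ℝ _ ⟨k₀, rfl⟩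
    have h2 : K.verts i - p ∈ (affineSpan ℝ (range x)).direction := by
      rwa [direction_affineSpan]
    have := AffineSubspace.vadd_mem_of_mem_direction h2 hpm
    simpa using this
  · exact subset_convexHull ℝ _ (himg ▸ ⟨k₀, rfl⟩)

/-- The parametrization by `V` is an isometry, so surface measure becomes a Haar measure on `V`, for
which scaling and uniqueness are available. -/
lemma lintegral_facetMeasure {d : ℕ} {K : TaggedSimplex d} {i : Fin (d + 1)}
    {V : Submodule ℝ (E d)} {p : E d} {D : Set V}
    (hD : K.facet i = (fun v : V => p + v) '' D) (g : E d → ℝ≥0∞) :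
    ∫⁻ x, g x ∂(facetMeasure K i) = ∫⁻ v in D, g (p + v) ∂(μHE[d - 1] : Measure V) := by
  have hiso : Isometry (fun v : V => p + (v : E d)) :=
    (isometry_add_left p).comp isometry_subtype_coe
  have hemb : MeasurableEmbedding (fun v : V => p + (v : E d)) :=
    hiso.isClosedEmbedding.measurableEmbedding
  have hmap := hiso.map_euclideanHausdorffMeasure (d := d - 1)
  have hsub : K.facet i ⊆ range (fun v : V => p + (v : E d)) := by
    rw [hD]; exact image_subset_range _ _
  have hpre : (fun v : V => p + (v : E d)) ⁻¹' (K.facet i) = D := by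
    rw [hD, preimage_image_eq _ hiso.injective]
  rw [facetMeasure, ← inter_eq_self_of_subset_left hsub,
    ← Measure.restrict_restrict (K.facet_closed i).measurableSet, ← hmap, ← hpre,
    ← hemb.lintegral_map, hemb.restrict_map]

lemma isAddHaarMeasure_facet {d : ℕ} {V : Submodule ℝ (E d)} (hV : Module.finrank ℝ V = d - 1) :
    (μHE[d - 1] : Measure V).IsAddHaarMeasure := by
  rw [← hV]; infer_instance

/-- A continuous function vanishing almost everywhere on a facet vanishes on the facet. -/
lemma eqOn_zero_of_ae_facetMeasure {d : ℕ} {K : TaggedSimplex d}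
    (hK : AffineIndependent ℝ K.verts) {i : Fin (d + 1)} {q : E d → ℝ} (hq : Continuous q)
    (h : ∫⁻ x, ‖q x‖ₑ ^ 2 ∂(facetMeasure K i) = 0) : ∀ x ∈ K.facet i, q x = 0 := by
  obtain ⟨V, p, D, hV, hDc, hDi, hDcl, hD, -, -⟩ := exists_facet_param K hK i
  have := isAddHaarMeasure_facet hV
  rw [lintegral_facetMeasure hD] at h
  have hcont : Continuous fun v : V => q (p + v) := by fun_prop
  rw [lintegral_eq_zero_iff (hcont.measurable.enorm.pow_const 2)] at h
  have h2 : ∀ v ∈ interior D, q (p + v) = 0 := by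
    intro v hv
    have h3 : (fun v : V => q (p + v)) =ᵐ[(μHE[d - 1] : Measure V).restrict (interior D)] 0 := by
      have := ae_mono (Measure.restrict_mono interior_subset le_rfl) h
      filter_upwards [this] with v hv
      simpa using hv
    exact Measure.eqOn_open_of_ae_eq h3 isOpen_interior hcont.continuousOn continuousOn_const hv
  have h3 : ∀ v ∈ D, q (p + v) = 0 := by
    intro v hv
    have hcl : closure (interior D) = closure D :=
      hDc.closure_interior_eq_closure_of_nonempty_interior hDi
    have hz : IsClosed {v : V | q (p + v) = 0} := isClosed_eq hcont continuous_const
    exact closure_minimal (fun v hv => h2 v hv) hz (hcl ▸ subset_closure hv)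
  intro x hx
  rw [hD] at hx
  obtain ⟨v, hv, rfl⟩ := hx
  exact h3 v hv

/-! ### The trace inequality for smooth functions. -/

lemma lintegral_comp_smul_le {V : Type*} [NormedAddCommGroup V] [NormedSpace ℝ V]
    [MeasurableSpace V] [BorelSpace V] [FiniteDimensional ℝ V] (μ : Measure V) [μ.IsAddHaarMeasure]
    {s : ℝ} (hs : 1 / 2 ≤ s) (f : V → ℝ≥0∞) :
    ∫⁻ x, f (s • x) ∂μ ≤ 2 ^ (Module.finrank ℝ V) * ∫⁻ x, f x ∂μ := by
  have hs0 : 0 < s := by linarith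
  rw [← (measurableEmbedding_const_smul₀ hs0.ne').lintegral_map f, Measure.map_addHaar_smul _ hs0.ne',
    lintegral_smul_measure, smul_eq_mul]
  gcongr
  rw [abs_of_pos (by positivity)]
  refine (ENNReal.ofReal_le_ofReal (q := 2 ^ (Module.finrank ℝ V)) ?_).trans ?_
  · rw [inv_le_comm₀ (pow_pos (by linarith) _) (by positivity), ← inv_pow]
    exact pow_le_pow_left₀ (by norm_num) (by linarith) _
  · rw [ENNReal.ofReal_pow (by norm_num)]
    simp

/-- Integration over the cone with a facet as base and the opposite vertex as apex. -/
lemma exists_cone_bound {d : ℕ} (K : TaggedSimplex d) (hK : AffineIndependent ℝ K.verts)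
    (i : Fin (d + 1)) :
    ∃ c : ℝ≥0, ∀ g : E d → ℝ≥0∞, Measurable g →
      ∫⁻ t in Ioc (0:ℝ) (1 / 2), ∫⁻ x, g (x + t • (K.verts i - x)) ∂(facetMeasure K i)
        ≤ c * ∫⁻ x in K.body, g x := by
  obtain ⟨V, p, D, hV, hDc, hDi, hDcl, hD, hb, hp⟩ := exists_facet_param K hK i
  have := isAddHaarMeasure_facet hV
  set ν : Measure V := μHE[d - 1] with hν
  set b := K.verts i - p with hbdef
  -- Cone coordinates. As `b` is transversal to `V`, this is a linear isomorphism, and the image of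
  -- the product measure is a Haar measure, that is, a multiple of Lebesgue measure.
  let L₀ : (ℝ × V) →ₗ[ℝ] E d := (LinearMap.toSpanSingleton ℝ (E d) b).coprod V.subtype
  have hL₀ : ∀ z, L₀ z = z.1 • b + z.2 := fun z => by simp [L₀]
  have hinj : Function.Injective L₀ := by
    rw [injective_iff_map_eq_zero]
    rintro ⟨t, v⟩ h
    rw [hL₀] at h
    simp only at h
    have ht : t = 0 := by
      by_contra ht
      apply hb
      have : b = -(t⁻¹) • (v : E d) := by
        have : t • b = -(v : E d) := eq_neg_of_add_eq_zero_left h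
        rw [neg_smul, ← smul_neg, ← this, smul_smul, inv_mul_cancel₀ ht, one_smul]
      rw [this]
      exact V.smul_mem _ v.2
    subst ht
    simp only [zero_smul, zero_add] at h
    ext1
    · rfl
    · exact Subtype.ext h
  have hfr : Module.finrank ℝ (ℝ × V) = Module.finrank ℝ (E d) := by
    rw [Module.finrank_prod, hV, finrank_euclideanSpace_fin]
    simp; have := K.dim_pos; omega
  let L : (ℝ × V) ≃L[ℝ] E d := (L₀.linearEquivOfInjective hinj hfr).toContinuousLinearEquiv
  have hL : ∀ z, L z = z.1 • b + z.2 := fun z => hL₀ z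
  have hHaar : (Measure.map L ((volume : Measure ℝ).prod ν)).IsAddHaarMeasure :=
    L.isAddHaarMeasure_map _
  have hsmul := Measure.isAddLeftInvariant_eq_smul (Measure.map L ((volume : Measure ℝ).prod ν))
    (volume : Measure (E d))
  set c₀ := (Measure.map L ((volume : Measure ℝ).prod ν)).addHaarScalarFactor
    (volume : Measure (E d)) with hc₀
  refine ⟨2 ^ (d - 1) * c₀, fun g hg => ?_⟩
  set h : E d → ℝ≥0∞ := K.body.indicator g with hh
  have hhm : Measurable h := hg.indicator K.body_closed.measurableSet
  have hstep : ∀ t ∈ Ioc (0:ℝ) (1 / 2), ∫⁻ x, g (x + t • (K.verts i - x)) ∂(facetMeasure K i)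
      ≤ 2 ^ (d - 1) * ∫⁻ v, h (p + (t • b + v)) ∂ν := by
    intro t ht
    rw [lintegral_facetMeasure hD]
    -- At height `t` the facet is shrunk by `1 - t`, which is at least `1 / 2` because the cone is
    -- cut at half height; undoing this costs `2 ^ (d - 1)`.
    have e1 : ∀ v : V, p + v + t • (K.verts i - (p + v)) = p + (t • b + ((1 - t) • v : V)) := by
      intro v; rw [hbdef]; push_cast; module
    have e2 : ∫⁻ v in D, g (p + v + t • (K.verts i - (p + v))) ∂ν
        ≤ ∫⁻ v in D, h (p + (t • b + ((1 - t) • v : V))) ∂ν := by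
      refine setLIntegral_mono' hDcl.measurableSet fun v hv => ?_
      have hmem : p + v + t • (K.verts i - (p + v)) ∈ K.body := by
        have hv' : p + (v : E d) ∈ K.body :=
          K.facet_subset_body i (hD ▸ mem_image_of_mem (fun v : V => p + (v : E d)) hv)
        exact K.body_convex.add_smul_sub_mem hv' (K.vert_mem_body i) ⟨ht.1.le, by linarith [ht.2]⟩
      rw [← e1, hh, indicator_of_mem hmem]
    refine e2.trans ((setLIntegral_le_lintegral _ _).trans ?_)
    have := lintegral_comp_smul_le ν (s := 1 - t) (by linarith [ht.2])
      (fun v => h (p + (t • b + v)))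
    rwa [hV] at this
  calc _ ≤ ∫⁻ t in Ioc (0:ℝ) (1 / 2), 2 ^ (d - 1) * ∫⁻ v, h (p + (t • b + v)) ∂ν :=
        setLIntegral_mono' measurableSet_Ioc hstep
    _ ≤ ∫⁻ t : ℝ, 2 ^ (d - 1) * ∫⁻ v, h (p + (t • b + v)) ∂ν := setLIntegral_le_lintegral _ _
    _ = 2 ^ (d - 1) * ∫⁻ z, h (p + L z) ∂((volume : Measure ℝ).prod ν) := by
        rw [lintegral_const_mul', lintegral_prod]
        · simp only [hL]
        · exact (hhm.comp (measurable_const.add L.continuous.measurable)).aemeasurable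
        · simp
    _ = 2 ^ (d - 1) * ∫⁻ x, h (p + x) ∂(Measure.map L ((volume : Measure ℝ).prod ν)) := by
        rw [lintegral_map (f := fun x => h (p + x)) (hhm.comp (measurable_const_add p))
          L.continuous.measurable]
    _ = 2 ^ (d - 1) * (c₀ * ∫⁻ x, h x) := by
        rw [hsmul, lintegral_smul_measure, lintegral_add_left_eq_self]; rfl
    _ = _ := by
        rw [hh, lintegral_indicator K.body_closed.measurableSet]
        push_cast; ring

/-- The trace inequality for smooth functions, in terms of extended integrals. -/
lemma exists_trace_bound {d : ℕ} (K : TaggedSimplex d) (hK : AffineIndependent ℝ K.verts)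
    (i : Fin (d + 1)) :
    ∃ c : ℝ≥0, ∀ φ : E d → ℝ, ContDiff ℝ ∞ φ →
      ∫⁻ x, ‖φ x‖ₑ ^ 2 ∂(facetMeasure K i)
        ≤ c * ((∫⁻ x in K.body, ‖φ x‖ₑ ^ 2) + ∫⁻ x in K.body, ENNReal.ofReal (gradSq φ x)) := by
  obtain ⟨c, hc⟩ := exists_cone_bound K hK i
  set δ := Metric.diam K.body with hδ
  refine ⟨4 * c + 4 * (Real.toNNReal (δ ^ 2) * c), fun φ hφ => ?_⟩
  set a := K.verts i with ha
  set μ := facetMeasure K i with hμ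
  have hφm := hφ.continuous.measurable
  have hgm := (continuous_gradSq hφ).measurable.ennreal_ofReal
  -- The Hausdorff measure on all of `E d` is not σ-finite. On the hyperplane of the facet it is the
  -- image of a Haar measure, which suffices for Tonelli.
  have : SFinite μ := by
    obtain ⟨V, p, D, hV, -, -, -, hD, -, -⟩ := exists_facet_param K hK i
    have := isAddHaarMeasure_facet hV
    have hiso : Isometry (fun v : V => p + (v : E d)) :=
      (isometry_add_left p).comp isometry_subtype_coe
    have hsub : K.facet i ⊆ range (fun v : V => p + (v : E d)) := by
      rw [hD]; exact image_subset_range _ _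
    rw [hμ, facetMeasure, ← inter_eq_self_of_subset_left hsub,
      ← Measure.restrict_restrict (K.facet_closed i).measurableSet,
      ← hiso.map_euclideanHausdorffMeasure]
    infer_instance
  have hae : ∀ᵐ x ∂μ, x ∈ K.facet i := ae_restrict_mem (K.facet_closed i).measurableSet
  -- The value on the facet is compared with the value a fraction `t` of the way to the opposite
  -- vertex `a`. Averaging over `t` then turns facet integrals into element integrals by the cone
  -- bound.
  have hpt : ∀ t ∈ Ioc (0:ℝ) (1 / 2), ∀ x ∈ K.facet i, ‖φ x‖ₑ ^ 2
      ≤ 2 * ‖φ (x + t • (a - x))‖ₑ ^ 2 + 2 * (ENNReal.ofReal (δ ^ 2) *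
        ∫⁻ r in Ioc (0:ℝ) (1 / 2), ENNReal.ofReal (gradSq φ (x + r • (a - x)))) := by
    intro t ht x hx
    have h1 := enorm_sub_sq_le_path hφ x (a - x) ht.1.le
    have h2 : ENNReal.ofReal (t * ‖a - x‖ ^ 2) *
        ∫⁻ r in Ioc (0:ℝ) t, ENNReal.ofReal (gradSq φ (x + r • (a - x)))
        ≤ ENNReal.ofReal (δ ^ 2) *
        ∫⁻ r in Ioc (0:ℝ) (1 / 2), ENNReal.ofReal (gradSq φ (x + r • (a - x))) := by
      refine mul_le_mul' (ENNReal.ofReal_le_ofReal ?_)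
        (lintegral_mono_set (Ioc_subset_Ioc_right ht.2))
      have h3 : ‖a - x‖ ≤ δ := K.norm_sub_le_diam (K.vert_mem_body i) (K.facet_subset_body i hx)
      have h4 : ‖a - x‖ ^ 2 ≤ δ ^ 2 := pow_le_pow_left₀ (norm_nonneg _) h3 2
      nlinarith [sq_nonneg ‖a - x‖, ht.1, ht.2]
    have h3 : ‖φ x‖ₑ ^ 2 ≤ 2 * ‖φ (x + t • (a - x))‖ₑ ^ 2
        + 2 * ‖φ (x + t • (a - x)) - φ x‖ₑ ^ 2 := by
      simp only [Real.enorm_eq_ofReal_abs, ← ENNReal.ofReal_pow (abs_nonneg _), sq_abs]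
      have e2 : ∀ y : ℝ, (2 : ℝ≥0∞) * ENNReal.ofReal y = ENNReal.ofReal (2 * y) := fun y => by
        rw [ENNReal.ofReal_mul (by norm_num)]; simp
      rw [e2, e2, ← ENNReal.ofReal_add (by positivity) (by positivity)]
      refine ENNReal.ofReal_le_ofReal ?_
      nlinarith [sq_nonneg (2 * φ (x + t • (a - x)) - φ x)]
    refine h3.trans ?_
    gcongr
    exact h1.trans h2
  have hmeas1 : Measurable fun z : ℝ × E d => ENNReal.ofReal (gradSq φ (z.2 + z.1 • (a - z.2))) :=
    hgm.comp (by fun_prop : Measurable fun z : ℝ × E d => z.2 + z.1 • (a - z.2))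
  have hmeas2 : Measurable fun x : E d =>
      ∫⁻ r in Ioc (0:ℝ) (1 / 2), ENNReal.ofReal (gradSq φ (x + r • (a - x))) :=
    Measurable.lintegral_prod_left' (f := fun z : ℝ × E d =>
      ENNReal.ofReal (gradSq φ (z.2 + z.1 • (a - z.2)))) hmeas1
  have hmeas3 : ∀ t : ℝ, Measurable fun x : E d => ‖φ (x + t • (a - x))‖ₑ ^ 2 := fun t =>
    (hφm.comp (by fun_prop : Measurable fun x : E d => x + t • (a - x))).enorm.pow_const _
  set I := ∫⁻ x, ‖φ x‖ₑ ^ 2 ∂μ with hI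
  set G := ∫⁻ x in K.body, ENNReal.ofReal (gradSq φ x) with hG
  have hswap : ∫⁻ x, ∫⁻ r in Ioc (0:ℝ) (1 / 2), ENNReal.ofReal (gradSq φ (x + r • (a - x))) ∂volume ∂μ
      ≤ c * G := by
    refine le_trans (le_of_eq ?_) (hc _ hgm)
    exact lintegral_lintegral_swap (f := fun x r => ENNReal.ofReal (gradSq φ (x + r • (a - x))))
      (hmeas1.comp measurable_swap).aemeasurable
  have ht : ∀ t ∈ Ioc (0:ℝ) (1 / 2), I ≤ 2 * ∫⁻ x, ‖φ (x + t • (a - x))‖ₑ ^ 2 ∂μ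
      + 2 * (ENNReal.ofReal (δ ^ 2) * (c * G)) := by
    intro t ht
    calc I ≤ ∫⁻ x, (2 * ‖φ (x + t • (a - x))‖ₑ ^ 2 + 2 * (ENNReal.ofReal (δ ^ 2) *
        ∫⁻ r in Ioc (0:ℝ) (1 / 2), ENNReal.ofReal (gradSq φ (x + r • (a - x))))) ∂μ := by
          refine lintegral_mono_ae ?_
          filter_upwards [hae] with x hx using hpt t ht x hx
      _ = 2 * ∫⁻ x, ‖φ (x + t • (a - x))‖ₑ ^ 2 ∂μ + 2 * (ENNReal.ofReal (δ ^ 2) *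
          ∫⁻ x, ∫⁻ r in Ioc (0:ℝ) (1 / 2), ENNReal.ofReal (gradSq φ (x + r • (a - x))) ∂volume ∂μ) := by
          rw [lintegral_add_left ((hmeas3 t).const_mul _), lintegral_const_mul _ (hmeas3 t),
            lintegral_const_mul _ (hmeas2.const_mul _), lintegral_const_mul _ hmeas2]
      _ ≤ _ := by gcongr
  -- The left side does not depend on `t`, so integration over an interval of length `1 / 2` yields
  -- half of it.
  have hint := setLIntegral_mono' (μ := volume) measurableSet_Ioc ht
  have h12 : (volume : Measure ℝ) (Ioc 0 (1 / 2)) = ENNReal.ofReal (1 / 2) := by simp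
  have hmeas4 : Measurable fun t : ℝ => ∫⁻ x, ‖φ (x + t • (a - x))‖ₑ ^ 2 ∂μ :=
    Measurable.lintegral_prod_right' (f := fun z : ℝ × E d => ‖φ (z.2 + z.1 • (a - z.2))‖ₑ ^ 2)
      ((hφm.comp (by fun_prop : Measurable fun z : ℝ × E d => z.2 + z.1 • (a - z.2))).enorm.pow_const _)
  rw [lintegral_add_left (hmeas4.const_mul _), lintegral_const_mul _ hmeas4] at hint
  simp only [lintegral_const, Measure.restrict_apply MeasurableSet.univ, univ_inter, h12] at hint
  have hA := hc (fun x => ‖φ x‖ₑ ^ 2) (hφm.enorm.pow_const _)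
  have h2 : I * ENNReal.ofReal (1 / 2) ≤ 2 * (c * ∫⁻ x in K.body, ‖φ x‖ₑ ^ 2)
      + 2 * (ENNReal.ofReal (δ ^ 2) * (c * G)) * ENNReal.ofReal (1 / 2) :=
    hint.trans (by gcongr)
  have hhalf : ENNReal.ofReal (1 / 2) * 2 = 1 := by
    rw [show (2 : ℝ≥0∞) = ENNReal.ofReal 2 by simp, ← ENNReal.ofReal_mul (by norm_num)]; norm_num
  have h3 : I ≤ 4 * (c * ∫⁻ x in K.body, ‖φ x‖ₑ ^ 2) + 2 * (ENNReal.ofReal (δ ^ 2) * (c * G)) := by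
    calc I = I * ENNReal.ofReal (1 / 2) * 2 := by rw [mul_assoc, hhalf, mul_one]
      _ ≤ (2 * (c * ∫⁻ x in K.body, ‖φ x‖ₑ ^ 2)
        + 2 * (ENNReal.ofReal (δ ^ 2) * (c * G)) * ENNReal.ofReal (1 / 2)) * 2 := by gcongr
      _ = 4 * (c * ∫⁻ x in K.body, ‖φ x‖ₑ ^ 2) + 2 * (ENNReal.ofReal (δ ^ 2) * (c * G)) *
          (ENNReal.ofReal (1 / 2) * 2) := by ring
      _ = _ := by rw [hhalf, mul_one]
  refine h3.trans ?_
  set A := ∫⁻ x in K.body, ‖φ x‖ₑ ^ 2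
  have e5 : (((4 * c + 4 * (Real.toNNReal (δ ^ 2) * c) : ℝ≥0)) : ℝ≥0∞)
      = 4 * c + 4 * (ENNReal.ofReal (δ ^ 2) * c) := by
    push_cast; rfl
  rw [e5]
  calc _ ≤ 4 * (c * A) + 4 * (ENNReal.ofReal (δ ^ 2) * (c * G)) := by
        gcongr; norm_num
    _ = 4 * c * A + 4 * (ENNReal.ofReal (δ ^ 2) * c) * G := by ring
    _ ≤ (4 * c + 4 * (ENNReal.ofReal (δ ^ 2) * c)) * A
        + (4 * c + 4 * (ENNReal.ofReal (δ ^ 2) * c)) * G := by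
        gcongr
        · exact le_self_add
        · exact le_add_self
    _ = _ := by ring

/-! ### Similarities and scaled trace bounds. -/

/-- `K` arises from `R` by the similarity `x ↦ a + s x`. -/
structure IsScaled {d : ℕ} (R K : TaggedSimplex d) (a : E d) (s : ℝ) : Prop where
  pos : 0 < s
  verts : ∀ i, K.verts i = a + s • R.verts i

namespace IsScaled

variable {d : ℕ} {R K : TaggedSimplex d} {a : E d} {s : ℝ}

lemma image_convexHull_affine (a : E d) (s : ℝ) (S : Set (E d)) :
    (fun x => a + s • x) '' convexHull ℝ S = convexHull ℝ ((fun x => a + s • x) '' S) := by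
  let f : E d →ᵃ[ℝ] E d := (AffineMap.const ℝ (E d) a) + (s • LinearMap.id).toAffineMap
  have hf : ⇑f = fun x => a + s • x := by ext1 x; simp [f]
  rw [← hf]; exact f.image_convexHull S

lemma body_eq (h : IsScaled R K a s) : K.body = (fun x => a + s • x) '' R.body := by
  rw [TaggedSimplex.body, TaggedSimplex.body, image_convexHull_affine, ← range_comp]
  congr 2; ext1 i; exact h.verts i

lemma facet_eq (h : IsScaled R K a s) (i : Fin (d + 1)) :
    K.facet i = (fun x => a + s • x) '' R.facet i := by
  rw [TaggedSimplex.facet, TaggedSimplex.facet, image_convexHull_affine, ← image_comp]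
  congr 1; exact image_congr fun i _ => h.verts i

lemma lintegral_body (h : IsScaled R K a s) (f : E d → ℝ≥0∞) :
    ∫⁻ x in R.body, f (a + s • x) = ENNReal.ofReal ((s ^ d)⁻¹) * ∫⁻ x in K.body, f x := by
  have hA := measurableEmbedding_affine a h.pos
  rw [← lintegral_indicator K.body_closed.measurableSet, ← lintegral_comp_affine a h.pos,
    ← lintegral_indicator R.body_closed.measurableSet]
  refine lintegral_congr fun x => ?_
  have : a + s • x ∈ K.body ↔ x ∈ R.body := by
    rw [h.body_eq]; exact hA.injective.mem_set_image
  by_cases hx : x ∈ R.body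
  · rw [indicator_of_mem hx, indicator_of_mem (this.mpr hx)]
  · rw [indicator_of_notMem hx, indicator_of_notMem (mt this.mp hx)]

open scoped Pointwise in
lemma facetMeasure_eq (h : IsScaled R K a s) (i : Fin (d + 1)) :
    facetMeasure K i
      = ENNReal.ofReal (s ^ (d - 1)) • (facetMeasure R i).map (fun x => a + s • x) := by
  have hA := measurableEmbedding_affine a h.pos
  have himg : ∀ S : Set (E d), (μHE[d - 1] : Measure (E d)) ((fun x => a + s • x) '' S)
      = ENNReal.ofReal (s ^ (d - 1)) * (μHE[d - 1] : Measure (E d)) S := by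
    intro S
    have e : (fun x : E d => a + s • x) '' S = (fun x => a + x) '' (s • S) := by
      rw [← image_smul, ← image_comp]; rfl
    rw [e, (isometry_add_left a).euclideanHausdorffMeasure_image,
      Measure.euclideanHausdorffMeasure_smul₀ _ h.pos.ne', ENNReal.smul_def, smul_eq_mul,
      ENNReal.ofReal_pow h.pos.le, ENNReal.coe_pow]
    congr 2
    rw [← enorm_eq_nnnorm, Real.enorm_of_nonneg h.pos.le]
  ext S hS
  rw [Measure.smul_apply, hA.map_apply, smul_eq_mul, facetMeasure, facetMeasure,
    Measure.restrict_apply hS, Measure.restrict_apply (hA.measurable hS), h.facet_eq, ← himg,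
    image_preimage_inter]

lemma lintegral_facet (h : IsScaled R K a s) (i : Fin (d + 1)) (f : E d → ℝ≥0∞) :
    ∫⁻ x, f x ∂(facetMeasure K i)
      = ENNReal.ofReal (s ^ (d - 1)) * ∫⁻ x, f (a + s • x) ∂(facetMeasure R i) := by
  rw [h.facetMeasure_eq, lintegral_smul_measure,
    (measurableEmbedding_affine a h.pos).lintegral_map, smul_eq_mul]

lemma affineIndependent (h : IsScaled R K a s) (hR : AffineIndependent ℝ R.verts) :
    AffineIndependent ℝ K.verts := by
  let f : E d →ᵃ[ℝ] E d := (AffineMap.const ℝ (E d) a) + (s • LinearMap.id).toAffineMap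
  have hf : ⇑f = fun x => a + s • x := by ext1 x; simp [f]
  have : K.verts = f ∘ R.verts := by ext1 i; rw [hf]; exact h.verts i
  rw [this]
  exact hR.map' f (by rw [hf]; exact (measurableEmbedding_affine a h.pos).injective)

end IsScaled

lemma gradSq_comp_affine {d : ℕ} {φ : E d → ℝ} (hφ : ContDiff ℝ ∞ φ) (a : E d) (s : ℝ) (x : E d) :
    gradSq (fun x => φ (a + s • x)) x = s ^ 2 * gradSq φ (a + s • x) := by
  rw [gradSq, gradSq, Finset.mul_sum]
  refine Finset.sum_congr rfl fun j _ => ?_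
  have hA : HasFDerivAt (fun x => a + s • x) (s • ContinuousLinearMap.id ℝ (E d)) x :=
    ((hasFDerivAt_id x).const_smul s).const_add _
  have h : HasFDerivAt (fun x => φ (a + s • x)) _ x :=
    ((hφ.differentiable (by simp) (a + s • x)).hasFDerivAt).comp x hA
  rw [partialDeriv, partialDeriv, h.fderiv]
  simp [mul_pow]

/-- The scaled trace inequality for smooth functions. -/
lemma exists_scaled_trace_bound {d : ℕ} (R : TaggedSimplex d) (hR : AffineIndependent ℝ R.verts)
    (i : Fin (d + 1)) :
    ∃ c : ℝ≥0, ∀ (K : TaggedSimplex d) (a : E d) (s : ℝ), IsScaled R K a s →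
      ∀ φ : E d → ℝ, ContDiff ℝ ∞ φ →
      ∫⁻ x, ‖φ x‖ₑ ^ 2 ∂(facetMeasure K i)
        ≤ c * (ENNReal.ofReal s⁻¹ * (∫⁻ x in K.body, ‖φ x‖ₑ ^ 2)
          + ENNReal.ofReal s * ∫⁻ x in K.body, ENNReal.ofReal (gradSq φ x)) := by
  obtain ⟨c, hc⟩ := exists_trace_bound R hR i
  refine ⟨c, fun K a s h φ hφ => ?_⟩
  have hs := h.pos
  obtain ⟨m, hm⟩ : ∃ m, d = m + 1 := ⟨d - 1, by have := R.dim_pos; omega⟩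
  have h1 := hc (fun x => φ (a + s • x)) (hφ.comp (by fun_prop))
  rw [h.lintegral_facet i]
  simp only [gradSq_comp_affine hφ] at h1
  have h2 := h.lintegral_body (fun x => ‖φ x‖ₑ ^ 2)
  have h3 := h.lintegral_body (fun x => ENNReal.ofReal (s ^ 2 * gradSq φ x))
  rw [h2, h3] at h1
  have h4 : ∫⁻ x in K.body, ENNReal.ofReal (s ^ 2 * gradSq φ x)
      = ENNReal.ofReal (s ^ 2) * ∫⁻ x in K.body, ENNReal.ofReal (gradSq φ x) := by
    rw [← lintegral_const_mul _ (continuous_gradSq hφ).measurable.ennreal_ofReal]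
    exact lintegral_congr fun x => ENNReal.ofReal_mul (by positivity)
  rw [h4] at h1
  refine (mul_le_mul_right h1 _).trans (le_of_eq ?_)
  set A := ∫⁻ x in K.body, ‖φ x‖ₑ ^ 2
  set G := ∫⁻ x in K.body, ENNReal.ofReal (gradSq φ x)
  -- The facet contributes `s ^ (d - 1)`, the element `s ^ (-d)` and the squared gradient `s ^ 2`;
  -- what remains is `s⁻¹` for the function and `s` for the gradient.
  have e1 : ENNReal.ofReal (s ^ (d - 1)) * ENNReal.ofReal ((s ^ d)⁻¹) = ENNReal.ofReal s⁻¹ := by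
    rw [← ENNReal.ofReal_mul (by positivity)]
    congr 1; subst hm; simp only [Nat.add_sub_cancel]; field_simp; rw [pow_succ]
  have e2 : ENNReal.ofReal s⁻¹ * ENNReal.ofReal (s ^ 2) = ENNReal.ofReal s := by
    rw [← ENNReal.ofReal_mul (by positivity)]; congr 1; field_simp
  calc _ = c * (ENNReal.ofReal (s ^ (d - 1)) * ENNReal.ofReal ((s ^ d)⁻¹) * A
        + ENNReal.ofReal (s ^ (d - 1)) * ENNReal.ofReal ((s ^ d)⁻¹) * ENNReal.ofReal (s ^ 2) * G) := by
        ring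
    _ = _ := by rw [e1, e2]

lemma lintegral_gradSq {d : ℕ} {φ : E d → ℝ} (hφ : ContDiff ℝ ∞ φ) (μ : Measure (E d)) :
    ∫⁻ x, ENNReal.ofReal (gradSq φ x) ∂μ = ∑ j, eLpNorm (partialDeriv j φ) 2 μ ^ 2 := by
  simp_rw [eLpNorm_two_sq]
  rw [← lintegral_finsetSum _ fun j _ =>
    (continuous_partialDeriv j hφ).measurable.enorm.pow_const _]
  refine lintegral_congr fun x => ?_
  rw [gradSq, ENNReal.ofReal_sum_of_nonneg fun j _ => sq_nonneg _]
  refine Finset.sum_congr rfl fun j _ => ?_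
  rw [← sq_abs, ENNReal.ofReal_pow (abs_nonneg _), ← Real.enorm_eq_ofReal_abs]

/-- The trace inequality for smooth functions, in terms of norms. -/
def TraceBound {d : ℕ} (K : TaggedSimplex d) (i : Fin (d + 1)) (c α β : ℝ≥0∞) : Prop :=
  ∀ φ : E d → ℝ, ContDiff ℝ ∞ φ → eLpNorm φ 2 (facetMeasure K i)
    ≤ c * (α * eLpNorm φ 2 (volOn (interior K.body))
      + β * ∑ j, eLpNorm (partialDeriv j φ) 2 (volOn (interior K.body)))

/-- The square root of the scaled trace inequality, in the form that survives limits of smooth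
functions. The constant `c + 1` serves as a convenient upper bound for the root of `c`. -/
lemma exists_traceBound {d : ℕ} (R : TaggedSimplex d) (hR : AffineIndependent ℝ R.verts)
    (i : Fin (d + 1)) :
    ∃ c : ℝ≥0, ∀ (K : TaggedSimplex d) (a : E d) (s : ℝ), IsScaled R K a s →
      TraceBound K i c (ENNReal.ofReal (√s)⁻¹) (ENNReal.ofReal √s) := by
  obtain ⟨c, hc⟩ := exists_scaled_trace_bound R hR i
  refine ⟨c + 1, fun K a s h φ hφ => ?_⟩
  have hs := h.pos
  have h1 := hc K a s h φ hφ
  rw [show volume.restrict K.body = volume.restrict (interior K.body) from K.volOn_body,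
    lintegral_gradSq hφ, ← eLpNorm_two_sq, ← eLpNorm_two_sq] at h1
  refine (ENNReal.pow_le_pow_left_iff (two_ne_zero)).mp (h1.trans ?_)
  set N := eLpNorm φ 2 (volOn (interior K.body))
  set B := fun j => eLpNorm (partialDeriv j φ) 2 (volOn (interior K.body))
  have hB : ∑ j, B j ^ 2 ≤ (∑ j, B j) ^ 2 := by
    rw [sq (∑ j, B j), Finset.sum_mul]
    refine Finset.sum_le_sum fun j hj => ?_
    rw [sq]
    gcongr
    exact Finset.single_le_sum (fun _ _ => zero_le) hj
  have e1 : ENNReal.ofReal s⁻¹ = ENNReal.ofReal (√s)⁻¹ ^ 2 := by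
    rw [← ENNReal.ofReal_pow (by positivity), inv_pow, Real.sq_sqrt hs.le]
  have e2 : ENNReal.ofReal s = ENNReal.ofReal (√s) ^ 2 := by
    rw [← ENNReal.ofReal_pow (by positivity), Real.sq_sqrt hs.le]
  rw [e1, e2]
  set α := ENNReal.ofReal (√s)⁻¹
  set β := ENNReal.ofReal √s
  have hc1 : (c : ℝ≥0∞) ≤ ((c + 1 : ℝ≥0) : ℝ≥0∞) ^ 2 := by
    rw [← ENNReal.coe_pow, ENNReal.coe_le_coe]
    exact (le_of_eq (by ring) : c ≤ c).trans (by nlinarith [c.2, sq_nonneg (c : ℝ), show (0:ℝ≥0) ≤ c ^ 2 from zero_le, show c ≤ c + (c + c ^ 2 + 1) from le_self_add])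
  calc _ ≤ ((c + 1 : ℝ≥0) : ℝ≥0∞) ^ 2 * (α ^ 2 * N ^ 2 + β ^ 2 * (∑ j, B j) ^ 2) := by gcongr
    _ ≤ ((c + 1 : ℝ≥0) : ℝ≥0∞) ^ 2 * (α * N + β * ∑ j, B j) ^ 2 := by
        gcongr
        rw [← mul_pow, ← mul_pow, add_sq]
        rw [add_right_comm]
        exact le_self_add
    _ = _ := by rw [mul_pow]

/-- The bound applied to the constant function one shows that the facet has finite surface measure.
-/
lemma TraceBound.isFiniteMeasure {d : ℕ} {K : TaggedSimplex d} {i : Fin (d + 1)} {c : ℝ≥0}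
    {α β : ℝ} (h : TraceBound K i c (ENNReal.ofReal α) (ENNReal.ofReal β)) :
    IsFiniteMeasure (facetMeasure K i) := by
  have h1 := h (fun _ => 1) contDiff_const
  have e : ∀ j : Fin d, partialDeriv j (fun _ : E d => (1:ℝ)) = 0 := fun j => by
    ext x; simp [partialDeriv]
  simp only [e, eLpNorm_zero, Finset.sum_const_zero, mul_zero, add_zero] at h1
  have hf : IsFiniteMeasure (volOn (interior K.body)) :=
    ⟨by simpa using (K.body_bounded.subset interior_subset).measure_lt_top⟩
  have h2 : eLpNorm (fun _ : E d => (1:ℝ)) 2 (volOn (interior K.body)) ≠ ⊤ :=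
    (memLp_const (1:ℝ)).eLpNorm_ne_top
  have h3 : eLpNorm (fun _ : E d => (1:ℝ)) 2 (facetMeasure K i) < ⊤ :=
    h1.trans_lt (ENNReal.mul_lt_top (by simp) (ENNReal.mul_lt_top (by simp) h2.lt_top))
  have h4 := eLpNorm_two_sq (μ := facetMeasure K i) (fun _ : E d => (1:ℝ))
  simp only [enorm_one, one_pow, lintegral_const, one_mul] at h4
  exact ⟨h4 ▸ ENNReal.pow_lt_top h3⟩

lemma isFiniteMeasure_facetMeasure {d : ℕ} {K : TaggedSimplex d}
    (hK : AffineIndependent ℝ K.verts) (i : Fin (d + 1)) : IsFiniteMeasure (facetMeasure K i) := by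
  obtain ⟨c, hc⟩ := exists_traceBound K hK i
  exact (hc K 0 1 ⟨one_pos, by simp⟩).isFiniteMeasure

lemma ae_mem_facet {d : ℕ} (K : TaggedSimplex d) (i : Fin (d + 1)) :
    ∀ᵐ x ∂(facetMeasure K i), x ∈ K.facet i := ae_restrict_mem (K.facet_closed i).measurableSet

lemma memLp_facet_of_continuous {d : ℕ} {K : TaggedSimplex d}
    (hK : AffineIndependent ℝ K.verts) (i : Fin (d + 1)) {φ : E d → ℝ} (hφ : Continuous φ) :
    MemLp φ 2 (facetMeasure K i) := by
  have := isFiniteMeasure_facetMeasure hK i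
  obtain ⟨M, hM⟩ := (K.facet_compact i).exists_bound_of_continuousOn hφ.continuousOn
  have : MemLp φ ⊤ (facetMeasure K i) := by
    refine memLp_top_of_bound hφ.aestronglyMeasurable M ?_
    filter_upwards [ae_mem_facet K i] with x hx using hM x hx
  exact this.mono_exponent le_top

/-! ### Traces of `H¹` functions -/

section Trace

variable {d : ℕ} {Ω : Set (E d)} {K : TaggedSimplex d} {i : Fin (d + 1)}

lemma partialDeriv_sub {φ ψ : E d → ℝ} (hφ : ContDiff ℝ ∞ φ) (hψ : ContDiff ℝ ∞ ψ) (j : Fin d) :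
    partialDeriv j (φ - ψ) = partialDeriv j φ - partialDeriv j ψ := by
  ext x
  simp [partialDeriv, fderiv_sub (hφ.differentiable (by simp) x) (hψ.differentiable (by simp) x)]

lemma partialDeriv_add {φ ψ : E d → ℝ} (hφ : ContDiff ℝ ∞ φ) (hψ : ContDiff ℝ ∞ ψ) (j : Fin d) :
    partialDeriv j (φ + ψ) = partialDeriv j φ + partialDeriv j ψ := by
  ext x
  simp [partialDeriv, fderiv_add (hφ.differentiable (by simp) x) (hψ.differentiable (by simp) x)]

lemma partialDeriv_const_smul {φ : E d → ℝ} (hφ : ContDiff ℝ ∞ φ) (r : ℝ) (j : Fin d) :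
    partialDeriv j (r • φ) = r • partialDeriv j φ := by
  ext x
  simp [partialDeriv, fderiv_const_smul (hφ.differentiable (by simp) x)]

lemma volOn_interior_ac {Ω : Set (E d)} (hKΩ : interior K.body ⊆ Ω) :
    volOn (interior K.body) ≪ volOn Ω :=
  (Measure.restrict_mono hKΩ le_rfl).absolutelyContinuous

lemma fn_add (v w : H1 Ω) : fn (v + w) =ᵐ[volOn Ω] fn v + fn w := Lp.coeFn_add _ _
lemma fn_smul (c : ℝ) (v : H1 Ω) : fn (c • v) =ᵐ[volOn Ω] c • fn v := Lp.coeFn_smul _ _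
lemma grad_add (v w : H1 Ω) (j : Fin d) : grad (v + w) j =ᵐ[volOn Ω] grad v j + grad w j :=
  Lp.coeFn_add _ _
lemma grad_smul (c : ℝ) (v : H1 Ω) (j : Fin d) : grad (c • v) j =ᵐ[volOn Ω] c • grad v j :=
  Lp.coeFn_smul _ _

lemma TraceBound.tendsto_zero {c : ℝ≥0} {α β : ℝ}
    (h : TraceBound K i c (ENNReal.ofReal α) (ENNReal.ofReal β)) {φ : ℕ → E d → ℝ}
    (hφ : ∀ n, ContDiff ℝ ∞ (φ n))
    (h0 : Tendsto (fun n => eLpNorm (φ n) 2 (volOn (interior K.body))) atTop (𝓝 0))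
    (h1 : ∀ j, Tendsto (fun n => eLpNorm (partialDeriv j (φ n)) 2 (volOn (interior K.body)))
      atTop (𝓝 0)) :
    Tendsto (fun n => eLpNorm (φ n) 2 (facetMeasure K i)) atTop (𝓝 0) := by
  refine tendsto_of_tendsto_of_tendsto_of_le_of_le tendsto_const_nhds ?_ (fun _ => zero_le)
    (fun n => h (φ n) (hφ n))
  have hs := tendsto_finsetSum Finset.univ fun j _ => h1 j
  have := ENNReal.Tendsto.const_mul (a := (c : ℝ≥0∞)) ((ENNReal.Tendsto.const_mul
    (a := ENNReal.ofReal α) h0 (Or.inr (by simp))).add (ENNReal.Tendsto.const_mul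
    (a := ENNReal.ofReal β) hs (Or.inr (by simp)))) (Or.inr (by simp))
  simpa using this

/-- The trace of an `H¹` function is unique. -/
lemma IsFacetTrace.ae_eq (hK : AffineIndependent ℝ K.verts) (hKΩ : interior K.body ⊆ Ω)
    {v : H1 Ω} {g g' : E d → ℝ} (h : IsFacetTrace K i v g) (h' : IsFacetTrace K i v g') :
    g =ᵐ[facetMeasure K i] g' := by
  obtain ⟨c, hc⟩ := exists_traceBound K hK i
  have hT := hc K 0 1 ⟨one_pos, by simp⟩
  obtain ⟨hg, φ, hφ, h0, h1, h2⟩ := h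
  obtain ⟨hg', φ', hφ', h0', h1', h2'⟩ := h'
  have hb := K.body_bounded.subset (interior_subset (s := K.body))
  have key : ∀ (μ : Measure (E d)) (f f' : ℕ → E d → ℝ) (w : E d → ℝ),
      (∀ n, AEStronglyMeasurable (f n) μ) → (∀ n, AEStronglyMeasurable (f' n) μ) →
      AEStronglyMeasurable w μ →
      Tendsto (fun n => eLpNorm (fun x => f n x - w x) 2 μ) atTop (𝓝 0) →
      Tendsto (fun n => eLpNorm (fun x => f' n x - w x) 2 μ) atTop (𝓝 0) →
      Tendsto (fun n => eLpNorm (f n - f' n) 2 μ) atTop (𝓝 0) := by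
    intro μ f f' w hf hf' hw ha hb
    refine tendsto_of_tendsto_of_tendsto_of_le_of_le tendsto_const_nhds
      (by simpa using ha.add hb) (fun _ => zero_le) (fun n => ?_)
    have : f n - f' n = (fun x => f n x - w x) - (fun x => f' n x - w x) := by ext x; simp
    rw [this]
    exact eLpNorm_sub_le ((hf n).sub hw) ((hf' n).sub hw) (by norm_num)
  have t0 := key _ φ φ' _ (fun n => (hφ n).continuous.aestronglyMeasurable)
    (fun n => (hφ' n).continuous.aestronglyMeasurable)
    (memLp_fn_of_subset hKΩ v).aestronglyMeasurable h0 h0'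
  have t1 := fun j => key _ (fun n => partialDeriv j (φ n)) (fun n => partialDeriv j (φ' n)) _
    (fun n => (continuous_partialDeriv j (hφ n)).aestronglyMeasurable)
    (fun n => (continuous_partialDeriv j (hφ' n)).aestronglyMeasurable)
    (memLp_grad_of_subset hKΩ v j).aestronglyMeasurable (h1 j) (h1' j)
  -- Two approximating sequences of the same `v` differ by a null sequence in `H¹(K)`, and the trace
  -- bound carries this over to the facet.
  have t2 := hT.tendsto_zero (φ := fun n => φ n - φ' n) (fun n => (hφ n).sub (hφ' n)) t0
    (fun j => by simpa only [partialDeriv_sub (hφ _) (hφ' _)] using t1 j)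
  have hz : eLpNorm (g - g') 2 (facetMeasure K i) = 0 := by
    refine le_antisymm (ge_of_tendsto' (f := fun n => eLpNorm (fun x => φ' n x - g' x) 2
      (facetMeasure K i) + (eLpNorm (φ n - φ' n) 2 (facetMeasure K i)
        + eLpNorm (fun x => φ n x - g x) 2 (facetMeasure K i))) (x := atTop)
      (by simpa using h2'.add (t2.add h2)) fun n => ?_) zero_le
    have m1 := (hφ n).continuous.aestronglyMeasurable (μ := facetMeasure K i)
    have m2 := (hφ' n).continuous.aestronglyMeasurable (μ := facetMeasure K i)
    have : g - g' = (fun x => φ' n x - g' x) + ((φ n - φ' n) - fun x => φ n x - g x) := by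
      ext x; simp
    rw [this]
    refine (eLpNorm_add_le (m2.sub hg'.1) ((m1.sub m2).sub (m1.sub hg.1)) (by norm_num)).trans ?_
    refine add_le_add_right ?_ _
    exact eLpNorm_sub_le (f := φ n - φ' n) (g := fun x => φ n x - g x) (m1.sub m2) (m1.sub hg.1)
      (by norm_num)
  have := (eLpNorm_eq_zero_iff (hg.sub hg').1 (by norm_num)).mp hz
  filter_upwards [this] with x hx
  simpa [sub_eq_zero] using hx

/-- The bound for smooth functions passes to the limit along the sequence that defines the trace. -/
lemma TraceBound.le_of_isFacetTrace {c : ℝ≥0} {α β : ℝ}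
    (hT : TraceBound K i c (ENNReal.ofReal α) (ENNReal.ofReal β)) (hKΩ : interior K.body ⊆ Ω)
    {v : H1 Ω} {g : E d → ℝ} (h : IsFacetTrace K i v g) :
    eLpNorm g 2 (facetMeasure K i)
      ≤ c * (ENNReal.ofReal α * eLpNorm (fn v) 2 (volOn (interior K.body))
      + ENNReal.ofReal β * ∑ j, eLpNorm (grad v j) 2 (volOn (interior K.body))) := by
  obtain ⟨hg, φ, hφ, h0, h1, h2⟩ := h
  have key : ∀ (μ : Measure (E d)) (f w : E d → ℝ), AEStronglyMeasurable f μ →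
      AEStronglyMeasurable w μ → eLpNorm f 2 μ ≤ eLpNorm w 2 μ + eLpNorm (fun x => f x - w x) 2 μ := by
    intro μ f w hf hw
    have : f = w + fun x => f x - w x := by ext x; simp
    conv_lhs => rw [this]
    exact eLpNorm_add_le hw (hf.sub hw) (by norm_num)
  set N := eLpNorm (fn v) 2 (volOn (interior K.body))
  set B := fun j => eLpNorm (grad v j) 2 (volOn (interior K.body))
  set e0 := fun n => eLpNorm (fun x => φ n x - fn v x) 2 (volOn (interior K.body))
  set e1 := fun n j => eLpNorm (fun x => partialDeriv j (φ n) x - grad v j x) 2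
    (volOn (interior K.body))
  set e2 := fun n => eLpNorm (fun x => φ n x - g x) 2 (facetMeasure K i)
  have hlim : Tendsto (fun n => e2 n + c * (ENNReal.ofReal α * (N + e0 n)
      + ENNReal.ofReal β * ∑ j, (B j + e1 n j))) atTop
      (𝓝 (0 + c * (ENNReal.ofReal α * (N + 0) + ENNReal.ofReal β * ∑ j, (B j + 0)))) := by
    refine h2.add (ENNReal.Tendsto.const_mul ((ENNReal.Tendsto.const_mul
      (tendsto_const_nhds.add h0) (Or.inr (by simp))).add (ENNReal.Tendsto.const_mul
      (tendsto_finsetSum Finset.univ fun j _ => (tendsto_const_nhds.add (h1 j)))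
      (Or.inr (by simp)))) (Or.inr (by simp)))
  simp only [add_zero, zero_add] at hlim
  refine ge_of_tendsto' hlim fun n => ?_
  have m1 := (hφ n).continuous.aestronglyMeasurable (μ := facetMeasure K i)
  have hg1 : eLpNorm g 2 (facetMeasure K i) ≤ eLpNorm (φ n) 2 (facetMeasure K i) + e2 n := by
    refine (key _ g (φ n) hg.1 m1).trans_eq ?_
    congr 1
    exact eLpNorm_sub_comm _ _ _ _
  rw [add_comm]
  refine hg1.trans (add_le_add_left ((hT (φ n) (hφ n)).trans ?_) _)
  refine mul_le_mul_right (add_le_add (mul_le_mul_right ?_ _)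
    (mul_le_mul_right (Finset.sum_le_sum fun j _ => ?_) _)) _
  · exact key _ _ _ (hφ n).continuous.aestronglyMeasurable
      (memLp_fn_of_subset hKΩ v).aestronglyMeasurable
  · exact key _ _ _ (continuous_partialDeriv _ (hφ n)).aestronglyMeasurable
      (memLp_grad_of_subset hKΩ v _).aestronglyMeasurable

/-- Smooth approximations on the convex interior with errors `2 ^ (-n)` have, by the trace bound,
restrictions to the facet that form a Cauchy sequence with summable bounds; its `L²`-limit is the
trace. -/
lemma exists_isFacetTrace (hK : AffineIndependent ℝ K.verts) (hKΩ : interior K.body ⊆ Ω)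
    (v : H1 Ω) : ∃ g, IsFacetTrace K i v g := by
  obtain ⟨c, hc⟩ := exists_traceBound K hK i
  have hT := hc K 0 1 ⟨one_pos, by simp⟩
  have hb := K.body_bounded.subset (interior_subset (s := K.body))
  have hpos : ∀ n : ℕ, (0:ℝ) < (1 / 2) ^ n := fun n => by positivity
  choose φ hφ h0 h1 using fun n => exists_smooth_approx K.body_convex.interior isOpen_interior hb
    hKΩ v (hpos n)
  set μ := volOn (interior K.body)
  have hε : Tendsto (fun n : ℕ => ENNReal.ofReal ((1 / 2) ^ n)) atTop (𝓝 0) := by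
    have := (ENNReal.continuous_ofReal.tendsto 0).comp
      (tendsto_pow_atTop_nhds_zero_of_lt_one (r := (1 / 2 : ℝ)) (by norm_num) (by norm_num))
    rw [ENNReal.ofReal_zero] at this
    exact this
  have key : ∀ (f f' w : E d → ℝ) (N n m : ℕ), N ≤ n → N ≤ m → AEStronglyMeasurable f μ →
      AEStronglyMeasurable f' μ → AEStronglyMeasurable w μ →
      eLpNorm (fun x => f x - w x) 2 μ ≤ ENNReal.ofReal ((1 / 2) ^ n) →
      eLpNorm (fun x => f' x - w x) 2 μ ≤ ENNReal.ofReal ((1 / 2) ^ m) →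
      eLpNorm (f - f') 2 μ ≤ 2 * ENNReal.ofReal ((1 / 2) ^ N) := by
    intro f f' w N n m hn hm hf hf' hw ha hb
    have : f - f' = (fun x => f x - w x) - (fun x => f' x - w x) := by ext x; simp
    rw [this, two_mul]
    refine (eLpNorm_sub_le (hf.sub hw) (hf'.sub hw) (by norm_num)).trans
      (add_le_add (ha.trans ?_) (hb.trans ?_)) <;>
    exact ENNReal.ofReal_le_ofReal (pow_le_pow_of_le_one (by norm_num) (by norm_num) (by assumption))
  -- The extra one makes the Cauchy estimate strict, as the completeness statement requires.
  set D : ℝ≥0∞ := c * (2 + ∑ _j : Fin d, 2) + 1 with hD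
  have hDtop : D ≠ ⊤ := by
    rw [hD]
    refine ENNReal.add_ne_top.mpr ⟨ENNReal.mul_ne_top (by simp) ?_, by simp⟩
    simp [ENNReal.mul_eq_top]
  have hcau : ∀ N n m : ℕ, N ≤ n → N ≤ m → eLpNorm (φ n - φ m) 2 (facetMeasure K i)
      < D * ENNReal.ofReal ((1 / 2) ^ N) := by
    intro N n m hn hm
    have hlt : c * (2 + ∑ _j : Fin d, 2) * ENNReal.ofReal ((1 / 2) ^ N)
        < D * ENNReal.ofReal ((1 / 2) ^ N) := by
      refine ENNReal.mul_lt_mul_left (by simp) (by simp) ?_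
      rw [hD]
      refine ENNReal.lt_add_right ?_ (by simp)
      exact (ENNReal.add_ne_top.mp (hD ▸ hDtop)).1
    refine lt_of_le_of_lt ((hT (φ n - φ m) ((hφ n).sub (hφ m))).trans ?_) hlt
    simp only [Real.sqrt_one, inv_one, ENNReal.ofReal_one, one_mul]
    rw [mul_assoc, add_mul, Finset.sum_mul]
    gcongr with j
    · exact key _ _ _ N n m hn hm (hφ n).continuous.aestronglyMeasurable
        (hφ m).continuous.aestronglyMeasurable (memLp_fn_of_subset hKΩ v).aestronglyMeasurable
        (h0 n) (h0 m)
    · rw [partialDeriv_sub (hφ n) (hφ m)]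
      exact key _ _ _ N n m hn hm (continuous_partialDeriv j (hφ n)).aestronglyMeasurable
        (continuous_partialDeriv j (hφ m)).aestronglyMeasurable
        (memLp_grad_of_subset hKΩ v j).aestronglyMeasurable (h1 n j) (h1 m j)
  obtain ⟨g, hg, hlim⟩ := Lp.cauchy_complete_eLpNorm (p := 2) (by norm_num)
    (fun n => memLp_facet_of_continuous hK i (hφ n).continuous)
    (B := fun N => D * ENNReal.ofReal ((1 / 2) ^ N)) (by
      rw [ENNReal.tsum_mul_left]
      refine ENNReal.mul_ne_top hDtop ?_
      have : Summable fun n : ℕ => ((1:ℝ) / 2) ^ n := summable_geometric_two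
      exact this.tsum_ofReal_ne_top) hcau
  refine ⟨g, hg, φ, hφ, ?_, fun j => ?_, hlim⟩
  · exact tendsto_of_tendsto_of_tendsto_of_le_of_le tendsto_const_nhds hε (fun _ => zero_le) h0
  · exact tendsto_of_tendsto_of_tendsto_of_le_of_le tendsto_const_nhds hε (fun _ => zero_le)
      fun n => h1 n j

lemma isFacetTrace_facetTrace (hK : AffineIndependent ℝ K.verts) (hKΩ : interior K.body ⊆ Ω)
    (v : H1 Ω) : IsFacetTrace K i v (facetTrace K i v) := by
  have h := exists_isFacetTrace (i := i) hK hKΩ v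
  rw [facetTrace, dif_pos h]
  exact h.choose_spec

lemma IsFacetTrace.add (hKΩ : interior K.body ⊆ Ω) {v w : H1 Ω} {g g' : E d → ℝ}
    (h : IsFacetTrace K i v g) (h' : IsFacetTrace K i w g') :
    IsFacetTrace K i (v + w) (g + g') := by
  obtain ⟨hg, φ, hφ, h0, h1, h2⟩ := h
  obtain ⟨hg', φ', hφ', h0', h1', h2'⟩ := h'
  have key : ∀ (μ : Measure (E d)) (f f' : ℕ → E d → ℝ) (u u' z : E d → ℝ),
      (∀ n, AEStronglyMeasurable (f n) μ) → (∀ n, AEStronglyMeasurable (f' n) μ) →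
      AEStronglyMeasurable u μ → AEStronglyMeasurable u' μ → z =ᵐ[μ] u + u' →
      Tendsto (fun n => eLpNorm (fun x => f n x - u x) 2 μ) atTop (𝓝 0) →
      Tendsto (fun n => eLpNorm (fun x => f' n x - u' x) 2 μ) atTop (𝓝 0) →
      Tendsto (fun n => eLpNorm (fun x => (f n + f' n) x - z x) 2 μ) atTop (𝓝 0) := by
    intro μ f f' u u' z hf hf' hu hu' hz ha hb
    refine tendsto_of_tendsto_of_tendsto_of_le_of_le tendsto_const_nhds
      (by simpa using ha.add hb) (fun _ => zero_le) (fun n => ?_)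
    refine le_trans (le_of_eq (eLpNorm_congr_ae ?_)) (eLpNorm_add_le ((hf n).sub hu)
      ((hf' n).sub hu') (by norm_num))
    filter_upwards [hz] with x hx
    simp [hx]; ring
  refine ⟨hg.add hg', fun n => φ n + φ' n, fun n => (hφ n).add (hφ' n), ?_, fun j => ?_, ?_⟩
  · exact key _ φ φ' _ _ _ (fun n => (hφ n).continuous.aestronglyMeasurable)
      (fun n => (hφ' n).continuous.aestronglyMeasurable)
      (memLp_fn_of_subset hKΩ v).1 (memLp_fn_of_subset hKΩ w).1
      ((volOn_interior_ac hKΩ).ae_le (fn_add v w)) h0 h0'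
  · simp only [partialDeriv_add (hφ _) (hφ' _)]
    exact key _ (fun n => partialDeriv j (φ n)) (fun n => partialDeriv j (φ' n)) _ _ _
      (fun n => (continuous_partialDeriv j (hφ n)).aestronglyMeasurable)
      (fun n => (continuous_partialDeriv j (hφ' n)).aestronglyMeasurable)
      (memLp_grad_of_subset hKΩ v j).1 (memLp_grad_of_subset hKΩ w j).1
      ((volOn_interior_ac hKΩ).ae_le (grad_add v w j)) (h1 j) (h1' j)
  · exact key _ φ φ' _ _ _ (fun n => (hφ n).continuous.aestronglyMeasurable)
      (fun n => (hφ' n).continuous.aestronglyMeasurable) hg.1 hg'.1 EventuallyEq.rfl h2 h2'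

lemma IsFacetTrace.smul (hKΩ : interior K.body ⊆ Ω) {v : H1 Ω} {g : E d → ℝ} (c : ℝ)
    (h : IsFacetTrace K i v g) : IsFacetTrace K i (c • v) (c • g) := by
  obtain ⟨hg, φ, hφ, h0, h1, h2⟩ := h
  have key : ∀ (μ : Measure (E d)) (f : ℕ → E d → ℝ) (u z : E d → ℝ), z =ᵐ[μ] c • u →
      Tendsto (fun n => eLpNorm (fun x => f n x - u x) 2 μ) atTop (𝓝 0) →
      Tendsto (fun n => eLpNorm (fun x => (c • f n) x - z x) 2 μ) atTop (𝓝 0) := by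
    intro μ f u z hz ha
    have : ∀ n, eLpNorm (fun x => (c • f n) x - z x) 2 μ
        = ‖c‖ₑ * eLpNorm (fun x => f n x - u x) 2 μ := by
      intro n
      rw [← eLpNorm_const_smul]
      refine eLpNorm_congr_ae ?_
      filter_upwards [hz] with x hx
      simp [hx, mul_sub]
    simp_rw [this]
    simpa using ENNReal.Tendsto.const_mul ha (Or.inr (by simp : ‖c‖ₑ ≠ ⊤))
  refine ⟨hg.const_smul c, fun n => c • φ n, fun n => contDiff_const.smul (hφ n), ?_, fun j => ?_, ?_⟩
  · exact key _ φ _ _ ((volOn_interior_ac hKΩ).ae_le (fn_smul c v)) h0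
  · simp only [partialDeriv_const_smul (hφ _)]
    exact key _ (fun n => partialDeriv j (φ n)) _ _
      ((volOn_interior_ac hKΩ).ae_le (grad_smul c v j)) (h1 j)
  · exact key _ φ _ _ EventuallyEq.rfl h2

/-- The trace of a function which is smooth on the element is its restriction. -/
lemma isFacetTrace_of_smooth (hK : AffineIndependent ℝ K.verts) {v : H1 Ω} {φ : E d → ℝ}
    (hφ : ContDiff ℝ ∞ φ) (h0 : fn v =ᵐ[volOn (interior K.body)] φ)
    (h1 : ∀ j, grad v j =ᵐ[volOn (interior K.body)] partialDeriv j φ) : IsFacetTrace K i v φ := by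
  have key : ∀ (μ : Measure (E d)) (f z : E d → ℝ), z =ᵐ[μ] f →
      Tendsto (fun _ : ℕ => eLpNorm (fun x => f x - z x) 2 μ) atTop (𝓝 0) := by
    intro μ f z hz
    have : eLpNorm (fun x => f x - z x) 2 μ = 0 := by
      rw [← eLpNorm_zero (α := E d) (ε := ℝ) (p := 2) (μ := μ)]
      refine eLpNorm_congr_ae ?_
      filter_upwards [hz] with x hx
      simp [hx]
    rw [this]; exact tendsto_const_nhds
  exact ⟨memLp_facet_of_continuous hK i hφ.continuous, fun _ => φ, fun _ => hφ, key _ _ _ h0,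
    fun j => key _ _ _ (h1 j), key _ _ _ EventuallyEq.rfl⟩

end Trace

/-! ### Barycentric coordinates -/

lemma affineMap_sum {d : ℕ} {ι : Type*} (s : Finset ι) (f : E d →ᵃ[ℝ] ℝ) (w : ι → ℝ) (x : ι → E d)
    (hw : ∑ i ∈ s, w i = 1) : f (∑ i ∈ s, w i • x i) = ∑ i ∈ s, w i * f (x i) := by
  have h : ∀ y, f y = f.linear y + f 0 := fun y => congrFun f.decomp y
  rw [h]
  simp_rw [h (x _), mul_add, Finset.sum_add_distrib, ← Finset.sum_mul, hw, map_sum, map_smul]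
  simp

open Classical in
/-- The barycentric coordinates of a simplex. -/
def bc {d : ℕ} (K : TaggedSimplex d) (i : Fin (d + 1)) : E d →ᵃ[ℝ] ℝ :=
  if h : AffineIndependent ℝ K.verts then
    (⟨K.verts, h, by rw [h.affineSpan_eq_top_iff_card_eq_finrank_add_one]; simp⟩ :
      AffineBasis (Fin (d + 1)) ℝ (E d)).coord i
  else 0

section Bary

variable {d : ℕ} {K : TaggedSimplex d}

lemma exists_bc_eq (hK : AffineIndependent ℝ K.verts) :
    ∃ b : AffineBasis (Fin (d + 1)) ℝ (E d), ⇑b = K.verts ∧ ∀ i, bc K i = b.coord i :=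
  ⟨⟨K.verts, hK, by rw [hK.affineSpan_eq_top_iff_card_eq_finrank_add_one]; simp⟩, rfl,
    fun i => by rw [bc, dif_pos hK]⟩

lemma bc_sum (hK : AffineIndependent ℝ K.verts) (x : E d) : ∑ i, bc K i x = 1 := by
  obtain ⟨b, hb, h⟩ := exists_bc_eq hK
  simp_rw [h]; exact b.sum_coord_apply_eq_one x

lemma bc_comb (hK : AffineIndependent ℝ K.verts) (x : E d) : ∑ i, bc K i x • K.verts i = x := by
  obtain ⟨b, hb, h⟩ := exists_bc_eq hK
  simp_rw [h, ← hb]; exact b.linear_combination_coord_eq_self x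

lemma bc_vert (hK : AffineIndependent ℝ K.verts) (i j : Fin (d + 1)) :
    bc K i (K.verts j) = if i = j then 1 else 0 := by
  obtain ⟨b, hb, h⟩ := exists_bc_eq hK
  rw [h, ← hb]; exact b.coord_apply i j

lemma bc_of_comb (hK : AffineIndependent ℝ K.verts) {w : Fin (d + 1) → ℝ} (hw : ∑ i, w i = 1)
    (i : Fin (d + 1)) : bc K i (∑ j, w j • K.verts j) = w i := by
  rw [affineMap_sum _ _ _ _ hw]
  simp [bc_vert hK]

lemma affine_eq_bc (hK : AffineIndependent ℝ K.verts) (f : E d →ᵃ[ℝ] ℝ) (x : E d) :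
    f x = ∑ i, bc K i x * f (K.verts i) := by
  conv_lhs => rw [← bc_comb hK x]
  exact affineMap_sum _ _ _ _ (bc_sum hK x)

lemma mem_body_iff (hK : AffineIndependent ℝ K.verts) {x : E d} :
    x ∈ K.body ↔ ∀ i, 0 ≤ bc K i x := by
  obtain ⟨b, hb, h⟩ := exists_bc_eq hK
  rw [TaggedSimplex.body, ← hb, b.convexHull_eq_nonneg_coord]
  simp [h]

lemma mem_interior_iff (hK : AffineIndependent ℝ K.verts) {x : E d} :
    x ∈ interior K.body ↔ ∀ i, 0 < bc K i x := by
  obtain ⟨b, hb, h⟩ := exists_bc_eq hK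
  rw [TaggedSimplex.body, ← hb, b.interior_convexHull]
  simp [h]

/-- Faces are cut out of the simplex by the vanishing of the remaining barycentric coordinates. This
serves the facets and, through conformity, the common faces of two elements. -/
lemma mem_convexHull_image_iff (hK : AffineIndependent ℝ K.verts) {I : Set (Fin (d + 1))}
    {x : E d} : x ∈ convexHull ℝ (K.verts '' I) ↔ x ∈ K.body ∧ ∀ i ∉ I, bc K i x = 0 := by
  classical
  constructor
  · intro hx
    refine ⟨convexHull_mono (image_subset_range _ _) hx, fun i hi => ?_⟩
    have hc : Convex ℝ {y | bc K i y = 0} := by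
      intro y hy z hz a b ha hb hab
      have := affineMap_sum Finset.univ (bc K i) ![a, b] ![y, z] (by simpa using hab)
      simp only [Fin.sum_univ_two, Matrix.cons_val_zero, Matrix.cons_val_one] at this
      change bc K i (a • y + b • z) = 0
      rw [this, hy, hz]; ring
    refine convexHull_min ?_ hc hx
    rintro _ ⟨j, hj, rfl⟩
    change bc K i (K.verts j) = 0
    rw [bc_vert hK, if_neg]
    rintro rfl; exact hi hj
  · rintro ⟨hx, h0⟩
    rw [mem_body_iff hK] at hx
    have hs : ∀ g : Fin (d + 1) → E d, ∑ i ∈ Finset.univ.filter (· ∈ I), bc K i x • g i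
        = ∑ i, bc K i x • g i := fun g => Finset.sum_filter_of_ne fun i _ hi => by
      by_contra h; exact hi (by rw [h0 i h, zero_smul])
    have hs1 : ∑ i ∈ Finset.univ.filter (· ∈ I), bc K i x = 1 := by
      rw [← bc_sum hK x]
      exact Finset.sum_filter_of_ne fun i _ hi => by
        by_contra h; exact hi (h0 i h)
    rw [← bc_comb hK x, ← hs]
    exact (convex_convexHull ℝ _).sum_mem (fun i _ => hx i) hs1 fun i hi =>
      subset_convexHull ℝ _ ⟨i, (Finset.mem_filter.mp hi).2, rfl⟩

lemma mem_facet_iff (hK : AffineIndependent ℝ K.verts) {i : Fin (d + 1)} {x : E d} :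
    x ∈ K.facet i ↔ x ∈ K.body ∧ bc K i x = 0 := by
  rw [TaggedSimplex.facet, mem_convexHull_image_iff hK]
  simp

lemma interior_body_nonempty (hK : AffineIndependent ℝ K.verts) : (interior K.body).Nonempty := by
  have hd : (0:ℝ) < (d + 1 : ℕ) := by positivity
  refine ⟨∑ i, ((d + 1 : ℕ) : ℝ)⁻¹ • K.verts i, ?_⟩
  rw [mem_interior_iff hK]
  intro i
  rw [bc_of_comb hK (w := fun _ => ((d + 1 : ℕ) : ℝ)⁻¹)]
  · positivity
  · simp; field_simp

lemma bc_scaled {R : TaggedSimplex d} {a : E d} {s : ℝ} (h : IsScaled R K a s)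
    (hR : AffineIndependent ℝ R.verts) (i : Fin (d + 1)) (x : E d) :
    bc K i (a + s • x) = bc R i x := by
  have hK := h.affineIndependent hR
  have : a + s • x = ∑ j, bc R j x • K.verts j := by
    simp_rw [h.verts, smul_add, Finset.sum_add_distrib, ← Finset.sum_smul, bc_sum hR, one_smul]
    conv_lhs => rw [← bc_comb hR x]
    rw [Finset.smul_sum]
    congr 1
    exact Finset.sum_congr rfl fun j _ => by rw [smul_comm]
  rw [this, bc_of_comb hK (bc_sum hR x)]

lemma continuous_bc (i : Fin (d + 1)) : Continuous (bc K i) :=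
  AffineMap.continuous_of_finiteDimensional _

lemma exists_lipschitz_bc (K : TaggedSimplex d) :
    ∃ L : ℝ, 0 < L ∧ ∀ i x y, |bc K i x - bc K i y| ≤ L * ‖x - y‖ := by
  have h : ∀ i, ∃ L : ℝ, 0 ≤ L ∧ ∀ x y, |bc K i x - bc K i y| ≤ L * ‖x - y‖ := fun i => by
    let l := LinearMap.toContinuousLinearMap (bc K i).linear
    refine ⟨‖l‖, norm_nonneg _, fun x y => ?_⟩
    have : bc K i x - bc K i y = l (x - y) := ((bc K i).linearMap_vsub x y).symm
    rw [this]
    exact l.le_opNorm _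
  choose L hL0 hL using h
  refine ⟨1 + ∑ i, L i, by have := Finset.sum_nonneg (s := Finset.univ) fun i _ => hL0 i; linarith,
    fun i x y => (hL i x y).trans ?_⟩
  gcongr
  have := Finset.single_le_sum (fun i _ => hL0 i) (Finset.mem_univ i)
  linarith

end Bary

/-! ### Polynomials -/

section Poly

variable {d : ℕ}

@[simp] lemma polyEval_mul (p q : MvPolynomial (Fin d) ℝ) (x : E d) :
    polyEval (p * q) x = polyEval p x * polyEval q x := by simp [polyEval]
@[simp] lemma polyEval_add (p q : MvPolynomial (Fin d) ℝ) (x : E d) :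
    polyEval (p + q) x = polyEval p x + polyEval q x := by simp [polyEval]
@[simp] lemma polyEval_sub (p q : MvPolynomial (Fin d) ℝ) (x : E d) :
    polyEval (p - q) x = polyEval p x - polyEval q x := by simp [polyEval]
@[simp] lemma polyEval_C (c : ℝ) (x : E d) :
    polyEval (MvPolynomial.C c) x = c := by simp [polyEval]
lemma polyEval_prod {ι : Type*} (s : Finset ι) (p : ι → MvPolynomial (Fin d) ℝ) (x : E d) :
    polyEval (∏ i ∈ s, p i) x = ∏ i ∈ s, polyEval (p i) x := by simp [polyEval, map_prod]
lemma polyEval_sum {ι : Type*} (s : Finset ι) (p : ι → MvPolynomial (Fin d) ℝ) (x : E d) :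
    polyEval (∑ i ∈ s, p i) x = ∑ i ∈ s, polyEval (p i) x := by simp [polyEval, map_sum]

lemma contDiff_polyEval (q : MvPolynomial (Fin d) ℝ) : ContDiff ℝ ∞ (polyEval q) := by
  induction q using MvPolynomial.induction_on with
  | C a =>
    have : polyEval (MvPolynomial.C a : MvPolynomial (Fin d) ℝ) = fun _ => a := by ext; simp
    rw [this]; exact contDiff_const
  | add p q hp hq =>
    have : polyEval (p + q) = fun x => polyEval p x + polyEval q x := by ext; simp
    rw [this]; exact hp.add hq
  | mul_X p i hp =>
    have : polyEval (p * MvPolynomial.X i) = fun x => polyEval p x * x i := by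
      ext; simp [polyEval]
    rw [this]; exact hp.mul (by fun_prop)

/-- Affine functions are polynomials of degree at most one. -/
lemma exists_poly_affine (f : E d →ᵃ[ℝ] ℝ) :
    ∃ q : MvPolynomial (Fin d) ℝ, q.totalDegree ≤ 1 ∧ ∀ x, polyEval q x = f x := by
  refine ⟨MvPolynomial.C (f 0) + ∑ j, MvPolynomial.C (f.linear (EuclideanSpace.single j 1)) *
    MvPolynomial.X j, ?_, fun x => ?_⟩
  · refine (MvPolynomial.totalDegree_add _ _).trans (max_le (by simp) ?_)
    refine (MvPolynomial.totalDegree_finsetSum _ _).trans (Finset.sup_le fun j _ => ?_)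
    refine (MvPolynomial.totalDegree_mul _ _).trans ?_
    simp
  · have hx : x = ∑ j, x j • EuclideanSpace.single j (1 : ℝ) := by
      ext i; simp [Finset.sum_apply, Pi.single_apply]
    have h : f x = f.linear x + f 0 := congrFun f.decomp x
    rw [polyEval_add, polyEval_sum, h]
    conv_rhs => rw [hx]
    rw [map_sum, add_comm]
    simp only [polyEval_C, polyEval_mul, map_smul, smul_eq_mul]
    congr 1
    exact Finset.sum_congr rfl fun j _ => by simp [polyEval, mul_comm]

/-- The Lagrange multi-indices. -/
def idx (d p : ℕ) : Finset (Fin (d + 1) → ℕ) := Finset.piAntidiag Finset.univ p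

lemma mem_idx {p : ℕ} {α : Fin (d + 1) → ℕ} : α ∈ idx d p ↔ ∑ i, α i = p := by
  simp [idx]

/-- The Lagrange node with a given multi-index. -/
def node (K : TaggedSimplex d) (p : ℕ) (α : Fin (d + 1) → ℕ) : E d :=
  ∑ i, ((α i : ℝ) / p) • K.verts i

/-- The Lagrange basis functions in barycentric coordinates. -/
def lag (p : ℕ) (α : Fin (d + 1) → ℕ) (l : Fin (d + 1) → ℝ) : ℝ :=
  ∏ i, ∏ j ∈ Finset.range (α i), (((α i : ℝ) - j)⁻¹ * (p * l i - j))

lemma sum_div_idx {p : ℕ} (hp : 1 ≤ p) {α : Fin (d + 1) → ℕ} (hα : α ∈ idx d p) :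
    ∑ i, ((α i : ℝ) / p) = 1 := by
  rw [mem_idx] at hα
  rw [← Finset.sum_div, ← Nat.cast_sum, hα]
  have : (p : ℝ) ≠ 0 := by positivity
  field_simp

lemma bc_node {K : TaggedSimplex d} (hK : AffineIndependent ℝ K.verts) {p : ℕ} (hp : 1 ≤ p)
    {α : Fin (d + 1) → ℕ} (hα : α ∈ idx d p) (i : Fin (d + 1)) :
    bc K i (node K p α) = (α i : ℝ) / p := bc_of_comb hK (sum_div_idx hp hα) i

lemma node_mem_body {K : TaggedSimplex d} (hK : AffineIndependent ℝ K.verts) {p : ℕ} (hp : 1 ≤ p)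
    {α : Fin (d + 1) → ℕ} (hα : α ∈ idx d p) : node K p α ∈ K.body := by
  rw [mem_body_iff hK]; intro i; rw [bc_node hK hp hα]; positivity

lemma node_injOn {K : TaggedSimplex d} (hK : AffineIndependent ℝ K.verts) {p : ℕ} (hp : 1 ≤ p)
    {α β : Fin (d + 1) → ℕ} (hα : α ∈ idx d p) (hβ : β ∈ idx d p)
    (h : node K p α = node K p β) : α = β := by
  ext i
  have := bc_node hK hp hα i
  rw [h, bc_node hK hp hβ] at this
  have hp0 : (p : ℝ) ≠ 0 := by positivity
  field_simp at this
  exact_mod_cast this.symm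

/-- Distinct multi-indices with equal sums satisfy `β i < α i` for some `i`, and then the factor
with `j = β i` vanishes. -/
lemma lag_node {p : ℕ} (hp : 1 ≤ p) {α β : Fin (d + 1) → ℕ} (hα : α ∈ idx d p) (hβ : β ∈ idx d p) :
    lag p α (fun i => (β i : ℝ) / p) = if α = β then 1 else 0 := by
  have hp0 : (p : ℝ) ≠ 0 := by positivity
  have e : ∀ i, (p : ℝ) * ((β i : ℝ) / p) = β i := fun i => by field_simp
  simp only [lag, e]
  split_ifs with h
  · subst h
    refine Finset.prod_eq_one fun i _ => Finset.prod_eq_one fun j hj => ?_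
    have : (j : ℝ) < α i := by exact_mod_cast Finset.mem_range.mp hj
    rw [inv_mul_cancel₀]; linarith
  · have : ∃ i, β i < α i := by
      by_contra hcon
      push Not at hcon
      rw [mem_idx] at hα hβ
      have := (Finset.sum_eq_sum_iff_of_le (fun i _ => hcon i)).mp (hα.trans hβ.symm)
      exact h (funext fun i => this i (Finset.mem_univ i))
    obtain ⟨i, hi⟩ := this
    refine Finset.prod_eq_zero (Finset.mem_univ i) (Finset.prod_eq_zero (Finset.mem_range.mpr hi) ?_)
    simp

lemma lag_eq_zero {p : ℕ} {α : Fin (d + 1) → ℕ} {l : Fin (d + 1) → ℝ} {i : Fin (d + 1)}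
    (hα : α i ≠ 0) (hl : l i = 0) : lag p α l = 0 := by
  refine Finset.prod_eq_zero (Finset.mem_univ i)
    (Finset.prod_eq_zero (Finset.mem_range.mpr (Nat.pos_of_ne_zero hα)) ?_)
  simp [hl]

lemma contDiff_lag (p : ℕ) (α : Fin (d + 1) → ℕ) : ContDiff ℝ ∞ (lag p α) := by
  unfold lag
  exact contDiff_prod fun i _ => contDiff_prod fun j _ =>
    contDiff_const.mul ((contDiff_const.mul (contDiff_apply ℝ ℝ i)).sub contDiff_const)

/-- Uniform bounds for the Lagrange basis functions on the unit cube. -/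
lemma exists_lag_bound (d p : ℕ) : ∃ B : ℝ, 0 < B ∧ ∀ α ∈ idx d p, ∀ l l' : Fin (d + 1) → ℝ,
    (∀ i, l i ∈ Icc (0:ℝ) 1) → (∀ i, l' i ∈ Icc (0:ℝ) 1) →
    |lag p α l| ≤ B ∧ |lag p α l - lag p α l'| ≤ B * ‖l - l'‖ := by
  have h : ∀ α : Fin (d + 1) → ℕ, ∃ B : ℝ, 0 ≤ B ∧ ∀ l l' : Fin (d + 1) → ℝ,
    (∀ i, l i ∈ Icc (0:ℝ) 1) → (∀ i, l' i ∈ Icc (0:ℝ) 1) →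
    |lag p α l| ≤ B ∧ |lag p α l - lag p α l'| ≤ B * ‖l - l'‖ := by
    intro α
    have hc : IsCompact (Set.pi univ fun _ : Fin (d + 1) => Icc (0:ℝ) 1) :=
      isCompact_univ_pi fun _ => isCompact_Icc
    obtain ⟨L, hL⟩ := (((contDiff_lag p α).of_le (by simp) :
      ContDiff ℝ 1 (lag p α)).locallyLipschitz.locallyLipschitzOn (s := _)
        ).exists_lipschitzOnWith_of_compact hc
    obtain ⟨M, hM⟩ := hc.exists_bound_of_continuousOn (contDiff_lag p α).continuous.continuousOn
    refine ⟨max M L, le_max_of_le_right L.2, fun l l' hl hl' => ⟨?_, ?_⟩⟩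
    · exact (hM l (fun i _ => hl i)).trans (le_max_left _ _)
    · have := hL.dist_le_mul l (fun i _ => hl i) l' (fun i _ => hl' i)
      rw [Real.dist_eq, dist_eq_norm] at this
      exact this.trans (mul_le_mul_of_nonneg_right (le_max_right _ _) (norm_nonneg _))
  choose B hB0 hB using h
  refine ⟨1 + ∑ α ∈ idx d p, B α, by
    have := Finset.sum_nonneg (s := idx d p) fun α _ => hB0 α; linarith, fun α hα l l' hl hl' => ?_⟩
  have hle : B α ≤ 1 + ∑ α ∈ idx d p, B α := by
    have := Finset.single_le_sum (fun α _ => hB0 α) hα; linarith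
  obtain ⟨h1, h2⟩ := hB α l l' hl hl'
  exact ⟨h1.trans hle, h2.trans (mul_le_mul_of_nonneg_right hle (norm_nonneg _))⟩

lemma exists_lagPoly (K : TaggedSimplex d) {p : ℕ} {α : Fin (d + 1) → ℕ} (hα : α ∈ idx d p) :
    ∃ q : MvPolynomial (Fin d) ℝ, q.totalDegree ≤ p ∧
      ∀ x, polyEval q x = lag p α (fun i => bc K i x) := by
  choose ℓ hℓd hℓ using fun i => exists_poly_affine (bc K i)
  refine ⟨∏ i, ∏ j ∈ Finset.range (α i), (MvPolynomial.C ((α i : ℝ) - j)⁻¹ *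
    (MvPolynomial.C (p : ℝ) * ℓ i - MvPolynomial.C (j : ℝ))), ?_, fun x => ?_⟩
  · refine (MvPolynomial.totalDegree_finsetProd _ _).trans ?_
    rw [mem_idx] at hα
    rw [← hα]
    refine Finset.sum_le_sum fun i _ => ?_
    refine (MvPolynomial.totalDegree_finsetProd _ _).trans ?_
    refine (Finset.sum_le_card_nsmul _ _ 1 fun j _ => ?_).trans (by simp)
    refine (MvPolynomial.totalDegree_mul _ _).trans ?_
    rw [MvPolynomial.totalDegree_C, zero_add]
    refine (MvPolynomial.totalDegree_sub _ _).trans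
      (max_le ?_ ((MvPolynomial.totalDegree_C _).le.trans zero_le_one))
    refine (MvPolynomial.totalDegree_mul _ _).trans ?_
    rw [MvPolynomial.totalDegree_C, zero_add]
    exact hℓd i
  · simp only [polyEval_prod, lag, hℓ, polyEval_mul, polyEval_sub, polyEval_C]

/-- Lagrange interpolation is exact on polynomials of degree at most `p`. -/
theorem lagrange_interpolation {K : TaggedSimplex d} (hK : AffineIndependent ℝ K.verts) {p : ℕ}
    (hp : 1 ≤ p) {q : MvPolynomial (Fin d) ℝ} (hq : q.totalDegree ≤ p) (x : E d) :
    polyEval q x = ∑ α ∈ idx d p, polyEval q (node K p α) * lag p α (fun i => bc K i x) := by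
  classical
  choose! L hLd hL using fun (α : Fin (d + 1) → ℕ) (hα : α ∈ idx d p) => exists_lagPoly K hα
  have hLn : ∀ α ∈ idx d p, ∀ β ∈ idx d p, polyEval (L α) (node K p β) = if α = β then 1 else 0 := by
    intro α hα β hβ
    rw [hL α hα]; simp_rw [bc_node hK hp hβ]; exact lag_node hp hα hβ
  set P := MvPolynomial.restrictTotalDegree (Fin d) ℝ p with hP
  let ev : P →ₗ[ℝ] (idx d p → ℝ) :=
    { toFun := fun q α => polyEval q.1 (node K p α)
      map_add' := fun a b => by ext α; simp
      map_smul' := fun c a => by ext α; simp [polyEval] }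
  have hmem : ∀ c : (Fin (d + 1) → ℕ) → ℝ, ∑ α ∈ idx d p, MvPolynomial.C (c α) * L α ∈ P := by
    intro c
    refine Submodule.sum_mem _ fun α hα => ?_
    rw [MvPolynomial.C_mul']
    exact P.smul_mem _ ((MvPolynomial.mem_restrictTotalDegree _ _ _).mpr (hLd α hα))
  have hevL : ∀ (c : (Fin (d + 1) → ℕ) → ℝ), ∀ β ∈ idx d p,
      polyEval (∑ α ∈ idx d p, MvPolynomial.C (c α) * L α) (node K p β) = c β := by
    intro c β hβ
    rw [polyEval_sum, Finset.sum_eq_single_of_mem β hβ]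
    · simp [hLn β hβ β hβ]
    · intro α hα hne
      simp [hLn α hα β hβ, hne]
  have hsurj : Function.Surjective ev := by
    intro c
    refine ⟨⟨_, hmem fun α => if h : α ∈ idx d p then c ⟨α, h⟩ else 0⟩, ?_⟩
    ext ⟨β, hβ⟩
    change polyEval _ (node K p β) = _
    rw [hevL _ β hβ, dif_pos hβ]
  set S : Set (Fin d →₀ ℕ) := {n | (n.sum fun _ e => e) ≤ p} with hS
  let b : Module.Basis S ℝ P := MvPolynomial.basisRestrictSupport ℝ S
  -- Monomials of degree at most `p` inject into the multi-indices by adding a slack entry. So the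
  -- polynomial space has at most as many dimensions as there are nodes, and evaluation at the
  -- nodes, being onto, is also injective.
  let g : S → idx d p := fun n => ⟨Fin.cons (p - ∑ j, n.1 j) n.1, by
    have h : ∑ j, n.1 j ≤ p := by
      have h2 : (n.1.sum fun _ e => e) ≤ p := n.2
      rwa [Finsupp.sum_fintype _ _ (fun _ => rfl)] at h2
    rw [mem_idx, Fin.sum_univ_succ]; simp only [Fin.cons_zero, Fin.cons_succ]; omega⟩
  have hg : Function.Injective g := by
    intro m n h
    have h1 : (Fin.cons (p - ∑ j, m.1 j) m.1 : Fin (d + 1) → ℕ) = Fin.cons (p - ∑ j, n.1 j) n.1 :=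
      congrArg (fun z : idx d p => z.1) h
    have h2 := (Fin.cons_injective2 (α := fun _ => ℕ) h1).2
    exact Subtype.ext (DFunLike.coe_injective h2)
  have hfin : Finite S := Finite.of_injective g hg
  have hfinP : FiniteDimensional ℝ P := Module.Finite.of_basis b
  have hle : Module.finrank ℝ P ≤ Module.finrank ℝ (idx d p → ℝ) := by
    rw [Module.finrank_eq_nat_card_basis b, Module.finrank_fintype_fun_eq_card,
      ← Nat.card_eq_fintype_card]
    exact Nat.card_le_card_of_injective g hg
  have hge : Module.finrank ℝ (idx d p → ℝ) ≤ Module.finrank ℝ P := by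
    have := ev.finrank_range_le
    rwa [LinearMap.range_eq_top.mpr hsurj, finrank_top] at this
  have hinj : Function.Injective ev :=
    (LinearMap.injective_iff_surjective_of_finrank_eq_finrank (le_antisymm hle hge)).mpr hsurj
  have hqP : q ∈ P := (MvPolynomial.mem_restrictTotalDegree _ _ _).mpr hq
  have heq : (⟨q, hqP⟩ : P) = ⟨_, hmem fun α => polyEval q (node K p α)⟩ := by
    apply hinj
    ext ⟨β, hβ⟩
    exact (hevL (fun α => polyEval q (node K p α)) β hβ).symm
  have := congrArg (fun z : P => polyEval z.1 x) heq
  simp only [polyEval_sum, polyEval_mul, polyEval_C] at this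
  rw [this]
  exact Finset.sum_congr rfl fun α hα => by rw [hL α hα]

end Poly

/-- Lagrange basis function of a simplex. -/
def lagf {d : ℕ} (K : TaggedSimplex d) (p : ℕ) (α : Fin (d + 1) → ℕ) (x : E d) : ℝ :=
  lag p α fun i => bc K i x

lemma continuous_lagf {d : ℕ} (K : TaggedSimplex d) (p : ℕ) (α : Fin (d + 1) → ℕ) :
    Continuous (lagf K p α) :=
  (contDiff_lag p α).continuous.comp (continuous_pi fun i => continuous_bc i)

lemma lagf_node {d : ℕ} {K : TaggedSimplex d} (hK : AffineIndependent ℝ K.verts) {p : ℕ}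
    (hp : 1 ≤ p) {α β : Fin (d + 1) → ℕ} (hα : α ∈ idx d p) (hβ : β ∈ idx d p) :
    lagf K p α (node K p β) = if α = β then 1 else 0 := by
  rw [lagf]; simp_rw [bc_node hK hp hβ]; exact lag_node hp hα hβ

lemma sq_integral_mul_le {α : Type*} [MeasurableSpace α] {μ : Measure α} {f g : α → ℝ}
    (hf : MemLp f 2 μ) (hg : MemLp g 2 μ) :
    (∫ x, f x * g x ∂μ) ^ 2 ≤ (∫ x, f x ^ 2 ∂μ) * ∫ x, g x ^ 2 ∂μ := by
  have h := integral_mul_norm_le_Lp_mul_Lq (μ := μ) Real.HolderConjugate.two_two (f := f) (g := g)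
    (by simpa using hf) (by simpa using hg)
  have h1 : |∫ x, f x * g x ∂μ| ≤ ∫ x, ‖f x‖ * ‖g x‖ ∂μ := by
    rw [← Real.norm_eq_abs]
    refine (norm_integral_le_integral_norm (fun x => f x * g x)).trans_eq ?_
    simp [norm_mul]
  have h2 := h1.trans h
  have e : ∀ u : α → ℝ, ∫ x, ‖u x‖ ^ (2:ℝ) ∂μ = ∫ x, u x ^ 2 ∂μ := fun u => by
    congr 1; ext x; rw [Real.rpow_two, Real.norm_eq_abs, sq_abs]
  rw [e, e, ← Real.sqrt_eq_rpow, ← Real.sqrt_eq_rpow] at h2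
  have hA : 0 ≤ ∫ x, f x ^ 2 ∂μ := integral_nonneg fun x => sq_nonneg _
  have hB : 0 ≤ ∫ x, g x ^ 2 ∂μ := integral_nonneg fun x => sq_nonneg _
  have h3 := pow_le_pow_left₀ (abs_nonneg _) h2 2
  rwa [sq_abs, mul_pow, Real.sq_sqrt hA, Real.sq_sqrt hB] at h3

/-! ### Elements and facets as carriers -/

/-- The carrier on `K`: the element itself or one of its facets. -/
def Carrier.on {d : ℕ} (K : TaggedSimplex d) : Option (Fin (d + 1)) → Carrier d
  | none => Carrier.elem K
  | some i => Carrier.facet K i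

/-- The codimension of a carrier. -/
def codim {d : ℕ} (o : Option (Fin (d + 1))) : ℕ := if o.isSome then 1 else 0

/-- The multi-indices of the nodes on a carrier. -/
def onIdx (d p : ℕ) (o : Option (Fin (d + 1))) : Finset (Fin (d + 1) → ℕ) :=
  (idx d p).filter fun α => ∀ i, o = some i → α i = 0

namespace Carrier

variable {d : ℕ} {Ω : Set (E d)} {K : TaggedSimplex d} {o : Option (Fin (d + 1))}

lemma set_on_subset : (on K o).set ⊆ K.body := by
  cases o with
  | none => exact subset_rfl
  | some i => exact K.facet_subset_body i

lemma ae_mem_set : ∀ᵐ x ∂(on K o).measure, x ∈ (on K o).set := by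
  cases o with
  | none => exact ae_restrict_mem K.body_closed.measurableSet
  | some i => exact ae_mem_facet K i

lemma isFiniteMeasure_on (hK : AffineIndependent ℝ K.verts) :
    IsFiniteMeasure (on K o).measure := by
  cases o with
  | none => exact ⟨by simpa [on, Carrier.measure] using K.body_compact.measure_lt_top⟩
  | some i => exact isFiniteMeasure_facetMeasure hK i

lemma memLp_on_of_continuous (hK : AffineIndependent ℝ K.verts) {φ : E d → ℝ}
    (hφ : Continuous φ) : MemLp φ 2 (on K o).measure := by
  cases o with
  | none => exact memLp_of_continuous_of_bounded K.body_bounded hφ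
  | some i => exact memLp_facet_of_continuous hK i hφ

lemma integrable_on_of_continuous (hK : AffineIndependent ℝ K.verts) {φ : E d → ℝ}
    (hφ : Continuous φ) : Integrable φ (on K o).measure := by
  have := isFiniteMeasure_on (o := o) hK
  exact (memLp_on_of_continuous hK hφ).integrable (by norm_num)

lemma eqOn_zero_of_integral_sq (hK : AffineIndependent ℝ K.verts) {φ : E d → ℝ}
    (hφ : Continuous φ) (h : ∫ x, φ x ^ 2 ∂(on K o).measure = 0) :
    ∀ x ∈ (on K o).set, φ x = 0 := by
  have h' : ∫⁻ x, ‖φ x‖ₑ ^ 2 ∂(on K o).measure = 0 := by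
    rw [lintegral_enorm_sq_eq (memLp_on_of_continuous hK hφ), h, ENNReal.ofReal_zero]
  cases o with
  | some i => exact eqOn_zero_of_ae_facetMeasure hK hφ h'
  | none =>
    rw [lintegral_eq_zero_iff (hφ.measurable.enorm.pow_const 2)] at h'
    have h2 : ∀ x ∈ interior K.body, φ x = 0 := by
      have h3 : φ =ᵐ[volume.restrict (interior K.body)] 0 := by
        filter_upwards [ae_mono (Measure.restrict_mono interior_subset le_rfl) h'] with x hx
        simpa using hx
      intro x hx
      exact Measure.eqOn_open_of_ae_eq h3 isOpen_interior hφ.continuousOn continuousOn_const hx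
    intro x hx
    have hcl : closure (interior K.body) = closure K.body :=
      K.body_convex.closure_interior_eq_closure_of_nonempty_interior (interior_body_nonempty hK)
    exact closure_minimal (fun v hv => h2 v hv) (isClosed_eq hφ continuous_const)
      (hcl ▸ subset_closure hx)

lemma measure_scaled {R : TaggedSimplex d} {a : E d} {s : ℝ} (h : IsScaled R K a s) :
    (on K o).measure
      = ENNReal.ofReal (s ^ (d - codim o)) • (on R o).measure.map (fun x => a + s • x) := by
  cases o with
  | some i => exact h.facetMeasure_eq i
  | none =>
    have hA := measurableEmbedding_affine a h.pos
    have hpre : (fun x : E d => a + s • x) ⁻¹' K.body = R.body := by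
      rw [h.body_eq, preimage_image_eq _ hA.injective]
    have hs := h.pos
    change volume.restrict K.body = ENNReal.ofReal (s ^ d) • (volume.restrict R.body).map _
    rw [← hpre, ← hA.restrict_map, map_volume_affine a h.pos, Measure.restrict_smul, smul_smul,
      ← ENNReal.ofReal_mul (by positivity), mul_inv_cancel₀ (by positivity)]
    simp

lemma integral_scaled {R : TaggedSimplex d} {a : E d} {s : ℝ} (h : IsScaled R K a s)
    (f : E d → ℝ) : ∫ x, f x ∂(on K o).measure
      = s ^ (d - codim o) * ∫ x, f (a + s • x) ∂(on R o).measure := by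
  have hs := h.pos
  rw [measure_scaled h, integral_smul_measure, (measurableEmbedding_affine a h.pos).integral_map,
    ENNReal.toReal_ofReal (by positivity), smul_eq_mul]

lemma node_mem_set_iff (hK : AffineIndependent ℝ K.verts) {p : ℕ} (hp : 1 ≤ p)
    {α : Fin (d + 1) → ℕ} (hα : α ∈ idx d p) : node K p α ∈ (on K o).set ↔ α ∈ onIdx d p o := by
  have hp0 : (p : ℝ) ≠ 0 := by positivity
  rw [onIdx, Finset.mem_filter, and_iff_right hα]
  cases o with
  | none =>
    change node K p α ∈ K.body ↔ _
    simpa using node_mem_body hK hp hα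
  | some i =>
    change node K p α ∈ K.facet i ↔ _
    rw [mem_facet_iff hK, and_iff_right (node_mem_body hK hp hα), bc_node hK hp hα]
    simp [hp0]

lemma lagf_eq_zero (hK : AffineIndependent ℝ K.verts) {p : ℕ} {α : Fin (d + 1) → ℕ}
    (hα : α ∈ idx d p) (hα' : α ∉ onIdx d p o) {x : E d} (hx : x ∈ (on K o).set) :
    lagf K p α x = 0 := by
  rw [onIdx, Finset.mem_filter, not_and] at hα'
  have := hα' hα
  push Not at this
  obtain ⟨i, rfl, hi⟩ := this
  exact lag_eq_zero hi ((mem_facet_iff hK).mp hx).2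

/-- Interpolation on a carrier only involves the nodes on the carrier. -/
lemma interpolation_on (hK : AffineIndependent ℝ K.verts) {p : ℕ} (hp : 1 ≤ p)
    {q : MvPolynomial (Fin d) ℝ} (hq : q.totalDegree ≤ p) {x : E d} (hx : x ∈ (on K o).set) :
    polyEval q x = ∑ α ∈ onIdx d p o, polyEval q (node K p α) * lagf K p α x := by
  rw [lagrange_interpolation hK hp hq]
  refine (Finset.sum_subset (Finset.filter_subset _ _) fun α hα hα' => ?_).symm
  change polyEval q (node K p α) * lagf K p α x = 0
  rw [lagf_eq_zero hK hα hα' hx, mul_zero]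

/-- The dual basis on a carrier. -/
lemma exists_dual_coeff (hK : AffineIndependent ℝ K.verts) (o : Option (Fin (d + 1))) {p : ℕ}
    (hp : 1 ≤ p) (α₀ : Fin (d + 1) → ℕ) :
    ∃ g : (Fin (d + 1) → ℕ) → ℝ, ∀ β ∈ onIdx d p o,
      ∫ x, (∑ α ∈ onIdx d p o, g α * lagf K p α x) * lagf K p β x ∂(on K o).measure
        = if β = α₀ then 1 else 0 := by
  classical
  set μ := (on K o).measure
  have hi : ∀ α β, Integrable (fun x => lagf K p α x * lagf K p β x) μ := fun α β =>
    integrable_on_of_continuous hK ((continuous_lagf K p α).mul (continuous_lagf K p β))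
  -- The Gram matrix of the Lagrange functions on the carrier. A kernel vector gives a combination
  -- with zero `L²` norm; it vanishes at all nodes of the carrier, so its coefficients are zero.
  let G : (onIdx d p o → ℝ) →ₗ[ℝ] (onIdx d p o → ℝ) :=
    Matrix.mulVecLin (Matrix.of fun β α => ∫ x, lagf K p α.1 x * lagf K p β.1 x ∂μ)
  have hG : ∀ c β, G c β = ∫ x, (∑ α, c α * lagf K p α.1 x) * lagf K p β.1 x ∂μ := by
    intro c β
    simp_rw [Finset.sum_mul, mul_assoc]
    rw [integral_finsetSum _ fun α _ => (hi α.1 β.1).const_mul _]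
    simp only [G, Matrix.mulVecLin_apply, Matrix.mulVec, dotProduct, Matrix.of_apply,
      integral_const_mul]
    exact Finset.sum_congr rfl fun α _ => mul_comm _ _
  have hinj : Function.Injective G := by
    rw [injective_iff_map_eq_zero]
    intro c hc
    set f : E d → ℝ := fun x => ∑ α, c α * lagf K p α.1 x with hf
    have hfc : Continuous f := continuous_finsetSum _ fun α _ =>
      continuous_const.mul (continuous_lagf K p α.1)
    have h0 : ∫ x, f x ^ 2 ∂μ = 0 := by
      have : ∀ x, f x ^ 2 = ∑ β, c β * (f x * lagf K p β.1 x) := by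
        intro x
        rw [sq]; nth_rewrite 2 [hf]
        rw [Finset.mul_sum]
        exact Finset.sum_congr rfl fun β _ => by ring
      simp_rw [this]
      rw [integral_finsetSum _ fun β _ => (integrable_on_of_continuous hK
        (hfc.mul (continuous_lagf K p β.1))).const_mul _]
      refine Finset.sum_eq_zero fun β _ => ?_
      rw [integral_const_mul, ← hG, hc]; simp
    have hz := eqOn_zero_of_integral_sq hK hfc h0
    ext β
    have hβ := Finset.mem_filter.mp β.2
    have := hz (node K p β.1) ((node_mem_set_iff hK hp hβ.1).mpr β.2)
    rw [hf] at this
    simp only at this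
    rw [Finset.sum_eq_single β] at this
    · rwa [lagf_node hK hp hβ.1 hβ.1, if_pos rfl, mul_one] at this
    · intro α _ hne
      rw [lagf_node hK hp (Finset.mem_filter.mp α.2).1 hβ.1, if_neg, mul_zero]
      exact fun h => hne (Subtype.ext h)
    · simp
  obtain ⟨c, hc⟩ := (LinearMap.injective_iff_surjective.mp hinj) fun β => if β.1 = α₀ then 1 else 0
  refine ⟨fun α => if h : α ∈ onIdx d p o then c ⟨α, h⟩ else 0, fun β hβ => ?_⟩
  have := congrFun hc ⟨β, hβ⟩
  rw [hG] at this
  rw [← this]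
  congr 1; ext x; congr 1
  rw [← Finset.sum_coe_sort]
  exact Finset.sum_congr rfl fun α _ => by simp only [dif_pos α.2]

end Carrier

lemma memLp_body {d : ℕ} {Ω : Set (E d)} {K : TaggedSimplex d} (hKΩ : interior K.body ⊆ Ω)
    (v : H1 Ω) : MemLp (fn v) 2 (volOn K.body) := by
  rw [K.volOn_body]; exact memLp_fn_of_subset hKΩ v

lemma memLp_grad_body {d : ℕ} {Ω : Set (E d)} {K : TaggedSimplex d} (hKΩ : interior K.body ⊆ Ω)
    (v : H1 Ω) (j : Fin d) : MemLp (grad v j) 2 (volOn K.body) := by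
  rw [K.volOn_body]; exact memLp_grad_of_subset hKΩ v j

namespace Carrier

variable {d : ℕ} {Ω : Set (E d)} {K : TaggedSimplex d} {o : Option (Fin (d + 1))}

lemma memLp_restrict (hK : AffineIndependent ℝ K.verts) (hKΩ : interior K.body ⊆ Ω) (v : H1 Ω) :
    MemLp ((on K o).restrict v) 2 (on K o).measure := by
  cases o with
  | none => exact memLp_body hKΩ v
  | some i => exact (isFacetTrace_facetTrace hK hKΩ v).1

lemma volOn_body_ac (hKΩ : interior K.body ⊆ Ω) : volOn K.body ≪ volOn Ω := by
  rw [K.volOn_body]; exact volOn_interior_ac hKΩ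

lemma restrict_add (hK : AffineIndependent ℝ K.verts) (hKΩ : interior K.body ⊆ Ω) (v w : H1 Ω) :
    (on K o).restrict (v + w) =ᵐ[(on K o).measure] (on K o).restrict v + (on K o).restrict w := by
  cases o with
  | none => exact (volOn_body_ac hKΩ).ae_le (fn_add v w)
  | some i =>
    have h := (isFacetTrace_facetTrace (i := i) hK hKΩ v).add hKΩ
      (isFacetTrace_facetTrace hK hKΩ w)
    exact (isFacetTrace_facetTrace hK hKΩ _).ae_eq hK hKΩ h

lemma restrict_smul (hK : AffineIndependent ℝ K.verts) (hKΩ : interior K.body ⊆ Ω) (c : ℝ)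
    (v : H1 Ω) :
    (on K o).restrict (c • v) =ᵐ[(on K o).measure] c • (on K o).restrict v := by
  cases o with
  | none => exact (volOn_body_ac hKΩ).ae_le (fn_smul c v)
  | some i =>
    have h := (isFacetTrace_facetTrace (i := i) hK hKΩ v).smul hKΩ c
    exact (isFacetTrace_facetTrace hK hKΩ _).ae_eq hK hKΩ h

lemma restrict_smooth (hK : AffineIndependent ℝ K.verts) (hKΩ : interior K.body ⊆ Ω) {v : H1 Ω}
    {φ : E d → ℝ} (hφ : ContDiff ℝ ∞ φ) (h0 : fn v =ᵐ[volOn (interior K.body)] φ)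
    (h1 : ∀ j, grad v j =ᵐ[volOn (interior K.body)] partialDeriv j φ) :
    (on K o).restrict v =ᵐ[(on K o).measure] φ := by
  cases o with
  | none =>
    change fn v =ᵐ[volOn K.body] φ
    rwa [K.volOn_body]
  | some i => exact (isFacetTrace_facetTrace hK hKΩ _).ae_eq hK hKΩ (isFacetTrace_of_smooth hK hφ h0 h1)

/-- The scaled trace inequality in `H¹`. -/
lemma exists_restrict_bound (R : TaggedSimplex d) (hR : AffineIndependent ℝ R.verts)
    (o : Option (Fin (d + 1))) :
    ∃ C : ℝ, 0 ≤ C ∧ ∀ (K : TaggedSimplex d) (a : E d) (s : ℝ), IsScaled R K a s →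
      interior K.body ⊆ Ω → ∀ v : H1 Ω, ∫ x, (on K o).restrict v x ^ 2 ∂(on K o).measure
        ≤ C * (s ^ codim o)⁻¹ * ((∫ x in K.body, fn v x ^ 2) + s ^ 2 * energy K.body v) := by
  cases o with
  | none =>
    refine ⟨1, zero_le_one, fun K a s h hKΩ v => ?_⟩
    have : 0 ≤ s ^ 2 * energy K.body v := mul_nonneg (sq_nonneg _) (energy_nonneg _ _)
    simp only [codim, Option.isSome_none, Bool.false_eq_true, ↓reduceIte, pow_zero, inv_one,
      mul_one, one_mul]
    exact le_add_of_nonneg_right this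
  | some i =>
    obtain ⟨c, hc⟩ := exists_traceBound R hR i
    -- The factor `2` comes from the square of a sum of two terms and `d` from Cauchy-Schwarz over
    -- the components of the gradient.
    refine ⟨2 * (c : ℝ) ^ 2 * (d + 1), by positivity, fun K a s h hKΩ v => ?_⟩
    have hs := h.pos
    have hK := h.affineIndependent hR
    have htr := isFacetTrace_facetTrace (i := i) hK hKΩ v
    have hb := (hc K a s h).le_of_isFacetTrace hKΩ htr
    rw [← K.volOn_body] at hb
    have hv := memLp_body hKΩ v
    have hg := memLp_grad_body hKΩ v
    set A := ∫ x in K.body, fn v x ^ 2 with hA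
    set B : Fin d → ℝ := fun j => ∫ x in K.body, grad v j x ^ 2 with hB
    have hA0 : 0 ≤ A := integral_nonneg fun _ => sq_nonneg _
    have hB0 : ∀ j, 0 ≤ B j := fun j => integral_nonneg fun _ => sq_nonneg _
    have hA1 : eLpNorm (fn v) 2 (volOn K.body) ≤ ENNReal.ofReal √A :=
      eLpNorm_le_of_integral_sq_le hv (Real.sqrt_nonneg _) (Real.sq_sqrt hA0).ge
    have hB1 : ∀ j, eLpNorm (grad v j) 2 (volOn K.body) ≤ ENNReal.ofReal √(B j) := fun j =>
      eLpNorm_le_of_integral_sq_le (hg j) (Real.sqrt_nonneg _) (Real.sq_sqrt (hB0 j)).ge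
    have hle : eLpNorm (facetTrace K i v) 2 (facetMeasure K i)
        ≤ ENNReal.ofReal (c * ((√s)⁻¹ * √A + √s * ∑ j, √(B j))) := by
      have hsum : 0 ≤ ∑ j, √(B j) := Finset.sum_nonneg fun j _ => Real.sqrt_nonneg _
      rw [ENNReal.ofReal_mul (by positivity), ENNReal.ofReal_add (by positivity) (by positivity),
        ENNReal.ofReal_mul (by positivity), ENNReal.ofReal_mul (by positivity),
        ENNReal.ofReal_sum_of_nonneg fun j _ => Real.sqrt_nonneg _, ENNReal.ofReal_coe_nnreal]
      refine hb.trans (mul_le_mul_right (add_le_add (mul_le_mul_right hA1 _)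
        (mul_le_mul_right (Finset.sum_le_sum fun j _ => hB1 j) _)) _)
    have hsum : 0 ≤ ∑ j, √(B j) := Finset.sum_nonneg fun j _ => Real.sqrt_nonneg _
    have hfin := integral_sq_le_of_eLpNorm_le htr.1 (by positivity) hle
    refine hfin.trans ?_
    have hS : (∑ j, √(B j)) ^ 2 ≤ d * ∑ j, B j := by
      have := sq_sum_le_card_mul_sum_sq (s := Finset.univ) (f := fun j => √(B j))
      simpa [Real.sq_sqrt (hB0 _)] using this
    have hE : energy K.body v = ∑ j, B j := rfl
    rw [hE]
    have hBs : 0 ≤ ∑ j, B j := Finset.sum_nonneg fun j _ => hB0 j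
    simp only [codim, Option.isSome_some, ↓reduceIte, pow_one]
    have e1 : ((√s)⁻¹ * √A) ^ 2 = s⁻¹ * A := by
      rw [mul_pow, inv_pow, Real.sq_sqrt hs.le, Real.sq_sqrt hA0]
    have e2 : (√s * ∑ j, √(B j)) ^ 2 ≤ s * (d * ∑ j, B j) := by
      rw [mul_pow, Real.sq_sqrt hs.le]; gcongr
    have e3 : s⁻¹ * (A + s ^ 2 * ∑ j, B j) = s⁻¹ * A + s * ∑ j, B j := by field_simp
    have e4 : ((√s)⁻¹ * √A + √s * ∑ j, √(B j)) ^ 2 ≤ 2 * (s⁻¹ * A + s * (d * ∑ j, B j)) := by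
      nlinarith [sq_nonneg ((√s)⁻¹ * √A - √s * ∑ j, √(B j))]
    have hsA : 0 ≤ s⁻¹ * A := by positivity
    have hsB : 0 ≤ s * ∑ j, B j := by positivity
    calc (c * ((√s)⁻¹ * √A + √s * ∑ j, √(B j))) ^ 2
        = (c : ℝ) ^ 2 * ((√s)⁻¹ * √A + √s * ∑ j, √(B j)) ^ 2 := by rw [mul_pow]
      _ ≤ (c : ℝ) ^ 2 * (2 * (s⁻¹ * A + s * (d * ∑ j, B j))) := by gcongr
      _ ≤ (c : ℝ) ^ 2 * (2 * ((d + 1) * (s⁻¹ * A + s * ∑ j, B j))) := by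
          gcongr
          have : (0:ℝ) ≤ d := Nat.cast_nonneg d
          nlinarith
      _ = _ := by rw [mul_assoc _ s⁻¹, e3]; ring

end Carrier

/-! ### Splines on a regular triangulation -/

section Mesh

variable {d : ℕ} {Ω : Set (E d)} {T : Mesh d} {p : ℕ}

/-- Conformity puts a shared point into the face spanned by the shared vertices, where the
coordinates of all other vertices vanish. -/
lemma IsRegularTriangulation.mem_common {T : Mesh d} (hT : IsRegularTriangulation Ω T)
    {K K' : TaggedSimplex d} (hK : K ∈ T) (hK' : K' ∈ T) {x : E d} (hx : x ∈ K.body)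
    (hx' : x ∈ K'.body) (i : Fin (d + 1)) (hi : bc K i x ≠ 0) : K.verts i ∈ range K'.verts := by
  have h : x ∈ K.body ∩ K'.body := ⟨hx, hx'⟩
  rw [hT.conforming K hK K' hK'] at h
  have e : range K.verts ∩ range K'.verts = K.verts '' {i | K.verts i ∈ range K'.verts} := by
    ext y; constructor
    · rintro ⟨⟨i, rfl⟩, h⟩; exact ⟨i, h, rfl⟩
    · rintro ⟨i, h, rfl⟩; exact ⟨⟨i, rfl⟩, h⟩
  rw [e, mem_convexHull_image_iff (hT.nondegenerate K hK)] at h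
  by_contra hcon
  exact hi (h.2 i hcon)

/-- A node in `K` may come from another element. Its multi-index is then supported on vertices
shared with `K`, so it can be rewritten with the numbering of `K`. -/
lemma IsRegularTriangulation.exists_node (hT : IsRegularTriangulation Ω T) (hp : 1 ≤ p)
    {K : TaggedSimplex d} (hK : K ∈ T) {y : E d} (hy : y ∈ nodes T p) (hyK : y ∈ K.body) :
    ∃ α ∈ idx d p, y = node K p α := by
  classical
  obtain ⟨K', hK', α', hα', rfl⟩ := hy
  have hαi : α' ∈ idx d p := mem_idx.mpr hα'
  have hn := hT.nondegenerate K' hK'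
  change node K' p α' ∈ K.body at hyK
  have hcom : ∀ i, α' i ≠ 0 → K'.verts i ∈ range K.verts := fun i hi => by
    refine hT.mem_common hK' hK (node_mem_body hn hp hαi) hyK i ?_
    rw [bc_node hn hp hαi]
    have : (p : ℝ) ≠ 0 := by positivity
    positivity
  have hinj := (hT.nondegenerate K hK).injective
  have hone : ∀ i, α' i ≠ 0 → ∃ k, K.verts k = K'.verts i ∧
      ∀ k', K'.verts i = K.verts k' ↔ k' = k := fun i hi => by
    obtain ⟨k, hk⟩ := hcom i hi
    exact ⟨k, hk, fun k' => ⟨fun h => hinj (h.symm.trans hk.symm), fun h => h ▸ hk.symm⟩⟩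
  -- For each `i` with `α' i ≠ 0` exactly one `k` matches, by injectivity of the vertices of `K`;
  -- the other `i` contribute nothing.
  refine ⟨fun k => ∑ i, if K'.verts i = K.verts k then α' i else 0, ?_, ?_⟩
  · rw [mem_idx, Finset.sum_comm, ← hα']
    refine Finset.sum_congr rfl fun i _ => ?_
    by_cases hi : α' i = 0
    · simp [hi]
    · obtain ⟨k, hk, hk'⟩ := hone i hi
      simp [hk']
  · rw [node]
    push_cast
    simp_rw [Finset.sum_div, Finset.sum_smul]
    rw [Finset.sum_comm]
    refine Finset.sum_congr rfl fun i _ => ?_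
    by_cases hi : α' i = 0
    · simp [hi]
    · obtain ⟨k, hk, hk'⟩ := hone i hi
      rw [Finset.sum_eq_single k]
      · rw [if_pos ((hk' k).mpr rfl), hk]
      · intro k₂ _ hne
        rw [if_neg (fun h => hne ((hk' k₂).mp h))]; simp
      · simp

lemma node_mem_nodes {K : TaggedSimplex d} (hK : K ∈ T) {α : Fin (d + 1) → ℕ} (hα : α ∈ idx d p) :
    node K p α ∈ nodes T p := ⟨K, hK, α, mem_idx.mp hα, rfl⟩

lemma IsRegularTriangulation.finite_nodes (hT : IsRegularTriangulation Ω T) :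
    (nodes T p).Finite := by
  refine (hT.finite.biUnion fun K _ => ((idx d p).finite_toSet.image (node K p))).subset ?_
  rintro z ⟨K, hK, α, hα, rfl⟩
  exact mem_biUnion hK ⟨α, mem_idx.mpr hα, rfl⟩

/-- Two polynomials agree on the intersection of two elements if they agree at the common nodes. -/
lemma IsRegularTriangulation.polyEval_eq (hT : IsRegularTriangulation Ω T) (hp : 1 ≤ p)
    {K K' : TaggedSimplex d} (hK : K ∈ T) (hK' : K' ∈ T) {q q' : MvPolynomial (Fin d) ℝ}
    (hq : q.totalDegree ≤ p) (hq' : q'.totalDegree ≤ p)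
    (h : ∀ z ∈ nodes T p, z ∈ K.body → z ∈ K'.body → polyEval q z = polyEval q' z) {x : E d}
    (hx : x ∈ K.body) (hx' : x ∈ K'.body) : polyEval q x = polyEval q' x := by
  have hn := hT.nondegenerate K hK
  rw [lagrange_interpolation hn hp hq, lagrange_interpolation hn hp hq']
  refine Finset.sum_congr rfl fun α hα => ?_
  -- At a shared point only those Lagrange functions survive whose multi-index is supported on
  -- shared vertices, and their nodes belong to both elements.
  by_cases h0 : lag p α (fun i => bc K i x) = 0
  · rw [h0, mul_zero, mul_zero]
  · congr 1
    refine h _ (node_mem_nodes hK hα) (node_mem_body hn hp hα) ?_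
    have : ∀ i, α i ≠ 0 → K.verts i ∈ range K'.verts := fun i hi =>
      hT.mem_common hK hK' hx hx' i fun hb => h0 (lag_eq_zero hi hb)
    have hm : node K p α ∈ convexHull ℝ (K.verts '' {i | K.verts i ∈ range K'.verts}) := by
      rw [mem_convexHull_image_iff hn]
      refine ⟨node_mem_body hn hp hα, fun i hi => ?_⟩
      rw [bc_node hn hp hα]
      have : α i = 0 := by
        by_contra hc; exact hi (this i hc)
      simp [this]
    refine convexHull_mono ?_ hm
    rintro _ ⟨i, hi, rfl⟩; exact hi

/-- Spline interpolation of prescribed nodal values. -/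
lemma IsRegularTriangulation.exists_spline (hT : IsRegularTriangulation Ω T) (hp : 1 ≤ p)
    (c : E d → ℝ) : ∃ V ∈ splineSpace Ω T p, ∀ y ∈ nodes T p, V y = c y := by
  classical
  have hq : ∀ K, ∃ q : MvPolynomial (Fin d) ℝ, K ∈ T → (q.totalDegree ≤ p ∧
      ∀ α ∈ idx d p, polyEval q (node K p α) = c (node K p α)) := by
    intro K
    by_cases hK : K ∈ T
    · choose! L hLd hL using fun (α : Fin (d + 1) → ℕ) (hα : α ∈ idx d p) => exists_lagPoly K hα
      refine ⟨∑ α ∈ idx d p, MvPolynomial.C (c (node K p α)) * L α, fun _ => ⟨?_, fun β hβ => ?_⟩⟩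
      · refine (MvPolynomial.totalDegree_finsetSum _ _).trans (Finset.sup_le fun α hα => ?_)
        refine (MvPolynomial.totalDegree_mul _ _).trans ?_
        rw [MvPolynomial.totalDegree_C, zero_add]
        exact hLd α hα
      · rw [polyEval_sum, Finset.sum_eq_single_of_mem β hβ]
        · rw [polyEval_mul, polyEval_C, hL β hβ]
          have := lagf_node (hT.nondegenerate K hK) hp hβ hβ
          rw [lagf] at this
          rw [this]; simp
        · intro α hα hne
          rw [polyEval_mul, polyEval_C, hL α hα]
          have := lagf_node (hT.nondegenerate K hK) hp hα hβ
          rw [lagf] at this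
          rw [this, if_neg hne, mul_zero]
    · exact ⟨0, fun h => absurd h hK⟩
  choose q hq using hq
  have hag : ∀ K ∈ T, ∀ K' ∈ T, ∀ x ∈ K.body, x ∈ K'.body →
      polyEval (q K) x = polyEval (q K') x := by
    intro K hK K' hK' x hx hx'
    refine hT.polyEval_eq hp hK hK' (hq K hK).1 (hq K' hK').1 (fun z hz hzK hzK' => ?_) hx hx'
    obtain ⟨α, hα, rfl⟩ := hT.exists_node hp hK hz hzK
    obtain ⟨β, hβ, hzβ⟩ := hT.exists_node hp hK' hz hzK'
    rw [(hq K hK).2 α hα]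
    rw [hzβ, (hq K' hK').2 β hβ]
  let V : E d → ℝ := fun x => if h : ∃ K ∈ T, x ∈ K.body then polyEval (q h.choose) x else 0
  have hV : ∀ K ∈ T, ∀ x ∈ K.body, V x = polyEval (q K) x := by
    intro K hK x hx
    have h : ∃ K ∈ T, x ∈ K.body := ⟨K, hK, hx⟩
    simp only [V]
    rw [dif_pos h]
    exact hag _ h.choose_spec.1 _ hK _ h.choose_spec.2 hx
  refine ⟨V, ⟨?_, fun K hK => ⟨q K, (hq K hK).1, hV K hK⟩⟩, ?_⟩
  · rw [← hT.cover, biUnion_eq_iUnion]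
    have : Finite T := hT.finite
    refine (locallyFinite_of_finite _).continuousOn_iUnion (fun K => K.1.body_closed) fun K => ?_
    exact (contDiff_polyEval (q K.1)).continuous.continuousOn.congr (hV K.1 K.2)
  · rintro y ⟨K, hK, α, hα, rfl⟩
    have hα' := mem_idx.mpr hα
    change V (node K p α) = c (node K p α)
    rw [hV K hK _ (node_mem_body (hT.nondegenerate K hK) hp hα'), (hq K hK).2 α hα']

lemma IsRegularTriangulation.spline_expansion (hT : IsRegularTriangulation Ω T) (hp : 1 ≤ p)
    {V : E d → ℝ} (hV : V ∈ splineSpace Ω T p) {K : TaggedSimplex d} (hK : K ∈ T) {x : E d}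
    (hx : x ∈ K.body) : V x = ∑ α ∈ idx d p, V (node K p α) * lagf K p α x := by
  obtain ⟨q, hq, hVq⟩ := hV.2 K hK
  have hn := hT.nondegenerate K hK
  rw [hVq x hx, lagrange_interpolation hn hp hq]
  exact Finset.sum_congr rfl fun α hα => by rw [hVq _ (node_mem_body hn hp hα)]; rfl

open Classical in
lemma IsRegularTriangulation.nodalBasis_spec (hT : IsRegularTriangulation Ω T) (hp : 1 ≤ p)
    (z : E d) : nodalBasis Ω T p z ∈ splineSpace Ω T p ∧
      ∀ y ∈ nodes T p, nodalBasis Ω T p z y = if y = z then 1 else 0 := by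
  have h := hT.exists_spline hp (fun y => if y = z then 1 else 0)
  rw [nodalBasis, dif_pos h]
  exact h.choose_spec

lemma IsRegularTriangulation.nodalBasis_node (hT : IsRegularTriangulation Ω T) (hp : 1 ≤ p)
    {K : TaggedSimplex d} (hK : K ∈ T) {α : Fin (d + 1) → ℕ} (hα : α ∈ idx d p) {x : E d}
    (hx : x ∈ K.body) : nodalBasis Ω T p (node K p α) x = lagf K p α x := by
  classical
  obtain ⟨h1, h2⟩ := hT.nodalBasis_spec hp (node K p α)
  have hn := hT.nondegenerate K hK
  rw [hT.spline_expansion hp h1 hK hx, Finset.sum_eq_single_of_mem α hα]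
  · rw [h2 _ (node_mem_nodes hK hα), if_pos rfl, one_mul]
  · intro β hβ hne
    rw [h2 _ (node_mem_nodes hK hβ), if_neg (fun h => hne (node_injOn hn hp hβ hα h)), zero_mul]

/-- The basis function of a node that is not a node of `K` vanishes at all nodes of `K`, hence on
`K`. This reduces the global sum to a sum over the multi-indices of one element. -/
lemma IsRegularTriangulation.finsum_nodalBasis (hT : IsRegularTriangulation Ω T) (hp : 1 ≤ p)
    (c : E d → ℝ) {K : TaggedSimplex d} (hK : K ∈ T) {x : E d} (hx : x ∈ K.body) :
    ∑ᶠ z ∈ nodes T p, c z * nodalBasis Ω T p z x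
      = ∑ α ∈ idx d p, c (node K p α) * lagf K p α x := by
  classical
  have hn := hT.nondegenerate K hK
  rw [finsum_mem_eq_finite_toFinset_sum _ hT.finite_nodes]
  have hsub : (idx d p).image (node K p) ⊆ (hT.finite_nodes (p := p)).toFinset := by
    intro z hz
    obtain ⟨α, hα, rfl⟩ := Finset.mem_image.mp hz
    simpa using node_mem_nodes hK hα
  rw [← Finset.sum_subset hsub, Finset.sum_image fun α hα β hβ h => node_injOn hn hp hα hβ h]
  · exact Finset.sum_congr rfl fun α hα => by rw [hT.nodalBasis_node hp hK hα hx]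
  · intro z hz hz'
    rw [(hT.finite_nodes).mem_toFinset] at hz
    obtain ⟨h1, h2⟩ := hT.nodalBasis_spec hp z
    rw [hT.spline_expansion hp h1 hK hx, Finset.sum_eq_zero, mul_zero]
    intro α hα
    rw [h2 _ (node_mem_nodes hK hα), if_neg, zero_mul]
    rintro rfl
    exact hz' (Finset.mem_image_of_mem _ hα)

/-! ### The dual functions -/

lemma IsRegularTriangulation.exists_isDualFunction (hT : IsRegularTriangulation Ω T) (hp : 1 ≤ p)
    {K : TaggedSimplex d} (hK : K ∈ T) (o : Option (Fin (d + 1))) {z : E d}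
    (hz : z ∈ nodes T p) (hzK : z ∈ K.body) :
    ∃ q, IsDualFunction Ω T p (Carrier.on K o) z q := by
  classical
  have hn := hT.nondegenerate K hK
  obtain ⟨α₀, hα₀, rfl⟩ := hT.exists_node hp hK hz hzK
  obtain ⟨g, hg⟩ := Carrier.exists_dual_coeff hn o hp α₀
  choose! L hLd hL using fun (α : Fin (d + 1) → ℕ) (hα : α ∈ idx d p) => exists_lagPoly K hα
  have hon : ∀ α ∈ onIdx d p o, α ∈ idx d p := fun α hα => (Finset.mem_filter.mp hα).1
  refine ⟨∑ α ∈ onIdx d p o, MvPolynomial.C (g α) * L α, ?_, ?_⟩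
  · refine (MvPolynomial.totalDegree_finsetSum _ _).trans (Finset.sup_le fun α hα => ?_)
    refine (MvPolynomial.totalDegree_mul _ _).trans ?_
    rw [MvPolynomial.totalDegree_C, zero_add]
    exact hLd α (hon α hα)
  · rintro y ⟨hy, hyσ⟩
    obtain ⟨β, hβ, rfl⟩ := hT.exists_node hp hK hy (Carrier.set_on_subset hyσ)
    have hβ' := (Carrier.node_mem_set_iff hn hp hβ).mp hyσ
    have h1 := hg β hβ'
    have h2 : (node K p β = node K p α₀) ↔ β = α₀ :=
      ⟨node_injOn hn hp hβ hα₀, fun h => by rw [h]⟩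
    simp only [h2]
    rw [← h1]
    refine integral_congr_ae ?_
    filter_upwards [Carrier.ae_mem_set] with x hx
    rw [hT.nodalBasis_node hp hK hβ (Carrier.set_on_subset hx), polyEval_sum]
    congr 1
    exact Finset.sum_congr rfl fun α hα => by
      rw [polyEval_mul, polyEval_C, hL α (hon α hα)]; rfl

/-- The coefficient of the Scott-Zhang interpolant at a node. -/
def szCoeff {d : ℕ} {Ω : Set (E d)} (T : Mesh d) (p : ℕ) (σ : E d → Carrier d) (v : H1 Ω)
    (z : E d) : ℝ :=
  ∫ y, polyEval (dualFunction Ω T p (σ z) z) y * (σ z).restrict v y ∂(σ z).measure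

lemma IsRegularTriangulation.dualFunction_spec (hT : IsRegularTriangulation Ω T) (hp : 1 ≤ p)
    {K : TaggedSimplex d} (hK : K ∈ T) (o : Option (Fin (d + 1))) {z : E d}
    (hz : z ∈ nodes T p) (hzK : z ∈ K.body) :
    IsDualFunction Ω T p (Carrier.on K o) z (dualFunction Ω T p (Carrier.on K o) z) := by
  have h := hT.exists_isDualFunction hp hK o hz hzK
  rw [dualFunction, dif_pos h]
  exact h.choose_spec

open Classical in
lemma IsRegularTriangulation.integral_dual_lagf (hT : IsRegularTriangulation Ω T) (hp : 1 ≤ p)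
    {K : TaggedSimplex d} (hK : K ∈ T) {o : Option (Fin (d + 1))} {α₀ : Fin (d + 1) → ℕ}
    (hα₀ : α₀ ∈ idx d p) {q : MvPolynomial (Fin d) ℝ}
    (hq : IsDualFunction Ω T p (Carrier.on K o) (node K p α₀) q) {β : Fin (d + 1) → ℕ}
    (hβ : β ∈ onIdx d p o) :
    ∫ x, polyEval q x * lagf K p β x ∂(Carrier.on K o).measure = if β = α₀ then 1 else 0 := by
  have hn := hT.nondegenerate K hK
  have hβ' := (Finset.mem_filter.mp hβ).1
  have h := hq.2 (node K p β) ⟨node_mem_nodes hK hβ', (Carrier.node_mem_set_iff hn hp hβ').mpr hβ⟩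
  have h2 : (node K p β = node K p α₀) ↔ β = α₀ :=
    ⟨node_injOn hn hp hβ' hα₀, fun h => by rw [h]⟩
  simp only [h2] at h
  rw [← h]
  refine integral_congr_ae ?_
  filter_upwards [Carrier.ae_mem_set] with x hx
  rw [hT.nodalBasis_node hp hK hβ' (Carrier.set_on_subset hx)]

/-- Pairing a polynomial with the dual function of a node evaluates it at the node. -/
lemma IsRegularTriangulation.integral_dual_poly (hT : IsRegularTriangulation Ω T) (hp : 1 ≤ p)
    {K : TaggedSimplex d} (hK : K ∈ T) {o : Option (Fin (d + 1))} {α₀ : Fin (d + 1) → ℕ}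
    (hα₀ : α₀ ∈ onIdx d p o) {q r : MvPolynomial (Fin d) ℝ}
    (hq : IsDualFunction Ω T p (Carrier.on K o) (node K p α₀) q) (hr : r.totalDegree ≤ p) :
    ∫ x, polyEval q x * polyEval r x ∂(Carrier.on K o).measure = polyEval r (node K p α₀) := by
  classical
  have hn := hT.nondegenerate K hK
  have hα₀' := (Finset.mem_filter.mp hα₀).1
  have h1 : ∫ x, polyEval q x * polyEval r x ∂(Carrier.on K o).measure
      = ∫ x, ∑ α ∈ onIdx d p o, polyEval r (node K p α) * (polyEval q x * lagf K p α x)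
        ∂(Carrier.on K o).measure := by
    refine integral_congr_ae ?_
    filter_upwards [Carrier.ae_mem_set] with x hx
    rw [Carrier.interpolation_on hn hp hr hx, Finset.mul_sum]
    exact Finset.sum_congr rfl fun α _ => by ring
  have hi : ∀ α, Integrable (fun x => polyEval q x * lagf K p α x) (Carrier.on K o).measure :=
    fun α => Carrier.integrable_on_of_continuous hn
      ((contDiff_polyEval q).continuous.mul (continuous_lagf K p α))
  rw [h1, integral_finsetSum _ fun α _ => (hi α).const_mul _,
    Finset.sum_eq_single_of_mem α₀ hα₀]
  · rw [integral_const_mul, hT.integral_dual_lagf hp hK hα₀' hq hα₀]; simp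
  · intro β hβ hne
    rw [integral_const_mul, hT.integral_dual_lagf hp hK hα₀' hq hβ, if_neg hne, mul_zero]

/-- The size of the dual functions under scaling. -/
lemma exists_dual_bound (R : TaggedSimplex d) (hR : AffineIndependent ℝ R.verts)
    (o : Option (Fin (d + 1))) (hp : 1 ≤ p) :
    ∃ C : ℝ, 0 ≤ C ∧ ∀ (T : Mesh d), IsRegularTriangulation Ω T → ∀ K ∈ T, ∀ (a : E d) (s : ℝ),
      IsScaled R K a s → ∀ α₀ ∈ onIdx d p o, ∀ q,
      IsDualFunction Ω T p (Carrier.on K o) (node K p α₀) q →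
      ∫ x, polyEval q x ^ 2 ∂(Carrier.on K o).measure ≤ C * (s ^ (d - codim o))⁻¹ := by
  classical
  choose g hg using fun α₀ => Carrier.exists_dual_coeff (p := p) hR o hp α₀
  set f : (Fin (d + 1) → ℕ) → E d → ℝ := fun α₀ x => ∑ α ∈ onIdx d p o, g α₀ α * lagf R p α x with hf
  have hfc : ∀ α₀, Continuous (f α₀) := fun α₀ => continuous_finsetSum _ fun α _ =>
    continuous_const.mul (continuous_lagf R p α)
  set μ := (Carrier.on R o).measure
  have hnn : ∀ α₀, 0 ≤ ∫ x, f α₀ x ^ 2 ∂μ := fun α₀ => integral_nonneg fun _ => sq_nonneg _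
  refine ⟨∑ α₀ ∈ onIdx d p o, ∫ x, f α₀ x ^ 2 ∂μ, Finset.sum_nonneg fun α₀ _ => hnn α₀, ?_⟩
  intro T hT K hK a s h α₀ hα₀ q hq
  have hs := h.pos
  have hn := hT.nondegenerate K hK
  set I := ∫ x, polyEval q x ^ 2 ∂(Carrier.on K o).measure with hI
  have hI0 : 0 ≤ I := integral_nonneg fun _ => sq_nonneg _
  -- Pairing the dual function with itself evaluates it at its own node. The same value is the
  -- pairing of the pulled-back polynomial `u` with the fixed dual function `f α₀` of the reference
  -- carrier; Cauchy-Schwarz then bounds `I ^ 2` by a multiple of `I`.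
  have h1 : I = polyEval q (node K p α₀) := by
    rw [← hT.integral_dual_poly hp hK hα₀ hq hq.1, hI]
    congr 1; ext x; ring
  set u : E d → ℝ := fun x => polyEval q (a + s • x) with hu
  have huc : Continuous u := (contDiff_polyEval q).continuous.comp (by fun_prop)
  have h2 : I = s ^ (d - codim o) * ∫ x, u x ^ 2 ∂μ :=
    Carrier.integral_scaled h (fun x => polyEval q x ^ 2)
  have h3 : polyEval q (node K p α₀) = ∫ x, u x * f α₀ x ∂μ := by
    have hux : ∀ x ∈ (Carrier.on R o).set, u x
        = ∑ β ∈ onIdx d p o, polyEval q (node K p β) * lagf R p β x := by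
      intro x hx
      have hx' : a + s • x ∈ (Carrier.on K o).set := by
        cases o with
        | none => change _ ∈ K.body; rw [h.body_eq]; exact ⟨x, hx, rfl⟩
        | some i => change _ ∈ K.facet i; rw [h.facet_eq]; exact ⟨x, hx, rfl⟩
      rw [hu]
      simp only
      rw [Carrier.interpolation_on hn hp hq.1 hx']
      refine Finset.sum_congr rfl fun β _ => ?_
      simp only [lagf, bc_scaled h hR]
    have h4 : ∫ x, u x * f α₀ x ∂μ = ∫ x, ∑ β ∈ onIdx d p o,
        polyEval q (node K p β) * (f α₀ x * lagf R p β x) ∂μ := by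
      refine integral_congr_ae ?_
      filter_upwards [Carrier.ae_mem_set] with x hx
      rw [hux x hx, Finset.sum_mul]
      exact Finset.sum_congr rfl fun β _ => by ring
    have hi : ∀ β, Integrable (fun x => f α₀ x * lagf R p β x) μ :=
      fun β => Carrier.integrable_on_of_continuous hR ((hfc α₀).mul (continuous_lagf R p β))
    rw [h4, integral_finsetSum _ fun β _ => (hi β).const_mul _, Finset.sum_eq_single_of_mem α₀ hα₀]
    · rw [integral_const_mul, hg α₀ α₀ hα₀]; simp
    · intro β hβ hne
      rw [integral_const_mul, hg α₀ β hβ, if_neg hne, mul_zero]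
  have h5 := sq_integral_mul_le (Carrier.memLp_on_of_continuous (o := o) hR huc)
    (Carrier.memLp_on_of_continuous (o := o) hR (hfc α₀))
  rw [← h3, ← h1] at h5
  have h6 : ∫ x, f α₀ x ^ 2 ∂μ ≤ ∑ α₀ ∈ onIdx d p o, ∫ x, f α₀ x ^ 2 ∂μ :=
    Finset.single_le_sum (fun α _ => hnn α) hα₀
  have h7 : ∫ x, u x ^ 2 ∂μ = (s ^ (d - codim o))⁻¹ * I := by rw [h2]; field_simp
  have h8 : I ^ 2 ≤ ((s ^ (d - codim o))⁻¹ * ∑ α₀ ∈ onIdx d p o, ∫ x, f α₀ x ^ 2 ∂μ) * I := by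
    refine h5.trans ?_
    rw [h7, mul_right_comm]
    exact mul_le_mul_of_nonneg_right (mul_le_mul_of_nonneg_left h6
      (inv_nonneg.mpr (pow_nonneg hs.le _))) hI0
  rcases hI0.eq_or_lt with h0 | h0
  · rw [← h0]
    exact mul_nonneg (Finset.sum_nonneg fun α₀ _ => hnn α₀) (inv_nonneg.mpr (pow_nonneg hs.le _))
  · rw [sq] at h8
    rw [mul_comm]
    exact le_of_mul_le_mul_right h8 h0

end Mesh

/-! ### The coefficients of the Scott-Zhang interpolant. -/

section Coeff

variable {d : ℕ} {Ω : Set (E d)} {T : Mesh d} {p : ℕ} {σ : E d → Carrier d}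

lemma Carrier.Admissible.exists_on {z : E d} {c : Carrier d} (h : c.Admissible Ω T z) :
    ∃ K ∈ T, ∃ o, c = Carrier.on K o ∧ z ∈ (Carrier.on K o).set := by
  cases c with
  | elem K => exact ⟨K, h.1, none, rfl, interior_subset h.2⟩
  | facet K i => exact ⟨K, h.1, some i, rfl, h.2.1⟩

lemma integrable_poly_mul_restrict {K : TaggedSimplex d} {o : Option (Fin (d + 1))}
    (hK : AffineIndependent ℝ K.verts) (hKΩ : interior K.body ⊆ Ω) (q : MvPolynomial (Fin d) ℝ)
    (v : H1 Ω) : Integrable (fun y => polyEval q y * (Carrier.on K o).restrict v y)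
      (Carrier.on K o).measure :=
  (Carrier.memLp_on_of_continuous hK (contDiff_polyEval q).continuous).integrable_mul (q := 2)
    (Carrier.memLp_restrict hK hKΩ v)

lemma szCoeff_add (hT : IsRegularTriangulation Ω T) (hTΩ : ∀ K ∈ T, interior K.body ⊆ Ω) {z : E d}
    (hσ : (σ z).Admissible Ω T z) (v w : H1 Ω) :
    szCoeff T p σ (v + w) z = szCoeff T p σ v z + szCoeff T p σ w z := by
  obtain ⟨K, hK, o, ho, -⟩ := hσ.exists_on
  have hn := hT.nondegenerate K hK
  simp only [szCoeff, ho]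
  rw [← integral_add (integrable_poly_mul_restrict hn (hTΩ K hK) _ v)
    (integrable_poly_mul_restrict hn (hTΩ K hK) _ w)]
  refine integral_congr_ae ?_
  filter_upwards [Carrier.restrict_add hn (hTΩ K hK) v w] with x hx
  rw [hx, Pi.add_apply, mul_add]

lemma szCoeff_smul (hT : IsRegularTriangulation Ω T) (hTΩ : ∀ K ∈ T, interior K.body ⊆ Ω) {z : E d}
    (hσ : (σ z).Admissible Ω T z) (c : ℝ) (v : H1 Ω) :
    szCoeff T p σ (c • v) z = c * szCoeff T p σ v z := by
  obtain ⟨K, hK, o, ho, -⟩ := hσ.exists_on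
  have hn := hT.nondegenerate K hK
  simp only [szCoeff, ho]
  rw [← integral_const_mul]
  refine integral_congr_ae ?_
  filter_upwards [Carrier.restrict_smul hn (hTΩ K hK) c v] with x hx
  rw [hx, Pi.smul_apply, smul_eq_mul]; ring

/-- The Scott-Zhang coefficients reproduce splines. -/
lemma szCoeff_spline (hT : IsRegularTriangulation Ω T) (hTΩ : ∀ K ∈ T, interior K.body ⊆ Ω)
    (hp : 1 ≤ p) {z : E d} (hz : z ∈ nodes T p) (hσ : (σ z).Admissible Ω T z) {v : H1 Ω}
    {V : E d → ℝ} (hV : V ∈ splineSpace Ω T p) (h0 : fn v =ᵐ[volOn Ω] V)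
    (h1 : ∀ j, grad v j =ᵐ[volOn Ω] partialDeriv j V) : szCoeff T p σ v z = V z := by
  obtain ⟨K, hK, o, ho, hzo⟩ := hσ.exists_on
  have hn := hT.nondegenerate K hK
  obtain ⟨q, hq, hVq⟩ := hV.2 K hK
  have hac := volOn_interior_ac (hTΩ K hK)
  have hmem : ∀ᵐ x ∂volOn (interior K.body), x ∈ interior K.body :=
    ae_restrict_mem isOpen_interior.measurableSet
  have h0' : fn v =ᵐ[volOn (interior K.body)] polyEval q := by
    filter_upwards [hac.ae_le h0, hmem] with x hx hxK
    rw [hx, hVq x (interior_subset hxK)]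
  have h1' : ∀ j, grad v j =ᵐ[volOn (interior K.body)] partialDeriv j (polyEval q) := by
    intro j
    filter_upwards [hac.ae_le (h1 j), hmem] with x hx hxK
    have : V =ᶠ[𝓝 x] polyEval q := by
      filter_upwards [isOpen_interior.mem_nhds hxK] with y hy
      exact hVq y (interior_subset hy)
    rw [hx, partialDeriv, partialDeriv, this.fderiv_eq]
  have hr := Carrier.restrict_smooth (o := o) hn (hTΩ K hK) (contDiff_polyEval q) h0' h1'
  have hzK := Carrier.set_on_subset hzo
  have hd := hT.dualFunction_spec hp hK o hz hzK
  obtain ⟨α, hα, rfl⟩ := hT.exists_node hp hK hz hzK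
  rw [hVq _ hzK, ← hT.integral_dual_poly hp hK ((Carrier.node_mem_set_iff hn hp hα).mp hzo) hd hq]
  simp only [szCoeff, ho]
  refine integral_congr_ae ?_
  filter_upwards [hr] with x hx
  rw [hx]

/-- The Scott-Zhang coefficients are bounded by the scaled `H¹`-norm on the element which carries
the domain of integration. -/
lemma exists_szCoeff_bound (Ω : Set (E d)) {𝓡 : Set (TaggedSimplex d)} (h𝓡 : 𝓡.Finite)
    (hR : ∀ R ∈ 𝓡, AffineIndependent ℝ R.verts) (hp : 1 ≤ p) :
    ∃ C : ℝ, 0 ≤ C ∧ ∀ (T : Mesh d) (σ : E d → Carrier d), IsRegularTriangulation Ω T →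
      ∀ K ∈ T, interior K.body ⊆ Ω → ∀ R ∈ 𝓡, ∀ (a : E d) (s : ℝ), IsScaled R K a s →
      ∀ z ∈ nodes T p, ∀ o, σ z = Carrier.on K o → z ∈ (Carrier.on K o).set → ∀ v : H1 Ω,
      szCoeff T p σ v z ^ 2
        ≤ C * (s ^ d)⁻¹ * ((∫ x in K.body, fn v x ^ 2) + s ^ 2 * energy K.body v) := by
  classical
  choose! C1 hC1 hC1' using fun (R : TaggedSimplex d) (h : R ∈ 𝓡) (o : Option (Fin (d + 1))) =>
    Carrier.exists_restrict_bound (Ω := Ω) R (hR R h) o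
  choose! C2 hC2 hC2' using fun (R : TaggedSimplex d) (h : R ∈ 𝓡) (o : Option (Fin (d + 1))) =>
    exists_dual_bound (Ω := Ω) (p := p) R (hR R h) o hp
  have hnn : ∀ R ∈ 𝓡, ∀ o, 0 ≤ C2 R o * C1 R o := fun R h o => mul_nonneg (hC2 R h o) (hC1 R h o)
  refine ⟨∑ R ∈ h𝓡.toFinset, ∑ o, C2 R o * C1 R o, Finset.sum_nonneg fun R h =>
    Finset.sum_nonneg fun o _ => hnn R (by simpa using h) o, ?_⟩
  intro T σ hT K hK hKΩ R hR' a s h z hz o ho hzo v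
  have hn := hT.nondegenerate K hK
  have hs := h.pos
  have hzK := Carrier.set_on_subset hzo
  have hdual := hT.dualFunction_spec hp hK o hz hzK
  obtain ⟨α, hα, rfl⟩ := hT.exists_node hp hK hz hzK
  have hαo := (Carrier.node_mem_set_iff hn hp hα).mp hzo
  have b1 := hC1' R hR' o K a s h hKΩ v
  have b2 := hC2' R hR' o T hT K hK a s h α hαo _ hdual
  have b3 := sq_integral_mul_le (Carrier.memLp_on_of_continuous (o := o) hn
    (contDiff_polyEval (dualFunction Ω T p (Carrier.on K o) (node K p α))).continuous)
    (Carrier.memLp_restrict (o := o) hn hKΩ v)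
  simp only [szCoeff, ho]
  set X := (∫ x in K.body, fn v x ^ 2) + s ^ 2 * energy K.body v with hX
  have hX0 : 0 ≤ X := add_nonneg (integral_nonneg fun _ => sq_nonneg _)
    (mul_nonneg (sq_nonneg _) (energy_nonneg _ _))
  -- The codimension cancels between dual function and trace, so elements and facets give the same
  -- rate `s ^ (-d)`.
  have hpow : (s ^ (d - codim o))⁻¹ * (s ^ codim o)⁻¹ = (s ^ d)⁻¹ := by
    rw [← mul_inv, ← pow_add, Nat.sub_add_cancel]
    have := K.dim_pos
    unfold codim; split_ifs <;> omega
  have hle : C2 R o * C1 R o ≤ ∑ R ∈ h𝓡.toFinset, ∑ o, C2 R o * C1 R o :=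
    (Finset.single_le_sum (f := fun o => C2 R o * C1 R o) (fun o _ => hnn R hR' o)
      (Finset.mem_univ o)).trans
    (Finset.single_le_sum (f := fun R => ∑ o, C2 R o * C1 R o) (fun R h =>
      Finset.sum_nonneg fun o _ => hnn R (by simpa using h) o) (by simpa using hR'))
  refine b3.trans ?_
  have hs1 : 0 ≤ (s ^ (d - codim o))⁻¹ := inv_nonneg.mpr (pow_nonneg hs.le _)
  refine (mul_le_mul b2 b1 (integral_nonneg fun _ => sq_nonneg _)
    (mul_nonneg (hC2 R hR' o) hs1)).trans ?_
  have e : C2 R o * (s ^ (d - codim o))⁻¹ * (C1 R o * (s ^ codim o)⁻¹ * X)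
      = (C2 R o * C1 R o) * ((s ^ d)⁻¹ * X) := by rw [← hpow]; ring
  rw [e, mul_assoc (∑ R ∈ h𝓡.toFinset, ∑ o, C2 R o * C1 R o)]
  exact mul_le_mul_of_nonneg_right hle (mul_nonneg (inv_nonneg.mpr (pow_nonneg hs.le _)) hX0)

lemma scottZhang_eq (hT : IsRegularTriangulation Ω T) (hp : 1 ≤ p) (v : H1 Ω)
    {K : TaggedSimplex d} (hK : K ∈ T) {x : E d} (hx : x ∈ K.body) :
    scottZhang T p σ v x = ∑ α ∈ idx d p, szCoeff T p σ v (node K p α) * lagf K p α x :=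
  hT.finsum_nodalBasis hp (fun z => szCoeff T p σ v z) hK hx

end Coeff

/-! ### Lipschitz domains and their triangulations. -/

section Domain

variable {d : ℕ} {Ω : Set (E d)}

lemma norm_proj_le {n : E d} (hn : ‖n‖ = 1) (t : ℝ) (y : E d) :
    (y - t • n) - (inner ℝ n (y - t • n)) • n = y - (inner ℝ n y) • n := by
  rw [inner_sub_right, inner_smul_right, real_inner_self_eq_norm_sq, hn]
  module

lemma continuous_graph {n : E d} {g : E d → ℝ} {L : ℝ≥0} (hg : LipschitzWith L g) :
    Continuous fun y : E d => g (y - (inner ℝ n y) • n) :=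
  hg.continuous.comp (by fun_prop)

/-- A Lipschitz domain is the interior of its closure. -/
lemma IsBoundedLipschitzDomain.interior_closure (hΩ : IsBoundedLipschitzDomain Ω) :
    interior (closure Ω) = Ω := by
  refine Subset.antisymm ?_ hΩ.isOpen.subset_interior_closure
  intro y hy
  by_contra hyΩ
  have hyf : y ∈ frontier Ω := ⟨interior_subset hy, by rwa [hΩ.isOpen.interior_eq]⟩
  obtain ⟨n, r, L, g, hn, hr, hg, hgr⟩ := hΩ.graph y hyf
  have hle : inner ℝ n y ≤ g (y - (inner ℝ n y) • n) := by
    by_contra hcon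
    push Not at hcon
    have : y ∈ Ω ∩ Metric.ball y r := by
      rw [hgr]; exact ⟨Metric.mem_ball_self hr, hcon⟩
    exact hyΩ this.1
  -- A boundary point that moves against the normal `n` enters the open region below the graph,
  -- which contains no point of `Ω` near `y`. Hence `y` cannot be interior to the closure.
  have hlim : Tendsto (fun t : ℝ => y - t • n) (𝓝[>] 0) (𝓝 y) := by
    have : Tendsto (fun t : ℝ => y - t • n) (𝓝 0) (𝓝 (y - (0:ℝ) • n)) :=
      Continuous.tendsto (by fun_prop) 0
    rw [zero_smul, sub_zero] at this
    exact this.mono_left nhdsWithin_le_nhds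
  have h1 := hlim.eventually (isOpen_interior.mem_nhds hy)
  have h2 := hlim.eventually (Metric.ball_mem_nhds y hr)
  obtain ⟨t, ht1, ht2, ht⟩ := (h1.and (h2.and self_mem_nhdsWithin)).exists
  set w := y - t • n with hw
  have hwlt : inner ℝ n w < g (w - (inner ℝ n w) • n) := by
    rw [hw, norm_proj_le hn, inner_sub_right, inner_smul_right, real_inner_self_eq_norm_sq, hn]
    have : (0:ℝ) < t := ht
    linarith
  have hO : IsOpen ({u : E d | inner ℝ n u < g (u - (inner ℝ n u) • n)} ∩ Metric.ball y r) :=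
    (isOpen_lt (by fun_prop) (continuous_graph hg)).inter Metric.isOpen_ball
  obtain ⟨u, ⟨hu1, hu2⟩, hu⟩ := mem_closure_iff.mp (interior_subset ht1) _ hO ⟨hwlt, ht2⟩
  have : u ∈ Ω ∩ Metric.ball y r := ⟨hu, hu2⟩
  rw [hgr] at this
  exact lt_asymm hu1 this.2

/-- The covering only places elements in the closure of `Ω`. Their interiors lie in `Ω` itself
because a Lipschitz domain is the interior of its closure. -/
lemma IsRegularTriangulation.interior_body_subset {T : Mesh d} (hT : IsRegularTriangulation Ω T)
    (hΩ : IsBoundedLipschitzDomain Ω) : ∀ K ∈ T, interior K.body ⊆ Ω := by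
  intro K hK
  rw [← hΩ.interior_closure]
  refine interior_mono ?_
  rw [← hT.cover]
  exact subset_biUnion_of_mem (u := fun K : TaggedSimplex d => K.body) hK

lemma isFiniteMeasure_volOn (hΩ : IsBoundedLipschitzDomain Ω) : IsFiniteMeasure (volOn Ω) :=
  ⟨by simpa using hΩ.isBounded.measure_lt_top⟩

lemma IsRegularTriangulation.ae_exists_interior {T : Mesh d} (hT : IsRegularTriangulation Ω T)
    (hΩ : IsBoundedLipschitzDomain Ω) : ∀ᵐ x ∂volOn Ω, ∃ K ∈ T, x ∈ interior K.body := by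
  have h1 : ∀ᵐ x ∂(volume : Measure (E d)), ∀ K ∈ T, x ∉ frontier K.body :=
    (ae_ball_iff hT.finite.countable).mpr fun K _ =>
      measure_eq_zero_iff_ae_notMem.mp (K.body_convex.addHaar_frontier volume)
  filter_upwards [ae_restrict_of_ae h1, ae_restrict_mem hΩ.isOpen.measurableSet] with x hx hxΩ
  have : x ∈ ⋃ K ∈ T, K.body := by rw [hT.cover]; exact subset_closure hxΩ
  simp only [mem_iUnion, exists_prop] at this
  obtain ⟨K, hK, hxK⟩ := this
  refine ⟨K, hK, ?_⟩
  by_contra hcon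
  exact hx K hK ⟨subset_closure hxK, hcon⟩

end Domain

/-! ### Splines as Sobolev functions. -/

/-- A continuous function on a finite union of closed convex pieces which is
Lipschitz on every piece is Lipschitz along every segment in the union. -/
lemma norm_sub_le_of_segment {d : ℕ} {T : Mesh d} (hT : T.Finite) {V : E d → ℝ} {A : Set (E d)}
    (hV : ContinuousOn V A) {M : ℝ}
    (hM : ∀ K ∈ T, ∀ x ∈ K.body, ∀ y ∈ K.body, |V x - V y| ≤ M * ‖x - y‖) {x y : E d}
    (hA : segment ℝ x y ⊆ A) (hcov : segment ℝ x y ⊆ ⋃ K ∈ T, K.body) :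
    |V y - V x| ≤ M * ‖y - x‖ := by
  set γ : ℝ → E d := fun t => x + t • (y - x) with hγ
  have hγc : Continuous γ := by fun_prop
  have hseg : ∀ t ∈ Icc (0:ℝ) 1, γ t ∈ segment ℝ x y := fun t ht => by
    rw [segment_eq_image']; exact ⟨t, ht, rfl⟩
  have hγd : ∀ s t, ‖γ s - γ t‖ = |s - t| * ‖y - x‖ := fun s t => by
    have : γ s - γ t = (s - t) • (y - x) := by simp only [hγ]; module
    rw [this, norm_smul, Real.norm_eq_abs]
  have hcont : ContinuousOn (fun t => V (γ t)) (Icc 0 1) :=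
    hV.comp hγc.continuousOn fun t ht => hA (hseg t ht)
  set S : Set ℝ := {t | |V (γ t) - V x| ≤ M * (t * ‖y - x‖)} with hS
  have hcl : IsClosed (S ∩ Icc 0 1) := by
    have : IsClosed {t ∈ Icc (0:ℝ) 1 | |V (γ t) - V x| ≤ M * (t * ‖y - x‖)} :=
      isClosed_Icc.isClosed_le (hcont.sub continuousOn_const).abs (by fun_prop)
    rwa [inter_comm]
  have h0 : (0:ℝ) ∈ S := by simp [hS, hγ]
  -- Continuous induction along the segment. Of the finitely many pieces one is met at parameters
  -- arbitrarily close to the right of `t`; being closed, it also contains the point at `t`, so its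
  -- Lipschitz bound extends the estimate beyond `t`.
  have key := hcl.Icc_subset_of_forall_exists_gt h0 (fun t ht u hu => by
    obtain ⟨htS, ht0, ht1⟩ := ht
    have hev : ∀ᶠ s in 𝓝[>] t, ∃ K ∈ T, γ s ∈ K.body := by
      filter_upwards [Ioc_mem_nhdsGT ht1] with s hs
      have := hcov (hseg s ⟨ht0.trans hs.1.le, hs.2⟩)
      simpa using this
    obtain ⟨K, hK, hfreq⟩ : ∃ K ∈ T, ∃ᶠ s in 𝓝[>] t, γ s ∈ K.body := by
      by_contra hcon
      push Not at hcon
      have h' : ∀ᶠ s in 𝓝[>] t, ∀ K ∈ T, γ s ∉ K.body :=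
        (eventually_all_finite hT).mpr hcon
      obtain ⟨s, ⟨K, hK, hs⟩, hs'⟩ := (hev.and h').exists
      exact hs' K hK hs
    have htK : γ t ∈ K.body := K.body_closed.mem_of_frequently_of_tendsto hfreq
      ((hγc.tendsto t).mono_left nhdsWithin_le_nhds)
    obtain ⟨s, hsK, hs1, hs2⟩ :=
      (hfreq.and_eventually (Ioc_mem_nhdsGT (mem_Ioi.mp hu))).exists
    refine ⟨s, ?_, hs1, hs2⟩
    have h3 := hM K hK _ hsK _ htK
    rw [hγd, abs_of_pos (sub_pos.mpr hs1)] at h3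
    have h4 : |V (γ s) - V x| ≤ |V (γ s) - V (γ t)| + |V (γ t) - V x| := abs_sub_le _ _ _
    simp only [hS, mem_ofPred_eq] at htS ⊢
    linarith [mul_sub M s t, show M * ((s - t) * ‖y - x‖) + M * (t * ‖y - x‖)
      = M * (s * ‖y - x‖) by ring])
  have h1 : (1:ℝ) ∈ S := key ⟨zero_le_one, le_rfl⟩
  simpa [hS, hγ] using h1

section Spline

variable {d : ℕ} {Ω : Set (E d)} {T : Mesh d} {p : ℕ}

lemma exists_fderiv_bound_on {K : Set (E d)} (hK : IsCompact K) (q : MvPolynomial (Fin d) ℝ) :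
    ∃ M : ℝ, 0 ≤ M ∧ ∀ x ∈ K, ‖fderiv ℝ (polyEval q) x‖ ≤ M := by
  obtain ⟨M, hM⟩ := hK.exists_bound_of_continuousOn
    ((contDiff_polyEval q).continuous_fderiv (by simp)).continuousOn
  exact ⟨max M 0, le_max_right _ _, fun x hx => (hM x hx).trans (le_max_left _ _)⟩

lemma IsRegularTriangulation.exists_spline_lipschitz (hT : IsRegularTriangulation Ω T)
    {V : E d → ℝ} (hV : V ∈ splineSpace Ω T p) :
    ∃ M : ℝ, 0 ≤ M ∧ (∀ K ∈ T, ∀ x ∈ K.body, ∀ y ∈ K.body, |V x - V y| ≤ M * ‖x - y‖) ∧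
      ∀ K ∈ T, ∀ x ∈ interior K.body, ∀ j, |partialDeriv j V x| ≤ M := by
  choose! q hq hVq using hV.2
  choose! M hM hMq using fun K (hK : K ∈ T) => exists_fderiv_bound_on K.body_compact (q K)
  obtain ⟨B, hB⟩ := (hT.finite.image M).bddAbove
  have hB' : ∀ K ∈ T, M K ≤ max B 0 := fun K hK =>
    (hB (mem_image_of_mem M hK)).trans (le_max_left _ _)
  refine ⟨max B 0, le_max_right _ _, fun K hK x hx y hy => ?_, fun K hK x hx j => ?_⟩
  · rw [hVq K hK x hx, hVq K hK y hy]
    have := K.body_convex.norm_image_sub_le_of_norm_fderiv_le (𝕜 := ℝ) (f := polyEval (q K))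
      (fun z _ => (contDiff_polyEval (q K)).contDiffAt.differentiableAt (by simp)) (hMq K hK) hy hx
    exact this.trans (mul_le_mul_of_nonneg_right (hB' K hK) (norm_nonneg _))
  · have : V =ᶠ[𝓝 x] polyEval (q K) := by
      filter_upwards [isOpen_interior.mem_nhds hx] with y hy
      exact hVq K hK y (interior_subset hy)
    rw [partialDeriv, this.fderiv_eq]
    refine ((fderiv ℝ (polyEval (q K)) x).le_opNorm _).trans ?_
    rw [PiLp.norm_single, norm_one, mul_one]
    exact (hMq K hK x (interior_subset hx)).trans (hB' K hK)

/-- A spline is locally Lipschitz in `Ω`. On a compact neighbourhood of the support of the test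
function it agrees with a Lipschitz function on the whole space, for which integration by parts
holds with the almost everywhere derivative; no jump terms on facets have to be examined. -/
lemma IsRegularTriangulation.isWeakPartial_spline (hT : IsRegularTriangulation Ω T)
    (hΩ : IsBoundedLipschitzDomain Ω) {V : E d → ℝ} (hV : V ∈ splineSpace Ω T p) (j : Fin d) :
    IsWeakPartial Ω j V (partialDeriv j V) := by
  intro φ hφ hφc hφΩ
  obtain ⟨M, hM0, hM, -⟩ := hT.exists_spline_lipschitz hV
  obtain ⟨A, hA, hφA, hAΩ⟩ := exists_compact_between hφc.isCompact hΩ.isOpen hφΩ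
  have hloc : LocallyLipschitzOn A V := by
    intro x hx
    obtain ⟨r, hr, hrΩ⟩ := Metric.isOpen_iff.mp hΩ.isOpen x (hAΩ hx)
    refine ⟨M.toNNReal, Metric.ball x r, mem_nhdsWithin_of_mem_nhds (Metric.ball_mem_nhds x hr), ?_⟩
    refine LipschitzOnWith.of_dist_le_mul fun y hy z hz => ?_
    rw [Real.coe_toNNReal _ hM0, Real.dist_eq, dist_eq_norm]
    have hseg := ((convex_ball x r).segment_subset hz hy).trans (hrΩ.trans subset_closure)
    exact norm_sub_le_of_segment hT.finite hV.1 hM hseg (by rwa [hT.cover])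
  obtain ⟨C, hC⟩ := LocallyLipschitzOn.exists_lipschitzOnWith_of_compact hA hloc
  obtain ⟨f, hf, hfV⟩ := hC.extend_real
  obtain ⟨D, hD⟩ := ContDiff.lipschitzWith_of_hasCompactSupport (𝕂 := ℝ) hφc hφ (by simp)
  have h := hf.integral_lineDeriv_mul_eq (μ := volume) hD hφc (EuclideanSpace.single j (1:ℝ))
  have hφd : ∀ x, DifferentiableAt ℝ φ x := fun x => hφ.contDiffAt.differentiableAt (by simp)
  have e1 : ∫ x in Ω, V x * partialDeriv j φ x
      = ∫ x, f x * partialDeriv j φ x := by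
    refine Eq.trans ?_ (setIntegral_eq_integral_of_forall_compl_eq_zero (s := Ω) ?_)
    · refine setIntegral_congr_fun hΩ.isOpen.measurableSet fun x _ => ?_
      by_cases hx : x ∈ tsupport φ
      · simp only [hfV (interior_subset (hφA hx))]
      · have : partialDeriv j φ x = 0 := by
          rw [partialDeriv, image_eq_zero_of_notMem_tsupport
            (fun h => hx (tsupport_fderiv_subset ℝ h))]; rfl
        simp [this]
    · intro x hx
      have : partialDeriv j φ x = 0 := by
        rw [partialDeriv, image_eq_zero_of_notMem_tsupport
          (fun h => hx (hφΩ (tsupport_fderiv_subset ℝ h)))]; rfl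
      simp [this]
  have e2 : ∫ x in Ω, partialDeriv j V x * φ x
      = ∫ x, lineDeriv ℝ f x (EuclideanSpace.single j (1:ℝ)) * φ x := by
    refine Eq.trans ?_ (setIntegral_eq_integral_of_forall_compl_eq_zero (s := Ω) ?_)
    · refine setIntegral_congr_ae hΩ.isOpen.measurableSet ?_
      filter_upwards [hf.ae_differentiableAt (μ := volume)] with x hx _
      by_cases hxφ : x ∈ tsupport φ
      · have hev : f =ᶠ[𝓝 x] V := by
          filter_upwards [isOpen_interior.mem_nhds (hφA hxφ)] with y hy
          exact (hfV (interior_subset hy)).symm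
        rw [hx.lineDeriv_eq_fderiv, partialDeriv, hev.fderiv_eq]
      · simp [image_eq_zero_of_notMem_tsupport hxφ]
    · intro x hx
      simp [image_eq_zero_of_notMem_tsupport (fun h => hx (hφΩ h))]
  have e3 : ∀ x, lineDeriv ℝ φ x (-EuclideanSpace.single j (1:ℝ)) = - partialDeriv j φ x := by
    intro x
    rw [(hφd x).lineDeriv_eq_fderiv, map_neg]; rfl
  simp_rw [e3, neg_mul] at h
  rw [integral_neg] at h
  rw [e1, e2, h, neg_neg]
  congr 1; ext x; ring

lemma memLp_spline (hΩ : IsBoundedLipschitzDomain Ω) {V : E d → ℝ} (hV : V ∈ splineSpace Ω T p) :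
    MemLp V 2 (volOn Ω) := by
  have := isFiniteMeasure_volOn hΩ
  obtain ⟨B, hB⟩ := (hΩ.isBounded.isCompact_closure).exists_bound_of_continuousOn hV.1
  refine MemLp.of_bound ((hV.1.mono subset_closure).aestronglyMeasurable hΩ.isOpen.measurableSet)
    B ?_
  filter_upwards [ae_restrict_mem hΩ.isOpen.measurableSet] with x hx
  exact hB x (subset_closure hx)

lemma IsRegularTriangulation.memLp_partialDeriv_spline (hT : IsRegularTriangulation Ω T)
    (hΩ : IsBoundedLipschitzDomain Ω) {V : E d → ℝ} (hV : V ∈ splineSpace Ω T p) (j : Fin d) :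
    MemLp (partialDeriv j V) 2 (volOn Ω) := by
  have := isFiniteMeasure_volOn hΩ
  obtain ⟨M, hM0, -, hM⟩ := hT.exists_spline_lipschitz hV
  refine MemLp.of_bound (measurable_fderiv_apply_const ℝ V _).aestronglyMeasurable M ?_
  filter_upwards [hT.ae_exists_interior hΩ] with x ⟨K, hK, hx⟩
  exact hM K hK x hx j

/-- Splines belong to `H¹(Ω)`. -/
lemma IsRegularTriangulation.exists_H1_spline (hT : IsRegularTriangulation Ω T)
    (hΩ : IsBoundedLipschitzDomain Ω) {V : E d → ℝ} (hV : V ∈ splineSpace Ω T p) :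
    ∃ w : H1 Ω, fn w =ᵐ[volOn Ω] V ∧ ∀ j, grad w j =ᵐ[volOn Ω] partialDeriv j V := by
  have h0 := memLp_spline hΩ hV
  have h1 := hT.memLp_partialDeriv_spline hΩ hV
  let w : L2Pair Ω := WithLp.toLp 2 (h0.toLp V, WithLp.toLp 2 fun j => (h1 j).toLp _)
  have hw0 : (w.fst : E d → ℝ) =ᵐ[volOn Ω] V := h0.coeFn_toLp
  have hw1 : ∀ j, (w.snd j : E d → ℝ) =ᵐ[volOn Ω] partialDeriv j V := fun j => (h1 j).coeFn_toLp
  refine ⟨⟨w, fun j φ hφ hφc hφΩ => ?_⟩, hw0, hw1⟩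
  have e0 : ∫ x in Ω, w.fst x * partialDeriv j φ x = ∫ x in Ω, V x * partialDeriv j φ x :=
    integral_congr_ae (by filter_upwards [hw0] with x hx; rw [hx])
  have e1 : ∫ x in Ω, w.snd j x * φ x = ∫ x in Ω, partialDeriv j V x * φ x :=
    integral_congr_ae (by filter_upwards [hw1 j] with x hx; rw [hx])
  exact e0.trans ((hT.isWeakPartial_spline hΩ hV j φ hφ hφc hφΩ).trans (congrArg Neg.neg e1.symm))

end Spline

/-! ### Connectivity of the star of a point through facets. -/

section Connectivity

variable {d : ℕ} {Ω : Set (E d)} {T : Mesh d}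

/-- Near a point of the closure, a Lipschitz domain is star-shaped with respect to a ball. -/
lemma IsBoundedLipschitzDomain.exists_apex (hΩ : IsBoundedLipschitzDomain Ω) {z : E d}
    (hz : z ∈ closure Ω) {r : ℝ} (hr : 0 < r) : ∃ ε > 0, ∃ y₀ : E d,
      ∀ x ∈ Ω ∩ Metric.ball z ε, ∀ y ∈ Metric.ball y₀ ε, segment ℝ x y ⊆ Ω ∩ Metric.ball z r := by
  by_cases hzΩ : z ∈ Ω
  · obtain ⟨ρ, hρ, hρΩ⟩ := Metric.isOpen_iff.mp hΩ.isOpen z hzΩ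
    refine ⟨min ρ r, lt_min hρ hr, z, fun x hx y hy => ?_⟩
    refine ((convex_ball z (min ρ r)).segment_subset hx.2 hy).trans (subset_inter ?_ ?_)
    · exact (Metric.ball_subset_ball (min_le_left _ _)).trans hρΩ
    · exact Metric.ball_subset_ball (min_le_right _ _)
  have hzf : z ∈ frontier Ω := ⟨hz, by rwa [hΩ.isOpen.interior_eq]⟩
  obtain ⟨n, r₀, L, g, hn, hr₀, hg, hgr⟩ := hΩ.graph z hzf
  obtain ⟨ρ, hρ0, hρr, hρr₀⟩ : ∃ ρ > 0, ρ ≤ r ∧ ρ ≤ r₀ :=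
    ⟨min r r₀, lt_min hr hr₀, min_le_left _ _, min_le_right _ _⟩
  have hL : (0:ℝ) ≤ L := L.2
  -- Along the segment the height grows at rate `ρ / 2`, up to the deviation `e` of norm below `2 *
  -- ε`. The graph rises at most at rate `2 * L * ‖e‖`, and `ε` makes `(1 + 2 * L) * (2 * ε)` equal
  -- to `ρ / 2`.
  set ε : ℝ := ρ / 2 / (2 * (1 + 2 * L)) with hε
  have hε0 : 0 < ε := by positivity
  have hε1 : ε * (2 * (1 + 2 * L)) = ρ / 2 := by rw [hε]; field_simp
  have hε2 : ε ≤ ρ / 4 := by nlinarith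
  refine ⟨ε, hε0, z + (ρ / 2) • n, fun x hx y hy => ?_⟩
  have hy' : ‖y - (z + (ρ / 2) • n)‖ < ε := by simpa [dist_eq_norm] using hy
  have hx' : ‖x - z‖ < ε := by simpa [dist_eq_norm] using hx.2
  have hyb : y ∈ Metric.ball z ρ := by
    rw [Metric.mem_ball, dist_eq_norm]
    have : y - z = (y - (z + (ρ / 2) • n)) + (ρ / 2) • n := by module
    rw [this]
    refine (norm_add_le _ _).trans_lt ?_
    rw [norm_smul, hn, Real.norm_eq_abs, abs_of_pos (by positivity)]
    linarith
  have hxb : x ∈ Metric.ball z ρ := by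
    rw [Metric.mem_ball, dist_eq_norm]; linarith
  have hball := (convex_ball z ρ).segment_subset hxb hyb
  refine subset_inter ?_ (hball.trans (Metric.ball_subset_ball hρr))
  intro w hw
  have hwb := Metric.ball_subset_ball hρr₀ (hball hw)
  rw [segment_eq_image'] at hw
  obtain ⟨t, ⟨ht0, ht1⟩, rfl⟩ := hw
  have hxg : g (x - inner ℝ n x • n) < inner ℝ n x := by
    have : x ∈ Ω ∩ Metric.ball z r₀ := ⟨hx.1, Metric.ball_subset_ball hρr₀ hxb⟩
    rw [hgr] at this; exact this.2
  set e : E d := (y - x) - (ρ / 2) • n with he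
  have hen : ‖e‖ < 2 * ε := by
    have : e = (y - (z + (ρ / 2) • n)) - (x - z) := by rw [he]; module
    rw [this]; exact (norm_sub_le _ _).trans_lt (by linarith)
  have hyx : y - x = (ρ / 2) • n + e := by rw [he]; module
  have hnn : inner ℝ n n = (1:ℝ) := by rw [real_inner_self_eq_norm_sq, hn]; norm_num
  set w := x + t • (y - x) with hw
  have hinner : inner ℝ n w = inner ℝ n x + t * (ρ / 2 + inner ℝ n e) := by
    rw [hw, hyx, inner_add_right, inner_smul_right, inner_add_right, inner_smul_right, hnn]; ring
  have hproj : (w - inner ℝ n w • n) - (x - inner ℝ n x • n) = t • (e - inner ℝ n e • n) := by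
    rw [hinner, hw, hyx]; module
  have hie : |inner ℝ n e| ≤ ‖e‖ := by
    have := abs_real_inner_le_norm n e
    rwa [hn, one_mul] at this
  have hPe : ‖e - inner ℝ n e • n‖ ≤ 2 * ‖e‖ := by
    refine (norm_sub_le _ _).trans ?_
    rw [norm_smul, hn, mul_one, Real.norm_eq_abs]; linarith
  have hgl : g (w - inner ℝ n w • n) ≤ g (x - inner ℝ n x • n) + L * (t * (2 * ‖e‖)) := by
    have h1 := hg.dist_le_mul (w - inner ℝ n w • n) (x - inner ℝ n x • n)
    rw [Real.dist_eq, dist_eq_norm, hproj, norm_smul, Real.norm_eq_abs, abs_of_nonneg ht0] at h1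
    have h2 := (le_abs_self _).trans h1
    have h3 : (L:ℝ) * (t * ‖e - inner ℝ n e • n‖) ≤ L * (t * (2 * ‖e‖)) := by gcongr
    linarith
  have hfin : w ∈ {y ∈ Metric.ball z r₀ | g (y - inner ℝ n y • n) < inner ℝ n y} := by
    refine ⟨hwb, hgl.trans_lt ?_⟩
    rw [hinner]
    have h4 : L * (t * (2 * ‖e‖)) ≤ t * (ρ / 2 + inner ℝ n e) := by
      have h5 := neg_abs_le (inner ℝ n e)
      have h6 : L * (2 * ‖e‖) ≤ ρ / 2 + inner ℝ n e := by nlinarith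
      calc L * (t * (2 * ‖e‖)) = t * (L * (2 * ‖e‖)) := by ring
        _ ≤ _ := by gcongr
    linarith
  rw [← hgr] at hfin
  exact hfin.1

lemma dense_affine_ne_zero (f : E d →ᵃ[ℝ] ℝ) {u : E d} (hu : f u ≠ 0) : Dense {y | f y ≠ 0} := by
  intro y
  by_cases hy : f y = 0
  · have hlim : Tendsto (fun t : ℝ => AffineMap.lineMap y u t) (𝓝[≠] 0) (𝓝 y) := by
      have : Tendsto (fun t : ℝ => AffineMap.lineMap y u t) (𝓝 0) (𝓝 (AffineMap.lineMap y u (0:ℝ))) :=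
        Continuous.tendsto (by fun_prop) 0
      rw [AffineMap.lineMap_apply_zero] at this
      exact this.mono_left nhdsWithin_le_nhds
    refine mem_closure_of_tendsto hlim ?_
    filter_upwards [self_mem_nhdsWithin] with t ht
    have ht' : t ≠ 0 := ht
    simp only [AffineMap.apply_lineMap, hy, AffineMap.lineMap_apply_ring']
    simpa using ⟨ht', hu⟩
  · exact subset_closure hy

/-- The union of the faces of codimension two of a mesh. -/
def codimTwo (T : Mesh d) : Set (E d) :=
  {w | ∃ K ∈ T, ∃ i j, i ≠ j ∧ w ∈ K.body ∧ bc K i w = 0 ∧ bc K j w = 0}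

/-- Generic segments avoid the faces of codimension two. -/
lemma exists_generic_segment (hT : IsRegularTriangulation Ω T) {x : E d} (hx : x ∉ codimTwo T)
    {U : Set (E d)} (hU : IsOpen U) (hUn : U.Nonempty) :
    ∃ y ∈ U, ∀ w ∈ segment ℝ x y, w ∉ codimTwo T := by
  classical
  -- For every pair of barycentric coordinates, a nonconstant affine function that vanishes at `x`
  -- and on the corresponding face. If it is nonzero at `y`, the segment can meet the face only at
  -- `x`, which is excluded. Such `y` are dense.
  let f : TaggedSimplex d × Fin (d + 1) × Fin (d + 1) → (E d →ᵃ[ℝ] ℝ) := fun k =>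
    if bc k.1 k.2.1 x = 0 ∧ bc k.1 k.2.2 x = 0 then bc k.1 k.2.1
    else bc k.1 k.2.2 x • bc k.1 k.2.1 - bc k.1 k.2.1 x • bc k.1 k.2.2
  let I : Set (TaggedSimplex d × Fin (d + 1) × Fin (d + 1)) := {k | k.1 ∈ T ∧ k.2.1 ≠ k.2.2}
  have hI : I.Finite := (hT.finite.prod finite_univ).subset fun k hk => ⟨hk.1, mem_univ _⟩
  have hfx : ∀ k, f k x = 0 := by
    intro k
    simp only [f]
    split_ifs with h
    · exact h.1
    · simp only [AffineMap.coe_sub, AffineMap.coe_smul, Pi.sub_apply, Pi.smul_apply, smul_eq_mul]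
      ring
  have hf0 : ∀ k w, bc k.1 k.2.1 w = 0 → bc k.1 k.2.2 w = 0 → f k w = 0 := by
    intro k w h1 h2
    simp only [f]
    split_ifs with h
    · exact h1
    · simp [h1, h2]
  have hfu : ∀ k ∈ I, ∃ u, f k u ≠ 0 := by
    rintro ⟨K, i, j⟩ ⟨hK, hij⟩
    have hn := hT.nondegenerate K hK
    simp only at hK hij
    simp only [f]
    split_ifs with h
    · exact ⟨K.verts i, by simp [bc_vert hn]⟩
    · by_cases hj : bc K j x = 0
      · refine ⟨K.verts j, ?_⟩
        have hi : bc K i x ≠ 0 := fun hi => h ⟨hi, hj⟩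
        simpa [bc_vert hn, hij] using hi
      · refine ⟨K.verts i, ?_⟩
        simpa [bc_vert hn, hij.symm] using hj
  have hdense : Dense (⋂ k ∈ I, {y | f k y ≠ 0}) := by
    refine dense_biInter_of_isOpen (fun k _ => ?_) hI.countable fun k hk => ?_
    · exact isOpen_ne_fun (f k).continuous_of_finiteDimensional continuous_const
    · obtain ⟨u, hu⟩ := hfu k hk
      exact dense_affine_ne_zero _ hu
  obtain ⟨y, hyU, hy⟩ := hdense.inter_open_nonempty U hU hUn
  simp only [mem_iInter] at hy
  refine ⟨y, hyU, ?_⟩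
  rintro w hw ⟨K, hK, i, j, hij, hwK, hi, hj⟩
  rw [segment_eq_image_lineMap] at hw
  obtain ⟨t, -, rfl⟩ := hw
  have h0 := hf0 (K, i, j) _ hi hj
  rw [AffineMap.apply_lineMap, hfx, AffineMap.lineMap_apply_ring'] at h0
  have hty := hy (K, i, j) ⟨hK, hij⟩
  have ht : t = 0 := by simpa using (mul_eq_zero.mp (by simpa using h0)).resolve_right hty
  rw [ht, AffineMap.lineMap_apply_zero] at hwK hi hj
  exact hx ⟨K, hK, i, j, hij, hwK, hi, hj⟩

/-- Two simplices are adjacent if all vertices of the first one, except for at most one, are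
vertices of the second one. -/
def FacetAdj (K K' : TaggedSimplex d) : Prop := ∃ i, ∀ k, k ≠ i → K.verts k ∈ range K'.verts

/-- Off the faces of codimension two at most one barycentric coordinate of a shared point vanishes,
so at most one vertex fails to be shared. -/
lemma IsRegularTriangulation.facetAdj (hT : IsRegularTriangulation Ω T) {K K' : TaggedSimplex d}
    (hK : K ∈ T) (hK' : K' ∈ T) {w : E d} (hw : w ∈ K.body) (hw' : w ∈ K'.body)
    (hwc : w ∉ codimTwo T) : FacetAdj K K' := by
  by_contra hcon
  simp only [FacetAdj, not_exists, not_forall] at hcon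
  obtain ⟨i, -, hi⟩ := hcon 0
  obtain ⟨j, hji, hj⟩ := hcon i
  have h0 : ∀ k, K.verts k ∉ range K'.verts → bc K k w = 0 := fun k hk => by
    by_contra h; exact hk (hT.mem_common hK hK' hw hw' k h)
  exact hwc ⟨K, hK, i, j, hji.symm, hw, h0 i hi, h0 j hj⟩

/-- Elements whose interior meets another element coincide with it. -/
lemma IsRegularTriangulation.eq_of_mem_interior (hT : IsRegularTriangulation Ω T)
    {K K' : TaggedSimplex d} (hK : K ∈ T) (hK' : K' ∈ T) {x : E d} (hx : x ∈ interior K.body)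
    (hx' : x ∈ K'.body) : K = K' := by
  have hn := hT.nondegenerate K hK
  have hsub : range K.verts ⊆ range K'.verts := by
    rintro _ ⟨i, rfl⟩
    exact hT.mem_common hK hK' (interior_subset hx) hx' i ((mem_interior_iff hn).mp hx i).ne'
  refine hT.injOn hK hK' ?_
  have hc : ∀ L ∈ T, (range L.verts).ncard = d + 1 := fun L hL => by
    rw [← image_univ, ncard_image_of_injective _ (hT.nondegenerate L hL).injective, ncard_univ,
      Nat.card_eq_fintype_card, Fintype.card_fin]
  rw [TaggedSimplex.body, TaggedSimplex.body,
    eq_of_subset_of_ncard_le hsub (by rw [hc K hK, hc K' hK']) (finite_range _)]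

lemma IsRegularTriangulation.notMem_codimTwo (hT : IsRegularTriangulation Ω T)
    {K : TaggedSimplex d} (hK : K ∈ T) {x : E d} (hx : x ∈ interior K.body) : x ∉ codimTwo T := by
  rintro ⟨K', hK', i, j, -, hxK', hi, -⟩
  obtain rfl := hT.eq_of_mem_interior hK hK' hx hxK'
  exact ((mem_interior_iff (hT.nondegenerate K hK)).mp hx i).ne' hi

lemma mem_closure_interior_body {K : TaggedSimplex d} (hK : AffineIndependent ℝ K.verts) {x : E d}
    (hx : x ∈ K.body) : x ∈ closure (interior K.body) := by
  rw [K.body_convex.closure_interior_eq_closure_of_nonempty_interior (interior_body_nonempty hK)]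
  exact subset_closure hx

/-- The elements around a point are connected through adjacent elements. -/
theorem IsRegularTriangulation.star_connected (hT : IsRegularTriangulation Ω T)
    (hΩ : IsBoundedLipschitzDomain Ω) {z : E d} {K₁ K₂ : TaggedSimplex d}
    (hK₁ : K₁ ∈ T) (hK₂ : K₂ ∈ T) (hz₁ : z ∈ K₁.body) (hz₂ : z ∈ K₂.body) :
    Relation.ReflTransGen (fun K K' => (K' ∈ T ∧ z ∈ K'.body) ∧ FacetAdj K K') K₁ K₂ := by
  set r := Relation.ReflTransGen
    (fun K K' : TaggedSimplex d => (K' ∈ T ∧ z ∈ K'.body) ∧ FacetAdj K K') K₁ with hr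
  have hzcl : z ∈ closure Ω := by
    rw [← hT.cover]; exact mem_biUnion hK₁ hz₁
  have hTΩ := hT.interior_body_subset hΩ
  -- Elements are closed and finite in number, so only those containing `z` reach a small ball
  -- around it.
  obtain ⟨ρ, hρ, hρT⟩ : ∃ ρ > 0, ∀ K ∈ T, ∀ w ∈ Metric.ball z ρ, w ∈ K.body → z ∈ K.body := by
    have hcl : IsClosed (⋃ K ∈ {K ∈ T | z ∉ K.body}, K.body) :=
      (hT.finite.subset (sep_subset _ _)).isClosed_biUnion fun K _ => K.body_closed
    have hzc : z ∉ ⋃ K ∈ {K ∈ T | z ∉ K.body}, K.body := by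
      simp only [mem_iUnion, not_exists]
      exact fun K hK hzK => hK.2 hzK
    obtain ⟨ρ, hρ, h⟩ := Metric.isOpen_iff.mp hcl.isOpen_compl z hzc
    refine ⟨ρ, hρ, fun K hK w hw hwK => ?_⟩
    by_contra hcon
    exact h hw (mem_biUnion (show K ∈ {K ∈ T | z ∉ K.body} from ⟨hK, hcon⟩) hwK)
  obtain ⟨ε, hε, y₀, hseg⟩ := hΩ.exists_apex hzcl hρ
  -- The elements that are reached and the remaining elements around `z` form two closed sets, which
  -- intersect only in faces of codimension two. A segment that avoids those faces is connected and
  -- stays in whichever set it meets.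
  set A : Set (E d) := ⋃ K ∈ {K ∈ T | r K}, K.body with hA
  set B : Set (E d) := ⋃ K ∈ {K ∈ T | z ∈ K.body ∧ ¬ r K}, K.body with hB
  have hAc : IsClosed A :=
    (hT.finite.subset (sep_subset _ _)).isClosed_biUnion fun K _ => K.body_closed
  have hBc : IsClosed B :=
    (hT.finite.subset (sep_subset _ _)).isClosed_biUnion fun K _ => K.body_closed
  have hcov : Ω ∩ Metric.ball z ρ ⊆ A ∪ B := by
    rintro w ⟨hw, hwb⟩
    have : w ∈ ⋃ K ∈ T, K.body := by rw [hT.cover]; exact subset_closure hw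
    simp only [mem_iUnion, exists_prop] at this
    obtain ⟨K, hK, hwK⟩ := this
    by_cases hrK : r K
    · exact Or.inl (mem_biUnion (show K ∈ {K ∈ T | r K} from ⟨hK, hrK⟩) hwK)
    · exact Or.inr (mem_biUnion (show K ∈ {K ∈ T | z ∈ K.body ∧ ¬ r K} from
        ⟨hK, hρT K hK w hwb hwK, hrK⟩) hwK)
  have hAB : ∀ w, w ∉ codimTwo T → w ∈ A → w ∉ B := by
    intro w hw hwA hwB
    simp only [hA, hB, mem_iUnion, exists_prop] at hwA hwB
    obtain ⟨K, ⟨hK, hrK⟩, hwK⟩ := hwA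
    obtain ⟨K', ⟨hK', hzK', hrK'⟩, hwK'⟩ := hwB
    exact hrK' (Relation.ReflTransGen.tail hrK ⟨⟨hK', hzK'⟩, hT.facetAdj hK hK' hwK hwK' hw⟩)
  have hprop : ∀ a b, segment ℝ a b ⊆ Ω ∩ Metric.ball z ρ →
      (∀ w ∈ segment ℝ a b, w ∉ codimTwo T) → ∀ u ∈ segment ℝ a b, u ∈ A →
      segment ℝ a b ⊆ A := by
    intro a b hab hgen u hu huA
    have hpre := (convex_segment (𝕜 := ℝ) a b).isPreconnected
    rw [isPreconnected_iff_subset_of_disjoint_closed] at hpre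
    refine (hpre A B hAc hBc (hab.trans hcov) ?_).resolve_right fun h => ?_
    · ext w
      simp only [mem_inter_iff, mem_empty_iff_false, iff_false, not_and]
      exact fun hw => hAB w (hgen w hw)
    · exact hAB u (hgen u hu) huA (h hu)
  have hnear : ∀ K ∈ T, z ∈ K.body → (interior K.body ∩ Metric.ball z ε).Nonempty := by
    intro K hK hzK
    obtain ⟨x, hx1, hx2⟩ := mem_closure_iff.mp (mem_closure_interior_body (hT.nondegenerate K hK) hzK)
      _ Metric.isOpen_ball (Metric.mem_ball_self hε)
    exact ⟨x, hx2, hx1⟩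
  -- Two generic segments lead from the interior of `K₁` to a point of the apex ball and from there
  -- into the interior of `K₂`.
  obtain ⟨x, hxK, hxb⟩ := hnear K₁ hK₁ hz₁
  obtain ⟨y, hyb, hy⟩ := exists_generic_segment hT (hT.notMem_codimTwo hK₁ hxK)
    Metric.isOpen_ball ⟨y₀, Metric.mem_ball_self hε⟩
  obtain ⟨x', ⟨hxK', hxb'⟩, hx'⟩ := exists_generic_segment hT (hy y (right_mem_segment _ _ _))
    (isOpen_interior.inter Metric.isOpen_ball) (hnear K₂ hK₂ hz₂)
  have hxA : x ∈ A := mem_biUnion (show K₁ ∈ {K ∈ T | r K} from ⟨hK₁, Relation.ReflTransGen.refl⟩)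
    (interior_subset hxK)
  have h1 := hprop x y (hseg x ⟨hTΩ K₁ hK₁ hxK, hxb⟩ y hyb) hy x (left_mem_segment _ _ _) hxA
  have h2 := hprop y x' (segment_symm ℝ x' y ▸ hseg x' ⟨hTΩ K₂ hK₂ hxK', hxb'⟩ y hyb) hx' y
    (left_mem_segment _ _ _) (h1 (right_mem_segment _ _ _))
  have h3 := h2 (right_mem_segment _ _ _)
  simp only [hA, mem_iUnion, exists_prop] at h3
  obtain ⟨K, ⟨hK, hrK⟩, hxK2⟩ := h3
  obtain rfl := hT.eq_of_mem_interior hK₂ hK hxK' hxK2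
  exact hrK

end Connectivity

/-- A function on a finite set which varies by at most `D` between related elements varies by at
most `#S * D` between connected elements. -/
lemma abs_sub_le_of_reflTransGen {α : Type*} {S : Set α} (hS : S.Finite) {r : α → α → Prop}
    {f : α → ℝ} {D : ℝ} (hD : 0 ≤ D) (hf : ∀ a ∈ S, ∀ b ∈ S, r a b → |f a - f b| ≤ D) {a b : α}
    (ha : a ∈ S) (hab : Relation.ReflTransGen (fun x y => y ∈ S ∧ r x y) a b) :
    |f a - f b| ≤ S.ncard * D := by
  classical
  have : Fintype S := hS.fintype
  let G : SimpleGraph S := SimpleGraph.fromRel fun x y => r x.1 y.1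
  have hreach : ∃ hb : b ∈ S, G.Reachable ⟨a, ha⟩ ⟨b, hb⟩ := by
    induction hab with
    | refl => exact ⟨ha, SimpleGraph.Reachable.refl _⟩
    | @tail b c _ hbc ih =>
      obtain ⟨hb, h⟩ := ih
      refine ⟨hbc.1, ?_⟩
      by_cases hne : b = c
      · subst hne; exact h
      · refine h.trans (SimpleGraph.Adj.reachable ?_)
        rw [SimpleGraph.fromRel_adj]
        exact ⟨fun h => hne (congrArg Subtype.val h), Or.inl hbc.2⟩
  obtain ⟨hb, ⟨w⟩⟩ := hreach
  have hwalk : ∀ {u v : S} (w : G.Walk u v), |f u.1 - f v.1| ≤ w.length * D := by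
    intro u v w
    induction w with
    | nil => simp
    | @cons u v x h w ih =>
      rw [SimpleGraph.fromRel_adj] at h
      have h1 : |f u.1 - f v.1| ≤ D := by
        rcases h.2 with h | h
        · exact hf _ u.2 _ v.2 h
        · rw [abs_sub_comm]; exact hf _ v.2 _ u.2 h
      have h2 := abs_sub_le (f u.1) (f v.1) (f x.1)
      rw [SimpleGraph.Walk.length_cons]
      push_cast
      linarith
  -- A walk without repeated vertices has fewer steps than there are elements.
  refine (hwalk w.toPath.1).trans (mul_le_mul_of_nonneg_right ?_ hD)
  have := w.toPath.2.length_lt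
  rw [← Nat.card_eq_fintype_card, Nat.card_coe_set_eq] at this
  exact_mod_cast this.le

/-! ### Shape regularity and its consequences for neighbouring elements. -/

/-- The diameter of an element. -/
def TaggedSimplex.size {d : ℕ} (K : TaggedSimplex d) : ℝ := Metric.diam K.body

/-- The mean value of a function on an element. -/
def mean {d : ℕ} {Ω : Set (E d)} (K : TaggedSimplex d) (v : H1 Ω) : ℝ :=
  avg (interior K.body) (fn v)

/-- Shape regularity: the barycentric coordinates have Lipschitz constant `Λ / diam K`. -/
structure ShapeRegular {d : ℕ} (Λ : ℝ) (K : TaggedSimplex d) : Prop where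
  indep : AffineIndependent ℝ K.verts
  lip : ∀ i x y, K.size * |bc K i x - bc K i y| ≤ Λ * ‖x - y‖

namespace ShapeRegular

variable {d : ℕ} {Λ : ℝ} {K : TaggedSimplex d}

lemma size_pos (h : ShapeRegular Λ K) : 0 < K.size := by
  have hne : K.verts 0 ≠ K.verts (Fin.last d) := fun hc => by
    have := h.indep.injective hc
    have := congrArg Fin.val this
    have hd := K.dim_pos
    simp at this; omega
  exact (norm_pos_iff.mpr (sub_ne_zero.mpr hne)).trans_le
    (K.norm_sub_le_diam (K.vert_mem_body _) (K.vert_mem_body _))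

lemma size_le_mul_norm (h : ShapeRegular Λ K) {i k : Fin (d + 1)} (hik : i ≠ k) :
    K.size ≤ Λ * ‖K.verts i - K.verts k‖ := by
  have := h.lip i (K.verts i) (K.verts k)
  rwa [bc_vert h.indep, bc_vert h.indep, if_pos rfl, if_neg hik, sub_zero, abs_one, mul_one] at this

lemma pos (h : ShapeRegular Λ K) : 0 < Λ := by
  have h0 : (0 : Fin (d + 1)) ≠ Fin.last d := fun hc => by
    have := congrArg Fin.val hc
    have hd := K.dim_pos
    simp at this; omega
  have h1 := h.size_pos.trans_le (h.size_le_mul_norm h0)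
  exact pos_of_mul_pos_left h1 (norm_nonneg _)

lemma one_le (h : ShapeRegular Λ K) : 1 ≤ Λ := by
  have h0 : (0 : Fin (d + 1)) ≠ Fin.last d := fun hc => by
    have := congrArg Fin.val hc
    have hd := K.dim_pos
    simp at this; omega
  have h1 := h.size_le_mul_norm h0
  have h2 : ‖K.verts 0 - K.verts (Fin.last d)‖ ≤ K.size :=
    K.norm_sub_le_diam (K.vert_mem_body _) (K.vert_mem_body _)
  have h3 := h1.trans (mul_le_mul_of_nonneg_left h2 h.pos.le)
  exact le_of_mul_le_mul_right (by linarith) h.size_pos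

lemma abs_bc_sub_lt (h : ShapeRegular Λ K) {x y : E d} {ε : ℝ}
    (hxy : ‖x - y‖ < ε * K.size / Λ) (i : Fin (d + 1)) : |bc K i x - bc K i y| < ε := by
  have h1 := h.lip i x y
  rw [lt_div_iff₀ h.pos] at hxy
  have h2 : K.size * |bc K i x - bc K i y| < K.size * ε := by linarith
  exact lt_of_mul_lt_mul_left h2 h.size_pos.le

/-- An element contains balls of comparable size near each of its points. -/
lemma exists_ball (h : ShapeRegular Λ K) {z : E d} (hz : z ∈ K.body) {r : ℝ} (hr : 0 < r)
    (hrK : r ≤ K.size) :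
    ∃ c, Metric.ball c (r / (Λ * (d + 1))) ⊆ interior K.body ∩ Metric.ball z (2 * r) := by
  have hs := h.size_pos
  have hΛ := h.pos
  -- The centre is obtained by moving from `z` towards the barycentre `b` by the fraction `r /
  -- K.size`. There every coordinate is at least `t / (d + 1)`, and within the stated radius it
  -- changes by less than that.
  set b : E d := ∑ i, (1 / ((d : ℝ) + 1)) • K.verts i with hb
  have hw : ∑ _i : Fin (d + 1), (1 / ((d : ℝ) + 1)) = 1 := by
    simp; field_simp
  have hbb : ∀ i, bc K i b = 1 / ((d : ℝ) + 1) := fun i => bc_of_comb h.indep hw i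
  have hbK : b ∈ K.body := (mem_body_iff h.indep).mpr fun i => by rw [hbb]; positivity
  set t : ℝ := r / K.size with ht
  have ht0 : 0 < t := by positivity
  have ht1 : t ≤ 1 := (div_le_one hs).mpr hrK
  refine ⟨AffineMap.lineMap z b t, fun x hx => ⟨?_, ?_⟩⟩
  · rw [mem_interior_iff h.indep]
    intro i
    have hxc : ‖x - AffineMap.lineMap z b t‖ < (t / (d + 1)) * K.size / Λ := by
      rw [Metric.mem_ball, dist_eq_norm] at hx
      refine hx.trans_eq ?_
      rw [ht]; field_simp
    have h1 := (abs_lt.mp (h.abs_bc_sub_lt hxc i)).1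
    rw [AffineMap.apply_lineMap, hbb, AffineMap.lineMap_apply_ring'] at h1
    have h2 := (mem_body_iff h.indep).mp hz i
    have h3 : t * (1 / ((d:ℝ) + 1)) = t / (d + 1) := by ring
    nlinarith [mul_nonneg (sub_nonneg.mpr ht1) h2]
  · rw [Metric.mem_ball, dist_eq_norm] at hx ⊢
    have h1 : ‖AffineMap.lineMap z b t - z‖ ≤ r := by
      rw [AffineMap.lineMap_apply, vsub_eq_sub, vadd_eq_add, add_sub_cancel_right, norm_smul,
        Real.norm_eq_abs, abs_of_pos ht0]
      have h2 : ‖b - z‖ ≤ K.size := K.norm_sub_le_diam hbK hz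
      calc t * ‖b - z‖ ≤ t * K.size := by gcongr
        _ = r := by rw [ht]; field_simp
    have h2 : r / (Λ * (d + 1)) ≤ r := div_le_self hr.le (by nlinarith [h.one_le, (Nat.cast_nonneg d : (0:ℝ) ≤ d)])
    have h3 := norm_add_le (x - AffineMap.lineMap z b t) (AffineMap.lineMap z b t - z)
    rw [sub_add_sub_cancel] at h3
    linarith

end ShapeRegular

/-- The volume of the unit ball. -/
def unitVol (d : ℕ) : ℝ := volume.real (Metric.ball (0 : E d) 1)

lemma unitVol_pos (d : ℕ) : 0 < unitVol d := by
  rw [unitVol, measureReal_def]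
  exact ENNReal.toReal_pos (Metric.measure_ball_pos volume _ one_pos).ne' Metric.isBounded_ball.measure_lt_top.ne

lemma volume_real_ball {d : ℕ} (x : E d) {r : ℝ} (hr : 0 < r) :
    volume.real (Metric.ball x r) = r ^ d * unitVol d := by
  rw [measureReal_def, Measure.addHaar_ball_of_pos _ _ hr, ENNReal.toReal_mul,
    ENNReal.toReal_ofReal (by positivity), finrank_euclideanSpace_fin, unitVol, measureReal_def]

section Mesh

variable {d : ℕ} {Ω : Set (E d)} {T : Mesh d} {Λ : ℝ}

/-- The number of elements around a point is bounded. -/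
lemma IsRegularTriangulation.ncard_star_le (hT : IsRegularTriangulation Ω T)
    (hΛ : ∀ K ∈ T, ShapeRegular Λ K) {z : E d} (hne : {K ∈ T | z ∈ K.body}.Nonempty) :
    ({K ∈ T | z ∈ K.body}.ncard : ℝ) ≤ (2 * Λ * (d + 1)) ^ d := by
  set S : Set (TaggedSimplex d) := {K ∈ T | z ∈ K.body} with hS
  have hfin : S.Finite := hT.finite.subset (sep_subset _ _)
  -- The smallest element of the star sets the scale: each element contains a ball of radius `r / (Λ
  -- * (d + 1))` inside the ball of radius `2 * r` around `z`, these balls are disjoint, and volumes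
  -- are compared.
  obtain ⟨K₀, hK₀, hmin⟩ := exists_min_image S TaggedSimplex.size hfin hne
  have hΛ0 := (hΛ K₀ hK₀.1).pos
  set r := K₀.size with hr
  have hr0 : 0 < r := (hΛ K₀ hK₀.1).size_pos
  choose! c hc using fun K (hK : K ∈ S) => (hΛ K hK.1).exists_ball hK.2 hr0 (hmin K hK)
  set ρ := r / (Λ * (d + 1)) with hρ
  have hρ0 : 0 < ρ := by positivity
  have hdisj : (hfin.toFinset : Set (TaggedSimplex d)).PairwiseDisjoint
      fun K => Metric.ball (c K) ρ := by
    intro K hK K' hK' hne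
    rw [Finite.coe_toFinset] at hK hK'
    refine disjoint_left.mpr fun x hx hx' => hne ?_
    exact hT.eq_of_mem_interior hK.1 hK'.1 (hc K hK hx).1 (interior_subset (hc K' hK' hx').1)
  have h1 : volume.real (⋃ K ∈ hfin.toFinset, Metric.ball (c K) ρ)
      ≤ volume.real (Metric.ball z (2 * r)) := by
    refine measureReal_mono ?_ Metric.isBounded_ball.measure_lt_top.ne
    refine iUnion₂_subset fun K hK => (hc K (hfin.mem_toFinset.mp hK)).trans inter_subset_right
  rw [measureReal_biUnion_finset hdisj (fun _ _ => measurableSet_ball)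
    (fun _ _ => Metric.isBounded_ball.measure_lt_top.ne), volume_real_ball _ (by positivity)] at h1
  simp_rw [volume_real_ball _ hρ0] at h1
  rw [Finset.sum_const, nsmul_eq_mul, ← ncard_eq_toFinset_card S hfin, ← mul_assoc] at h1
  have h2 := le_of_mul_le_mul_right h1 (unitVol_pos d)
  have h3 : (2 * r) ^ d = (2 * Λ * (d + 1)) ^ d * ρ ^ d := by
    rw [← mul_pow, hρ]; congr 1; field_simp
  rw [h3] at h2
  exact le_of_mul_le_mul_right h2 (by positivity)

/-- In dimension at least two a facet has an edge. It belongs to both elements, and shape regularity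
bounds each diameter by `Λ` times the length of this edge. -/
lemma IsRegularTriangulation.size_le_of_facetAdj (hd : 2 ≤ d) {K K' : TaggedSimplex d}
    (hK : ShapeRegular Λ K) (hK' : ShapeRegular Λ K') (h : FacetAdj K K') :
    K.size ≤ Λ * K'.size ∧ K'.size ≤ Λ * K.size := by
  obtain ⟨i, hi⟩ := h
  obtain ⟨k, hk, l, hl, hkl⟩ : ∃ k, k ≠ i ∧ ∃ l, l ≠ i ∧ k ≠ l := by
    have hcard : 1 < ((Finset.univ : Finset (Fin (d + 1))).erase i).card := by
      rw [Finset.card_erase_of_mem (Finset.mem_univ _), Finset.card_univ, Fintype.card_fin]; omega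
    obtain ⟨k, hk, l, hl, hkl⟩ := Finset.one_lt_card.mp hcard
    exact ⟨k, Finset.ne_of_mem_erase hk, l, Finset.ne_of_mem_erase hl, hkl⟩
  obtain ⟨k', hk'⟩ := hi k hk
  obtain ⟨l', hl'⟩ := hi l hl
  have hkl' : k' ≠ l' := fun h => hkl (hK.indep.injective (by rw [← hk', ← hl', h]))
  constructor
  · refine (hK.size_le_mul_norm hkl).trans (mul_le_mul_of_nonneg_left ?_ hK.pos.le)
    rw [← hk', ← hl']
    exact K'.norm_sub_le_diam (K'.vert_mem_body _) (K'.vert_mem_body _)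
  · refine (hK'.size_le_mul_norm hkl').trans (mul_le_mul_of_nonneg_left ?_ hK.pos.le)
    rw [hk', hl']
    exact K.norm_sub_le_diam (K.vert_mem_body _) (K.vert_mem_body _)

/-- Adjacent elements contain a ball around the barycenter of their common facet. -/
lemma IsRegularTriangulation.exists_ball_of_facetAdj (hT : IsRegularTriangulation Ω T)
    {K K' : TaggedSimplex d} (hK : K ∈ T) (hK' : K' ∈ T) (hne : K ≠ K') (h : FacetAdj K K')
    (hΛ : ShapeRegular Λ K) (hΛ' : ShapeRegular Λ K') {ρ : ℝ} (hρ0 : 0 < ρ)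
    (hρ : ρ ≤ 1 / d * K.size / Λ) (hρ' : ρ ≤ 1 / d * K'.size / Λ) :
    ∃ b, b ∈ K.body ∧ b ∈ K'.body ∧ Metric.ball b ρ ⊆ K.body ∪ K'.body := by
  classical
  obtain ⟨i, hi⟩ := h
  have hd : (0:ℝ) < d := Nat.cast_pos.mpr K.dim_pos
  have hn := hΛ.indep
  have hn' := hΛ'.indep
  choose! e he using hi
  have heinj : ∀ k, k ≠ i → ∀ l, l ≠ i → e k = e l → k = l := fun k hk l hl hkl =>
    hn.injective (by rw [← he k hk, ← he l hl, hkl])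
  -- By counting, one vertex of `K'` is missed by the shared vertices; it is opposite to the common
  -- facet, as `i` is in `K`.
  obtain ⟨j, hj⟩ : ∃ j, ∀ k, k ≠ i → e k ≠ j := by
    by_contra hcon
    push Not at hcon
    choose u hu hu' using hcon
    have : Function.Injective u := fun a b hab => by rw [← hu' a, ← hu' b, hab]
    obtain ⟨a, ha⟩ := Finite.surjective_of_injective this i
    exact hu a ha
  have hsurj : ∀ j', j' ≠ j → ∃ k, k ≠ i ∧ e k = j' := by
    let F : {k // k ≠ i} → {j' // j' ≠ j} := fun k => ⟨e k.1, hj k.1 k.2⟩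
    have hF : Function.Bijective F := by
      rw [Fintype.bijective_iff_injective_and_card]
      refine ⟨fun a b hab => Subtype.ext (heinj _ a.2 _ b.2 (congrArg Subtype.val hab)), ?_⟩
      rw [Fintype.card_subtype_compl, Fintype.card_subtype_compl]; simp
    intro j' hj'
    obtain ⟨k, hk⟩ := hF.2 ⟨j', hj'⟩
    exact ⟨k.1, k.2, congrArg Subtype.val hk⟩
  set w : Fin (d + 1) → ℝ := fun k => if k = i then 0 else 1 / d with hw
  have hwsum : ∑ k, w k = 1 := by
    rw [hw, Finset.sum_ite, Finset.sum_const_zero, zero_add, Finset.sum_const, nsmul_eq_mul]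
    have : ({x ∈ (Finset.univ : Finset (Fin (d + 1))) | ¬ x = i}).card = d := by
      rw [Finset.filter_ne' Finset.univ i, Finset.card_erase_of_mem (Finset.mem_univ _),
        Finset.card_univ, Fintype.card_fin, Nat.add_sub_cancel]
    rw [this]; field_simp
  set b : E d := ∑ k, w k • K.verts k with hb
  have hbK : ∀ k, bc K k b = w k := fun k => bc_of_comb hn hwsum k
  have hbi : bc K i b = 0 := by rw [hbK]; simp [hw]
  have hbk : ∀ k, k ≠ i → bc K k b = 1 / d := fun k hk => by rw [hbK]; simp [hw, hk]
  have hb' : ∀ j', bc K' j' b = ∑ k, w k * bc K' j' (K.verts k) := fun j' => by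
    rw [affine_eq_bc hn]; simp_rw [hbK]
  have hbk' : ∀ k, k ≠ i → bc K' (e k) b = 1 / d := by
    intro k hk
    rw [hb', Finset.sum_eq_single k]
    · rw [← he k hk, bc_vert hn', if_pos rfl, mul_one]; simp [hw, hk]
    · intro l _ hlk
      by_cases hl : l = i
      · simp [hw, hl]
      · rw [← he l hl, bc_vert hn', if_neg (fun h => hlk (heinj l hl k hk h.symm)), mul_zero]
    · simp
  -- Both coordinates vanish on the common facet, so one is a multiple of the other.
  have hfj : ∀ x, bc K' j x = bc K i x * bc K' j (K.verts i) := by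
    intro x
    rw [affine_eq_bc hn, Finset.sum_eq_single i]
    · intro k _ hk
      rw [← he k hk, bc_vert hn', if_neg (hj k hk).symm, mul_zero]
    · simp
  have hball : ∀ x ∈ Metric.ball b ρ, ∀ k, k ≠ i → 0 < bc K k x := by
    intro x hx k hk
    rw [Metric.mem_ball, dist_eq_norm] at hx
    have := (abs_lt.mp (hΛ.abs_bc_sub_lt (hx.trans_le hρ) k)).1
    rw [hbk k hk] at this; linarith
  have hball' : ∀ x ∈ Metric.ball b ρ, ∀ j', j' ≠ j → 0 < bc K' j' x := by
    intro x hx j' hj'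
    obtain ⟨k, hk, rfl⟩ := hsurj j' hj'
    rw [Metric.mem_ball, dist_eq_norm] at hx
    have := (abs_lt.mp (hΛ'.abs_bc_sub_lt (hx.trans_le hρ') (e k))).1
    rw [hbk' k hk] at this; linarith
  have hbb := Metric.mem_ball_self (x := b) hρ0
  -- Were the factor nonnegative, points slightly inside `K` would lie in `K'` as well. Hence the
  -- elements lie on opposite sides of the facet and together cover a ball around its barycentre.
  have hc : bc K' j (K.verts i) < 0 := by
    by_contra hcon
    push Not at hcon
    have hlim : Tendsto (fun t : ℝ => AffineMap.lineMap b (K.verts i) t) (𝓝[>] 0) (𝓝 b) := by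
      have : Tendsto (fun t : ℝ => AffineMap.lineMap b (K.verts i) t) (𝓝 0)
          (𝓝 (AffineMap.lineMap b (K.verts i) (0:ℝ))) := Continuous.tendsto (by fun_prop) 0
      rw [AffineMap.lineMap_apply_zero] at this
      exact this.mono_left nhdsWithin_le_nhds
    obtain ⟨t, ht, ht0⟩ := ((hlim.eventually (Metric.ball_mem_nhds b hρ0)).and
      self_mem_nhdsWithin).exists
    have ht0 : (0:ℝ) < t := ht0
    set x := AffineMap.lineMap b (K.verts i) t with hx
    have hxi : bc K i x = t := by
      rw [hx, AffineMap.apply_lineMap, hbi, bc_vert hn, if_pos rfl,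
        AffineMap.lineMap_apply_ring']; ring
    refine hne (hT.eq_of_mem_interior hK hK' (x := x) ?_ ?_)
    · rw [mem_interior_iff hn]
      intro k
      by_cases hk : k = i
      · rw [hk, hxi]; exact ht0
      · exact hball x ht k hk
    · rw [mem_body_iff hn']
      intro j'
      by_cases hj' : j' = j
      · rw [hj', hfj, hxi]; exact mul_nonneg ht0.le hcon
      · exact (hball' x ht j' hj').le
  have key : ∀ x ∈ Metric.ball b ρ, (0 ≤ bc K i x → x ∈ K.body) ∧ (bc K i x ≤ 0 → x ∈ K'.body) := by
    intro x hx
    refine ⟨fun h => (mem_body_iff hn).mpr fun k => ?_, fun h => (mem_body_iff hn').mpr fun j' => ?_⟩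
    · by_cases hk : k = i
      · rw [hk]; exact h
      · exact (hball x hx k hk).le
    · by_cases hj' : j' = j
      · rw [hj', hfj]; exact mul_nonneg_of_nonpos_of_nonpos h hc.le
      · exact (hball' x hx j' hj').le
  refine ⟨b, (key b hbb).1 hbi.ge, (key b hbb).2 hbi.le, fun x hx => ?_⟩
  rcases le_total 0 (bc K i x) with h | h
  · exact Or.inl ((key x hx).1 h)
  · exact Or.inr ((key x hx).2 h)

end Mesh

/-! ### Comparison of mean values on touching elements. -/

section Averages

variable {d : ℕ} {Ω : Set (E d)} {T : Mesh d} {Λ : ℝ}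

lemma poincare_body {K : TaggedSimplex d} (hK : AffineIndependent ℝ K.verts)
    (hKΩ : interior K.body ⊆ Ω) (v : H1 Ω) :
    ∫ x in K.body, (fn v x - mean K v) ^ 2 ≤ 4 * 2 ^ d * K.size ^ 2 * energy K.body v := by
  have h := poincare K.body_convex.interior isOpen_interior
    (K.body_bounded.subset interior_subset) (interior_body_nonempty hK) hKΩ (δ := K.size)
    (fun x hx y hy => K.norm_sub_le_diam (interior_subset hx) (interior_subset hy)) v
  have hvol : volume.restrict (interior K.body) = volume.restrict K.body := K.volOn_body.symm
  have e : energy (interior K.body) v = energy K.body v := by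
    simp only [energy]
    exact Finset.sum_congr rfl fun j _ => by rw [hvol]
  rw [e, hvol] at h
  exact h

lemma setIntegral_sq_mono {A B : Set (E d)} (hAB : A ⊆ B) {f : E d → ℝ}
    (hf : MemLp f 2 (volOn B)) : ∫ x in A, f x ^ 2 ≤ ∫ x in B, f x ^ 2 :=
  setIntegral_mono_set hf.integrable_sq (Eventually.of_forall fun _ => sq_nonneg _)
    (Eventually.of_forall hAB)

/-- Constants close to a function on two sets are close to each other. -/
lemma measure_mul_sub_sq_le {A B C : Set (E d)} (hAB : A ⊆ B) (hAC : A ⊆ C)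
    (hB : volume B ≠ ⊤) (hC : volume C ≠ ⊤) {f : E d → ℝ} (hfB : MemLp f 2 (volOn B))
    (hfC : MemLp f 2 (volOn C)) (a b : ℝ) :
    volume.real A * (a - b) ^ 2
      ≤ 2 * (∫ x in B, (f x - a) ^ 2) + 2 * ∫ x in C, (f x - b) ^ 2 := by
  have hBf : IsFiniteMeasure (volOn B) := ⟨by simpa using hB.lt_top⟩
  have hCf : IsFiniteMeasure (volOn C) := ⟨by simpa using hC.lt_top⟩
  have h1 : MemLp (fun x => f x - a) 2 (volOn B) := hfB.sub (memLp_const a)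
  have h2 : MemLp (fun x => f x - b) 2 (volOn C) := hfC.sub (memLp_const b)
  have h1A := h1.mono_measure (Measure.restrict_mono hAB le_rfl)
  have h2A := h2.mono_measure (Measure.restrict_mono hAC le_rfl)
  have h3 := integral_add_sq_le h1A.neg h2A
  have e : ∫ x in A, ((-fun x => f x - a) x + (f x - b)) ^ 2 = volume.real A * (a - b) ^ 2 := by
    have : ∀ x, ((-fun x => f x - a) x + (f x - b)) ^ 2 = (a - b) ^ 2 := fun x => by
      simp only [Pi.neg_apply]; ring
    simp_rw [this]
    rw [setIntegral_const, smul_eq_mul]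
  rw [e] at h3
  have h4 := setIntegral_sq_mono hAB h1
  have h5 := setIntegral_sq_mono hAC h2
  have h6 : ∫ x in A, ((-fun x => f x - a) x) ^ 2 = ∫ x in A, (f x - a) ^ 2 := by
    congr 1; ext x; simp only [Pi.neg_apply]; ring
  rw [h6] at h3
  linarith

lemma energy_le_of_subset_union {K K' : TaggedSimplex d} {B : Set (E d)}
    (hB : B ⊆ K.body ∪ K'.body) (hKΩ : interior K.body ⊆ Ω) (hKΩ' : interior K'.body ⊆ Ω)
    (v : H1 Ω) : energy B v ≤ energy K.body v + energy K'.body v := by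
  simp only [energy]
  rw [← Finset.sum_add_distrib]
  refine Finset.sum_le_sum fun j _ => ?_
  have h1 := (memLp_grad_body hKΩ v j).integrable_sq
  have h2 := (memLp_grad_body hKΩ' v j).integrable_sq
  rw [← integral_add_measure h1 h2]
  exact integral_mono_measure ((Measure.restrict_mono hB le_rfl).trans
    (Measure.restrict_union_le _ _)) (Eventually.of_forall fun _ => sq_nonneg _) (h1.add_measure h2)

/-- The mean values on adjacent elements are close to each other. -/
lemma IsRegularTriangulation.mean_sub_sq_le (hT : IsRegularTriangulation Ω T)
    (hΩ : IsBoundedLipschitzDomain Ω) (hd : 2 ≤ d) {K K' : TaggedSimplex d} (hK : K ∈ T)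
    (hK' : K' ∈ T) (h : FacetAdj K K') (hΛ : ShapeRegular Λ K) (hΛ' : ShapeRegular Λ K')
    (v : H1 Ω) : (mean K v - mean K' v) ^ 2
      ≤ 64 * 2 ^ d * Λ ^ 2 * (4 * d * Λ ^ 3 * (d + 1)) ^ d / unitVol d * (K.size ^ 2
        * (K.size ^ d)⁻¹) * (energy K.body v + energy K'.body v) := by
  have hTΩ := hT.interior_body_subset hΩ
  have hs := hΛ.size_pos
  have hs' := hΛ'.size_pos
  have hΛ0 := hΛ.pos
  have hΛ1 := hΛ.one_le
  have he := energy_nonneg K.body v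
  have he' := energy_nonneg K'.body v
  have hu := unitVol_pos d
  have hd0 : (0:ℝ) < d := by positivity
  have hd2 : (2:ℝ) ≤ d := by exact_mod_cast hd
  by_cases hne : K = K'
  · subst hne
    rw [sub_self, zero_pow two_ne_zero]; positivity
  obtain ⟨hss', hs's⟩ := IsRegularTriangulation.size_le_of_facetAdj hd hΛ hΛ' h
  -- The second factor `Λ` allows for `K'` being smaller than `K`, and the `2` keeps the diameter of
  -- the ball below that of `K`.
  set ρ := K.size / (2 * d * Λ ^ 2) with hρ
  have hρ0 : 0 < ρ := by positivity
  have hρΛ : ρ * (2 * d * Λ ^ 2) = K.size := by rw [hρ]; field_simp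
  have hΛΛ : Λ ≤ Λ ^ 2 := by nlinarith
  have hρ1 : ρ ≤ 1 / d * K.size / Λ := by
    rw [le_div_iff₀ hΛ0, ← hρΛ]
    have : 1 / (d:ℝ) * (ρ * (2 * d * Λ ^ 2)) = ρ * (2 * Λ ^ 2) := by field_simp
    rw [this]; gcongr; linarith
  have hρ2 : ρ ≤ 1 / d * K'.size / Λ := by
    rw [le_div_iff₀ hΛ0]
    have h1 : ρ * (2 * d * Λ ^ 2) ≤ Λ * K'.size := hρΛ.trans_le hss'
    have h2 : ρ * Λ * (2 * d) ≤ K'.size := le_of_mul_le_mul_left (by linarith) hΛ0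
    have h3 : ρ * Λ * d ≤ K'.size := le_trans (by
      have : 0 ≤ ρ * Λ * d := by positivity
      linarith) h2
    rw [one_div, inv_mul_eq_div, le_div_iff₀ hd0]; exact h3
  have hρK : ρ ≤ K.size := by
    rw [← hρΛ]; refine le_mul_of_one_le_right hρ0.le ?_; nlinarith
  have hρK' : ρ ≤ K'.size := by
    refine hρ2.trans ((div_le_self (by positivity) hΛ1).trans ?_)
    rw [one_div, inv_mul_eq_div]; exact div_le_self hs'.le (by linarith)
  obtain ⟨b, hbK, hbK', hB⟩ := hT.exists_ball_of_facetAdj hK hK' hne h hΛ hΛ' hρ0 hρ1 hρ2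
  have hBΩ : Metric.ball b ρ ⊆ Ω := by
    rw [← hΩ.interior_closure]
    refine interior_maximal (hB.trans (union_subset ?_ ?_)) Metric.isOpen_ball
    · rw [← hT.cover]; exact subset_biUnion_of_mem (u := fun K : TaggedSimplex d => K.body) hK
    · rw [← hT.cover]; exact subset_biUnion_of_mem (u := fun K : TaggedSimplex d => K.body) hK'
  -- The mean over a ball across the common facet is the link: on each side it is compared with the
  -- mean of the element on a smaller ball contained in both sets, by two Poincaré inequalities.
  set β := avg (Metric.ball b ρ) (fn v) with hβ
  have hP := poincare (convex_ball b ρ) Metric.isOpen_ball Metric.isBounded_ball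
    ⟨b, Metric.mem_ball_self hρ0⟩ hBΩ (δ := 2 * ρ) (fun x hx y hy => by
      rw [Metric.mem_ball, dist_eq_norm] at hx hy
      have : x - y = (x - b) - (y - b) := by abel
      rw [this]; exact (norm_sub_le _ _).trans (by linarith)) v
  have hE := energy_le_of_subset_union hB (hTΩ K hK) (hTΩ K' hK') v
  have h2ρ : 2 * ρ ≤ K.size := by
    rw [← hρΛ]
    have : 1 ≤ Λ ^ 2 := by nlinarith
    have : (2:ℝ) ≤ 2 * d * Λ ^ 2 := by nlinarith
    nlinarith
  have hP' : ∫ x in Metric.ball b ρ, (fn v x - β) ^ 2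
      ≤ 4 * 2 ^ d * K.size ^ 2 * (energy K.body v + energy K'.body v) :=
    hP.trans (by have := energy_nonneg (Metric.ball b ρ) v; gcongr)
  have hball_top : volume (Metric.ball b ρ) ≠ ⊤ := Metric.isBounded_ball.measure_lt_top.ne
  have hfB := memLp_fn_of_subset hBΩ v
  set q := ρ / 2 / (Λ * (d + 1)) with hq
  have hq0 : 0 < q := by positivity
  have step : ∀ L ∈ T, ShapeRegular Λ L → b ∈ L.body → ρ ≤ L.size → L.size ≤ Λ * K.size →
      energy L.body v ≤ energy K.body v + energy K'.body v →
      q ^ d * unitVol d * (mean L v - β) ^ 2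
        ≤ 16 * 2 ^ d * Λ ^ 2 * K.size ^ 2 * (energy K.body v + energy K'.body v) := by
    intro L hL hLΛ hbL hρL hLK hLE
    obtain ⟨c, hc⟩ := hLΛ.exists_ball hbL (half_pos hρ0) (by linarith)
    rw [mul_div_cancel₀ ρ two_ne_zero] at hc
    have h1 := measure_mul_sub_sq_le ((hc.trans inter_subset_left).trans interior_subset)
      (hc.trans inter_subset_right) L.body_compact.measure_lt_top.ne hball_top
      (memLp_body (hTΩ L hL) v) hfB (mean L v) β
    rw [volume_real_ball _ hq0] at h1
    have h2 := poincare_body hLΛ.indep (hTΩ L hL) v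
    have h3 : 4 * 2 ^ d * L.size ^ 2 * energy L.body v
        ≤ 4 * 2 ^ d * (Λ * K.size) ^ 2 * (energy K.body v + energy K'.body v) := by
      have := hLΛ.size_pos
      have := energy_nonneg L.body v
      gcongr
    have h4 : 4 * 2 ^ d * K.size ^ 2 * (energy K.body v + energy K'.body v)
        ≤ 4 * 2 ^ d * (Λ * K.size) ^ 2 * (energy K.body v + energy K'.body v) := by
      gcongr; exact le_mul_of_one_le_left hs.le hΛ1
    refine (h1.trans (add_le_add (mul_le_mul_of_nonneg_left (h2.trans h3) zero_le_two)
      (mul_le_mul_of_nonneg_left (hP'.trans h4) zero_le_two))).trans_eq ?_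
    ring
  have s1 := step K hK hΛ hbK hρK (le_mul_of_one_le_left hs.le hΛ1) (by linarith)
  have s2 := step K' hK' hΛ' hbK' hρK' hs's (by linarith)
  have hqd : q ^ d = K.size ^ d / (4 * d * Λ ^ 3 * (d + 1)) ^ d := by
    rw [← div_pow, hq, hρ]; congr 1; field_simp; norm_num
  set X := energy K.body v + energy K'.body v with hX
  have hfin : q ^ d * unitVol d * (mean K v - mean K' v) ^ 2
      ≤ 64 * 2 ^ d * Λ ^ 2 * K.size ^ 2 * X := by
    have h5 : (mean K v - mean K' v) ^ 2 ≤ 2 * (mean K v - β) ^ 2 + 2 * (mean K' v - β) ^ 2 := by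
      nlinarith [sq_nonneg ((mean K v - β) + (mean K' v - β))]
    calc q ^ d * unitVol d * (mean K v - mean K' v) ^ 2
        ≤ q ^ d * unitVol d * (2 * (mean K v - β) ^ 2 + 2 * (mean K' v - β) ^ 2) := by gcongr
      _ = 2 * (q ^ d * unitVol d * (mean K v - β) ^ 2)
          + 2 * (q ^ d * unitVol d * (mean K' v - β) ^ 2) := by ring
      _ ≤ 2 * (16 * 2 ^ d * Λ ^ 2 * K.size ^ 2 * X) + 2 * (16 * 2 ^ d * Λ ^ 2 * K.size ^ 2 * X) := by
          gcongr
      _ = _ := by ring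
  rw [hqd] at hfin
  have hpos : 0 < K.size ^ d / (4 * d * Λ ^ 3 * (d + 1)) ^ d * unitVol d := by positivity
  rw [mul_comm, ← le_div_iff₀ hpos] at hfin
  refine hfin.trans_eq ?_
  field_simp

/-- Sizes and mean values of elements which share a point are comparable. -/
theorem exists_star_bound (hd : 2 ≤ d) (Λ : ℝ) : ∃ κ : ℝ, 1 ≤ κ ∧ ∃ C : ℝ, 0 ≤ C ∧
    ∀ {Ω : Set (E d)} {T : Mesh d}, IsBoundedLipschitzDomain Ω → IsRegularTriangulation Ω T →
      (∀ K ∈ T, ShapeRegular Λ K) → ∀ z, ∀ K ∈ T, z ∈ K.body → ∀ K' ∈ T, z ∈ K'.body →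
      K.size ≤ κ * K'.size ∧ ∀ (v : H1 Ω) (X : ℝ),
        (∀ L ∈ T, z ∈ L.body → energy L.body v ≤ X) →
        (mean K v - mean K' v) ^ 2 ≤ C * (K.size ^ 2 * (K.size ^ d)⁻¹) * X := by
  -- A bound for the number of elements around a point, hence for the length of a chain; it is a
  -- natural number because it becomes an exponent in `κ`.
  obtain ⟨N, hN⟩ := exists_nat_ge ((2 * Λ * (d + 1)) ^ d)
  set Λ' := max Λ 1 with hΛ'
  have hΛ1 : 1 ≤ Λ' := le_max_right _ _
  set C₀ := 64 * 2 ^ d * Λ ^ 2 * (4 * d * Λ ^ 3 * (d + 1)) ^ d / unitVol d with hC₀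
  set κ := Λ' ^ N with hκ
  have hκ1 : 1 ≤ κ := one_le_pow₀ hΛ1
  refine ⟨κ, hκ1, N ^ 2 * (|C₀| * κ ^ 2 * κ ^ d * 2), by positivity, ?_⟩
  intro Ω T hΩ hT hΛ z K hK hz K' hK' hz'
  set S : Set (TaggedSimplex d) := {L ∈ T | z ∈ L.body} with hS
  have hSfin : S.Finite := hT.finite.subset (sep_subset _ _)
  have hSN : (S.ncard : ℝ) ≤ N := (hT.ncard_star_le hΛ ⟨K, hK, hz⟩).trans hN
  have hchain : ∀ L ∈ S, Relation.ReflTransGen (fun x y => y ∈ S ∧ FacetAdj x y) K L :=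
    fun L hL => hT.star_connected hΩ hK hL.1 hz hL.2
  have hlog0 : 0 ≤ Real.log Λ' := Real.log_nonneg hΛ1
  -- Logarithms make the comparison of sizes additive, so that the same chain argument serves sizes
  -- and mean values.
  have hlog : ∀ a ∈ S, ∀ b ∈ S, FacetAdj a b →
      |Real.log a.size - Real.log b.size| ≤ Real.log Λ' := by
    intro a ha b hb hab
    obtain ⟨h1, h2⟩ := IsRegularTriangulation.size_le_of_facetAdj hd (hΛ a ha.1) (hΛ b hb.1) hab
    have ha0 := (hΛ a ha.1).size_pos
    have hb0 := (hΛ b hb.1).size_pos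
    have hΛ0 : 0 < Λ' := zero_lt_one.trans_le hΛ1
    have h1' : a.size ≤ Λ' * b.size := h1.trans (by gcongr; exact le_max_left _ _)
    have h2' : b.size ≤ Λ' * a.size := h2.trans (by gcongr; exact le_max_left _ _)
    have h3 := Real.log_le_log ha0 h1'
    have h4 := Real.log_le_log hb0 h2'
    rw [Real.log_mul hΛ0.ne' hb0.ne'] at h3
    rw [Real.log_mul hΛ0.ne' ha0.ne'] at h4
    rw [abs_le]; constructor <;> linarith
  have hsize : ∀ L ∈ S, K.size ≤ κ * L.size ∧ L.size ≤ κ * K.size := by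
    intro L hL
    have h := abs_sub_le_of_reflTransGen hSfin hlog0 hlog (show K ∈ S from ⟨hK, hz⟩) (hchain L hL)
    have hK0 := (hΛ K hK).size_pos
    have hL0 := (hΛ L hL.1).size_pos
    have hκ0 : 0 < κ := by positivity
    have h' : |Real.log K.size - Real.log L.size| ≤ Real.log κ := by
      rw [hκ, Real.log_pow]
      exact h.trans (mul_le_mul_of_nonneg_right hSN hlog0)
    rw [abs_le] at h'
    constructor
    · rw [← Real.log_le_log_iff hK0 (by positivity), Real.log_mul hκ0.ne' hL0.ne']; linarith
    · rw [← Real.log_le_log_iff hL0 (by positivity), Real.log_mul hκ0.ne' hK0.ne']; linarith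
  refine ⟨(hsize K' ⟨hK', hz'⟩).1, fun v X hX => ?_⟩
  have hK0 := (hΛ K hK).size_pos
  have hX0 : 0 ≤ X := (energy_nonneg _ v).trans (hX K hK hz)
  set Y := |C₀| * κ ^ 2 * κ ^ d * 2 * (K.size ^ 2 * (K.size ^ d)⁻¹) * X with hY
  have hY0 : 0 ≤ Y := by positivity
  have hadj : ∀ a ∈ S, ∀ b ∈ S, FacetAdj a b → |mean a v - mean b v| ≤ √Y := by
    intro a ha b hb hab
    refine Real.abs_le_sqrt ?_
    refine (hT.mean_sub_sq_le hΩ hd ha.1 hb.1 hab (hΛ a ha.1) (hΛ b hb.1) v).trans ?_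
    have ha0 := (hΛ a ha.1).size_pos
    have h1 := hX a ha.1 ha.2
    have h2 := hX b hb.1 hb.2
    have h3 := energy_nonneg a.body v
    have h4 := energy_nonneg b.body v
    have h5 : (a.size ^ d)⁻¹ ≤ κ ^ d * (K.size ^ d)⁻¹ := by
      rw [← div_eq_mul_inv, ← one_div, div_le_div_iff₀ (by positivity) (by positivity), one_mul,
        ← mul_pow]
      gcongr
      exact (hsize a ha).1
    calc C₀ * (a.size ^ 2 * (a.size ^ d)⁻¹) * (energy a.body v + energy b.body v)
        ≤ |C₀| * (a.size ^ 2 * (a.size ^ d)⁻¹) * (energy a.body v + energy b.body v) := by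
          gcongr; exact le_abs_self _
      _ ≤ |C₀| * ((κ * K.size) ^ 2 * (κ ^ d * (K.size ^ d)⁻¹)) * (X + X) := by
          gcongr; exact (hsize a ha).2
      _ = Y := by rw [hY]; ring
  have h := abs_sub_le_of_reflTransGen hSfin (Real.sqrt_nonneg Y) hadj (show K ∈ S from ⟨hK, hz⟩)
    (hchain K' ⟨hK', hz'⟩)
  have h' : |mean K v - mean K' v| ≤ N * √Y :=
    h.trans (mul_le_mul_of_nonneg_right hSN (Real.sqrt_nonneg _))
  have h2 := pow_le_pow_left₀ (abs_nonneg _) h' 2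
  rw [sq_abs, mul_pow, Real.sq_sqrt hY0] at h2
  refine h2.trans_eq ?_
  rw [hY]; ring

end Averages

/-! ### Local stability and approximation. -/

section Local

variable {d : ℕ} {Ω : Set (E d)} {T : Mesh d} {p : ℕ} {σ : E d → Carrier d}

/-- Every element is, up to translation, a multiple of one of the given simplices. -/
def Shaped {d : ℕ} (𝓡 : Set (TaggedSimplex d)) (T : Mesh d) : Prop :=
  ∀ K ∈ T, ∃ R ∈ 𝓡, ∃ a, IsScaled R K a K.size

/-- The coordinates of a translated and scaled copy have the Lipschitz constant of the reference
simplex divided by the scale, so finitely many reference simplices give one constant. -/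
lemma exists_shapeRegular {𝓡 : Set (TaggedSimplex d)} (h𝓡 : 𝓡.Finite)
    (hR : ∀ R ∈ 𝓡, AffineIndependent ℝ R.verts) :
    ∃ Λ : ℝ, ∀ T : Mesh d, Shaped 𝓡 T → ∀ K ∈ T, ShapeRegular Λ K := by
  choose L hL hL' using fun R : TaggedSimplex d => exists_lipschitz_bc R
  obtain ⟨Λ, hΛ⟩ := (h𝓡.image L).bddAbove
  refine ⟨Λ, fun T hT K hK => ?_⟩
  obtain ⟨R, hR', a, h⟩ := hT K hK
  refine ⟨h.affineIndependent (hR R hR'), fun i x y => ?_⟩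
  have hs := h.pos
  have e : ∀ x, bc K i x = bc R i (K.size⁻¹ • (x - a)) := fun x => by
    rw [← bc_scaled h (hR R hR'), smul_smul, mul_inv_cancel₀ hs.ne', one_smul, add_sub_cancel]
  have h1 := hL' R i (K.size⁻¹ • (x - a)) (K.size⁻¹ • (y - a))
  rw [← e, ← e, ← smul_sub, sub_sub_sub_cancel_right, norm_smul, Real.norm_eq_abs,
    abs_of_pos (inv_pos.mpr hs)] at h1
  calc K.size * |bc K i x - bc K i y| ≤ K.size * (L R * (K.size⁻¹ * ‖x - y‖)) := by gcongr
    _ = L R * ‖x - y‖ := by field_simp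
    _ ≤ Λ * ‖x - y‖ := by gcongr; exact hΛ (mem_image_of_mem L hR')

lemma volume_body_le {K : TaggedSimplex d} (hK : 0 < K.size) :
    volume.real K.body ≤ 2 ^ d * unitVol d * K.size ^ d := by
  have h : K.body ⊆ Metric.ball (K.verts 0) (2 * K.size) := fun x hx => by
    rw [Metric.mem_ball, dist_eq_norm]
    have : ‖x - K.verts 0‖ ≤ K.size := K.norm_sub_le_diam hx (K.vert_mem_body 0)
    linarith
  refine (measureReal_mono h Metric.isBounded_ball.measure_lt_top.ne).trans_eq ?_
  rw [volume_real_ball _ (by positivity)]; ring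

lemma poly_mem_splineSpace (T : Mesh d) {q : MvPolynomial (Fin d) ℝ} (hq : q.totalDegree ≤ p) :
    polyEval q ∈ splineSpace Ω T p :=
  ⟨(contDiff_polyEval q).continuous.continuousOn, fun _ _ => ⟨q, hq, fun _ _ => rfl⟩⟩

lemma partialDeriv_poly_const (c : ℝ) (j : Fin d) (x : E d) :
    partialDeriv j (polyEval (MvPolynomial.C c)) x = 0 := by
  have : (polyEval (MvPolynomial.C c) : E d → ℝ) = fun _ => c := by ext x; simp
  rw [partialDeriv, this]; simp

/-- The polynomial `∑ c_j x_j`. -/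
def linPoly {d : ℕ} (c : Fin d → ℝ) : MvPolynomial (Fin d) ℝ :=
  ∑ j, MvPolynomial.C (c j) * MvPolynomial.X j

lemma totalDegree_linPoly (c : Fin d → ℝ) : (linPoly c).totalDegree ≤ 1 := by
  refine (MvPolynomial.totalDegree_finsetSum _ _).trans (Finset.sup_le fun j _ => ?_)
  refine (MvPolynomial.totalDegree_mul _ _).trans ?_
  rw [MvPolynomial.totalDegree_C, MvPolynomial.totalDegree_X]

lemma partialDeriv_linPoly (c : Fin d → ℝ) (j : Fin d) (x : E d) :
    partialDeriv j (polyEval (linPoly c)) x = c j := by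
  let A : E d →L[ℝ] ℝ := ∑ i, c i • EuclideanSpace.proj i
  have : (polyEval (linPoly c) : E d → ℝ) = A := by
    ext x; simp [A, linPoly, polyEval]
  rw [partialDeriv, this, A.fderiv]
  simp [A, PiLp.single_apply]

/-- Deviation of the Scott-Zhang coefficients from the mean value. -/
lemma exists_coeff_bound (hd : 2 ≤ d) (hp : 1 ≤ p) (hΩ : IsBoundedLipschitzDomain Ω)
    {𝓡 : Set (TaggedSimplex d)} (h𝓡 : 𝓡.Finite) (hR : ∀ R ∈ 𝓡, AffineIndependent ℝ R.verts) :
    ∃ C : ℝ, 0 ≤ C ∧ ∀ (T : Mesh d) (σ : E d → Carrier d), IsRegularTriangulation Ω T →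
      Shaped 𝓡 T → (∀ z ∈ nodes T p, (σ z).Admissible Ω T z) → ∀ K ∈ T, ∀ z ∈ nodes T p,
      z ∈ K.body → ∀ (v : H1 Ω) (X : ℝ),
      (∀ L ∈ T, (L.body ∩ K.body).Nonempty → energy L.body v ≤ X) →
      (szCoeff T p σ v z - mean K v) ^ 2 ≤ C * (K.size ^ 2 * (K.size ^ d)⁻¹) * X := by
  obtain ⟨Λ, hΛ⟩ := exists_shapeRegular h𝓡 hR
  obtain ⟨κ, hκ, C₁, hC₁, hstar⟩ := exists_star_bound hd Λ
  obtain ⟨C₂, hC₂, hcoeff⟩ := exists_szCoeff_bound Ω h𝓡 hR hp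
  have hu := unitVol_pos d
  -- The three summands belong to the Poincaré inequality on the carrying element, to the comparison
  -- of its mean with that of `K`, and to the energy term of the coefficient bound.
  set M := 2 * (4 * 2 ^ d) + 2 * (2 ^ d * unitVol d * C₁) + 1 with hM
  have hM0 : 0 ≤ M := by positivity
  refine ⟨C₂ * M * κ ^ 2 * κ ^ d, by positivity, ?_⟩
  intro T σ hT hsh hσ K hK z hz hzK v X hX
  have hTΩ := hT.interior_body_subset hΩ
  set c := mean K v with hc
  obtain ⟨w, hw0, hw1⟩ := hT.exists_H1_spline hΩ (p := p)
    (poly_mem_splineSpace T (q := MvPolynomial.C c) (by simp))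
  -- Constants are reproduced, so the deviation from the mean is a coefficient of `v - c`, whose
  -- scaled norm on the carrying element `L` involves only gradients on the patch. The element `L`
  -- may differ from `K` but shares `z` with it.
  have hsz : szCoeff T p σ v z - c = szCoeff T p σ (v - w) z := by
    have h1 := szCoeff_add (p := p) hT hTΩ (hσ z hz) (v - w) w
    rw [sub_add_cancel] at h1
    have h2 := szCoeff_spline hT hTΩ hp hz (hσ z hz)
      (poly_mem_splineSpace T (q := MvPolynomial.C c) (by simp)) hw0 hw1
    rw [h1, h2]; simp
  obtain ⟨L, hL, o, ho, hzo⟩ := (hσ z hz).exists_on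
  have hzL := Carrier.set_on_subset hzo
  obtain ⟨R, hR', a, hsc⟩ := hsh L hL
  have hb := hcoeff T σ hT L hL (hTΩ L hL) R hR' a L.size hsc z hz o ho hzo (v - w)
  have hac := Carrier.volOn_body_ac (hTΩ L hL)
  have hfnsub : ∀ᵐ x ∂volOn L.body, fn (v - w) x = fn v x - c := by
    have h1 := fn_add (v - w) w
    rw [sub_add_cancel] at h1
    filter_upwards [hac.ae_le h1, hac.ae_le hw0] with x hx1 hx2
    rw [hx1, Pi.add_apply, hx2]; simp
  have hgradsub : ∀ j, ∀ᵐ x ∂volOn L.body, grad (v - w) j x = grad v j x := by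
    intro j
    have h1 := grad_add (v - w) w j
    rw [sub_add_cancel] at h1
    filter_upwards [hac.ae_le h1, hac.ae_le (hw1 j)] with x hx1 hx2
    rw [hx1, Pi.add_apply, hx2, partialDeriv_poly_const, add_zero]
  have e1 : ∫ x in L.body, fn (v - w) x ^ 2 = ∫ x in L.body, (fn v x - c) ^ 2 :=
    integral_congr_ae (by filter_upwards [hfnsub] with x hx; rw [hx])
  have e2 : energy L.body (v - w) = energy L.body v := Finset.sum_congr rfl fun j _ =>
    integral_congr_ae (by filter_upwards [hgradsub j] with x hx; rw [hx])
  rw [e1, e2] at hb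
  have hs := (hΛ T hsh L hL).size_pos
  have hsK := (hΛ T hsh K hK).size_pos
  have hst := hstar hΩ hT (hΛ T hsh) z L hL hzL K hK hzK
  have hXz : ∀ L' ∈ T, z ∈ L'.body → energy L'.body v ≤ X :=
    fun L' hL' hz' => hX L' hL' ⟨z, hz', hzK⟩
  have hmean := hst.2 v X hXz
  have hXL := hXz L hL hzL
  have hX0 : 0 ≤ X := (energy_nonneg _ v).trans hXL
  have hfL := memLp_body (hTΩ L hL) v
  have hLf : IsFiniteMeasure (volOn L.body) := ⟨by simpa using L.body_compact.measure_lt_top⟩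
  have h1 : ∫ x in L.body, (fn v x - c) ^ 2
      ≤ 2 * (∫ x in L.body, (fn v x - mean L v) ^ 2)
        + 2 * (volume.real L.body * (mean L v - c) ^ 2) := by
    have h := integral_add_sq_le (μ := volOn L.body) (f := fun x => fn v x - mean L v)
      (g := fun _ => mean L v - c) (hfL.sub (memLp_const _)) (memLp_const _)
    simp only [sub_add_sub_cancel] at h
    rwa [setIntegral_const, smul_eq_mul] at h
  have h2 := poincare_body (hT.nondegenerate L hL) (hTΩ L hL) v
  have h3 := volume_body_le hs
  have h4 : volume.real L.body * (mean L v - c) ^ 2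
      ≤ 2 ^ d * unitVol d * C₁ * L.size ^ 2 * X := by
    calc volume.real L.body * (mean L v - c) ^ 2
        ≤ (2 ^ d * unitVol d * L.size ^ d) * (C₁ * (L.size ^ 2 * (L.size ^ d)⁻¹) * X) := by
          gcongr
      _ = _ := by field_simp
  have h5 : (∫ x in L.body, (fn v x - c) ^ 2) + L.size ^ 2 * energy L.body v
      ≤ M * (L.size ^ 2 * X) := by
    have h6 : 4 * 2 ^ d * L.size ^ 2 * energy L.body v ≤ 4 * 2 ^ d * L.size ^ 2 * X := by gcongr
    have h7 : L.size ^ 2 * energy L.body v ≤ L.size ^ 2 * X := by gcongr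
    have h8 : M * (L.size ^ 2 * X) = 2 * (4 * 2 ^ d * L.size ^ 2 * X)
        + 2 * (2 ^ d * unitVol d * C₁ * L.size ^ 2 * X) + L.size ^ 2 * X := by rw [hM]; ring
    rw [h8]; linarith
  rw [hsz]
  refine hb.trans ?_
  have h9 := (hstar hΩ hT (hΛ T hsh) z K hK hzK L hL hzL).1
  have h10 : (L.size ^ d)⁻¹ ≤ κ ^ d * (K.size ^ d)⁻¹ := by
    rw [← div_eq_mul_inv, ← one_div, div_le_div_iff₀ (by positivity) (by positivity), one_mul,
      ← mul_pow]
    gcongr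
  calc C₂ * (L.size ^ d)⁻¹ * ((∫ x in L.body, (fn v x - c) ^ 2) + L.size ^ 2 * energy L.body v)
      ≤ C₂ * (κ ^ d * (K.size ^ d)⁻¹) * (M * ((κ * K.size) ^ 2 * X)) := by
        refine mul_le_mul (by gcongr) (h5.trans ?_) ?_ (by positivity)
        · gcongr; exact hst.1
        · exact add_nonneg (integral_nonneg fun _ => sq_nonneg _)
            (mul_nonneg (sq_nonneg _) (energy_nonneg _ _))
    _ = _ := by ring

lemma sum_lagf {K : TaggedSimplex d} (hK : AffineIndependent ℝ K.verts) (hp : 1 ≤ p) (x : E d) :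
    ∑ α ∈ idx d p, lagf K p α x = 1 := by
  have h := lagrange_interpolation hK hp (q := MvPolynomial.C 1) (by simp) x
  simp only [polyEval_C, one_mul] at h
  exact h.symm

lemma bc_mem_Icc {K : TaggedSimplex d} (hK : AffineIndependent ℝ K.verts) {x : E d}
    (hx : x ∈ K.body) (i : Fin (d + 1)) : bc K i x ∈ Icc (0:ℝ) 1 := by
  have h := (mem_body_iff hK).mp hx
  refine ⟨h i, ?_⟩
  rw [← bc_sum hK x]
  exact Finset.single_le_sum (f := fun i => bc K i x) (fun i _ => h i) (Finset.mem_univ i)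

/-- Pointwise bounds for combinations of Lagrange basis functions. -/
lemma exists_lagf_bound (d p : ℕ) : ∃ B : ℝ, 0 ≤ B ∧ ∀ (Λ : ℝ) (K : TaggedSimplex d),
    ShapeRegular Λ K → ∀ (γ : (Fin (d + 1) → ℕ) → ℝ) (y : ℝ), (∀ α ∈ idx d p, |γ α| ≤ y) → 0 ≤ y →
    (∀ x ∈ K.body, |∑ α ∈ idx d p, γ α * lagf K p α x| ≤ B * y) ∧
    ∀ x ∈ K.body, ∀ x' ∈ K.body, |(∑ α ∈ idx d p, γ α * lagf K p α x)
      - ∑ α ∈ idx d p, γ α * lagf K p α x'| ≤ B * y * (Λ / K.size) * ‖x - x'‖ := by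
  obtain ⟨B, hB, h⟩ := exists_lag_bound d p
  refine ⟨(idx d p).card * B, by positivity, fun Λ K hK γ y hγ hy => ⟨fun x hx => ?_,
    fun x hx x' hx' => ?_⟩⟩
  · refine (Finset.abs_sum_le_sum_abs _ _).trans ?_
    refine (Finset.sum_le_card_nsmul _ _ (B * y) fun α hα => ?_).trans_eq ?_
    · have hb : |lagf K p α x| ≤ B :=
        (h α hα _ _ (bc_mem_Icc hK.indep hx) (bc_mem_Icc hK.indep hx)).1
      rw [abs_mul, mul_comm]
      exact mul_le_mul hb (hγ α hα) (abs_nonneg _) hB.le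
    · rw [nsmul_eq_mul, mul_assoc]
  · rw [← Finset.sum_sub_distrib]
    refine (Finset.abs_sum_le_sum_abs _ _).trans ?_
    refine (Finset.sum_le_card_nsmul _ _ (B * y * (Λ / K.size) * ‖x - x'‖) fun α hα => ?_).trans_eq ?_
    · have hb : |lagf K p α x - lagf K p α x'| ≤ B * ‖(fun i => bc K i x) - fun i => bc K i x'‖ :=
        (h α hα _ _ (bc_mem_Icc hK.indep hx) (bc_mem_Icc hK.indep hx')).2
      have hs := hK.size_pos
      have hn : ‖(fun i => bc K i x) - fun i => bc K i x'‖ ≤ Λ / K.size * ‖x - x'‖ := by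
        have := hK.pos
        rw [pi_norm_le_iff_of_nonneg (by positivity)]
        intro i
        have := hK.lip i x x'
        rw [div_mul_eq_mul_div, le_div_iff₀ hs, Real.norm_eq_abs, Pi.sub_apply]
        linarith
      rw [← mul_sub, abs_mul]
      calc |γ α| * |lagf K p α x - lagf K p α x'|
          ≤ y * (B * (Λ / K.size * ‖x - x'‖)) :=
            mul_le_mul (hγ α hα) (hb.trans (by gcongr)) (abs_nonneg _) hy
        _ = _ := by ring
    · rw [nsmul_eq_mul]; ring

lemma integral_sq_le_of_bound {K : TaggedSimplex d} {f : E d → ℝ} {M : ℝ}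
    (h : ∀ᵐ x ∂volOn K.body, f x ^ 2 ≤ M) :
    ∫ x in K.body, f x ^ 2 ≤ volume.real K.body * M := by
  have hLf : IsFiniteMeasure (volOn K.body) := ⟨by simpa using K.body_compact.measure_lt_top⟩
  refine (integral_mono_of_nonneg (Eventually.of_forall fun _ => sq_nonneg _)
    (integrable_const M) h).trans_eq ?_
  rw [setIntegral_const, smul_eq_mul]

/-- Local stability of the Scott-Zhang interpolant. -/
lemma exists_local_stability (hd : 2 ≤ d) (hp : 1 ≤ p) (hΩ : IsBoundedLipschitzDomain Ω)
    {𝓡 : Set (TaggedSimplex d)} (h𝓡 : 𝓡.Finite) (hR : ∀ R ∈ 𝓡, AffineIndependent ℝ R.verts) :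
    ∃ C : ℝ, 0 ≤ C ∧ ∀ (T : Mesh d) (σ : E d → Carrier d), IsRegularTriangulation Ω T →
      Shaped 𝓡 T → (∀ z ∈ nodes T p, (σ z).Admissible Ω T z) → ∀ K ∈ T, ∀ (v : H1 Ω) (X : ℝ),
      (∀ L ∈ T, (L.body ∩ K.body).Nonempty → energy L.body v ≤ X) →
      ∫ x in K.body, (scottZhang T p σ v x - fn v x) ^ 2 ≤ C * K.size ^ 2 * X ∧
      ∀ j, ∫ x in K.body, partialDeriv j (scottZhang T p σ v) x ^ 2 ≤ C * X := by
  obtain ⟨Λ, hΛ⟩ := exists_shapeRegular h𝓡 hR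
  obtain ⟨C, hC, hcoeff⟩ := exists_coeff_bound (p := p) hd hp hΩ h𝓡 hR
  obtain ⟨B, hB, hlag⟩ := exists_lagf_bound d p
  have hu := unitVol_pos d
  refine ⟨2 * (2 ^ d * unitVol d * (B ^ 2 * C)) + 2 * (4 * 2 ^ d)
    + 2 ^ d * unitVol d * (B ^ 2 * Λ ^ 2 * C), by positivity, ?_⟩
  intro T σ hT hsh hσ K hK v X hX
  have hTΩ := hT.interior_body_subset hΩ
  have hreg := hΛ T hsh K hK
  have hn := hT.nondegenerate K hK
  have hs := hreg.size_pos
  have hX0 : 0 ≤ X := (energy_nonneg _ v).trans (hX K hK ⟨K.verts 0, K.vert_mem_body 0,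
    K.vert_mem_body 0⟩)
  set c := mean K v with hc
  set Y := C * (K.size ^ 2 * (K.size ^ d)⁻¹) * X with hY
  have hY0 : 0 ≤ Y := by positivity
  have hγ : ∀ α ∈ idx d p, |szCoeff T p σ v (node K p α) - c| ≤ √Y := fun α hα =>
    Real.abs_le_sqrt (hcoeff T σ hT hsh hσ K hK _ (node_mem_nodes hK hα)
      (node_mem_body hn hp hα) v X hX)
  obtain ⟨hb1, hb2⟩ := hlag Λ K hreg (fun α => szCoeff T p σ v (node K p α) - c) √Y hγ
    (Real.sqrt_nonneg _)
  -- The Lagrange functions sum to one, so subtracting `c` from the interpolant subtracts it from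
  -- each coefficient.
  have hu' : ∀ x ∈ K.body, scottZhang T p σ v x - c
      = ∑ α ∈ idx d p, (szCoeff T p σ v (node K p α) - c) * lagf K p α x := by
    intro x hx
    simp_rw [sub_mul]
    rw [Finset.sum_sub_distrib, ← Finset.mul_sum, sum_lagf hn hp, mul_one,
      scottZhang_eq hT hp v hK hx]
  have hvol := volume_body_le hs
  have hsd : K.size ^ d ≠ 0 := by positivity
  have hmem : ∀ᵐ x ∂volOn K.body, x ∈ interior K.body := by
    rw [K.volOn_body]; exact ae_restrict_mem isOpen_interior.measurableSet
  have hC2 : 0 ≤ 2 ^ d * unitVol d * (B ^ 2 * Λ ^ 2 * C) := by positivity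
  have hC1 : 0 ≤ 2 * (2 ^ d * unitVol d * (B ^ 2 * C)) + 2 * (4 * 2 ^ d) := by positivity
  have hcontK : ContinuousOn (scottZhang T p σ v) K.body := by
    have : ContinuousOn (fun x => ∑ α ∈ idx d p, szCoeff T p σ v (node K p α) * lagf K p α x)
        K.body := (continuous_finsetSum _ fun α _ =>
      continuous_const.mul (continuous_lagf K p α)).continuousOn
    exact this.congr fun x hx => scottZhang_eq hT hp v hK hx
  have hLf : IsFiniteMeasure (volOn K.body) := ⟨by simpa using K.body_compact.measure_lt_top⟩
  have hbound : ∀ x ∈ K.body, (scottZhang T p σ v x - c) ^ 2 ≤ B ^ 2 * Y := by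
    intro x hx
    have h := pow_le_pow_left₀ (abs_nonneg _) (hb1 x hx) 2
    rw [← hu' x hx, sq_abs, mul_pow, Real.sq_sqrt hY0] at h
    exact h
  have hbd : ∀ᵐ x ∂volOn K.body, (scottZhang T p σ v x - c) ^ 2 ≤ B ^ 2 * Y := by
    filter_upwards [hmem] with x hx
    exact hbound x (interior_subset hx)
  constructor
  · have hmemLp : MemLp (fun x => scottZhang T p σ v x - c) 2 (volOn K.body) := by
      refine MemLp.of_bound ((hcontK.sub continuousOn_const).aestronglyMeasurable
        K.body_closed.measurableSet) √(B ^ 2 * Y) ?_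
      filter_upwards [hbd] with x hx
      exact Real.abs_le_sqrt hx
    have h1 := integral_add_sq_le hmemLp (((memLp_body (hTΩ K hK) v).sub (memLp_const c)).neg)
    have e : ∀ x, scottZhang T p σ v x - c + (-(fn v - fun _ => c) : E d → ℝ) x
        = scottZhang T p σ v x - fn v x := fun x => by
      simp only [Pi.neg_apply, Pi.sub_apply]; ring
    simp_rw [e] at h1
    have e2 : ∫ x in K.body, (-(fn v - fun _ => c) : E d → ℝ) x ^ 2 = ∫ x in K.body, (fn v x - c) ^ 2 := by
      congr 1; ext x; simp only [Pi.neg_apply, Pi.sub_apply]; ring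
    rw [e2] at h1
    have h2 := poincare_body hn (hTΩ K hK) v
    have h3 := integral_sq_le_of_bound hbd
    have h4 : volume.real K.body * (B ^ 2 * Y) ≤ 2 ^ d * unitVol d * (B ^ 2 * C) * K.size ^ 2 * X := by
      calc volume.real K.body * (B ^ 2 * Y) ≤ 2 ^ d * unitVol d * K.size ^ d * (B ^ 2 * Y) := by
            gcongr
        _ = _ := by rw [hY]; field_simp
    have h5 : 4 * 2 ^ d * K.size ^ 2 * energy K.body v ≤ 4 * 2 ^ d * K.size ^ 2 * X := by
      gcongr
      exact hX K hK ⟨K.verts 0, K.vert_mem_body 0, K.vert_mem_body 0⟩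
    have h6 : 0 ≤ 2 ^ d * unitVol d * (B ^ 2 * Λ ^ 2 * C) * (K.size ^ 2 * X) := by positivity
    linarith
  · intro j
    have hΛ0 := hreg.pos
    have hM0 : 0 ≤ B * √Y * (Λ / K.size) := by positivity
    -- The gradient is bounded by the Lipschitz constant on the element, which takes the place of an
    -- inverse estimate.
    have hlip : LipschitzOnWith (B * √Y * (Λ / K.size)).toNNReal (scottZhang T p σ v) K.body := by
      refine LipschitzOnWith.of_dist_le_mul fun x hx y hy => ?_
      rw [Real.coe_toNNReal _ hM0, Real.dist_eq, dist_eq_norm]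
      have := hb2 x hx y hy
      rwa [← hu' x hx, ← hu' y hy, sub_sub_sub_cancel_right] at this
    have hder : ∀ᵐ x ∂volOn K.body,
        partialDeriv j (scottZhang T p σ v) x ^ 2 ≤ (B * √Y * (Λ / K.size)) ^ 2 := by
      filter_upwards [hmem] with x hx
      have h1 := norm_fderiv_le_of_lipschitzOn ℝ (mem_interior_iff_mem_nhds.mp hx) hlip
      rw [Real.coe_toNNReal _ hM0] at h1
      have h2 : |partialDeriv j (scottZhang T p σ v) x| ≤ B * √Y * (Λ / K.size) := by
        refine ((fderiv ℝ (scottZhang T p σ v) x).le_opNorm _).trans ?_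
        rw [PiLp.norm_single, norm_one, mul_one]; exact h1
      have h3 := pow_le_pow_left₀ (abs_nonneg _) h2 2
      rwa [sq_abs] at h3
    refine (integral_sq_le_of_bound hder).trans ?_
    -- The factor `K.size ^ 2` in `Y` cancels the squared inverse size, and the remaining `K.size ^
    -- (-d)` is absorbed by the volume.
    have e : (B * √Y * (Λ / K.size)) ^ 2 = B ^ 2 * Λ ^ 2 * C * (K.size ^ d)⁻¹ * X := by
      rw [mul_pow, mul_pow, Real.sq_sqrt hY0, hY]; field_simp
    rw [e]
    have h4 : volume.real K.body * (B ^ 2 * Λ ^ 2 * C * (K.size ^ d)⁻¹ * X)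
        ≤ 2 ^ d * unitVol d * (B ^ 2 * Λ ^ 2 * C) * X := by
      calc _ ≤ 2 ^ d * unitVol d * K.size ^ d * (B ^ 2 * Λ ^ 2 * C * (K.size ^ d)⁻¹ * X) := by
            gcongr
        _ = _ := by field_simp
    have h5 := mul_nonneg hC1 hX0
    linarith

lemma contDiff_lagf (K : TaggedSimplex d) {α : Fin (d + 1) → ℕ} (hα : α ∈ idx d p) :
    ContDiff ℝ ∞ (lagf K p α) := by
  obtain ⟨q, -, hq⟩ := exists_lagPoly K hα
  have : lagf K p α = polyEval q := by ext x; exact (hq x).symm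
  rw [this]; exact contDiff_polyEval q

lemma scottZhang_mem (hT : IsRegularTriangulation Ω T) (hp : 1 ≤ p) (v : H1 Ω) :
    scottZhang T p σ v ∈ splineSpace Ω T p := by
  refine ⟨?_, fun K hK => ?_⟩
  · have e : scottZhang T p σ v = fun x => ∑ z ∈ (hT.finite_nodes (p := p)).toFinset,
        szCoeff T p σ v z * nodalBasis Ω T p z x := by
      ext x
      exact finsum_mem_eq_finite_toFinset_sum _ hT.finite_nodes
    rw [e]
    exact continuousOn_finsetSum _ fun z _ => continuousOn_const.mul (hT.nodalBasis_spec hp z).1.1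
  · choose! L hLd hL using fun (α : Fin (d + 1) → ℕ) (hα : α ∈ idx d p) => exists_lagPoly K hα
    refine ⟨∑ α ∈ idx d p, MvPolynomial.C (szCoeff T p σ v (node K p α)) * L α, ?_, fun x hx => ?_⟩
    · refine (MvPolynomial.totalDegree_finsetSum _ _).trans (Finset.sup_le fun α hα => ?_)
      refine (MvPolynomial.totalDegree_mul _ _).trans ?_
      rw [MvPolynomial.totalDegree_C, zero_add]
      exact hLd α hα
    · rw [scottZhang_eq hT hp v hK hx, polyEval_sum]
      exact Finset.sum_congr rfl fun α hα => by rw [polyEval_mul, polyEval_C, hL α hα]; rfl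

/-- Local approximation by the Scott-Zhang interpolant. -/
theorem exists_local_approx (hd : 2 ≤ d) (hp : 1 ≤ p) (hΩ : IsBoundedLipschitzDomain Ω)
    {𝓡 : Set (TaggedSimplex d)} (h𝓡 : 𝓡.Finite) (hR : ∀ R ∈ 𝓡, AffineIndependent ℝ R.verts) :
    ∃ C : ℝ, 0 ≤ C ∧ ∀ (T : Mesh d) (σ : E d → Carrier d), IsRegularTriangulation Ω T →
      Shaped 𝓡 T → (∀ z ∈ nodes T p, (σ z).Admissible Ω T z) → ∀ K ∈ T, ∀ (v : H1 Ω)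
      (c : Fin d → ℝ) (X : ℝ), (∀ L ∈ T, (L.body ∩ K.body).Nonempty →
        ∑ j, ∫ x in L.body, (grad v j x - c j) ^ 2 ≤ X) →
      ∫ x in K.body, (scottZhang T p σ v x - fn v x) ^ 2 ≤ C * K.size ^ 2 * X ∧
      ∀ j, ∫ x in K.body, (partialDeriv j (scottZhang T p σ v) x - grad v j x) ^ 2 ≤ C * X := by
  obtain ⟨C, hC, hst⟩ := exists_local_stability hd hp hΩ h𝓡 hR
  refine ⟨2 * C + 2, by positivity, ?_⟩
  intro T σ hT hsh hσ K hK v c X hX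
  have hTΩ := hT.interior_body_subset hΩ
  have hn := hT.nondegenerate K hK
  -- The linear function with gradient `c` is reproduced because its degree is at most `p`.
  -- Stability is applied to `v` minus this function, whose energy is the deviation of the gradient
  -- from `c`.
  have hlin := poly_mem_splineSpace (Ω := Ω) T ((totalDegree_linPoly c).trans hp)
  obtain ⟨w, hw0, hw1⟩ := hT.exists_H1_spline hΩ hlin
  have hsum : v - w + w = v := sub_add_cancel v w
  have hfn : ∀ L ∈ T, ∀ᵐ x ∂volOn L.body, fn (v - w) x = fn v x - polyEval (linPoly c) x := by
    intro L hL
    have hac := Carrier.volOn_body_ac (hTΩ L hL)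
    have h1 := fn_add (v - w) w
    rw [hsum] at h1
    filter_upwards [hac.ae_le h1, hac.ae_le hw0] with x hx1 hx2
    rw [hx1, Pi.add_apply, hx2, add_sub_cancel_right]
  have hgr : ∀ L ∈ T, ∀ j, ∀ᵐ x ∂volOn L.body, grad (v - w) j x = grad v j x - c j := by
    intro L hL j
    have hac := Carrier.volOn_body_ac (hTΩ L hL)
    have h1 := grad_add (v - w) w j
    rw [hsum] at h1
    filter_upwards [hac.ae_le h1, hac.ae_le (hw1 j)] with x hx1 hx2
    rw [hx1, Pi.add_apply, hx2, partialDeriv_linPoly, add_sub_cancel_right]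
  have hen : ∀ L ∈ T, energy L.body (v - w) = ∑ j, ∫ x in L.body, (grad v j x - c j) ^ 2 :=
    fun L hL => Finset.sum_congr rfl fun j _ =>
      integral_congr_ae (by filter_upwards [hgr L hL j] with x hx; rw [hx])
  have hXw : ∀ L ∈ T, (L.body ∩ K.body).Nonempty → energy L.body (v - w) ≤ X :=
    fun L hL h => (hen L hL).trans_le (hX L hL h)
  obtain ⟨h1, h2⟩ := hst T σ hT hsh hσ K hK (v - w) X hXw
  have hXK := hXw K hK ⟨K.verts 0, K.vert_mem_body 0, K.vert_mem_body 0⟩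
  have hX0 : 0 ≤ X := (energy_nonneg _ _).trans hXK
  have hsz : ∀ x ∈ K.body, scottZhang T p σ v x
      = scottZhang T p σ (v - w) x + polyEval (linPoly c) x := by
    intro x hx
    rw [scottZhang_eq hT hp v hK hx, scottZhang_eq hT hp (v - w) hK hx,
      lagrange_interpolation hn hp ((totalDegree_linPoly c).trans hp) x, ← Finset.sum_add_distrib]
    refine Finset.sum_congr rfl fun α hα => ?_
    have hz := node_mem_nodes (p := p) hK hα
    have h3 := szCoeff_add (p := p) hT hTΩ (hσ _ hz) (v - w) w
    rw [hsum, szCoeff_spline hT hTΩ hp hz (hσ _ hz) hlin hw0 hw1] at h3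
    rw [h3, add_mul]; rfl
  have hmem : ∀ᵐ x ∂volOn K.body, x ∈ interior K.body := by
    rw [K.volOn_body]; exact ae_restrict_mem isOpen_interior.measurableSet
  refine ⟨?_, fun j => ?_⟩
  · have e : ∫ x in K.body, (scottZhang T p σ v x - fn v x) ^ 2
        = ∫ x in K.body, (scottZhang T p σ (v - w) x - fn (v - w) x) ^ 2 := by
      refine integral_congr_ae ?_
      filter_upwards [hfn K hK, hmem] with x hx hxK
      rw [hx, hsz x (interior_subset hxK)]; ring
    rw [e]
    refine h1.trans ?_
    gcongr; linarith
  · have hgm := memLp_grad_body (hTΩ K hK) (v - w) j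
    have hpd : ∀ x ∈ interior K.body, partialDeriv j (scottZhang T p σ v) x
        = partialDeriv j (scottZhang T p σ (v - w)) x + c j := by
      intro x hx
      have hev : scottZhang T p σ v
          =ᶠ[𝓝 x] scottZhang T p σ (v - w) + polyEval (linPoly c) := by
        filter_upwards [isOpen_interior.mem_nhds hx] with y hy
        exact hsz y (interior_subset hy)
      have hd1 : DifferentiableAt ℝ (scottZhang T p σ (v - w)) x := by
        have hev' : scottZhang T p σ (v - w) =ᶠ[𝓝 x]
            fun y => ∑ α ∈ idx d p, szCoeff T p σ (v - w) (node K p α) * lagf K p α y := by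
          filter_upwards [isOpen_interior.mem_nhds hx] with y hy
          exact scottZhang_eq hT hp _ hK (interior_subset hy)
        refine DifferentiableAt.congr_of_eventuallyEq ?_ hev'
        refine DifferentiableAt.fun_sum fun α hα => DifferentiableAt.const_mul ?_ _
        exact (contDiff_lagf K hα).contDiffAt.differentiableAt (by simp)
      rw [partialDeriv, hev.fderiv_eq, fderiv_add hd1
        ((contDiff_polyEval _).contDiffAt.differentiableAt (by simp))]
      have := partialDeriv_linPoly c j x
      rw [partialDeriv] at this
      simp only [add_apply, this, partialDeriv]
    have hpm : MemLp (partialDeriv j (scottZhang T p σ (v - w))) 2 (volOn K.body) := by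
      have hV := scottZhang_mem (σ := σ) hT hp (v - w)
      rw [K.volOn_body]
      exact (hT.memLp_partialDeriv_spline hΩ hV j).mono_measure
        (Measure.restrict_mono (hTΩ K hK) le_rfl)
    have h3 := integral_add_sq_le hpm hgm.neg
    have e : ∫ x in K.body, (partialDeriv j (scottZhang T p σ v) x - grad v j x) ^ 2
        = ∫ x in K.body, (partialDeriv j (scottZhang T p σ (v - w)) x + (-grad (v - w) j) x) ^ 2 := by
      refine integral_congr_ae ?_
      filter_upwards [hgr K hK j, hmem] with x hx hxK
      rw [hpd x hxK, Pi.neg_apply, hx]; ring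
    have e2 : ∫ x in K.body, (-grad (v - w) j) x ^ 2 = ∫ x in K.body, grad (v - w) j x ^ 2 := by
      congr 1; ext x; simp only [Pi.neg_apply]; ring
    have h4 : ∫ x in K.body, grad (v - w) j x ^ 2 ≤ energy K.body (v - w) :=
      Finset.single_le_sum (f := fun j => ∫ x in K.body, grad (v - w) j x ^ 2)
        (fun j _ => integral_nonneg fun _ => sq_nonneg _) (Finset.mem_univ j)
    rw [e]
    rw [e2] at h3
    have h5 := h2 j
    linarith

end Local

/-! ### Uniform approximation on small elements. -/

section Global

variable {d : ℕ} {Ω : Set (E d)} {T : Mesh d} {p : ℕ} {σ : E d → Carrier d}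

/-- The part of the domain covered by small elements. -/
def smallPart (T : Mesh d) (δ : ℝ) : Set (E d) :=
  ⋃ K ∈ {K ∈ T | K.size ≤ δ}, interior K.body

lemma IsRegularTriangulation.pairwise_disjoint_interior (hT : IsRegularTriangulation Ω T)
    {S : Finset (TaggedSimplex d)} (hS : ∀ K ∈ S, K ∈ T) :
    Set.Pairwise (S : Set (TaggedSimplex d)) (Function.onFun Disjoint fun K => interior K.body) := by
  intro K hK K' hK' hne
  refine disjoint_left.mpr fun x hx hx' => hne ?_
  exact hT.eq_of_mem_interior (hS K hK) (hS K' hK') hx (interior_subset hx')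

lemma IsRegularTriangulation.integral_smallPart (hT : IsRegularTriangulation Ω T)
    (hTΩ : ∀ K ∈ T, interior K.body ⊆ Ω) (δ : ℝ) {f : E d → ℝ} (hf : Integrable f (volOn Ω)) :
    ∫ x in smallPart T δ, f x = ∑ K ∈ (hT.finite.subset (sep_subset T (fun K => K.size ≤ δ))).toFinset,
      ∫ x in K.body, f x := by
  set S := (hT.finite.subset (sep_subset T (fun K => K.size ≤ δ))).toFinset with hS
  have hST : ∀ K ∈ S, K ∈ T := fun K hK => by
    rw [hS, Finite.mem_toFinset] at hK; exact hK.1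
  have e : smallPart T δ = ⋃ K ∈ S, interior K.body := by
    rw [smallPart]
    simp only [hS, Finite.mem_toFinset]
  rw [e, integral_biUnion_finset S (fun K _ => isOpen_interior.measurableSet)
    (hT.pairwise_disjoint_interior hST)
    fun K hK => hf.mono_measure (Measure.restrict_mono (hTΩ K (hST K hK)) le_rfl)]
  refine Finset.sum_congr rfl fun K _ => ?_
  have hvol : volume.restrict (interior K.body) = volume.restrict K.body := K.volOn_body.symm
  rw [hvol]

lemma IsRegularTriangulation.sum_integral_le (hT : IsRegularTriangulation Ω T)
    (hTΩ : ∀ K ∈ T, interior K.body ⊆ Ω) {f : E d → ℝ} (hf : Integrable f (volOn Ω))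
    (hf0 : ∀ x, 0 ≤ f x) :
    ∑ K ∈ hT.finite.toFinset, ∫ x in K.body, f x ≤ ∫ x in Ω, f x := by
  have hST : ∀ K ∈ hT.finite.toFinset, K ∈ T := fun K hK => by simpa using hK
  have h := integral_biUnion_finset (μ := volume) (f := f) hT.finite.toFinset
    (fun K _ => isOpen_interior.measurableSet) (hT.pairwise_disjoint_interior hST)
    fun K hK => hf.mono_measure (Measure.restrict_mono (hTΩ K (hST K hK)) le_rfl)
  have e : ∑ K ∈ hT.finite.toFinset, ∫ x in K.body, f x
      = ∑ K ∈ hT.finite.toFinset, ∫ x in interior K.body, f x :=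
    Finset.sum_congr rfl fun K _ => by
      have hvol : volume.restrict (interior K.body) = volume.restrict K.body := K.volOn_body.symm
      rw [hvol]
  rw [e, ← h]
  exact setIntegral_mono_set hf (Eventually.of_forall hf0)
    (Eventually.of_forall (iUnion₂_subset fun K hK => hTΩ K (hST K hK)))

/-- The number of elements which meet a given element is bounded. -/
lemma IsRegularTriangulation.ncard_patch_le (hT : IsRegularTriangulation Ω T) {Λ : ℝ}
    (hΛ : ∀ K ∈ T, ShapeRegular Λ K) {L : TaggedSimplex d} (hL : L ∈ T) :
    ({K ∈ T | (L.body ∩ K.body).Nonempty}.ncard : ℝ) ≤ (d + 1) * (2 * Λ * (d + 1)) ^ d := by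
  have hsub : {K ∈ T | (L.body ∩ K.body).Nonempty}
      ⊆ ⋃ i : Fin (d + 1), {K ∈ T | L.verts i ∈ K.body} := by
    rintro K ⟨hK, hne⟩
    -- Touching elements of a conforming mesh share a vertex, so a patch is covered by the stars of
    -- `d + 1` vertices.
    rw [hT.conforming L hL K hK, convexHull_nonempty_iff] at hne
    obtain ⟨_, ⟨i, rfl⟩, ⟨k, hk⟩⟩ := hne
    exact mem_iUnion.mpr ⟨i, hK, hk ▸ K.vert_mem_body k⟩
  have hfin : ∀ i : Fin (d + 1), {K ∈ T | L.verts i ∈ K.body}.Finite := fun i =>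
    hT.finite.subset (sep_subset _ _)
  have h1 := ncard_le_ncard hsub (finite_iUnion hfin)
  have h2 : (⋃ i : Fin (d + 1), {K ∈ T | L.verts i ∈ K.body}).ncard
      ≤ ∑ i : Fin (d + 1), {K ∈ T | L.verts i ∈ K.body}.ncard := by
    have := Finset.set_ncard_biUnion_le (Finset.univ : Finset (Fin (d + 1)))
      fun i => {K ∈ T | L.verts i ∈ K.body}
    simpa using this
  have h3 : (∑ i : Fin (d + 1), {K ∈ T | L.verts i ∈ K.body}.ncard : ℝ)
      ≤ ∑ _i : Fin (d + 1), (2 * Λ * (d + 1)) ^ d :=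
    Finset.sum_le_sum fun i _ => hT.ncard_star_le hΛ ⟨L, hL, L.vert_mem_body i⟩
  rw [Finset.sum_const, Finset.card_univ, Fintype.card_fin, nsmul_eq_mul] at h3
  push_cast at h3
  refine le_trans ?_ h3
  exact_mod_cast h1.trans h2

/-- The error of the Scott-Zhang interpolant on small elements is uniformly small. -/
theorem exists_smallPart_bound (hd : 2 ≤ d) (hp : 1 ≤ p) (hΩ : IsBoundedLipschitzDomain Ω)
    {𝓡 : Set (TaggedSimplex d)} (h𝓡 : 𝓡.Finite) (hR : ∀ R ∈ 𝓡, AffineIndependent ℝ R.verts)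
    (v : H1 Ω) {ε : ℝ} (hε : 0 < ε) : ∃ δ > 0, ∀ (T : Mesh d) (σ : E d → Carrier d),
      IsRegularTriangulation Ω T → Shaped 𝓡 T → (∀ z ∈ nodes T p, (σ z).Admissible Ω T z) →
      ∫ x in smallPart T δ, (scottZhang T p σ v x - fn v x) ^ 2 ≤ ε ∧
      ∀ j, ∫ x in smallPart T δ, (partialDeriv j (scottZhang T p σ v) x - grad v j x) ^ 2 ≤ ε := by
  classical
  obtain ⟨Λ, hΛ⟩ := exists_shapeRegular h𝓡 hR
  obtain ⟨κ, hκ, _, _, hstar⟩ := exists_star_bound hd Λ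
  obtain ⟨C, hC, hloc⟩ := exists_local_approx hd hp hΩ h𝓡 hR
  obtain ⟨N, hN⟩ := exists_nat_ge ((d + 1) * (2 * Λ * (d + 1)) ^ d)
  have hfinΩ := isFiniteMeasure_volOn hΩ
  set V := volume.real Ω with hV
  have hV0 : 0 ≤ V := measureReal_nonneg
  -- The bracket anticipates the final sum: `N` patches per element, `d` components, and the
  -- contributions of the approximation error and of the oscillation on a set of volume `V`.
  obtain ⟨η, hη, hηε⟩ : ∃ η > 0, C * (N * (2 * d * (1 + V) * η ^ 2)) ≤ ε := by
    set Q := C * (N * (2 * d * (1 + V))) with hQ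
    have hQ0 : 0 ≤ Q := by positivity
    refine ⟨√(ε / (Q + 1)), Real.sqrt_pos.mpr (by positivity), ?_⟩
    rw [Real.sq_sqrt (by positivity)]
    calc C * (N * (2 * d * (1 + V) * (ε / (Q + 1)))) = ε * (Q / (Q + 1)) := by rw [hQ]; ring
      _ ≤ ε * 1 := by gcongr; rw [div_le_one (by positivity)]; linarith
      _ = ε := mul_one ε
  -- A uniformly continuous approximation of the gradient is nearly constant on small patches; no
  -- regularity of `v` beyond `H¹` enters.
  have happ : ∀ j, ∃ g : E d → ℝ, Continuous g ∧ UniformContinuous g ∧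
      MemLp g 2 (volOn Ω) ∧ ∫ x in Ω, (grad v j x - g x) ^ 2 ≤ η ^ 2 := by
    intro j
    obtain ⟨g, hgc, hge, hg, hgm⟩ := (memLp_grad v j).exists_hasCompactSupport_eLpNorm_sub_le
      (by simp) (ε := ENNReal.ofReal η) (by simpa using hη)
    exact ⟨g, hg, hgc.uniformContinuous_of_continuous hg, hgm,
      integral_sq_le_of_eLpNorm_le ((memLp_grad v j).sub hgm) hη.le hge⟩
  choose g hgc hgu hgm hge using happ
  obtain ⟨δ₀, hδ₀, hgδ⟩ : ∃ δ₀ > 0, ∀ j, ∀ x y, dist x y < δ₀ → |g j x - g j y| < η := by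
    choose δ hδ h using fun j => Metric.uniformContinuous_iff.mp (hgu j) η hη
    have : Nonempty (Fin d) := ⟨⟨0, by omega⟩⟩
    refine ⟨Finset.univ.inf' Finset.univ_nonempty δ, ?_, fun j x y hxy => ?_⟩
    · rw [gt_iff_lt, Finset.lt_inf'_iff]; exact fun j _ => hδ j
    · exact h j (hxy.trans_le (Finset.inf'_le _ (Finset.mem_univ j)))
  -- The bound one removes the factor `K.size ^ 2`. The other term accounts for neighbours being
  -- larger by a factor up to `κ`, so that every point of the patch is within `δ₀` of the first
  -- vertex.
  set δ := min 1 (δ₀ / (2 * (κ + 1))) with hδ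
  have hδ0 : 0 < δ := lt_min one_pos (by positivity)
  refine ⟨δ, hδ0, ?_⟩
  intro T σ hT hsh hσ
  have hTΩ := hT.interior_body_subset hΩ
  have hreg := hΛ T hsh
  set e : TaggedSimplex d → ℝ := fun L => ∑ j, (2 * (∫ x in L.body, (grad v j x - g j x) ^ 2)
    + 2 * (volume.real L.body * η ^ 2)) with he
  have he0 : ∀ L, 0 ≤ e L := fun L => Finset.sum_nonneg fun j _ => by
    have : 0 ≤ ∫ x in L.body, (grad v j x - g j x) ^ 2 := integral_nonneg fun _ => sq_nonneg _
    positivity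
  set F := hT.finite.toFinset with hF
  have hFT : ∀ K, K ∈ F ↔ K ∈ T := fun K => by rw [hF, Finite.mem_toFinset]
  set S := (hT.finite.subset (sep_subset T (fun K => K.size ≤ δ))).toFinset with hS
  have hST : ∀ K, K ∈ S ↔ K ∈ T ∧ K.size ≤ δ := fun K => by rw [hS, Finite.mem_toFinset]; rfl
  set X : TaggedSimplex d → ℝ := fun K => ∑ L ∈ F with (L.body ∩ K.body).Nonempty, e L with hX
  have hX0 : ∀ K, 0 ≤ X K := fun K => Finset.sum_nonneg fun L _ => he0 L
  have hbound : ∀ K ∈ S, ∀ L ∈ T, (L.body ∩ K.body).Nonempty →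
      ∑ j, ∫ x in L.body, (grad v j x - g j (K.verts 0)) ^ 2 ≤ X K := by
    intro K hK L hL hLK
    obtain ⟨hKT, hKδ⟩ := (hST K).mp hK
    have h1 : e L ≤ X K := Finset.single_le_sum (f := e) (fun L _ => he0 L)
      (Finset.mem_filter.mpr ⟨(hFT L).mpr hL, hLK⟩)
    refine le_trans (Finset.sum_le_sum fun j _ => ?_) h1
    obtain ⟨z, hzL, hzK⟩ := hLK
    have hsL := (hstar hΩ hT hreg z L hL hzL K hKT hzK).1
    have hdist : ∀ x ∈ L.body, dist x (K.verts 0) < δ₀ := by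
      intro x hx
      have h2 : ‖x - z‖ ≤ L.size := L.norm_sub_le_diam hx hzL
      have h3 : ‖z - K.verts 0‖ ≤ K.size := K.norm_sub_le_diam hzK (K.vert_mem_body 0)
      have h4 := norm_add_le (x - z) (z - K.verts 0)
      rw [sub_add_sub_cancel] at h4
      have h5 : δ * (2 * (κ + 1)) ≤ δ₀ := by
        rw [← le_div_iff₀ (by positivity)]; exact min_le_right _ _
      rw [dist_eq_norm]
      have h6 : κ * K.size ≤ κ * δ := by gcongr
      nlinarith
    have hLf : IsFiniteMeasure (volOn L.body) := ⟨by simpa using L.body_compact.measure_lt_top⟩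
    have hm1 : MemLp (fun x => grad v j x - g j x) 2 (volOn L.body) := by
      rw [L.volOn_body]
      exact ((memLp_grad v j).sub (hgm j)).mono_measure (Measure.restrict_mono (hTΩ L hL) le_rfl)
    have hm2 : MemLp (fun x => g j x - g j (K.verts 0)) 2 (volOn L.body) := by
      refine MemLp.sub ?_ (memLp_const _)
      rw [L.volOn_body]
      exact (hgm j).mono_measure (Measure.restrict_mono (hTΩ L hL) le_rfl)
    have h7 := integral_add_sq_le hm1 hm2
    simp only [sub_add_sub_cancel] at h7
    have h8 : ∫ x in L.body, (g j x - g j (K.verts 0)) ^ 2 ≤ volume.real L.body * η ^ 2 := by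
      refine integral_sq_le_of_bound ?_
      filter_upwards [ae_restrict_mem L.body_closed.measurableSet] with x hx
      have := (hgδ j x _ (hdist x hx)).le
      have := pow_le_pow_left₀ (abs_nonneg _) this 2
      rwa [sq_abs] at this
    linarith
  have hloc' : ∀ K ∈ S, ∫ x in K.body, (scottZhang T p σ v x - fn v x) ^ 2 ≤ C * X K ∧
      ∀ j, ∫ x in K.body, (partialDeriv j (scottZhang T p σ v) x - grad v j x) ^ 2 ≤ C * X K := by
    intro K hK
    obtain ⟨hKT, hKδ⟩ := (hST K).mp hK
    have h := hloc T σ hT hsh hσ K hKT v (fun j => g j (K.verts 0)) (X K) (hbound K hK)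
    refine ⟨h.1.trans ?_, h.2⟩
    have hs := (hreg K hKT).size_pos
    have h1 : K.size ^ 2 ≤ 1 := pow_le_one₀ hs.le (hKδ.trans (min_le_left _ _))
    calc C * K.size ^ 2 * X K ≤ C * 1 * X K := by gcongr
      _ = _ := by rw [mul_one]
  have hsumvol : ∑ L ∈ F, volume.real L.body ≤ V := by
    have := hT.sum_integral_le hTΩ (f := fun _ => (1:ℝ)) (integrable_const _) (fun _ => zero_le_one)
    simpa using this
  have hsume : ∑ L ∈ F, e L ≤ 2 * d * (1 + V) * η ^ 2 := by
    simp only [he]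
    rw [Finset.sum_comm]
    have h1 : ∀ j : Fin d, ∑ L ∈ F, (2 * (∫ x in L.body, (grad v j x - g j x) ^ 2)
        + 2 * (volume.real L.body * η ^ 2)) ≤ 2 * (1 + V) * η ^ 2 := by
      intro j
      rw [Finset.sum_add_distrib, ← Finset.mul_sum, ← Finset.mul_sum, ← Finset.sum_mul]
      have h2 := (hT.sum_integral_le hTΩ ((memLp_grad v j).sub (hgm j)).integrable_sq
        (fun _ => sq_nonneg _)).trans (hge j)
      have h3 : (∑ L ∈ F, volume.real L.body) * η ^ 2 ≤ V * η ^ 2 := by gcongr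
      simp only [Pi.sub_apply] at h2
      linarith
    refine (Finset.sum_le_sum fun j _ => h1 j).trans_eq ?_
    rw [Finset.sum_const, Finset.card_univ, Fintype.card_fin, nsmul_eq_mul]; ring
  have hsumX : ∑ K ∈ S, X K ≤ N * (2 * d * (1 + V) * η ^ 2) := by
    have h1 : ∑ K ∈ S, X K ≤ ∑ K ∈ F, X K :=
      Finset.sum_le_sum_of_subset_of_nonneg
        (fun K hK => (hFT K).mpr ((hST K).mp hK).1) fun K _ _ => hX0 K
    -- Double counting: each `L` occurs in the patches of at most `N` elements.
    have h2 : ∑ K ∈ F, X K = ∑ L ∈ F, ∑ K ∈ F with (L.body ∩ K.body).Nonempty, e L := by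
      simp only [hX, Finset.sum_filter]
      exact Finset.sum_comm
    have h3 : ∀ L ∈ F, ∑ K ∈ F with (L.body ∩ K.body).Nonempty, e L ≤ N * e L := by
      intro L hL
      rw [Finset.sum_const, nsmul_eq_mul]
      refine mul_le_mul_of_nonneg_right ?_ (he0 L)
      have h4 := (hT.ncard_patch_le hreg ((hFT L).mp hL)).trans hN
      have h5 : {K ∈ T | (L.body ∩ K.body).Nonempty}
          = ((F.filter fun K => (L.body ∩ K.body).Nonempty : Finset _) : Set (TaggedSimplex d)) := by
        ext K; simp [hFT]
      rwa [h5, ncard_coe_finset] at h4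
    refine h1.trans (h2.trans_le ((Finset.sum_le_sum h3).trans ?_))
    rw [← Finset.mul_sum]
    gcongr
  have hspl := scottZhang_mem (σ := σ) hT hp v
  have hfin : C * ∑ K ∈ S, X K ≤ ε := (mul_le_mul_of_nonneg_left hsumX hC).trans hηε
  rw [Finset.mul_sum] at hfin
  constructor
  · have hi := ((memLp_spline hΩ hspl).sub (memLp_fn v)).integrable_sq
    simp only [Pi.sub_apply] at hi
    rw [hT.integral_smallPart hTΩ δ hi]
    exact (Finset.sum_le_sum fun K hK => (hloc' K hK).1).trans hfin
  · intro j
    have hi := ((hT.memLp_partialDeriv_spline hΩ hspl j).sub (memLp_grad v j)).integrable_sq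
    simp only [Pi.sub_apply] at hi
    rw [hT.integral_smallPart hTΩ δ hi]
    exact (Finset.sum_le_sum fun K hK => (hloc' K hK).2 j).trans hfin

end Global

/-! ### Norm and completeness of the Sobolev space. -/

section Sobolev

variable {d : ℕ} {Ω : Set (E d)}

/-- An element of `H¹(Ω)` is determined by its underlying function. -/
lemma H1.ext_fn (hΩ : IsBoundedLipschitzDomain Ω) {v w : H1 Ω} (h : fn v =ᵐ[volOn Ω] fn w) :
    v = w := by
  have hfin := isFiniteMeasure_volOn hΩ
  have h0 : v.1.fst = w.1.fst := Lp.ext h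
  have h1 : ∀ j, v.1.snd j = w.1.snd j := by
    intro j
    refine Lp.ext ?_
    have hint : Integrable (fun x => grad v j x - grad w j x) (volOn Ω) :=
      ((memLp_grad v j).sub (memLp_grad w j)).integrable (by norm_num)
    -- Uniqueness of weak derivatives: the difference of the two gradients integrates to zero
    -- against all test functions.
    have key := hΩ.isOpen.ae_eq_zero_of_integral_contDiff_smul_eq_zero (μ := volume)
      (f := fun x => grad v j x - grad w j x) (IntegrableOn.locallyIntegrableOn hint) ?_
    · rw [EventuallyEq, ae_restrict_iff' hΩ.isOpen.measurableSet]
      filter_upwards [key] with x hx hxΩ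
      exact sub_eq_zero.mp (hx hxΩ)
    · intro φ hφ hφc hφΩ
      have ev := v.2 j φ hφ hφc hφΩ
      have ew := w.2 j φ hφ hφc hφΩ
      have e0 : ∫ x in Ω, v.1.fst x * partialDeriv j φ x = ∫ x in Ω, w.1.fst x * partialDeriv j φ x := by
        rw [h0]
      have e1 : ∫ x, φ x • (grad v j x - grad w j x)
          = ∫ x in Ω, (grad v j x * φ x - grad w j x * φ x) := by
        rw [← setIntegral_eq_integral_of_forall_compl_eq_zero (s := Ω)]
        · congr 1; ext x; rw [smul_eq_mul]; ring
        · intro x hx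
          rw [image_eq_zero_of_notMem_tsupport fun h => hx (hφΩ h), zero_smul]
      have i1 : Integrable (fun x => grad v j x * φ x) (volOn Ω) :=
        integrable_mul_test (v.1.snd j) hφ.continuous hφc
      have i2 : Integrable (fun x => grad w j x * φ x) (volOn Ω) :=
        integrable_mul_test (w.1.snd j) hφ.continuous hφc
      rw [e1, integral_sub i1 i2]
      have e2 := ev.symm.trans (e0.trans ew)
      change (∫ x in Ω, v.1.snd j x * φ x) - ∫ x in Ω, w.1.snd j x * φ x = 0
      linarith
  refine Subtype.ext (WithLp.ofLp_injective 2 (Prod.ext h0 ?_))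
  exact PiLp.ext h1

lemma norm_sq_Lp (f : Lp ℝ 2 (volOn Ω)) : ‖f‖ ^ 2 = ∫ x in Ω, f x ^ 2 := by
  have h := Lp.memLp f
  rw [Lp.norm_def, ← ENNReal.toReal_pow, eLpNorm_two_sq, lintegral_enorm_sq_eq h,
    ENNReal.toReal_ofReal (integral_nonneg fun _ => sq_nonneg _)]

/-- The norm of `H¹(Ω)`. -/
lemma H1.norm_sq (v : H1 Ω) :
    ‖v‖ ^ 2 = (∫ x in Ω, fn v x ^ 2) + ∑ j, ∫ x in Ω, grad v j x ^ 2 := by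
  have h : ‖v‖ = ‖v.1‖ := rfl
  rw [h, WithLp.prod_norm_sq_eq_of_L2, PiLp.norm_sq_eq_of_L2, norm_sq_Lp]
  congr 1
  exact Finset.sum_congr rfl fun j _ => norm_sq_Lp _

lemma continuous_integral_mul {ψ : E d → ℝ} (hψ : MemLp ψ 2 (volOn Ω)) :
    Continuous fun f : Lp ℝ 2 (volOn Ω) => ∫ x in Ω, f x * ψ x := by
  have e : (fun f : Lp ℝ 2 (volOn Ω) => ∫ x in Ω, f x * ψ x)
      = fun f => inner ℝ (hψ.toLp ψ) f := by
    ext f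
    rw [L2.inner_def]
    refine integral_congr_ae ?_
    filter_upwards [hψ.coeFn_toLp] with x hx
    rw [hx]; simp
  rw [e]; fun_prop

/-- For a fixed test function both sides of the defining identity are inner products in `L²`, so
each condition is closed. Completeness of the space follows. -/
lemma isClosed_H1 : IsClosed (H1 Ω : Set (L2Pair Ω)) := by
  have e : (H1 Ω : Set (L2Pair Ω)) = ⋂ (j : Fin d) (φ : E d → ℝ) (_ : ContDiff ℝ ∞ φ)
      (_ : HasCompactSupport φ) (_ : tsupport φ ⊆ Ω),
      {w : L2Pair Ω | ∫ x in Ω, w.fst x * partialDeriv j φ x = - ∫ x in Ω, w.snd j x * φ x} := by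
    ext w
    simp only [mem_iInter]
    exact Iff.rfl
  rw [e]
  refine isClosed_iInter fun j => isClosed_iInter fun φ => isClosed_iInter fun hφ =>
    isClosed_iInter fun hc => isClosed_iInter fun _ => ?_
  have h1 : MemLp (partialDeriv j φ) 2 (volOn Ω) :=
    ((continuous_partialDeriv j hφ).memLp_of_hasCompactSupport (hasCompactSupport_partialDeriv j hc))
  have h2 : MemLp φ 2 (volOn Ω) := hφ.continuous.memLp_of_hasCompactSupport hc
  refine isClosed_eq ((continuous_integral_mul h1).comp (by fun_prop)) ?_
  exact ((continuous_integral_mul h2).comp (g := fun f : Lp ℝ 2 (volOn Ω) => ∫ x in Ω, f x * φ x)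
    (f := fun w : L2Pair Ω => w.snd j) (by fun_prop)).neg

instance : CompleteSpace (H1 Ω) := isClosed_H1.completeSpace_coe

end Sobolev

/-! ### The interpolant as a bounded operator. -/

section Operator

variable {d : ℕ} {Ω : Set (E d)} {T : Mesh d} {p : ℕ} {σ : E d → Carrier d}

lemma fn_sum_smul {ι : Type*} (s : Finset ι) (c : ι → ℝ) (w : ι → H1 Ω) (f : ι → E d → ℝ)
    (h : ∀ i, fn (w i) =ᵐ[volOn Ω] f i) :
    fn (∑ i ∈ s, c i • w i) =ᵐ[volOn Ω] fun x => ∑ i ∈ s, c i * f i x := by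
  classical
  induction s using Finset.induction_on with
  | empty =>
    simp only [Finset.sum_empty]
    exact Lp.coeFn_zero ℝ 2 (volOn Ω)
  | insert i s hi ih =>
    rw [Finset.sum_insert hi]
    filter_upwards [fn_add (c i • w i) (∑ i ∈ s, c i • w i), fn_smul (c i) (w i), h i, ih]
      with x h1 h2 h3 h4
    rw [h1, Pi.add_apply, h2, Pi.smul_apply, h3, h4, Finset.sum_insert hi, smul_eq_mul]

/-- Boundedness on a single mesh needs no uniform constant, so the carrying element serves as its
own reference simplex with scale one. -/
lemma exists_szCoeff_clm (hT : IsRegularTriangulation Ω T) (hΩ : IsBoundedLipschitzDomain Ω)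
    (hp : 1 ≤ p) {z : E d} (hz : z ∈ nodes T p) (hσ : (σ z).Admissible Ω T z) :
    ∃ S : H1 Ω →L[ℝ] ℝ, ∀ v, S v = szCoeff T p σ v z := by
  have hTΩ := hT.interior_body_subset hΩ
  obtain ⟨K, hK, o, ho, hzo⟩ := hσ.exists_on
  obtain ⟨C, hC, hb⟩ := exists_szCoeff_bound (p := p) Ω (finite_singleton K)
    (fun R hR => by rw [mem_singleton_iff.mp hR]; exact hT.nondegenerate K hK) hp
  have hKK : IsScaled K K 0 1 := ⟨one_pos, fun i => by simp⟩
  let S : H1 Ω →ₗ[ℝ] ℝ :=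
    { toFun := fun v => szCoeff T p σ v z
      map_add' := fun v w => szCoeff_add hT hTΩ hσ v w
      map_smul' := fun c v => szCoeff_smul hT hTΩ hσ c v }
  refine ⟨S.mkContinuousOfExistsBound ⟨√C, fun v => ?_⟩, fun v => rfl⟩
  have h1 := hb T σ hT K hK (hTΩ K hK) K rfl 0 1 hKK z hz o ho hzo v
  rw [one_pow, inv_one, mul_one, one_pow, one_mul] at h1
  have h2 : (∫ x in K.body, fn v x ^ 2) + energy K.body v ≤ ‖v‖ ^ 2 := by
    have hvol : volume.restrict K.body ≤ volume.restrict Ω := by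
      have : volume.restrict K.body = volume.restrict (interior K.body) := K.volOn_body
      rw [this]; exact Measure.restrict_mono (hTΩ K hK) le_rfl
    rw [H1.norm_sq]
    exact add_le_add (integral_mono_measure hvol (Eventually.of_forall fun _ => sq_nonneg _)
      (memLp_fn v).integrable_sq) (Finset.sum_le_sum fun j _ => integral_mono_measure hvol
      (Eventually.of_forall fun _ => sq_nonneg _) (memLp_grad v j).integrable_sq)
  have h3 : szCoeff T p σ v z ^ 2 ≤ C * ‖v‖ ^ 2 := h1.trans (mul_le_mul_of_nonneg_left h2 hC)
  have h4 := Real.abs_le_sqrt h3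
  rwa [Real.sqrt_mul hC, Real.sqrt_sq (norm_nonneg v)] at h4

/-- The Scott-Zhang operator as a bounded operator on `H¹(Ω)`. -/
lemma exists_scottZhang_clm (hT : IsRegularTriangulation Ω T) (hΩ : IsBoundedLipschitzDomain Ω)
    (hp : 1 ≤ p) (hσ : ∀ z ∈ nodes T p, (σ z).Admissible Ω T z) :
    ∃ J : H1 Ω →L[ℝ] H1 Ω, ∀ v, fn (J v) =ᵐ[volOn Ω] scottZhang T p σ v ∧
      ∀ j, grad (J v) j =ᵐ[volOn Ω] partialDeriv j (scottZhang T p σ v) := by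
  choose! S hS using fun z (hz : z ∈ nodes T p) => exists_szCoeff_clm hT hΩ hp hz (hσ z hz)
  choose w hw _ using fun z => hT.exists_H1_spline hΩ (hT.nodalBasis_spec hp z).1
  set F := (hT.finite_nodes (p := p)).toFinset with hF
  refine ⟨∑ z ∈ F, (S z).smulRight (w z), fun v => ?_⟩
  have h0 : fn ((∑ z ∈ F, (S z).smulRight (w z)) v) =ᵐ[volOn Ω] scottZhang T p σ v := by
    have e : (∑ z ∈ F, (S z).smulRight (w z)) v = ∑ z ∈ F, S z v • w z := by
      rw [sum_apply]; rfl
    have e2 : scottZhang T p σ v = fun x => ∑ z ∈ F, S z v * nodalBasis Ω T p z x := by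
      ext x
      refine (finsum_mem_eq_finite_toFinset_sum _ hT.finite_nodes).trans ?_
      refine Finset.sum_congr rfl fun z hz => ?_
      rw [hS z (by simpa [hF] using hz)]; rfl
    rw [e, e2]
    exact fn_sum_smul F _ w _ hw
  refine ⟨h0, ?_⟩
  -- The spline itself represents an element of `H¹` with known gradient, and elements of `H¹` with
  -- the same underlying function coincide.
  obtain ⟨u, hu0, hu1⟩ := hT.exists_H1_spline hΩ (scottZhang_mem (σ := σ) hT hp v)
  rw [H1.ext_fn hΩ (h0.trans hu0.symm)]
  exact hu1

end Operator

/-! ### Persistence of large elements. -/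

section Persistence

/-- If a finite number of large sets can be present in a sequence of antichains refining each
other, then all large sets are eventually persistent. -/
lemma exists_persistent {α : Type*} {el : ℕ → Set (Set α)} {P : Set (Set α)} (hP : P.Finite)
    (hanti : ∀ l, ∀ S ∈ el l, ∀ S' ∈ el l, S ⊆ S' → S = S')
    (href : ∀ l m, l ≤ m → ∀ S' ∈ el m, ∃ S ∈ el l, S' ⊆ S) :
    ∃ l₀, ∀ l ≥ l₀, ∀ S ∈ el l, S ∈ P → ∀ m ≥ l, S ∈ el m := by
  -- A set cannot disappear and return: in between it would be contained in a set which is contained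
  -- in a member of the first family, and the antichain property forces equality throughout.
  have hret : ∀ S l m m', l ≤ m → m ≤ m' → S ∈ el l → S ∈ el m' → S ∈ el m := by
    intro S l m m' hlm hmm' hl hm'
    obtain ⟨S₂, hS₂, h₂⟩ := href m m' hmm' S hm'
    obtain ⟨S₃, hS₃, h₃⟩ := href l m hlm S₂ hS₂
    have := hanti l S hl S₃ hS₃ (h₂.trans h₃)
    rwa [h₂.antisymm (this ▸ h₃)]
  have h1 : ∀ S, ∃ l₀, ∀ l ≥ l₀, S ∈ el l → ∀ m ≥ l, S ∈ el m := by
    intro S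
    -- Once lost, the set is absent from then on, and the level of the loss is a valid threshold; a
    -- set that is never lost needs none. Finitely many thresholds have a maximum.
    by_cases h : ∃ l m, l ≤ m ∧ S ∈ el l ∧ S ∉ el m
    · obtain ⟨l, m, hlm, hl, hm⟩ := h
      exact ⟨m, fun k hk hS => absurd (hret S l m k hlm hk hl hS) hm⟩
    · push Not at h
      exact ⟨0, fun l _ hl m hm => h l m hm hl⟩
  choose L hL using h1
  obtain ⟨l₀, hl₀⟩ := (hP.image L).bddAbove
  exact ⟨l₀, fun l hl S hS hSP m hm =>
    hL S l ((hl₀ (mem_image_of_mem L hSP)).trans hl) hS m hm⟩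

variable {d : ℕ} {Ω : Set (E d)} {p : ℕ} {T : ℕ → Mesh d} {σ : ℕ → E d → Carrier d}

/-- The interpolants do not change on elements with persistent neighbours. -/
lemma scottZhang_eq_of_persistent
    (hJ : ∀ l, ∀ S ∈ elements (T l) ∩ elements (T (l + 1)),
      patch (T l) S ⊆ ⋃₀ (elements (T l) ∩ elements (T (l + 1))) →
      ∀ (v : H1 Ω), ∀ x ∈ S,
        scottZhang (T (l + 1)) p (σ (l + 1)) v x = scottZhang (T l) p (σ l) v x)
    (hanti : ∀ l, ∀ S ∈ elements (T l), ∀ S' ∈ elements (T l), S ⊆ S' → S = S')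
    (href : ∀ l m, l ≤ m → ∀ S' ∈ elements (T m), ∃ S ∈ elements (T l), S' ⊆ S)
    {l : ℕ} {S : Set (E d)} (hS : S ∈ elements (T l)) (hSn : S.Nonempty)
    (hper : ∀ S' ∈ elements (T l), (S' ∩ S).Nonempty → ∀ m ≥ l, S' ∈ elements (T m))
    {m : ℕ} (hm : l ≤ m) (v : H1 Ω) {x : E d} (hx : x ∈ S) :
    scottZhang (T m) p (σ m) v x = scottZhang (T l) p (σ l) v x := by
  have hSS : (S ∩ S).Nonempty := by rwa [inter_self]
  induction m, hm using Nat.le_induction with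
  | base => rfl
  | succ m hm ih =>
    rw [← ih]
    refine hJ m S ⟨hper S hS hSS m hm, hper S hS hSS (m + 1) (by omega)⟩ ?_ v x hx
    refine sUnion_subset_sUnion ?_
    -- An element of the later mesh that meets `S` lies in an earlier one that meets `S`. The latter
    -- persists, so the two coincide: the patch of `S` still consists of persistent elements.
    rintro S₂ ⟨hS₂, hne⟩
    obtain ⟨S', hS', hsub⟩ := href l m hm S₂ hS₂
    have hne' : (S' ∩ S).Nonempty := hne.mono (inter_subset_inter_left _ hsub)
    have hp1 := hper S' hS' hne'
    have := hanti m S₂ hS₂ S' (hp1 m hm) hsub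
    exact ⟨hS₂, this ▸ hp1 (m + 1) (by omega)⟩

end Persistence

/-! ### Convergence of the operators. -/

section Limit

variable {d : ℕ} {Ω : Set (E d)} {p : ℕ}

lemma isOpen_smallPart (T : Mesh d) (δ : ℝ) : IsOpen (smallPart T δ) :=
  isOpen_biUnion fun _ _ => isOpen_interior

/-- Two functions which coincide outside of two sets and are close to a third one inside. -/
lemma integral_sub_sq_le_of_split {D D' : Set (E d)} (hD : IsOpen D)
    (hD' : IsOpen D') (hDΩ : D ⊆ Ω) (hDΩ' : D' ⊆ Ω) {f g h : E d → ℝ}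
    (hf : MemLp f 2 (volOn Ω)) (hg : MemLp g 2 (volOn Ω)) (hh : MemLp h 2 (volOn Ω))
    (hsplit : ∀ᵐ x ∂volOn Ω, f x = g x ∨ (x ∈ D ∧ x ∈ D')) :
    ∫ x in Ω, (f x - g x) ^ 2
      ≤ 2 * (∫ x in D, (f x - h x) ^ 2) + 2 * ∫ x in D', (g x - h x) ^ 2 := by
  have h1 := (hf.sub hh).integrable_sq
  have h2 := (hg.sub hh).integrable_sq
  simp only [Pi.sub_apply] at h1 h2
  have e : ∀ (A : Set (E d)), IsOpen A → A ⊆ Ω → ∀ u : E d → ℝ,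
      ∫ x in A, u x = ∫ x in Ω, A.indicator u x := fun A hA hAΩ u => by
    rw [setIntegral_indicator hA.measurableSet, inter_eq_self_of_subset_right hAΩ]
  rw [e D hD hDΩ, e D' hD' hDΩ', ← integral_const_mul, ← integral_const_mul,
    ← integral_add ((h1.indicator hD.measurableSet).const_mul 2)
      ((h2.indicator hD'.measurableSet).const_mul 2)]
  refine integral_mono_of_nonneg (Eventually.of_forall fun _ => sq_nonneg _)
    (((h1.indicator hD.measurableSet).const_mul 2).add
      ((h2.indicator hD'.measurableSet).const_mul 2)) ?_
  filter_upwards [hsplit] with x hx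
  have n1 : 0 ≤ D.indicator (fun x => (f x - h x) ^ 2) x := indicator_nonneg (fun _ _ => sq_nonneg _) _
  have n2 : 0 ≤ D'.indicator (fun x => (g x - h x) ^ 2) x :=
    indicator_nonneg (fun _ _ => sq_nonneg _) _
  rcases hx with hx | ⟨hx, hx'⟩
  · simp only [hx, sub_self]
    have : (0:ℝ) ^ 2 = 0 := by norm_num
    rw [this]; positivity
  · rw [indicator_of_mem hx, indicator_of_mem hx']
    nlinarith [sq_nonneg ((f x - h x) + (g x - h x))]

/-- Banach-Steinhaus: pointwise convergence alone yields a bounded limit, so no uniform operator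
bound has to be proved. -/
lemma exists_clm_of_tendsto {F : Type*} [NormedAddCommGroup F] [NormedSpace ℝ F] [CompleteSpace F]
    (J : ℕ → F →L[ℝ] F) {f : F → F} (hf : ∀ v, Tendsto (fun l => J l v) atTop (𝓝 (f v))) :
    ∃ Jlim : F →L[ℝ] F, ∀ v, Tendsto (fun l => J l v) atTop (𝓝 (Jlim v)) :=
  ⟨continuousLinearMapOfTendsto J (tendsto_pi_nhds.mpr hf), hf⟩

/-- Convergence of the Scott-Zhang operators along a sequence of shape regular refinements. -/
theorem exists_limit_of_shaped (hd : 2 ≤ d) (hp : 1 ≤ p) (hΩ : IsBoundedLipschitzDomain Ω)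
    {T : ℕ → Mesh d} {σ : ℕ → E d → Carrier d} (hT : ∀ l, IsRegularTriangulation Ω (T l))
    (hσ : ∀ l, ∀ z ∈ nodes (T l) p, (σ l z).Admissible Ω (T l) z)
    (hJ : ∀ l, ∀ S ∈ elements (T l) ∩ elements (T (l + 1)),
      patch (T l) S ⊆ ⋃₀ (elements (T l) ∩ elements (T (l + 1))) →
      ∀ (v : H1 Ω), ∀ x ∈ S,
        scottZhang (T (l + 1)) p (σ (l + 1)) v x = scottZhang (T l) p (σ l) v x)
    {𝓡 : Set (TaggedSimplex d)} (h𝓡 : 𝓡.Finite) (hR : ∀ R ∈ 𝓡, AffineIndependent ℝ R.verts)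
    (hsh : ∀ l, Shaped 𝓡 (T l))
    (hlarge : ∀ δ > 0, {S | ∃ l, S ∈ elements (T l) ∧ δ ≤ Metric.diam S}.Finite)
    (href : ∀ l m, l ≤ m → ∀ S' ∈ elements (T m), ∃ S ∈ elements (T l), S' ⊆ S) :
    ∃ J : ℕ → (H1 Ω →L[ℝ] H1 Ω),
      (∀ l v, fn (J l v) =ᵐ[volOn Ω] scottZhang (T l) p (σ l) v) ∧
      ∃ Jlim : H1 Ω →L[ℝ] H1 Ω, ∀ v, Tendsto (fun l => J l v) atTop (𝓝 (Jlim v)) := by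
  have hTΩ := fun l => (hT l).interior_body_subset hΩ
  choose J hJs using fun l => exists_scottZhang_clm (hT l) hΩ hp (hσ l)
  refine ⟨J, fun l v => (hJs l v).1, ?_⟩
  obtain ⟨Λ, hΛ⟩ := exists_shapeRegular h𝓡 hR
  obtain ⟨κ, hκ, _, _, hstar⟩ := exists_star_bound hd Λ
  have hanti : ∀ l, ∀ S ∈ elements (T l), ∀ S' ∈ elements (T l), S ⊆ S' → S = S' := by
    rintro l _ ⟨K, hK, rfl⟩ _ ⟨K', hK', rfl⟩ hsub
    obtain ⟨x, hx⟩ := interior_body_nonempty ((hT l).nondegenerate K hK)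
    rw [(hT l).eq_of_mem_interior hK hK' hx (hsub (interior_subset hx))]
  have hcauchy : ∀ v, CauchySeq fun l => J l v := by
    intro v
    rw [Metric.cauchySeq_iff']
    intro ε hε
    -- The function and its `d` derivatives each contribute four times this error, in total `ε ^ 2 /
    -- 2`.
    obtain ⟨δ, hδ, hsmall⟩ := exists_smallPart_bound (p := p) hd hp hΩ h𝓡 hR v
      (ε := ε ^ 2 / (8 * (1 + d))) (by positivity)
    -- The threshold is `δ / κ` because an element larger than `δ` has only neighbours of at least
    -- this size.
    obtain ⟨l, hl⟩ := exists_persistent (hlarge (δ / κ) (by positivity)) hanti href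
    refine ⟨l, fun m hm => ?_⟩
    obtain ⟨hsl0, hsl1⟩ := hsmall (T l) (σ l) (hT l) (hsh l) (hσ l)
    obtain ⟨hsm0, hsm1⟩ := hsmall (T m) (σ m) (hT m) (hsh m) (hσ m)
    have hDΩ : ∀ k, smallPart (T k) δ ⊆ Ω := fun k => iUnion₂_subset fun K hK => hTΩ k K hK.1
    -- Let `L` be the coarse element around `x`. If its whole patch persists, the interpolants agree
    -- on `L`. Otherwise some neighbour is smaller than `δ / κ`, so `L` and the finer element inside
    -- it are small. Agreement is recorded near `x`, so that it also covers the derivatives.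
    have hsplit : ∀ᵐ x ∂volOn Ω, scottZhang (T m) p (σ m) v =ᶠ[𝓝 x] scottZhang (T l) p (σ l) v ∨
        (x ∈ smallPart (T m) δ ∧ x ∈ smallPart (T l) δ) := by
      filter_upwards [(hT m).ae_exists_interior hΩ] with x ⟨K, hK, hx⟩
      obtain ⟨_, ⟨L, hL, rfl⟩, hKL⟩ := href l m hm K.body ⟨K, hK, rfl⟩
      have hxL : x ∈ interior L.body := interior_mono hKL hx
      by_cases hper : ∀ S' ∈ elements (T l), (S' ∩ L.body).Nonempty → ∀ m ≥ l, S' ∈ elements (T m)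
      · refine Or.inl ?_
        filter_upwards [isOpen_interior.mem_nhds hxL] with y hy
        exact scottZhang_eq_of_persistent hJ hanti href ⟨L, hL, rfl⟩ ⟨x, interior_subset hxL⟩ hper
          hm v (interior_subset hy)
      · push Not at hper
        obtain ⟨_, ⟨L', hL', rfl⟩, ⟨z, hzL', hzL⟩, k, hk, hnot⟩ := hper
        have hsz : L'.size < δ / κ := by
          by_contra hcon
          push Not at hcon
          exact hnot (hl l le_rfl _ ⟨L', hL', rfl⟩ ⟨l, ⟨L', hL', rfl⟩, hcon⟩ k hk)
        have h1 := (hstar hΩ (hT l) (hΛ _ (hsh l)) z L hL hzL L' hL' hzL').1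
        have h2 : L.size ≤ δ := by
          rw [lt_div_iff₀ (by positivity)] at hsz; linarith
        have h3 : K.size ≤ L.size := Metric.diam_mono hKL L.body_bounded
        exact Or.inr ⟨mem_biUnion (show K ∈ {K ∈ T m | K.size ≤ δ} from ⟨hK, h3.trans h2⟩) hx,
          mem_biUnion (show L ∈ {K ∈ T l | K.size ≤ δ} from ⟨hL, h2⟩) hxL⟩
    have hspl := fun k => scottZhang_mem (σ := σ k) (hT k) hp v
    have b0 := integral_sub_sq_le_of_split (isOpen_smallPart (T m) δ) (isOpen_smallPart (T l) δ)
      (hDΩ m) (hDΩ l) (memLp_spline hΩ (hspl m)) (memLp_spline hΩ (hspl l)) (memLp_fn v)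
      (by filter_upwards [hsplit] with x hx using hx.imp_left fun h => h.self_of_nhds)
    have b1 := fun j => integral_sub_sq_le_of_split (isOpen_smallPart (T m) δ)
      (isOpen_smallPart (T l) δ) (hDΩ m) (hDΩ l)
      ((hT m).memLp_partialDeriv_spline hΩ (hspl m) j)
      ((hT l).memLp_partialDeriv_spline hΩ (hspl l) j) (memLp_grad v j)
      (by filter_upwards [hsplit] with x hx using hx.imp_left fun h => by
            rw [partialDeriv, partialDeriv, h.fderiv_eq])
    have e0 : ∫ x in Ω, fn (J m v - J l v) x ^ 2
        = ∫ x in Ω, (scottZhang (T m) p (σ m) v x - scottZhang (T l) p (σ l) v x) ^ 2 := by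
      refine integral_congr_ae ?_
      have hs : fn (J m v - J l v) =ᵐ[volOn Ω] fn (J m v) - fn (J l v) := Lp.coeFn_sub _ _
      filter_upwards [hs, (hJs m v).1, (hJs l v).1] with x h1 h2 h3
      rw [h1, Pi.sub_apply, h2, h3]
    have e1 : ∀ j, ∫ x in Ω, grad (J m v - J l v) j x ^ 2
        = ∫ x in Ω, (partialDeriv j (scottZhang (T m) p (σ m) v) x
          - partialDeriv j (scottZhang (T l) p (σ l) v) x) ^ 2 := by
      intro j
      refine integral_congr_ae ?_
      have hs : grad (J m v - J l v) j =ᵐ[volOn Ω] grad (J m v) j - grad (J l v) j :=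
        Lp.coeFn_sub _ _
      filter_upwards [hs, (hJs m v).2 j, (hJs l v).2 j] with x h1 h2 h3
      rw [h1, Pi.sub_apply, h2, h3]
    have hnorm : ‖J m v - J l v‖ ^ 2 ≤ ε ^ 2 / 2 := by
      rw [H1.norm_sq, e0]
      simp_rw [e1]
      set η := ε ^ 2 / (8 * (1 + (d:ℝ))) with hη
      have h4 : ∑ j, ∫ x in Ω, (partialDeriv j (scottZhang (T m) p (σ m) v) x
          - partialDeriv j (scottZhang (T l) p (σ l) v) x) ^ 2 ≤ ∑ _j : Fin d, 4 * η :=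
        Finset.sum_le_sum fun j _ => (b1 j).trans (by linarith [hsm1 j, hsl1 j])
      rw [Finset.sum_const, Finset.card_univ, Fintype.card_fin, nsmul_eq_mul] at h4
      have h5 : ε ^ 2 / 2 = 4 * η + d * (4 * η) := by rw [hη]; field_simp; ring
      rw [h5]
      linarith
    rw [dist_eq_norm]
    have h6 : ‖J m v - J l v‖ ^ 2 < ε ^ 2 := by
      have : 0 < ε ^ 2 := by positivity
      linarith
    exact lt_of_pow_lt_pow_left₀ 2 hε.le h6
  choose f hf using fun v => cauchySeq_tendsto_of_complete (hcauchy v)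
  exact exists_clm_of_tendsto J hf

end Limit

/-! ### Newest vertex bisection produces finitely many shapes. -/

section Bisection

variable {d : ℕ}

/-- The vertices of a simplex of type `γ` in terms of a path `y₀, …, y_d` of edges:
`(y₀, (y₀ + y_{d-γ+1})/2, …, (y₀ + y_d)/2, y₁, …, y_{d-γ})`. -/
def pathVert (γ : ℕ) (y : ℕ → E d) (i : ℕ) : E d :=
  if i = 0 then y 0 else if i ≤ γ then midpoint ℝ (y 0) (y (d - γ + i)) else y (i - γ)

/-- `K` is described by a path whose edges are the `s`-fold of vectors of `W`. -/
def PathForm (W : Set (E d)) (s : ℝ) (K : TaggedSimplex d) : Prop :=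
  ∃ y : ℕ → E d, (∀ j < d, ∃ w ∈ W, y (j + 1) - y j = s • w) ∧
    ∀ i : Fin (d + 1), K.verts i = pathVert K.type y i

lemma TaggedSimplex.vert_eq (K : TaggedSimplex d) {γ : ℕ} {y : ℕ → E d}
    (h : ∀ i : Fin (d + 1), K.verts i = pathVert γ y i) {k : ℕ} (hk : k ≤ d) :
    K.vert k = pathVert γ y k := by
  rw [TaggedSimplex.vert, h, Fin.val_ofNat, Nat.mod_eq_of_lt (by omega)]

/-- Passing to the next type. -/
lemma pathForm_of_next {W : Set (E d)} {s : ℝ} {K K' : TaggedSimplex d} {y : ℕ → E d}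
    (hy : ∀ j < d, ∃ w ∈ W, y (j + 1) - y j = s • w) (htype : K'.type = K.nextType)
    (hv : ∀ i : Fin (d + 1), K'.verts i = pathVert (K.type + 1) y i) :
    ∃ k, PathForm W ((1 / 2) ^ k * s) K' ∧ (K.type : ℕ) + 1 = k * d + K'.type := by
  have hlt := K.type.2
  have hd := K.dim_pos
  by_cases h : (K.type : ℕ) + 1 < d
  · have ht : (K'.type : ℕ) = K.type + 1 := by
      rw [htype]; exact Nat.mod_eq_of_lt h
    exact ⟨0, ⟨y, by simpa using hy, fun i => by rw [hv, ht]⟩, by omega⟩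
  -- When the type returns to zero, every vertex but `y 0` is a midpoint with `y 0`; the path of
  -- these midpoints has all edges halved.
  · have he : (K.type : ℕ) + 1 = d := by omega
    have ht : (K'.type : ℕ) = 0 := by
      rw [htype]; simp [TaggedSimplex.nextType, he]
    refine ⟨1, ⟨fun i => midpoint ℝ (y 0) (y i), fun j hj => ?_, fun i => ?_⟩, by omega⟩
    · obtain ⟨w, hw, hjw⟩ := hy j hj
      refine ⟨w, hw, ?_⟩
      beta_reduce
      rw [midpoint_eq_smul_add, midpoint_eq_smul_add, ← smul_sub, add_sub_add_left_eq_sub, hjw,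
        smul_smul, invOf_eq_inv]
      norm_num
    · rw [hv, ht, he]
      simp only [pathVert]
      by_cases hi : (i : ℕ) = 0
      · simp [hi]
      · have : (i : ℕ) ≤ d := by omega
        simp [hi, this]

/-- The refinement edge joins `y 0` and `y (d - γ)`. Replacing its far end by the midpoint is what
raising the type by one does to the same path. -/
lemma PathForm.child₁ {W : Set (E d)} {s : ℝ} {K : TaggedSimplex d} (h : PathForm W s K) :
    ∃ k, PathForm W ((1 / 2) ^ k * s) K.child₁ ∧ (K.type : ℕ) + 1 = k * d + K.child₁.type := by
  obtain ⟨y, hy, hv⟩ := h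
  have hlt := K.type.2
  have hd := K.dim_pos
  refine pathForm_of_next hy rfl fun i => ?_
  have hi := i.2
  have hvd : K.vert d = y (d - K.type) := by
    rw [K.vert_eq hv le_rfl, pathVert, if_neg (by omega), if_neg (by omega)]
  have hv0 : K.vert 0 = y 0 := by rw [K.vert_eq hv (by omega), pathVert, if_pos rfl]
  simp only [TaggedSimplex.child₁, hvd, hv0, pathVert]
  split_ifs with h0 h1 h2 h3
  · rfl
  · congr 2; omega
  · omega
  · rw [K.vert_eq hv (by omega), pathVert, if_neg (by omega), if_pos (by omega)]
    congr 2; omega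
  · rw [K.vert_eq hv (by omega), pathVert, if_neg (by omega), if_neg (by omega)]
    congr 1; omega

/-- The path of the second child reverses the first `d - γ` edges and translates the rest. Edges
change at most their sign, so a symmetric edge set is preserved. -/
lemma PathForm.child₂ {W : Set (E d)} (hW : ∀ w ∈ W, -w ∈ W) {s : ℝ} {K : TaggedSimplex d}
    (h : PathForm W s K) :
    ∃ k, PathForm W ((1 / 2) ^ k * s) K.child₂ ∧ (K.type : ℕ) + 1 = k * d + K.child₂.type := by
  obtain ⟨y, hy, hv⟩ := h
  have hlt := K.type.2
  have hd := K.dim_pos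
  have hvd : K.vert d = y (d - K.type) := by
    rw [K.vert_eq hv le_rfl, pathVert, if_neg (by omega), if_neg (by omega)]
  have hv0 : K.vert 0 = y 0 := by rw [K.vert_eq hv (by omega), pathVert, if_pos rfl]
  -- The translation makes the midpoints between the new initial point and the tail equal to the old
  -- midpoints.
  let y' : ℕ → E d := fun k =>
    if k ≤ d - K.type then y (d - K.type - k) else y k + y 0 - y (d - K.type)
  refine pathForm_of_next (y := y') (fun j hj => ?_) rfl fun i => ?_
  · rcases lt_trichotomy j (d - K.type) with h1 | h1 | h1
    · obtain ⟨w, hw, hjw⟩ := hy (d - K.type - (j + 1)) (by omega)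
      refine ⟨-w, hW w hw, ?_⟩
      have e : d - (K.type : ℕ) - (j + 1) + 1 = d - K.type - j := by omega
      rw [e] at hjw
      simp only [y']
      rw [if_pos (by omega), if_pos h1.le, smul_neg, ← hjw, neg_sub]
    · obtain ⟨w, hw, hjw⟩ := hy j hj
      refine ⟨w, hw, ?_⟩
      simp only [y']
      rw [if_neg (by omega), if_pos h1.le, ← hjw, ← h1, Nat.sub_self]
      abel
    · obtain ⟨w, hw, hjw⟩ := hy j hj
      refine ⟨w, hw, ?_⟩
      simp only [y']
      rw [if_neg (by omega), if_neg (by omega), ← hjw]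
      abel
  · have hi := i.2
    have e0 : y' 0 = y (d - K.type) := by simp [y']
    simp only [TaggedSimplex.child₂, hvd, hv0, pathVert, e0]
    split_ifs with h0 h1 h2 h3
    · rfl
    · have e1 : y' (d - (K.type + 1) + i) = y 0 := by
        have : d - ((K.type : ℕ) + 1) + i = d - K.type := by omega
        simp [y', this]
      rw [e1, midpoint_comm]
    · omega
    · have e1 : y' (d - (K.type + 1) + i) = y (d - K.type + (i - 1)) + y 0 - y (d - K.type) := by
        have : d - ((K.type : ℕ) + 1) + i = d - K.type + (i - 1) := by omega
        simp only [y', this]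
        rw [if_neg (by omega)]
      rw [e1, K.vert_eq hv (by omega), pathVert, if_neg (by omega), if_pos (by omega),
        midpoint_eq_smul_add, midpoint_eq_smul_add]
      congr 1; abel
    · rw [K.vert_eq hv (by omega), pathVert, if_neg (by omega), if_neg (by omega)]
      simp only [y']
      rw [if_pos (by omega)]
      congr 1; omega

/-- The path of an arbitrary tagged simplex. -/
def TaggedSimplex.path (K : TaggedSimplex d) (k : ℕ) : E d :=
  if k = 0 then K.vert 0 else if k ≤ d - K.type then K.vert (K.type + k)
  else (2 : ℝ) • K.vert (k - (d - K.type)) - K.vert 0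

/-- Every tagged simplex of any type has a path, found by solving the midpoint relations for their
far ends. Hence no compatibility of the initial tags is required. -/
lemma TaggedSimplex.verts_eq_path (K : TaggedSimplex d) (i : Fin (d + 1)) :
    K.verts i = pathVert K.type K.path i := by
  have hlt := K.type.2
  have hi := i.2
  have hvi : K.verts i = K.vert i := by
    rw [TaggedSimplex.vert]; congr 1; ext; rw [Fin.val_ofNat, Nat.mod_eq_of_lt hi]
  rw [hvi, pathVert]
  have e0 : K.path 0 = K.vert 0 := by simp [TaggedSimplex.path]
  rw [e0]
  split_ifs with h0 h1
  · rw [h0]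
  · have e1 : K.path (d - K.type + i) = (2 : ℝ) • K.vert i - K.vert 0 := by
      rw [TaggedSimplex.path, if_neg (by omega), if_neg (by omega), Nat.add_sub_cancel_left]
    rw [e1, midpoint_eq_smul_add, add_sub_cancel, smul_smul]
    norm_num
  · rw [TaggedSimplex.path, if_neg (by omega), if_pos (by omega)]
    congr 1; omega

/-- The edges of the paths of the elements of a mesh, with both signs. -/
def edgeSet (T : Mesh d) : Set (E d) :=
  {w | ∃ K ∈ T, ∃ j : Fin d, w = K.path (j + 1) - K.path j ∨ -w = K.path (j + 1) - K.path j}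

lemma finite_edgeSet {T : Mesh d} (hT : T.Finite) : (edgeSet T).Finite := by
  have h1 : (⋃ K ∈ T, range fun j : Fin d => K.path (j + 1) - K.path j).Finite :=
    hT.biUnion fun K _ => finite_range _
  refine (h1.union (h1.image Neg.neg)).subset ?_
  rintro w ⟨K, hK, j, h | h⟩
  · exact Or.inl (mem_biUnion hK ⟨j, h.symm⟩)
  · exact Or.inr ⟨-w, mem_biUnion hK ⟨j, h.symm⟩, neg_neg w⟩

lemma neg_mem_edgeSet {T : Mesh d} : ∀ w ∈ edgeSet T, -w ∈ edgeSet T := by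
  rintro w ⟨K, hK, j, h⟩
  exact ⟨K, hK, j, by rw [neg_neg]; exact h.symm⟩

/-- The descendants of the elements of a mesh in the `n`-th generation. -/
def gen (T : Mesh d) : ℕ → Mesh d
  | 0 => T
  | n + 1 => TaggedSimplex.child₁ '' gen T n ∪ TaggedSimplex.child₂ '' gen T n

lemma finite_gen {T : Mesh d} (hT : T.Finite) : ∀ n, (gen T n).Finite
  | 0 => hT
  | n + 1 => ((finite_gen hT n).image _).union ((finite_gen hT n).image _)

/-- The generation is tracked by `k * d + type`, so the edges are halved once every `d` bisections.
It is only an inequality because the initial type may be positive. -/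
lemma pathForm_gen {T : Mesh d} : ∀ (n : ℕ), ∀ K ∈ gen T n,
    ∃ k, n ≤ k * d + K.type ∧ PathForm (edgeSet T) ((1 / 2) ^ k) K
  | 0, K, hK => ⟨0, Nat.zero_le _, K.path, fun j hj => ⟨_, ⟨K, hK, ⟨j, hj⟩, Or.inl rfl⟩, by simp⟩,
      K.verts_eq_path⟩
  | n + 1, K, hK => by
    rcases hK with ⟨L, hL, rfl⟩ | ⟨L, hL, rfl⟩
    · obtain ⟨k, hk, h⟩ := pathForm_gen n L hL
      obtain ⟨k', h', hk'⟩ := h.child₁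
      exact ⟨k' + k, by rw [add_mul]; omega, by rwa [pow_add]⟩
    · obtain ⟨k, hk, h⟩ := pathForm_gen n L hL
      obtain ⟨k', h', hk'⟩ := h.child₂ neg_mem_edgeSet
      exact ⟨k' + k, by rw [add_mul]; omega, by rwa [pow_add]⟩

/-- The reference simplex of type `γ` with given edges of its path. -/
def refSimplex (γ : Fin d) (w : Fin d → E d) : TaggedSimplex d where
  verts i := pathVert γ (fun k => ∑ j : Fin d with j.1 < k, w j) i
  type := γ

/-- Up to translation and scale, the simplex is determined by its type and by `d` edges from `W`;
for finite `W` there are only finitely many choices. -/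
lemma PathForm.exists_isScaled {W : Set (E d)} {s : ℝ} (hs : 0 < s) {K : TaggedSimplex d}
    (h : PathForm W s K) : ∃ w : Fin d → E d, (∀ j, w j ∈ W) ∧
      ∃ a, IsScaled (refSimplex K.type w) K a s := by
  obtain ⟨y, hy, hv⟩ := h
  choose w hw hyw using fun j : Fin d => hy j j.2
  have hsum : ∀ k ≤ d, y k = y 0 + s • ∑ j : Fin d with j.1 < k, w j := by
    intro k
    induction k with
    | zero => intro _; simp
    | succ k ih =>
      intro hk
      have e : ({j : Fin d | j.1 < k + 1} : Finset (Fin d))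
          = insert ⟨k, hk⟩ ({j : Fin d | j.1 < k} : Finset (Fin d)) := by
        ext j
        simp only [Finset.mem_filter_univ, Finset.mem_insert, Fin.ext_iff]; omega
      rw [e, Finset.sum_insert (by simp), smul_add, ← hyw ⟨k, hk⟩, add_left_comm,
        ← ih (by omega), sub_add_cancel]
  have hlt := K.type.2
  refine ⟨w, hw, y 0, hs, fun i => ?_⟩
  have hi := i.2
  rw [hv]
  simp only [refSimplex, pathVert]
  split_ifs with h0 h1
  · simp
  · rw [hsum (d - K.type + i) (by omega), midpoint_eq_smul_add, midpoint_eq_smul_add]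
    simp only [Nat.not_lt_zero, Finset.filter_false, Finset.sum_empty, zero_add, invOf_eq_inv]
    module
  · exact hsum _ (by omega)

open scoped Pointwise in
lemma IsScaled.size_eq {R K : TaggedSimplex d} {a : E d} {s : ℝ} (h : IsScaled R K a s) :
    K.size = s * R.size := by
  have e : K.body = (fun x => a + x) '' (s • R.body) := by
    rw [h.body_eq, ← image_smul, image_image]
  rw [TaggedSimplex.size, e, (isometry_add_left a).diam_image, diam_smul₀, Real.norm_eq_abs,
    abs_of_pos h.pos]
  rfl

lemma IsScaled.symm {R K : TaggedSimplex d} {a : E d} {s : ℝ} (h : IsScaled R K a s) :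
    IsScaled K R (-(s⁻¹ • a)) s⁻¹ :=
  ⟨inv_pos.mpr h.pos, fun i => by
    rw [h.verts, smul_add, smul_smul, inv_mul_cancel₀ h.pos.ne', one_smul, neg_add_cancel_left]⟩

lemma TaggedSimplex.size_pos {K : TaggedSimplex d} (h : AffineIndependent ℝ K.verts) :
    0 < K.size := by
  have hne : K.verts 0 ≠ K.verts (Fin.last d) := fun hc => by
    have := congrArg Fin.val (h.injective hc)
    have hd := K.dim_pos
    simp at this; omega
  exact (norm_pos_iff.mpr (sub_ne_zero.mpr hne)).trans_le
    (K.norm_sub_le_diam (K.vert_mem_body _) (K.vert_mem_body _))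

/-- The reference simplex scaled to unit size. -/
def TaggedSimplex.normalize (R : TaggedSimplex d) : TaggedSimplex d where
  verts i := R.size⁻¹ • R.verts i
  type := R.type

/-- The descendants of a mesh have a finite number of shapes, and their sizes tend to zero. -/
theorem exists_shapes {T₀ : Mesh d} (hT₀ : T₀.Finite) :
    ∃ 𝓡 : Set (TaggedSimplex d), 𝓡.Finite ∧ (∀ R ∈ 𝓡, AffineIndependent ℝ R.verts) ∧
      (∀ n, ∀ K ∈ gen T₀ n, AffineIndependent ℝ K.verts → ∃ R ∈ 𝓡, ∃ a, IsScaled R K a K.size) ∧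
      ∀ δ > 0, ∃ N, ∀ n, ∀ K ∈ gen T₀ n, δ ≤ K.size → n ≤ N := by
  set W := edgeSet T₀ with hW
  have hWfin : W.Finite := finite_edgeSet hT₀
  set 𝓡₀ : Set (TaggedSimplex d) :=
    (fun k : Fin d × (Fin d → E d) => refSimplex k.1 k.2) '' (univ ×ˢ univ.pi fun _ => W) with h𝓡₀
  have hfin₀ : 𝓡₀.Finite := (finite_univ.prod (Finite.pi fun _ => hWfin)).image _
  have hform : ∀ n, ∀ K ∈ gen T₀ n, ∃ k, n ≤ k * d + K.type ∧
      ∃ R ∈ 𝓡₀, ∃ a, IsScaled R K a ((1 / 2) ^ k) := by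
    intro n K hK
    obtain ⟨k, hk, h⟩ := pathForm_gen n K hK
    obtain ⟨w, hw, a, ha⟩ := h.exists_isScaled (by positivity)
    exact ⟨k, hk, _, ⟨(K.type, w), ⟨mem_univ _, fun j _ => hw j⟩, rfl⟩, a, ha⟩
  -- Degenerate edge choices are discarded, and normalization to unit diameter makes the scale of a
  -- copy equal to its size.
  refine ⟨TaggedSimplex.normalize '' {R ∈ 𝓡₀ | AffineIndependent ℝ R.verts},
    (hfin₀.subset (sep_subset _ _)).image _, ?_, ?_, ?_⟩
  · rintro _ ⟨R, ⟨-, hR⟩, rfl⟩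
    have hs := TaggedSimplex.size_pos hR
    have h : IsScaled R R.normalize 0 R.size⁻¹ :=
      ⟨inv_pos.mpr hs, fun i => by rw [zero_add]; rfl⟩
    exact h.affineIndependent hR
  · intro n K hK hn
    obtain ⟨k, -, R, hR, a, h⟩ := hform n K hK
    have hRi := h.symm.affineIndependent hn
    have hs := TaggedSimplex.size_pos hRi
    refine ⟨_, ⟨R, ⟨hR, hRi⟩, rfl⟩, a, TaggedSimplex.size_pos hn, fun i => ?_⟩
    rw [h.size_eq, h.verts]
    simp only [TaggedSimplex.normalize, smul_smul]
    rw [mul_assoc, mul_inv_cancel₀ hs.ne', mul_one]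
  · intro δ hδ
    obtain ⟨B, hB⟩ := (hfin₀.image TaggedSimplex.size).bddAbove
    obtain ⟨k₀, hk₀⟩ := exists_pow_lt_of_lt_one (show 0 < δ / (|B| + 1) by positivity)
      (show (1 / 2 : ℝ) < 1 by norm_num)
    -- An element of size at least `δ` has been halved fewer than `k₀` times, and its type is less
    -- than `d`.
    refine ⟨k₀ * d + d, fun n K hK hKδ => ?_⟩
    obtain ⟨k, hk, R, hR, a, h⟩ := hform n K hK
    have hlt := K.type.2
    have hkk : k < k₀ := by
      by_contra hcon
      push Not at hcon
      have h1 : (1 / 2 : ℝ) ^ k ≤ (1 / 2) ^ k₀ :=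
        pow_le_pow_of_le_one (by norm_num) (by norm_num) hcon
      have h2 : R.size ≤ |B| + 1 :=
        (hB (mem_image_of_mem _ hR)).trans ((le_abs_self B).trans (by linarith))
      rw [h.size_eq] at hKδ
      rw [lt_div_iff₀ (by positivity)] at hk₀
      have h3 : (1 / 2 : ℝ) ^ k * R.size ≤ (1 / 2) ^ k₀ * (|B| + 1) :=
        mul_le_mul h1 h2 Metric.diam_nonneg (by positivity)
      linarith
    have : k * d ≤ k₀ * d := Nat.mul_le_mul_right d hkk.le
    omega

lemma TaggedSimplex.vert_mem (K : TaggedSimplex d) (k : ℕ) : K.vert k ∈ K.body :=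
  K.vert_mem_body _

lemma TaggedSimplex.midpoint_mem (K : TaggedSimplex d) :
    midpoint ℝ (K.vert 0) (K.vert d) ∈ K.body :=
  K.body_convex.midpoint_mem (K.vert_mem 0) (K.vert_mem d)

lemma TaggedSimplex.child₁_subset (K : TaggedSimplex d) : K.child₁.body ⊆ K.body := by
  refine convexHull_min ?_ K.body_convex
  rintro _ ⟨i, rfl⟩
  simp only [child₁]
  split_ifs
  exacts [K.vert_mem _, K.midpoint_mem, K.vert_mem _]

lemma TaggedSimplex.child₂_subset (K : TaggedSimplex d) : K.child₂.body ⊆ K.body := by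
  refine convexHull_min ?_ K.body_convex
  rintro _ ⟨i, rfl⟩
  simp only [child₂]
  split_ifs
  exacts [K.vert_mem _, K.midpoint_mem, K.vert_mem _, K.vert_mem _]

lemma IsBisection.exists_subset {T T' : Mesh d} (h : IsBisection T T') :
    ∀ K' ∈ T', ∃ K ∈ T, K'.body ⊆ K.body := by
  induction h with
  | refl => exact fun K hK => ⟨K, hK, subset_rfl⟩
  | tail _ hstep ih =>
    obtain ⟨L, hL, rfl⟩ := hstep
    rintro K' (hK' | rfl | rfl)
    · exact ih K' hK'.1
    · obtain ⟨K, hK, h⟩ := ih L hL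
      exact ⟨K, hK, L.child₁_subset.trans h⟩
    · obtain ⟨K, hK, h⟩ := ih L hL
      exact ⟨K, hK, L.child₂_subset.trans h⟩

lemma IsBisection.exists_gen {T₀ T T' : Mesh d} (h : IsBisection T T')
    (hT : ∀ K ∈ T, ∃ n, K ∈ gen T₀ n) : ∀ K ∈ T', ∃ n, K ∈ gen T₀ n := by
  induction h with
  | refl => exact hT
  | tail _ hstep ih =>
    obtain ⟨L, hL, rfl⟩ := hstep
    rintro K' (hK' | rfl | rfl)
    · exact ih K' hK'.1
    · obtain ⟨n, hn⟩ := ih L hL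
      exact ⟨n + 1, Or.inl ⟨L, hn, rfl⟩⟩
    · obtain ⟨n, hn⟩ := ih L hL
      exact ⟨n + 1, Or.inr ⟨L, hn, rfl⟩⟩

lemma IsRefine.regular_and_bisection {Ω : Set (E d)} {T T' : Mesh d} (h : IsRefine Ω T T')
    (hT : IsRegularTriangulation Ω T) : IsRegularTriangulation Ω T' ∧ IsBisection T T' := by
  induction h with
  | refl => exact ⟨hT, Relation.ReflTransGen.refl⟩
  | tail _ hstep ih =>
    obtain ⟨M, -, hM, -⟩ := hstep
    exact ⟨hM.regular, ih.2.trans hM.bisection⟩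

end Bisection

end AFEM

end

/-! ### The convergence theorem. -/

theorem proposition4p3 {d : ℕ} (hd : 2 ≤ d) {p : ℕ} (hp : 1 ≤ p)
    (Ω : Set (AFEM.E d)) (hΩ : AFEM.IsBoundedLipschitzDomain Ω)
    (T : ℕ → AFEM.Mesh d)
    (hT₀ : AFEM.IsRegularTriangulation Ω (T 0))
    (hT : ∀ l, AFEM.IsRefine Ω (T l) (T (l + 1)))
    (σ : ℕ → AFEM.E d → AFEM.Carrier d)
    (hσ : ∀ l, ∀ z ∈ AFEM.nodes (T l) p, (σ l z).Admissible Ω (T l) z)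
    (hJ : ∀ l, ∀ S ∈ AFEM.elements (T l) ∩ AFEM.elements (T (l + 1)),
      AFEM.patch (T l) S ⊆ ⋃₀ (AFEM.elements (T l) ∩ AFEM.elements (T (l + 1))) →
      ∀ (v : AFEM.H1 Ω), ∀ x ∈ S,
        AFEM.scottZhang (T (l + 1)) p (σ (l + 1)) v x = AFEM.scottZhang (T l) p (σ l) v x) :
    ∃ J : ℕ → (AFEM.H1 Ω →L[ℝ] AFEM.H1 Ω),
      (∀ l v, AFEM.fn (J l v) =ᵐ[AFEM.volOn Ω] AFEM.scottZhang (T l) p (σ l) v) ∧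
      ∃ Jlim : AFEM.H1 Ω →L[ℝ] AFEM.H1 Ω,
        ∀ v, Tendsto (fun l => J l v) atTop (𝓝 (Jlim v)) := by
  have hreg : ∀ l, AFEM.IsRegularTriangulation Ω (T l) := by
    intro l
    induction l with
    | zero => exact hT₀
    | succ l ih => exact ((hT l).regular_and_bisection ih).1
  have hbis : ∀ l m, l ≤ m → AFEM.IsBisection (T l) (T m) := by
    intro l m hlm
    induction m, hlm using Nat.le_induction with
    | base => exact Relation.ReflTransGen.refl
    | succ m _ ih => exact ih.trans ((hT m).regular_and_bisection (hreg m)).2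
  have hgen : ∀ l, ∀ K ∈ T l, ∃ n, K ∈ AFEM.gen (T 0) n := fun l =>
    (hbis 0 l (Nat.zero_le l)).exists_gen fun K hK => ⟨0, hK⟩
  obtain ⟨𝓡, h𝓡, hR, hshape, hsize⟩ := AFEM.exists_shapes hT₀.finite
  refine AFEM.exists_limit_of_shaped hd hp hΩ hreg hσ hJ h𝓡 hR (fun l K hK => ?_) (fun δ hδ => ?_) ?_
  · obtain ⟨n, hn⟩ := hgen l K hK
    exact hshape n K hn ((hreg l).nondegenerate K hK)
  -- Large elements have bounded generation, and each generation is finite, so only finitely many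
  -- bodies occur over all levels.
  · obtain ⟨N, hN⟩ := hsize δ hδ
    refine ((finite_le_nat N).biUnion fun n _ =>
      (AFEM.finite_gen hT₀.finite n).image AFEM.TaggedSimplex.body).subset ?_
    rintro _ ⟨l, ⟨K, hK, rfl⟩, hδK⟩
    obtain ⟨n, hn⟩ := hgen l K hK
    exact mem_biUnion (show n ∈ {n | n ≤ N} from hN n K hn hδK) ⟨K, hn, rfl⟩
  · rintro l m hlm _ ⟨K', hK', rfl⟩
    obtain ⟨K, hK, h⟩ := (hbis l m hlm).exists_subset K' hK'
    exact ⟨K.body, ⟨K, hK, rfl⟩, h⟩
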